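/- **Setting.** Let $G$ be a compact matrix quantum group, represented by the Hopf $*$-algebra $\mathcal A$ of polynomial functions on it (coproduct $\phi$, counit $\epsilon$, antipode $\kappa$, $\mathrm{ad}(a)=a^{(2)}\otimes\kappa(a^{(1)})a^{(3)}$). Let $\Gamma$ be a first-order bicovariant $*$-calculus over $G$, $\Gamma^\wedge$ its universal differential envelope, $\Gamma_{inv}\subseteq\Gamma$ the space of left-invariant elements, $\Gamma_{inv}^\wedge\subseteq\Gamma^\wedge$ the subalgebra generated by it, and $\pi\colon\mathcal A\to\Gamma_{inv}$, $\pi(a)=\kappa(a^{(1)})\,da^{(2)}$. Put $\varpi\pi=(\pi\otimes\mathrm{id})\,\mathrm{ad}$ and $\pi(a)\circ b=\pi(ab-\epsilon(a)b)$. Let $P=(\mathcal B,i,F)$ be a quantum principal $G$-bundle over $M$: $F\colon\mathcal B\to\mathcal B\otimes\mathcal A$ is a free right coaction by a $*$-homomorphism, and the base algebra is $\mathcal V=\{b: F(b)=b\otimes1\}$. Let $\Omega(P)$ be a graded-differential $*$-algebra with $\Omega^0(P)=\mathcal B$, generated by $\mathcal B$ as a differential algebra, and such that $F$ extends to a homomorphism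 $\widehat F\colon\Omega(P)\to\Omega(P)\,\widehat\otimes\,\Gamma^\wedge$ of graded-differential $*$-algebras. Put $F^\wedge=(\mathrm{id}\otimes p_*)\widehat F$, with $p_*\colon\Gamma^\wedge\to\mathcal A$ the projection, $\mathfrak{hor}(P)=\widehat F^{-1}(\Omega(P)\otimes\mathcal A)$, $\Omega(M)=\{\alpha:\widehat F(\alpha)=\alpha\otimes1\}$; let $Z(M)$ be the graded centre of $\Omega(M)$ and $HZ(M)$ its cohomology. A *regular multiplicative connection* is a hermitian map $\omega\colon\Gamma_{inv}\to\Omega^1(P)$ with $\widehat F\omega(\vartheta)=\sum_k\omega(\vartheta_k)\otimes c_k+1\otimes\vartheta$, where $\varpi(\vartheta)=\sum_k\vartheta_k\otimes c_k$, such that $\omega(\vartheta)\varphi=(-1)^{\partial\varphi}\sum_k\varphi_k\,\omega(\vartheta\circ c_k)$ for every $\varphi\in\mathfrak{hor}(P)$ with $F^\wedge(\varphi)=\sum_k\varphi_k\otimes c_k$, and such that $\omega$ extends to a homomorphism $\omega^\wedge\colon\Gamma^\wedge_{inv}\to\Omega(P)$. Its horizontal projection is $h_\omega=(\mathrm{id}\otimes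 p_*)m_\omega^{-1}$, where $m_\omega\colon\mathfrak{hor}(P)\otimes\Gamma_{inv}^\wedge\to\Omega(P)$, $m_\omega(\varphi\otimes\vartheta)=\varphi\,\omega^\wedge(\vartheta)$; its covariant derivative is $D_\omega=h_\omega d$ and its curvature is $R_\omega=D_\omega\omega$. Assume that at least one regular multiplicative connection exists. For a finite-dimensional unitary representation $u=(u_{ij})$ of $G$ on $H_u$ with orthonormal basis $(e_i)$ and biorthogonal basis $(e_i^*)$ of $H_u^*$, let $u^c$ be the contragradient representation, $C_u$ the canonical strictly positive intertwiner between $u$ and $u^{cc}$ (normalized by $\mathrm{tr}(C_uf)=\mathrm{tr}(C_u^{-1}f)$ for all $f\in\mathrm{Mor}(u,u)$), and $\mathfrak E_u=\mathrm{Mor}(u,F^\wedge)$ the $\Omega(M)$-bimodule of intertwiners $H_u\to\mathfrak{hor}(P)$; put $\mathfrak E_u^*=\mathrm{Mor}(u^c,F^\wedge)$. There are finitely many $\nu_k\in\mathrm{Mor}(u^c,F)$, $\mu_k\in\mathrm{Mor}(u,F)$ with $\sum_k\nu_k(e_i^*)\mu_k(e_j)=\delta_{ij}$. For left-linear $T$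 on $\mathfrak E_u$ put $$(T_u)_{ij}=\sum_{l,k}(C_u^{-1})_{il}\,\nu_k(e_l^*)\,(T\mu_k)(e_j),\qquad \mathrm{tr}_M(T)=\sum_{i,j,k}(C_u^{-1})_{ji}\,\nu_k(e_i^*)\,(T\mu_k)(e_j).$$ With the pairings $\langle\varphi,\psi\rangle_u^+=\sum_i\varphi(e_i)\psi(e_i^*)$ and $\langle\psi,\varphi\rangle_u^-=\sum_{ij}(C_u^{-1})_{ji}\psi(e_i^*)\varphi(e_j)$, an isomorphism $J\colon\mathfrak E_u\to\mathfrak E_v$ of graded $\Omega(M)$-bimodules is *transposable* if one map $J^\top\colon\mathfrak E_v^*\to\mathfrak E_u^*$ satisfies both $\langle Jx,\varphi\rangle_v^+=\langle x,J^\top\varphi\rangle_u^+$ and $\langle\varphi,Jx\rangle_v^-=\langle J^\top\varphi,x\rangle_u^-$. Let $K(M,P)$ be the Grothendieck ring of the semiring of classes $[\mathfrak E_u]$ modulo transposable isomorphism, with $[\mathfrak E_u]+[\mathfrak E_v]=[\mathfrak E_{u\oplus v}]$, $[\mathfrak E_u][\mathfrak E_v]=[\mathfrak E_{u\times v}]$.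 An element $A\in Z(M)$ acts on $\mathfrak E_u$ by left multiplication. Put $\mathfrak{ch}^u(A)=\sum_{k\ge0}\frac1{(2\pi i)^kk!}\,\mathrm{tr}_M(A\,D_\omega^{2k})$, where $D_\omega$ acts on $\mathfrak E_u$ by composition. Infinite sums are formal series in the graded space: the cohomology is completed to $\prod_nHZ^n(M)$, and all maps are extended to formal series degree by degree. Let $I^\star\subseteq\Gamma_{inv}^\otimes$ be the algebra of elements invariant under the adjoint action, and let $\mathfrak w(M)\subseteq HZ(M)$ be the algebra of characteristic classes: the set of all $[R_\omega^\otimes(\vartheta)]$, $\vartheta\in I^\star$, where $R_\omega^\otimes$ is the unital multiplicative extension of $R_\omega$. **Statement.** The Chern character is well defined: there is exactly one right action $\circ$ of the ring $K(M,P)$ on the completed $HZ(M)$ by linear maps such that $[A]\circ[\mathfrak E_u]=[\mathfrak{ch}^u(A)]$ for all $u$, all closed $A$ in (the completion of) $Z(M)$ and all regular multiplicative connections. Moreover: (i) For every regular multiplicative connection $\omega$, every $u$, every choice of $(\nu_k,\mu_k)$ and every closed $A$, with $(R_{\omega,u})_{ij}=R_\omega\pi(u_{ij})$, each $\mathrm{tr}(A_uR_{\omega,u}^\alpha)$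 is a closed element of $Z(M)$, and $$[A]\circ[\mathfrak E_u]=\sum_{\alpha\ge0}\frac{(-1)^\alpha}{(2\pi i)^\alpha\,\alpha!}\,\bigl[\mathrm{tr}(A_uR_{\omega,u}^\alpha)\bigr].$$ (ii) The algebra $\mathfrak w(M)$ is invariant under the action of $K(M,P)$: if all homogeneous components of $\xi$ lie in $\mathfrak w(M)$ and $x\in K(M,P)$, then all homogeneous components of $\xi\circ x$ lie in $\mathfrak w(M)$. -/

import Mathlib

open scoped TensorProduct ComplexOrder DirectSum Matrix

noncomputable section

namespace QPB

/-! ### Compact matrix quantum groups and their unitary representations -/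

section Groups

variable {A : Type*} [Ring A] [HopfAlgebra ℂ A] [StarRing A] [StarModule ℂ A]

/-- A unitary representation of the quantum group on the unitary space `ℂ^ι` with its standard
orthonormal basis `e_i`: a unitary matrix `u` over `A` with `u e_i = ∑ j, e_j ⊗ u_{ji}`,
`φ u_{ij} = ∑ k, u_{ik} ⊗ u_{kj}` and `ε u_{ij} = δ_{ij}`. -/
structure Rep (A : Type*) [Ring A] [HopfAlgebra ℂ A] [StarRing A] where
  ι : Type
  [fin : Fintype ι]
  [dec : DecidableEq ι]
  mat : Matrix ι ι A
  comul_mat : ∀ i j, Coalgebra.comul (R := ℂ) (mat i j) = ∑ k, mat i k ⊗ₜ[ℂ] mat k j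
  counit_mat : ∀ i j, Coalgebra.counit (R := ℂ) (mat i j) = if i = j then 1 else 0
  unitary_left : matᴴ * mat = 1
  unitary_right : mat * matᴴ = 1

attribute [instance] Rep.fin Rep.dec

/-- `A` is the Hopf *-algebra of polynomial functions on a compact matrix quantum group: the
coproduct is a *-homomorphism, and the matrix elements of one unitary representation generate `A`. -/
class IsCompactMatrixQuantumGroup (A : Type*) [Ring A] [HopfAlgebra ℂ A] [StarRing A]
    [StarModule ℂ A] : Prop where
  comul_star : ∀ a : A, Coalgebra.comul (R := ℂ) (star a) = star (Coalgebra.comul (R := ℂ) a)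
  exists_generator : ∃ u : Rep A, Algebra.adjoin ℂ {a : A | ∃ i j, a = u.mat i j} = ⊤

/-- The antipode `κ`. -/
abbrev antip (A : Type*) [Ring A] [HopfAlgebra ℂ A] : A →ₗ[ℂ] A := HopfAlgebra.antipode ℂ

/-- The adjoint action `ad a = a₍₂₎ ⊗ κ(a₍₁₎) a₍₃₎`. -/
def ad (A : Type*) [Ring A] [HopfAlgebra ℂ A] : A →ₗ[ℂ] A ⊗[ℂ] A :=
  TensorProduct.map LinearMap.id
      (LinearMap.mul' ℂ A ∘ₗ TensorProduct.map (antip A) LinearMap.id)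
    ∘ₗ (TensorProduct.leftComm ℂ A A A).toLinearMap
    ∘ₗ TensorProduct.map LinearMap.id Coalgebra.comul ∘ₗ Coalgebra.comul

namespace Rep

/-- The direct sum of two representations. -/
def add (u v : Rep A) : Rep A where
  ι := u.ι ⊕ v.ι
  mat := Matrix.fromBlocks u.mat 0 0 v.mat
  comul_mat := by
    rintro (i | i) (j | j) <;>
      simp [u.comul_mat, v.comul_mat]
  counit_mat := by
    rintro (i | i) (j | j) <;>
      simp [u.counit_mat, v.counit_mat]
  unitary_left := by
    rw [Matrix.fromBlocks_conjTranspose, Matrix.fromBlocks_multiply]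
    simp [u.unitary_left, v.unitary_left]
  unitary_right := by
    rw [Matrix.fromBlocks_conjTranspose, Matrix.fromBlocks_multiply]
    simp [u.unitary_right, v.unitary_right]

/-- The product of two representations, acting in `H_u ⊗ H_v`. -/
def mul (u v : Rep A) : Rep A where
  ι := u.ι × v.ι
  mat := Matrix.of fun p q => u.mat p.1 q.1 * v.mat p.2 q.2
  comul_mat := by
    rintro ⟨i, i'⟩ ⟨j, j'⟩
    rw [Matrix.of_apply, Bialgebra.comul_mul, u.comul_mat, v.comul_mat, Finset.sum_mul_sum,
      Fintype.sum_prod_type]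
    simp [Algebra.TensorProduct.tmul_mul_tmul]
  counit_mat := by
    rintro ⟨i, i'⟩ ⟨j, j'⟩
    rw [Matrix.of_apply, Bialgebra.counit_mul, u.counit_mat, v.counit_mat]
    simp only [Prod.mk.injEq]
    split_ifs <;> simp_all
  unitary_left := by
    ext ⟨i, i'⟩ ⟨j, j'⟩
    have h1 : ∀ i j, ∑ k, star (u.mat k i) * u.mat k j = if i = j then 1 else 0 := fun i j => by
      have := congrFun (congrFun u.unitary_left i) j
      simpa [Matrix.mul_apply, Matrix.one_apply] using this
    have h2 : ∀ i j, ∑ k, star (v.mat k i) * v.mat k j = if i = j then 1 else 0 := fun i j => by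
      have := congrFun (congrFun v.unitary_left i) j
      simpa [Matrix.mul_apply, Matrix.one_apply] using this
    simp only [Matrix.mul_apply, Matrix.conjTranspose_apply, Matrix.one_apply, Matrix.of_apply,
      Fintype.sum_prod_type, Prod.mk.injEq]
    rw [Finset.sum_comm]
    have : ∀ y x, star (u.mat x i * v.mat y i') * (u.mat x j * v.mat y j')
        = star (v.mat y i') * ((star (u.mat x i) * u.mat x j) * v.mat y j') := by
      intro y x; rw [star_mul]; simp only [mul_assoc]
    simp only [this, ← Finset.mul_sum, ← Finset.sum_mul, h1]
    by_cases h : i = j <;> simp [h, h2]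
  unitary_right := by
    ext ⟨i, i'⟩ ⟨j, j'⟩
    have h1 : ∀ i j, ∑ k, u.mat i k * star (u.mat j k) = if i = j then 1 else 0 := fun i j => by
      have := congrFun (congrFun u.unitary_right i) j
      simpa [Matrix.mul_apply, Matrix.one_apply] using this
    have h2 : ∀ i j, ∑ k, v.mat i k * star (v.mat j k) = if i = j then 1 else 0 := fun i j => by
      have := congrFun (congrFun v.unitary_right i) j
      simpa [Matrix.mul_apply, Matrix.one_apply] using this
    simp only [Matrix.mul_apply, Matrix.conjTranspose_apply, Matrix.one_apply, Matrix.of_apply,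
      Fintype.sum_prod_type, Prod.mk.injEq]
    have : ∀ x y, u.mat i x * v.mat i' y * star (u.mat j x * v.mat j' y)
        = u.mat i x * ((v.mat i' y * star (v.mat j' y)) * star (u.mat j x)) := by
      intro x y; rw [star_mul]; simp only [mul_assoc]
    simp only [this, ← Finset.mul_sum, ← Finset.sum_mul, h2]
    by_cases h : i' = j' <;> simp [h, h1]

/-- The trivial representation, acting in `ℂ`. -/
def triv : Rep A where
  ι := Unit
  mat := 1
  comul_mat := by simp [Algebra.TensorProduct.one_def]
  counit_mat := by simp
  unitary_left := by simp
  unitary_right := by simp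

/-- The matrix of the contragradient representation `u^c` on `H_u^*`, with respect to the
biorthogonal basis `e_i^*`: `(u^c)_{ij} = κ(u_{ji})`. -/
def contra (u : Rep A) : Matrix u.ι u.ι A := fun i j => antip A (u.mat j i)

/-- `C` is the canonical intertwiner between `u` and its second contragradient `u^{cc}`
(whose matrix is `κ²(u)`): it is strictly positive, and `tr(C f) = tr(C⁻¹ f)` for every
`f ∈ Mor(u, u)`; for irreducible `u` the last condition says `tr C = tr C⁻¹`. These
conditions determine `C`. -/
structure IsCanonical (u : Rep A) (C : Matrix u.ι u.ι ℂ) : Prop where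
  posDef : C.PosDef
  intertwines : (u.mat.map fun a => antip A (antip A a)) * C.map (algebraMap ℂ A)
    = C.map (algebraMap ℂ A) * u.mat
  trace_eq : ∀ f : Matrix u.ι u.ι ℂ,
    u.mat * f.map (algebraMap ℂ A) = f.map (algebraMap ℂ A) * u.mat →
      (C * f).trace = (C⁻¹ * f).trace

open Classical in
/-- The canonical intertwiner `C_u`. -/
def canon (u : Rep A) : Matrix u.ι u.ι ℂ :=
  if h : ∃ C, u.IsCanonical C then h.choose else 1

end Rep

end Groups

/-! ### First-order bicovariant *-calculi and the universal differential envelope -/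

section Calculus

/-- The linear map `a ⊗ b ↦ a (d b)`. -/
def formMap {A Γ : Type*} [Ring A] [Algebra ℂ A] [AddCommGroup Γ] [Module ℂ Γ] [Module A Γ]
    [IsScalarTower ℂ A Γ] (d : A →ₗ[ℂ] Γ) : A ⊗[ℂ] A →ₗ[ℂ] Γ :=
  TensorProduct.lift (LinearMap.mk₂ ℂ (fun a b => a • d b)
    (fun a a' b => add_smul _ _ _) (fun c a b => smul_assoc _ _ _)
    (fun a b b' => by rw [map_add, smul_add])
    (fun c a b => by rw [map_smul, smul_algebra_smul_comm]))

/-- A first-order bicovariant *-calculus `Γ` over the quantum group: an `A`-bimodule with a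
derivation `d`, spanned by the elements `a (d b)`, left-covariant, right-covariant and with a
compatible *-structure. -/
structure FODC (A Γ : Type*) [Ring A] [HopfAlgebra ℂ A] [StarRing A] [StarModule ℂ A]
    [AddCommGroup Γ] [Module ℂ Γ] [Module A Γ] [Module Aᵐᵒᵖ Γ] [SMulCommClass A Aᵐᵒᵖ Γ]
    [IsScalarTower ℂ A Γ] [IsScalarTower ℂ Aᵐᵒᵖ Γ] where
  d : A →ₗ[ℂ] Γ
  leibniz : ∀ a b : A, d (a * b) = a • d b + MulOpposite.op b • d a
  spanned : Function.Surjective (formMap d)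
  /-- `∑ a_k d b_k = 0` implies `∑ φ(a_k) (id ⊗ d) φ(b_k) = 0` -/
  left_cov : ∀ t : A ⊗[ℂ] A, formMap d t = 0 →
    TensorProduct.map (LinearMap.mul' ℂ A) (formMap d)
      (TensorProduct.tensorTensorTensorComm ℂ A A A A
        (TensorProduct.map Coalgebra.comul Coalgebra.comul t)) = 0
  /-- `∑ a_k d b_k = 0` implies `∑ φ(a_k) (d ⊗ id) φ(b_k) = 0` -/
  right_cov : ∀ t : A ⊗[ℂ] A, formMap d t = 0 →
    TensorProduct.map (formMap d) (LinearMap.mul' ℂ A)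
      (TensorProduct.tensorTensorTensorComm ℂ A A A A
        (TensorProduct.map Coalgebra.comul Coalgebra.comul t)) = 0
  st : Γ →ₛₗ[starRingEnd ℂ] Γ
  st_smul : ∀ (a : A) (γ : Γ), st (a • γ) = MulOpposite.op (star a) • st γ
  st_d : ∀ a : A, st (d a) = d (star a)

variable {A Γ : Type*} [Ring A] [HopfAlgebra ℂ A] [StarRing A] [StarModule ℂ A]
    [AddCommGroup Γ] [Module ℂ Γ] [Module A Γ] [Module Aᵐᵒᵖ Γ] [SMulCommClass A Aᵐᵒᵖ Γ]
    [IsScalarTower ℂ A Γ] [IsScalarTower ℂ Aᵐᵒᵖ Γ]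

namespace FODC

/-- For linear maps `f, g` into an algebra, the map `a ⊗ b ↦ f a * g b`. -/
def mulMap {X Y E : Type*} [AddCommGroup X] [Module ℂ X] [AddCommGroup Y] [Module ℂ Y]
    [Semiring E] [Algebra ℂ E] (f : X →ₗ[ℂ] E) (g : Y →ₗ[ℂ] E) : X ⊗[ℂ] Y →ₗ[ℂ] E :=
  LinearMap.mul' ℂ E ∘ₗ TensorProduct.map f g

/-- The degree-zero generators. -/
abbrev gen0 (A Γ : Type*) [Ring A] [Algebra ℂ A] [AddCommGroup Γ] [Module ℂ Γ] :
    A →ₗ[ℂ] TensorAlgebra ℂ (A × Γ) := TensorAlgebra.ι ℂ ∘ₗ LinearMap.inl ℂ A Γ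

/-- The degree-one generators. -/
abbrev gen1 (A Γ : Type*) [Ring A] [Algebra ℂ A] [AddCommGroup Γ] [Module ℂ Γ] :
    Γ →ₗ[ℂ] TensorAlgebra ℂ (A × Γ) := TensorAlgebra.ι ℂ ∘ₗ LinearMap.inr ℂ A Γ

/-- The relations of `Γ^∧ = Γ^⊗ / S^∧`. The first four present the tensor algebra `Γ^⊗` of the
`A`-bimodule `Γ`; the last one imposes `∑ da_k db_k = 0` whenever `∑ a_k db_k = 0`. -/
inductive EnvRel (c : FODC A Γ) : TensorAlgebra ℂ (A × Γ) → TensorAlgebra ℂ (A × Γ) → Prop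
  | one : EnvRel c (gen0 A Γ 1) 1
  | mul (a b : A) : EnvRel c (gen0 A Γ (a * b)) (gen0 A Γ a * gen0 A Γ b)
  | left (a : A) (γ : Γ) : EnvRel c (gen1 A Γ (a • γ)) (gen0 A Γ a * gen1 A Γ γ)
  | right (a : A) (γ : Γ) :
      EnvRel c (gen1 A Γ (MulOpposite.op a • γ)) (gen1 A Γ γ * gen0 A Γ a)
  | wedge (t : A ⊗[ℂ] A) (h : formMap c.d t = 0) :
      EnvRel c (mulMap (gen1 A Γ ∘ₗ c.d) (gen1 A Γ ∘ₗ c.d) t) 0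

/-- The universal differential envelope `Γ^∧` of the first-order calculus `Γ`. -/
def Env (c : FODC A Γ) : Type _ := RingQuot c.EnvRel

instance (c : FODC A Γ) : Ring c.Env := inferInstanceAs (Ring (RingQuot c.EnvRel))

instance (c : FODC A Γ) : Algebra ℂ c.Env := inferInstanceAs (Algebra ℂ (RingQuot c.EnvRel))

/-- The quotient map onto `Γ^∧`. -/
def mkEnv (c : FODC A Γ) : TensorAlgebra ℂ (A × Γ) →ₐ[ℂ] c.Env := RingQuot.mkAlgHom ℂ c.EnvRel

variable (c : FODC A Γ)

/-- The inclusion of `A` into `Γ^∧`. -/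
def inA : A →ₗ[ℂ] c.Env := c.mkEnv.toLinearMap ∘ₗ gen0 A Γ

/-- The inclusion of `Γ` into `Γ^∧`. -/
def inΓ : Γ →ₗ[ℂ] c.Env := c.mkEnv.toLinearMap ∘ₗ gen1 A Γ

lemma mkEnv_rel {x y : TensorAlgebra ℂ (A × Γ)} (h : c.EnvRel x y) : c.mkEnv x = c.mkEnv y :=
  RingQuot.mkAlgHom_rel ℂ h

lemma inA_one : c.inA 1 = 1 := by
  have := c.mkEnv_rel (EnvRel.one (c := c))
  exact this.trans (map_one _)

lemma inA_mul (a b : A) : c.inA (a * b) = c.inA a * c.inA b := by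
  have := c.mkEnv_rel (EnvRel.mul (c := c) a b)
  exact this.trans (map_mul _ _ _)

lemma inΓ_left (a : A) (γ : Γ) : c.inΓ (a • γ) = c.inA a * c.inΓ γ := by
  have := c.mkEnv_rel (EnvRel.left (c := c) a γ)
  rw [map_mul] at this
  exact this

lemma inΓ_right (a : A) (γ : Γ) : c.inΓ (MulOpposite.op a • γ) = c.inΓ γ * c.inA a := by
  have := c.mkEnv_rel (EnvRel.right (c := c) a γ)
  rw [map_mul] at this
  exact this

/-- The map `a ⊗ b ↦ da db` into `Γ^∧`. -/
abbrev ddMap : A ⊗[ℂ] A →ₗ[ℂ] c.Env := mulMap (c.inΓ ∘ₗ c.d) (c.inΓ ∘ₗ c.d)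

lemma algHom_mulMap {X Y E E' : Type*} [AddCommGroup X] [Module ℂ X] [AddCommGroup Y]
    [Module ℂ Y] [Semiring E] [Algebra ℂ E] [Semiring E'] [Algebra ℂ E'] (F : E →ₐ[ℂ] E')
    (f : X →ₗ[ℂ] E) (g : Y →ₗ[ℂ] E) (t : X ⊗[ℂ] Y) :
    F (mulMap f g t) = mulMap (F.toLinearMap ∘ₗ f) (F.toLinearMap ∘ₗ g) t := by
  induction t with
  | zero => simp
  | tmul x y => simp [mulMap]
  | add x y hx hy => simp [hx, hy]

lemma ddMap_eq_zero (t : A ⊗[ℂ] A) (h : formMap c.d t = 0) : c.ddMap t = 0 := by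
  have := c.mkEnv_rel (EnvRel.wedge (c := c) t h)
  rw [map_zero, algHom_mulMap] at this
  exact this

/-- Universal property used to define maps out of `Γ^∧`. -/
def envLift {E : Type*} [Semiring E] [Algebra ℂ E] (f : A →ₗ[ℂ] E) (g : Γ →ₗ[ℂ] E)
    (h1 : f 1 = 1) (hm : ∀ a b, f (a * b) = f a * f b) (hl : ∀ a γ, g (a • γ) = f a * g γ)
    (hr : ∀ a γ, g (MulOpposite.op a • γ) = g γ * f a)
    (hw : ∀ t, formMap c.d t = 0 → mulMap (g ∘ₗ c.d) (g ∘ₗ c.d) t = 0) : c.Env →ₐ[ℂ] E :=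
  RingQuot.liftAlgHom ℂ ⟨TensorAlgebra.lift ℂ (f.coprod g), by
    intro x y hxy
    have e0 : (TensorAlgebra.lift ℂ (f.coprod g)).toLinearMap ∘ₗ gen0 A Γ = f := by ext; simp
    have e1 : (TensorAlgebra.lift ℂ (f.coprod g)).toLinearMap ∘ₗ gen1 A Γ = g := by ext; simp
    cases hxy with
    | one => simpa using h1
    | mul a b => simpa using hm a b
    | left a γ => simpa using hl a γ
    | right a γ => simpa using hr a γ
    | wedge t h =>
      rw [map_zero, algHom_mulMap, ← LinearMap.comp_assoc, e1]
      exact hw t h⟩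

lemma envLift_inA {E : Type*} [Semiring E] [Algebra ℂ E] (f : A →ₗ[ℂ] E) (g : Γ →ₗ[ℂ] E)
    (h1 hm hl hr hw) (a : A) : c.envLift f g h1 hm hl hr hw (c.inA a) = f a :=
  (RingQuot.liftAlgHom_mkAlgHom_apply ℂ _ _ _).trans (by simp)

lemma envLift_inΓ {E : Type*} [Semiring E] [Algebra ℂ E] (f : A →ₗ[ℂ] E) (g : Γ →ₗ[ℂ] E)
    (h1 hm hl hr hw) (γ : Γ) : c.envLift f g h1 hm hl hr hw (c.inΓ γ) = g γ :=
  (RingQuot.liftAlgHom_mkAlgHom_apply ℂ _ _ _).trans (by simp)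

lemma env_hom_ext {E : Type*} [Semiring E] [Algebra ℂ E] {F G : c.Env →ₐ[ℂ] E}
    (h0 : ∀ a, F (c.inA a) = G (c.inA a)) (h1 : ∀ γ, F (c.inΓ γ) = G (c.inΓ γ)) : F = G := by
  apply RingQuot.ringQuot_ext'
  apply TensorAlgebra.hom_ext
  apply LinearMap.prod_ext
  · ext a; exact h0 a
  · ext γ; exact h1 γ

/-- The projection `p_* : Γ^∧ → A` onto the degree-zero part. -/
def proj : c.Env →ₐ[ℂ] A :=
  c.envLift LinearMap.id 0 (by simp) (by simp) (by simp) (by simp)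
    (by intro t _; simp [mulMap])

/-- The differential on one-forms, `∑ a_k db_k ↦ ∑ da_k db_k`. -/
def dOne : Γ →ₗ[ℂ] c.Env :=
  (LinearMap.ker (formMap c.d)).liftQ c.ddMap (fun t ht => c.ddMap_eq_zero t ht)
    ∘ₗ ((formMap c.d).quotKerEquivOfSurjective c.spanned).symm.toLinearMap

lemma dOne_formMap (t : A ⊗[ℂ] A) : c.dOne (formMap c.d t) = c.ddMap t := by
  have : ((formMap c.d).quotKerEquivOfSurjective c.spanned).symm (formMap c.d t)
      = Submodule.Quotient.mk t := by
    rw [LinearEquiv.symm_apply_eq]; rfl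
  simp only [dOne, LinearMap.comp_apply, LinearEquiv.coe_coe, this]
  rfl

lemma d_one : c.d 1 = 0 := by
  have := c.leibniz 1 1
  simpa using this

lemma dOne_d (a : A) : c.dOne (c.d a) = 0 := by
  have := c.dOne_formMap (1 ⊗ₜ a)
  simpa [formMap, mulMap, d_one] using this

lemma dOne_left (a : A) (γ : Γ) :
    c.dOne (a • γ) = c.inA a * c.dOne γ + c.inΓ (c.d a) * c.inΓ γ := by
  obtain ⟨t, rfl⟩ := c.spanned γ
  induction t with
  | zero => simp
  | add x y hx hy => simp only [map_add, smul_add, hx, hy, mul_add]; abel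
  | tmul x y =>
    have h1 := c.dOne_formMap ((a * x) ⊗ₜ y)
    have h2 := c.dOne_formMap (x ⊗ₜ y)
    simp only [formMap, mulMap, TensorProduct.lift.tmul, LinearMap.mk₂_apply, LinearMap.comp_apply,
      TensorProduct.map_tmul, LinearMap.mul'_apply, c.leibniz, map_add, inΓ_left, inΓ_right,
      mul_smul] at h1 h2 ⊢
    rw [h1, h2]; noncomm_ring

lemma dOne_right (a : A) (γ : Γ) :
    c.dOne (MulOpposite.op a • γ) = c.dOne γ * c.inA a - c.inΓ γ * c.inΓ (c.d a) := by
  obtain ⟨t, rfl⟩ := c.spanned γ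
  induction t with
  | zero => simp
  | add x y hx hy => simp only [map_add, smul_add, hx, hy, add_mul]; abel
  | tmul x y =>
    have h0 : MulOpposite.op a • x • c.d y = x • c.d (y * a) - (x * y) • c.d a := by
      rw [c.leibniz, smul_add, mul_smul, ← smul_comm x (MulOpposite.op a)]; abel
    have h1 := c.dOne_formMap (x ⊗ₜ (y * a))
    have h2 := c.dOne_formMap ((x * y) ⊗ₜ a)
    have h3 := c.dOne_formMap (x ⊗ₜ y)
    simp only [formMap, mulMap, TensorProduct.lift.tmul, LinearMap.mk₂_apply, LinearMap.comp_apply,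
      TensorProduct.map_tmul, LinearMap.mul'_apply] at h1 h2 h3 ⊢
    rw [h0, map_sub, h1, h2, h3]
    simp only [c.leibniz, map_add, inΓ_left, inΓ_right]
    noncomm_ring

/-- The matrix `((a, da), (0, a))`. -/
def dMatA : A →ₗ[ℂ] Matrix (Fin 2) (Fin 2) c.Env where
  toFun a := !![c.inA a, c.inΓ (c.d a); 0, c.inA a]
  map_add' a b := by ext i j; fin_cases i <;> fin_cases j <;> simp
  map_smul' r a := by ext i j; fin_cases i <;> fin_cases j <;> simp

/-- The matrix `((-γ, dγ), (0, γ))`. -/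
def dMatΓ : Γ →ₗ[ℂ] Matrix (Fin 2) (Fin 2) c.Env where
  toFun γ := !![-c.inΓ γ, c.dOne γ; 0, c.inΓ γ]
  map_add' a b := by ext i j; fin_cases i <;> fin_cases j <;> simp [add_comm]
  map_smul' r a := by ext i j; fin_cases i <;> fin_cases j <;> simp

lemma dMat_dd (t : A ⊗[ℂ] A) :
    mulMap (c.dMatΓ ∘ₗ c.d) (c.dMatΓ ∘ₗ c.d) t = !![c.ddMap t, 0; 0, c.ddMap t] := by
  induction t with
  | zero => ext i j; fin_cases i <;> fin_cases j <;> simp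
  | add x y hx hy =>
    rw [map_add, hx, hy]; ext i j; fin_cases i <;> fin_cases j <;> simp
  | tmul x y =>
    simp only [mulMap, LinearMap.comp_apply, TensorProduct.map_tmul, LinearMap.mul'_apply,
      dMatΓ, LinearMap.coe_mk, AddHom.coe_mk, dOne_d]
    ext i j; fin_cases i <;> fin_cases j <;> simp [Matrix.mul_apply]

/-- The homomorphism `x ↦ (((-1)^{∂x} x, dx), (0, x))` whose corner is the differential. -/
def dHom : c.Env →ₐ[ℂ] Matrix (Fin 2) (Fin 2) c.Env :=
  c.envLift c.dMatA c.dMatΓ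
    (by ext i j; fin_cases i <;> fin_cases j <;> simp [dMatA, inA_one, d_one])
    (by
      intro a b
      ext i j; fin_cases i <;> fin_cases j <;>
        simp [dMatA, Matrix.mul_apply, inA_mul, c.leibniz, inΓ_left, inΓ_right])
    (by
      intro a γ
      ext i j; fin_cases i <;> fin_cases j <;>
        simp [dMatA, dMatΓ, Matrix.mul_apply, inΓ_left, dOne_left, mul_neg])
    (by
      intro a γ
      ext i j; fin_cases i <;> fin_cases j <;>
        simp [dMatA, dMatΓ, Matrix.mul_apply, inΓ_right, dOne_right, sub_eq_neg_add, neg_mul])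
    (by
      intro t ht
      rw [dMat_dd, c.ddMap_eq_zero t ht]
      ext i j; fin_cases i <;> fin_cases j <;> simp)

/-- The differential of `Γ^∧`. -/
def dEnv : c.Env →ₗ[ℂ] c.Env where
  toFun x := c.dHom x 0 1
  map_add' x y := by simp
  map_smul' r x := by simp

/-- The degree-`n` part of `Γ^∧`: the span of the products `a γ₁ ⋯ γ_n`. -/
def grading (n : ℕ) : Submodule ℂ c.Env :=
  LinearMap.range c.inA * LinearMap.range c.inΓ ^ n

lemma inA_mem (a : A) : c.inA a ∈ c.grading 0 := by
  simp [grading]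

lemma one_mem_rangeA : (1 : c.Env) ∈ LinearMap.range c.inA := ⟨1, c.inA_one⟩

lemma inΓ_mem (γ : Γ) : c.inΓ γ ∈ c.grading 1 := by
  have := Submodule.mul_mem_mul c.one_mem_rangeA (LinearMap.mem_range_self c.inΓ γ)
  simpa [grading] using this

lemma grading_mul (m n : ℕ) : c.grading m * c.grading n ≤ c.grading (m + n) := by
  have hAA : LinearMap.range c.inA * LinearMap.range c.inA ≤ LinearMap.range c.inA := by
    rw [Submodule.mul_le]
    rintro _ ⟨a, rfl⟩ _ ⟨b, rfl⟩
    exact ⟨a * b, c.inA_mul a b⟩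
  have hGA : LinearMap.range c.inΓ * LinearMap.range c.inA ≤ LinearMap.range c.inΓ := by
    rw [Submodule.mul_le]
    rintro _ ⟨a, rfl⟩ _ ⟨b, rfl⟩
    exact ⟨_, c.inΓ_right b a⟩
  have h1 : (1 : Submodule ℂ c.Env) ≤ LinearMap.range c.inA := by
    rw [Submodule.one_le]; exact c.one_mem_rangeA
  have key : LinearMap.range c.inΓ ^ m * LinearMap.range c.inA
      ≤ LinearMap.range c.inA * LinearMap.range c.inΓ ^ m := by
    cases m with
    | zero => simp
    | succ m =>
      calc LinearMap.range c.inΓ ^ (m + 1) * LinearMap.range c.inA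
          = LinearMap.range c.inΓ ^ m * (LinearMap.range c.inΓ * LinearMap.range c.inA) := by
            rw [pow_succ, mul_assoc]
        _ ≤ LinearMap.range c.inΓ ^ m * LinearMap.range c.inΓ := by gcongr
        _ = 1 * LinearMap.range c.inΓ ^ (m + 1) := by rw [pow_succ, one_mul]
        _ ≤ LinearMap.range c.inA * LinearMap.range c.inΓ ^ (m + 1) := by gcongr
  unfold grading
  calc LinearMap.range c.inA * LinearMap.range c.inΓ ^ m
        * (LinearMap.range c.inA * LinearMap.range c.inΓ ^ n)
      = LinearMap.range c.inA * (LinearMap.range c.inΓ ^ m * LinearMap.range c.inA)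
        * LinearMap.range c.inΓ ^ n := by simp only [mul_assoc]
    _ ≤ LinearMap.range c.inA * (LinearMap.range c.inA * LinearMap.range c.inΓ ^ m)
        * LinearMap.range c.inΓ ^ n := by gcongr
    _ = (LinearMap.range c.inA * LinearMap.range c.inA) * LinearMap.range c.inΓ ^ (m + n) := by
        rw [pow_add]; simp only [mul_assoc]
    _ ≤ LinearMap.range c.inA * LinearMap.range c.inΓ ^ (m + n) := by gcongr

instance gradedMonoid : SetLike.GradedMonoid c.grading where
  one_mem := by rw [← c.inA_one]; exact c.inA_mem 1
  mul_mem _ _ _ _ hx hy := c.grading_mul _ _ (Submodule.mul_mem_mul hx hy)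

/-- `A` as the degree-zero part of the direct sum of the homogeneous parts. -/
def dsA : A →ₗ[ℂ] ⨁ i, c.grading i :=
  DirectSum.lof ℂ ℕ (fun i => c.grading i) 0 ∘ₗ c.inA.codRestrict _ c.inA_mem

/-- `Γ` as part of the direct sum of the homogeneous parts. -/
def dsΓ : Γ →ₗ[ℂ] ⨁ i, c.grading i :=
  DirectSum.lof ℂ ℕ (fun i => c.grading i) 1 ∘ₗ c.inΓ.codRestrict _ c.inΓ_mem

lemma ddMap_mem (t : A ⊗[ℂ] A) : c.ddMap t ∈ c.grading 2 := by
  induction t with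
  | zero => simp
  | add x y hx hy => rw [map_add]; exact add_mem hx hy
  | tmul x y =>
    simp only [mulMap, LinearMap.comp_apply, TensorProduct.map_tmul, LinearMap.mul'_apply]
    exact c.grading_mul 1 1 (Submodule.mul_mem_mul (c.inΓ_mem _) (c.inΓ_mem _))

lemma ds_dd (t : A ⊗[ℂ] A) : mulMap (c.dsΓ ∘ₗ c.d) (c.dsΓ ∘ₗ c.d) t
    = DirectSum.lof ℂ ℕ (fun i => c.grading i) 2 ⟨c.ddMap t, c.ddMap_mem t⟩ := by
  suffices h : mulMap (c.dsΓ ∘ₗ c.d) (c.dsΓ ∘ₗ c.d)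
      = DirectSum.lof ℂ ℕ (fun i => c.grading i) 2 ∘ₗ c.ddMap.codRestrict _ c.ddMap_mem from
    LinearMap.congr_fun h t
  apply TensorProduct.ext'
  intro x y
  simp only [mulMap, LinearMap.comp_apply, TensorProduct.map_tmul, LinearMap.mul'_apply, dsΓ,
    DirectSum.lof_eq_of, DirectSum.of_mul_of]
  rfl

/-- The decomposition of `Γ^∧` into homogeneous components. -/
def decomp : c.Env →ₐ[ℂ] ⨁ i, c.grading i :=
  c.envLift c.dsA c.dsΓ
    (by
      simp only [dsA, LinearMap.comp_apply, DirectSum.lof_eq_of]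
      refine DirectSum.of_eq_of_gradedMonoid_eq (Sigma.subtype_ext rfl ?_)
      exact c.inA_one)
    (by
      intro a b
      simp only [dsA, LinearMap.comp_apply, DirectSum.lof_eq_of, DirectSum.of_mul_of]
      refine DirectSum.of_eq_of_gradedMonoid_eq (Sigma.subtype_ext rfl ?_)
      exact c.inA_mul a b)
    (by
      intro a γ
      simp only [dsA, dsΓ, LinearMap.comp_apply, DirectSum.lof_eq_of, DirectSum.of_mul_of]
      refine DirectSum.of_eq_of_gradedMonoid_eq (Sigma.subtype_ext rfl ?_)
      exact c.inΓ_left a γ)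
    (by
      intro a γ
      simp only [dsA, dsΓ, LinearMap.comp_apply, DirectSum.lof_eq_of, DirectSum.of_mul_of]
      refine DirectSum.of_eq_of_gradedMonoid_eq (Sigma.subtype_ext rfl ?_)
      exact c.inΓ_right a γ)
    (by
      intro t ht
      rw [c.ds_dd t]
      have : (⟨c.ddMap t, c.ddMap_mem t⟩ : c.grading 2) = 0 :=
        Subtype.ext (c.ddMap_eq_zero t ht)
      rw [this, map_zero])

lemma decomp_right : (DirectSum.coeAlgHom c.grading).comp c.decomp = AlgHom.id ℂ c.Env := by
  apply c.env_hom_ext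
  · intro a
    simp only [AlgHom.comp_apply, decomp, envLift_inA, dsA, LinearMap.comp_apply,
      DirectSum.lof_eq_of, DirectSum.coeAlgHom_of]
    rfl
  · intro γ
    simp only [AlgHom.comp_apply, decomp, envLift_inΓ, dsΓ, LinearMap.comp_apply,
      DirectSum.lof_eq_of, DirectSum.coeAlgHom_of]
    rfl

lemma decomp_mem_aux (n : ℕ) : ∀ x ∈ LinearMap.range c.inΓ ^ n, ∀ a : A,
    ∃ y : c.grading n, c.decomp (c.inA a * x) = DirectSum.of (fun i => c.grading i) n y := by
  induction n with
  | zero =>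
    intro x hx a
    rw [pow_zero, Submodule.mem_one] at hx
    obtain ⟨r, rfl⟩ := hx
    refine ⟨r • ⟨c.inA a, c.inA_mem a⟩, ?_⟩
    rw [← Algebra.commutes, ← Algebra.smul_def, map_smul, ← DirectSum.lof_eq_of ℂ, map_smul]
    congr 1
    simp only [decomp, envLift_inA]
    rfl
  | succ n ih =>
    intro x hx
    rw [pow_succ'] at hx
    induction hx using Submodule.mul_induction_on' with
    | mem_mul_mem m hm z hz =>
      obtain ⟨γ, rfl⟩ := hm
      intro a
      obtain ⟨y, hy⟩ := ih z hz 1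
      rw [c.inA_one, one_mul] at hy
      have hG : c.decomp (c.inΓ (a • γ))
          = DirectSum.of (fun i => c.grading i) 1 ⟨c.inΓ (a • γ), c.inΓ_mem _⟩ := by
        simp only [decomp, envLift_inΓ]
        rfl
      rw [← mul_assoc, ← c.inΓ_left, map_mul, hy, hG, DirectSum.of_mul_of]
      refine ⟨⟨c.inΓ (a • γ) * y, ?_⟩, ?_⟩
      · rw [add_comm]; exact SetLike.mul_mem_graded (c.inΓ_mem _) y.2
      · exact DirectSum.of_eq_of_gradedMonoid_eq (Sigma.subtype_ext (add_comm _ _) rfl)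
    | add x _ y _ hx hy =>
      intro a
      obtain ⟨x', hx'⟩ := hx a
      obtain ⟨y', hy'⟩ := hy a
      exact ⟨x' + y', by rw [mul_add, map_add, hx', hy', map_add]⟩

lemma decomp_mem (n : ℕ) (x : c.Env) (hx : x ∈ c.grading n) :
    ∃ y : c.grading n, c.decomp x = DirectSum.of (fun i => c.grading i) n y := by
  unfold grading at hx
  induction hx using Submodule.mul_induction_on' with
  | mem_mul_mem m hm z hz =>
    obtain ⟨a, rfl⟩ := hm
    exact c.decomp_mem_aux n z hz a
  | add x _ y _ hx hy =>
    obtain ⟨x', hx'⟩ := hx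
    obtain ⟨y', hy'⟩ := hy
    exact ⟨x' + y', by rw [map_add, hx', hy', map_add]⟩

instance gradedAlgebra : GradedAlgebra c.grading :=
  GradedAlgebra.ofAlgHom _ c.decomp c.decomp_right (by
    intro n x
    obtain ⟨y, hy⟩ := c.decomp_mem n x x.2
    have h := AlgHom.congr_fun c.decomp_right (x : c.Env)
    simp only [AlgHom.comp_apply, AlgHom.id_apply] at h
    rw [hy, DirectSum.coeAlgHom_of] at h
    rw [hy, Subtype.ext h])

end FODC

end Calculus

/-! ### Left-invariant forms, quantum principal bundles, differential calculus on bundles -/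

section Bundles

open FODC

variable {A Γ : Type*} [Ring A] [HopfAlgebra ℂ A] [StarRing A] [StarModule ℂ A]
    [AddCommGroup Γ] [Module ℂ Γ] [Module A Γ] [Module Aᵐᵒᵖ Γ] [SMulCommClass A Aᵐᵒᵖ Γ]
    [IsScalarTower ℂ A Γ] [IsScalarTower ℂ Aᵐᵒᵖ Γ]

namespace FODC

variable (c : FODC A Γ)

/-- The map `a ↦ κ(a₍₁₎) d a₍₂₎`, with values in `Γ^∧`. -/
def piEnv : A →ₗ[ℂ] c.Env := mulMap (c.inA ∘ₗ antip A) (c.inΓ ∘ₗ c.d) ∘ₗ Coalgebra.comul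

/-- The space `Γ_inv` of left-invariant elements of `Γ`, inside `Γ^∧`. -/
def inv : Submodule ℂ c.Env := LinearMap.range c.piEnv

/-- The surjection `π : A → Γ_inv`. -/
def pi : A →ₗ[ℂ] c.inv := c.piEnv.rangeRestrict

/-- The left-invariant subalgebra `Γ_inv^∧` of `Γ^∧`. -/
def invWedge : Subalgebra ℂ c.Env := Algebra.adjoin ℂ (c.inv : Set c.Env)

/-- The adjoint action `T(A) → T(A) ⊗ A` on the tensor algebra of `A`. -/
def adTensor (A : Type*) [Ring A] [HopfAlgebra ℂ A] :
    TensorAlgebra ℂ A →ₐ[ℂ] TensorAlgebra ℂ A ⊗[ℂ] A :=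
  TensorAlgebra.lift ℂ (TensorProduct.map (TensorAlgebra.ι ℂ) LinearMap.id ∘ₗ ad A)

/-- The multiplicative extension `π^⊗ : T(A) → Γ_inv^⊗`. -/
def piTensor : TensorAlgebra ℂ A →ₐ[ℂ] TensorAlgebra ℂ c.inv :=
  TensorAlgebra.lift ℂ (TensorAlgebra.ι ℂ ∘ₗ c.pi)

/-- `ϑ` is invariant under the adjoint action `ϖ` on `Γ_inv^⊗`, that is `ϖ(ϑ) = ϑ ⊗ 1`. The
action is determined by `ϖ π^⊗ = (π^⊗ ⊗ id) ad`, where `π^⊗` is surjective. -/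
def IsInvariant (θ : TensorAlgebra ℂ c.inv) : Prop :=
  ∃ t : TensorAlgebra ℂ A, c.piTensor t = θ ∧
    TensorProduct.map c.piTensor.toLinearMap LinearMap.id (adTensor A t) = θ ⊗ₜ[ℂ] (1 : A)

end FODC

/-- A quantum principal bundle `P = (B, i, F)`: a *-algebra `B` with a *-homomorphism
`F : B → B ⊗ A` which is a right coaction and is free, in the sense that `b ⊗ q ↦ b F(q)` maps
`B ⊗ B` onto `B ⊗ A`. The base is the algebra of elements with `F(b) = b ⊗ 1`, and `i` is its
inclusion. -/
structure Bundle (A B : Type*) [Ring A] [HopfAlgebra ℂ A] [StarRing A] [StarModule ℂ A]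
    [Ring B] [Algebra ℂ B] [StarRing B] [StarModule ℂ B] where
  F : B →ₐ[ℂ] B ⊗[ℂ] A
  F_star : ∀ b, F (star b) = star (F b)
  coassoc : ∀ b, TensorProduct.assoc ℂ B A A (F.toLinearMap.rTensor A (F b))
    = (Coalgebra.comul (R := ℂ) (A := A)).lTensor B (F b)
  counit : ∀ b, TensorProduct.rid ℂ B ((Coalgebra.counit (R := ℂ) (A := A)).lTensor B (F b)) = b
  free : Function.Surjective
    (mulMap (Algebra.TensorProduct.includeLeft (R := ℂ) (S := ℂ) (A := B) (B := A)).toLinearMap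
      F.toLinearMap)

/-- The parity map `x ↦ (-1)^{∂x} x` of a graded algebra. -/
def parity {Ω : Type*} [Ring Ω] [Algebra ℂ Ω] (𝒪 : ℕ → Submodule ℂ Ω) [GradedAlgebra 𝒪] :
    Ω →ₗ[ℂ] Ω :=
  DirectSum.toModule ℂ ℕ Ω (fun n => ((-1 : ℂ) ^ n) • (𝒪 n).subtype)
    ∘ₗ (DirectSum.decomposeLinearEquiv 𝒪).toLinearMap

variable {B Ω : Type*} [Ring B] [Algebra ℂ B] [StarRing B] [StarModule ℂ B]
  [Ring Ω] [Algebra ℂ Ω]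

/-- A differential calculus `Ω(P)` on the bundle `P`, over the calculus `Γ^∧` on the structure
group: a graded-differential *-algebra, with `Ω⁰(P) = B`, generated as a differential algebra by
`B`, and such that the right action `F` extends to a homomorphism
`F̂ : Ω(P) → Ω(P) ⊗̂ Γ^∧` of differential algebras (as `B` generates, `F̂` is then
grade-preserving and hermitian). The *-structure obeys `(x y)* = (-1)^{∂x ∂y} y* x*`. -/
structure Calc (c : FODC A Γ) (P : Bundle A B) (𝒪 : ℕ → Submodule ℂ Ω) [GradedAlgebra 𝒪] where
  d : Ω →ₗ[ℂ] Ω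
  d_mem : ∀ n, ∀ x ∈ 𝒪 n, d x ∈ 𝒪 (n + 1)
  d_d : ∀ x, d (d x) = 0
  d_mul : ∀ n, ∀ x ∈ 𝒪 n, ∀ y, d (x * y) = d x * y + (-1 : ℂ) ^ n • (x * d y)
  st : Ω →ₛₗ[starRingEnd ℂ] Ω
  st_mem : ∀ n, ∀ x ∈ 𝒪 n, st x ∈ 𝒪 n
  st_st : ∀ x, st (st x) = x
  st_mul : ∀ m n, ∀ x ∈ 𝒪 m, ∀ y ∈ 𝒪 n, st (x * y) = (-1 : ℂ) ^ (m * n) • (st y * st x)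
  st_d : ∀ x, st (d x) = d (st x)
  j : B →ₐ[ℂ] Ω
  j_injective : Function.Injective j
  j_range : LinearMap.range j.toLinearMap = 𝒪 0
  j_star : ∀ b, j (star b) = st (j b)
  generated : Algebra.adjoin ℂ (Set.range j ∪ Set.range fun b => d (j b)) = ⊤
  Fhat : Ω →ₐ[ℂ] 𝒪 ᵍ⊗[ℂ] c.grading
  Fhat_j : ∀ b, (GradedTensorProduct.of ℂ 𝒪 c.grading).symm (Fhat (j b))
    = TensorProduct.map j.toLinearMap c.inA (P.F b)
  Fhat_d : ∀ x, (GradedTensorProduct.of ℂ 𝒪 c.grading).symm (Fhat (d x))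
    = TensorProduct.map d LinearMap.id ((GradedTensorProduct.of ℂ 𝒪 c.grading).symm (Fhat x))
      + TensorProduct.map (parity 𝒪) c.dEnv
          ((GradedTensorProduct.of ℂ 𝒪 c.grading).symm (Fhat x))

namespace Calc

variable {c : FODC A Γ} {P : Bundle A B} {𝒪 : ℕ → Submodule ℂ Ω} [GradedAlgebra 𝒪]
  (X : Calc c P 𝒪)

/-- The map `F̂ : Ω(P) → Ω(P) ⊗ Γ^∧`, at the level of vector spaces. -/
def hat : Ω →ₗ[ℂ] Ω ⊗[ℂ] c.Env :=
  (GradedTensorProduct.of ℂ 𝒪 c.grading).symm.toLinearMap ∘ₗ X.Fhat.toLinearMap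

/-- The right action `F^∧ = (id ⊗ p_*) F̂` of the group on `Ω(P)`. -/
def act : Ω →ₗ[ℂ] Ω ⊗[ℂ] A := TensorProduct.map LinearMap.id c.proj.toLinearMap ∘ₗ X.hat

/-- The horizontal forms `hor(P) = F̂⁻¹(Ω(P) ⊗ A)`. -/
def hor : Submodule ℂ Ω := (LinearMap.range (TensorProduct.map LinearMap.id c.inA)).comap X.hat

/-- The forms on the base, `Ω(M) = {α | F̂(α) = α ⊗ 1}`. -/
def base : Submodule ℂ Ω :=
  LinearMap.ker (X.hat - (TensorProduct.mk ℂ Ω c.Env).flip 1)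

/-- The graded centre `Z(M)` of `Ω(M)`. -/
def Z : Submodule ℂ Ω where
  carrier := {z | z ∈ X.base ∧ ∀ q, ∀ α ∈ X.base ⊓ 𝒪 q, z * α = α * ((parity 𝒪) ^ q) z}
  zero_mem' := ⟨zero_mem _, by simp⟩
  add_mem' := by
    rintro x y ⟨hx, hx'⟩ ⟨hy, hy'⟩
    exact ⟨add_mem hx hy, fun q α hα => by rw [add_mul, hx' q α hα, hy' q α hα, map_add, mul_add]⟩
  smul_mem' := by
    rintro r x ⟨hx, hx'⟩
    exact ⟨Submodule.smul_mem _ r hx, fun q α hα => by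
      rw [smul_mul_assoc, hx' q α hα, map_smul, mul_smul_comm]⟩

/-- The closed elements of `Z(M)`. -/
def closed : Submodule ℂ Ω := X.Z ⊓ LinearMap.ker X.d

/-- The cohomology `HZ(M)` of `Z(M)`. -/
abbrev HZ : Type _ := X.closed ⧸ ((X.Z.map X.d).comap X.closed.subtype)

/-- The cohomology class of a closed element of `Z(M)`. -/
abbrev cls : X.closed →ₗ[ℂ] X.HZ := Submodule.mkQ _

/-- The homogeneous part `HZⁿ(M)`. -/
def HZdeg (n : ℕ) : Submodule ℂ X.HZ := ((𝒪 n).comap X.closed.subtype).map X.cls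

/-- Formal series `∑ ξ_n` with `ξ_n ∈ HZⁿ(M)`. -/
def HZhat : Submodule ℂ (ℕ → X.HZ) := Submodule.pi Set.univ X.HZdeg

/-- The class in the completed cohomology of a formal series `∑ z_n` of closed elements. -/
def clsHat (z : ℕ → Ω) (hz : ∀ n, z n ∈ X.closed ⊓ 𝒪 n) : X.HZhat :=
  ⟨fun n => X.cls ⟨z n, (hz n).1⟩, fun n _ => ⟨⟨z n, (hz n).1⟩, (hz n).2, rfl⟩⟩

/-! ### Associated bimodules, the canonical trace and the K-ring -/

/-- The bimodule `Mor(v, F^∧)` of intertwiners with values in `hor(P)`, for a representation with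
matrix `v`: families `μ_i = μ(e_i)` in `hor(P)` with `F^∧(μ_i) = ∑ j, μ_j ⊗ v_{ji}`. -/
def bimod {ι : Type} [Fintype ι] (v : Matrix ι ι A) : Submodule ℂ (ι → Ω) where
  carrier := {μ | ∀ i, μ i ∈ X.hor ∧ X.act (μ i) = ∑ k, μ k ⊗ₜ[ℂ] v k i}
  zero_mem' := fun i => ⟨zero_mem _, by simp⟩
  add_mem' := fun {x y} hx hy i => ⟨add_mem (hx i).1 (hy i).1, by
    simp [(hx i).2, (hy i).2, TensorProduct.add_tmul, Finset.sum_add_distrib]⟩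
  smul_mem' := fun r x hx i => ⟨Submodule.smul_mem _ r (hx i).1, by
    simp [(hx i).2, Finset.smul_sum, TensorProduct.smul_tmul']⟩

/-- The pairing `⟨φ, ψ⟩⁺ = ∑ i, φ(e_i) ψ(e_i^*)`. -/
def pairPlus {ι : Type} [Fintype ι] (φ ψ : ι → Ω) : Ω := ∑ i, φ i * ψ i

/-- The pairing `⟨ψ, φ⟩⁻ = ∑ ij, (C_u⁻¹)_{ji} ψ(e_i^*) φ(e_j)`. -/
def pairMinus (u : Rep A) (ψ φ : u.ι → Ω) : Ω := ∑ i, ∑ k, (u.canon⁻¹ k i) • (ψ i * φ k)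

/-- A representative `∑ k, ν_k ⊗ μ_k` of the image of `1` under the map dual to the contraction
`H_u^* ⊗ H_u → ℂ`: intertwiners `ν_k ∈ Mor(u^c, F)`, `μ_k ∈ Mor(u, F)` with
`∑ k, ν_k(e_i^*) μ_k(e_j) = δ_{ij}`. -/
structure DualFamily (u : Rep A) where
  N : ℕ
  ν : Fin N → X.bimod u.contra
  μ : Fin N → X.bimod u.mat
  ν_zero : ∀ k i, (ν k).1 i ∈ 𝒪 0
  μ_zero : ∀ k i, (μ k).1 i ∈ 𝒪 0
  sum_eq : ∀ i j, ∑ k, (ν k).1 i * (μ k).1 j = if i = j then 1 else 0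

open Classical in
/-- The canonical trace `tr_M(T) = ∑ k, ⟨ν_k, T μ_k⟩⁻` of a left-linear map `T`; it does not
depend on the choice of the representative. -/
def trM (u : Rep A) (T : X.bimod u.mat →ₗ[ℂ] (u.ι → Ω)) : Ω :=
  if h : Nonempty (X.DualFamily u) then
    ∑ k, pairMinus u (h.some.ν k).1 (T (h.some.μ k))
  else 0

/-- The matrix `(T_u)_{ij} = ∑ lk, (C_u⁻¹)_{il} ν_k(e_l^*) (T μ_k)(e_j)`. -/
def DualFamily.mat {X : Calc c P 𝒪} {u : Rep A} (S : X.DualFamily u)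
    (T : X.bimod u.mat →ₗ[ℂ] (u.ι → Ω)) : Matrix u.ι u.ι Ω :=
  Matrix.of fun i j => ∑ l, ∑ k, (u.canon⁻¹ i l) • ((S.ν k).1 l * T (S.μ k) j)

/-- The operator `μ ↦ f ∘ μ` on the bimodule of `u`. -/
def compOp (u : Rep A) (f : Ω →ₗ[ℂ] Ω) : X.bimod u.mat →ₗ[ℂ] (u.ι → Ω) :=
  f.compLeft u.ι ∘ₗ (X.bimod u.mat).subtype

/-- The bimodules of `u` and `v` are equivalent: there is an isomorphism `J` of graded
`Ω(M)`-bimodules which is transposable, that is, its two transposed maps, defined through the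
pairings `⟨ ⟩⁺` and `⟨ ⟩⁻`, coincide. -/
def Equivalent (u v : Rep A) : Prop :=
  ∃ (J : X.bimod u.mat ≃ₗ[ℂ] X.bimod v.mat) (T : X.bimod v.contra →ₗ[ℂ] X.bimod u.contra),
    (∀ α ∈ X.base, ∀ x y : X.bimod u.mat,
      (∀ i, y.1 i = α * x.1 i) → ∀ i, (J y).1 i = α * (J x).1 i) ∧
    (∀ α ∈ X.base, ∀ x y : X.bimod u.mat,
      (∀ i, y.1 i = x.1 i * α) → ∀ i, (J y).1 i = (J x).1 i * α) ∧
    (∀ n, ∀ x : X.bimod u.mat, (∀ i, x.1 i ∈ 𝒪 n) → ∀ i, (J x).1 i ∈ 𝒪 n) ∧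
    (∀ x φ, pairPlus (J x).1 φ.1 = pairPlus x.1 (T φ).1) ∧
    (∀ x φ, pairMinus v φ.1 (J x).1 = pairMinus u (T φ).1 x.1)

/-- The relations of the K-ring. -/
inductive KRel : FreeAlgebra ℤ (Rep A) → FreeAlgebra ℤ (Rep A) → Prop
  | add (u v : Rep A) :
      KRel (FreeAlgebra.ι ℤ (u.add v)) (FreeAlgebra.ι ℤ u + FreeAlgebra.ι ℤ v)
  | mul (u v : Rep A) :
      KRel (FreeAlgebra.ι ℤ (u.mul v)) (FreeAlgebra.ι ℤ u * FreeAlgebra.ι ℤ v)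
  | one : KRel (FreeAlgebra.ι ℤ Rep.triv) 1
  | equiv (u v : Rep A) (h : X.Equivalent u v) :
      KRel (FreeAlgebra.ι ℤ u) (FreeAlgebra.ι ℤ v)

/-- The ring `K(M, P)`: the Grothendieck ring of the semiring of equivalence classes of the
bimodules `Mor(u, F^∧)`, with sum and product induced by those of representations. It is presented
by the classes `[u]`, with `[u ⊕ v] = [u] + [v]`, `[u × v] = [u][v]`, `[∅] = 1` and `[u] = [v]`
for equivalent bimodules. -/
def K : Type _ := RingQuot X.KRel

instance : Ring X.K := inferInstanceAs (Ring (RingQuot X.KRel))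

/-- The class in `K(M, P)` of the bimodule `Mor(u, F^∧)`. -/
def kcls (u : Rep A) : X.K := RingQuot.mkRingHom X.KRel (FreeAlgebra.ι ℤ u)

/-! ### Regular connections, curvature, Chern character and characteristic classes -/

/-- A regular and multiplicative connection on `P`: a hermitian first-order map
`ω : Γ_inv → Ω(P)` with `F̂ ω(ϑ) = ∑ ω(ϑ_k) ⊗ c_k + 1 ⊗ ϑ`, where `ϖ(ϑ) = ∑ ϑ_k ⊗ c_k`; regularity is
`ω(ϑ) φ = (-1)^{∂φ} ∑ φ_k ω(ϑ ∘ c_k)` for horizontal `φ` with `F^∧(φ) = ∑ φ_k ⊗ c_k`;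
multiplicativity is the existence of the (unique) extension `wedge : Γ_inv^∧ → Ω(P)`. Here
`ϖ π = (π ⊗ id) ad`, `π(a)* = -π(κ(a)*)` and `π(a) ∘ b = π(a b - ε(a) b)`. -/
structure RegularConnection where
  ω : c.inv →ₗ[ℂ] Ω
  ω_mem : ∀ θ, ω θ ∈ 𝒪 1
  hermitian : ∀ a, X.st (ω (c.pi a)) = -ω (c.pi (star (antip A a)))
  hat_ω : ∀ a, X.hat (ω (c.pi a))
    = TensorProduct.map (ω ∘ₗ c.pi) c.inA (ad A a) + 1 ⊗ₜ[ℂ] (c.pi a : c.Env)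
  regular : ∀ a n, ∀ φ ∈ X.hor ⊓ 𝒪 n, ω (c.pi a) * φ = (-1 : ℂ) ^ n •
    mulMap LinearMap.id
      (ω ∘ₗ c.pi ∘ₗ (LinearMap.mulLeft ℂ a - Coalgebra.counit (R := ℂ) a • LinearMap.id))
      (X.act φ)
  wedge : c.invWedge →ₐ[ℂ] Ω
  wedge_ω : ∀ θ : c.inv, wedge ⟨θ, Algebra.subset_adjoin θ.2⟩ = ω θ

namespace RegularConnection

variable {X} (w : X.RegularConnection)

/-- The decomposition map `m_ω : hor(P) ⊗ Γ_inv^∧ → Ω(P)`, `φ ⊗ ϑ ↦ φ ω^∧(ϑ)`. -/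
def m : X.hor ⊗[ℂ] c.invWedge →ₗ[ℂ] Ω := mulMap X.hor.subtype w.wedge.toLinearMap

open Classical in
/-- The horizontal projection `h_ω = (id ⊗ p_*) m_ω⁻¹`; on `Γ_inv^∧` the projection `p_*` is
scalar-valued, the scalar being read off by the counit. -/
def h : Ω →ₗ[ℂ] Ω :=
  if hm : Function.Bijective w.m then
    ((TensorProduct.rid ℂ Ω).toLinearMap ∘ₗ
      TensorProduct.map X.hor.subtype
        (Coalgebra.counit (R := ℂ) (A := A) ∘ₗ c.proj.toLinearMap ∘ₗ c.invWedge.val.toLinearMap))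
      ∘ₗ (LinearEquiv.ofBijective w.m hm).symm.toLinearMap
  else 0

/-- The covariant derivative `D_ω = h_ω d`. -/
def D : Ω →ₗ[ℂ] Ω := w.h ∘ₗ X.d

/-- The curvature `R_ω = D_ω ω`. -/
def R : c.inv →ₗ[ℂ] Ω := w.D ∘ₗ w.ω

/-- The matrix `(R_{ω,u})_{ij} = R_ω π(u_{ij})`. -/
def curv (u : Rep A) : Matrix u.ι u.ι Ω := Matrix.of fun i j => w.R (c.pi (u.mat i j))

/-- The degree-`n` component of `ch^u(z) = ∑ k, ((2πi)^k k!)⁻¹ tr_M(z D_{ω,u}^{2k})`, for a formal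
series `z = ∑ z_n` with `z_n` of degree `n`; the elements of `Z(M)` act by left multiplication. -/
def ch (u : Rep A) (z : ℕ → Ω) (n : ℕ) : Ω :=
  ∑ k ∈ Finset.range (n / 2 + 1),
    (1 / ((2 * Real.pi * Complex.I) ^ k * (k.factorial : ℂ))) •
      X.trM u (X.compOp u (LinearMap.mulLeft ℂ (z (n - 2 * k)) ∘ₗ w.D ^ (2 * k)))

/-- The image `𝔴(M)` of the Weil homomorphism `W : I^* → HZ(M)`, `W(ϑ) = [R_ω^⊗(ϑ)]`, where `I^*`
is the algebra of invariant elements of `Γ_inv^⊗`. -/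
def weil : Set X.HZ :=
  {ξ | ∃ θ : TensorAlgebra ℂ c.inv, c.IsInvariant θ ∧
    ∃ h : TensorAlgebra.lift ℂ w.R θ ∈ X.closed, ξ = X.cls ⟨_, h⟩}

end RegularConnection

/-- `ρ` is the Chern character, that is, the right action of `K(M, P)` on the completed cohomology
for which `[z] ∘ [Mor(u, F^∧)] = [ch^u(z)]`, whichever regular connection is used. -/
def IsChernCharacter (ρ : X.Kᵐᵒᵖ →+* Module.End ℂ X.HZhat) : Prop :=
  ∀ (w : X.RegularConnection) (u : Rep A) (z : ℕ → Ω) (hz : ∀ n, z n ∈ X.closed ⊓ 𝒪 n),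
    ∃ h : ∀ n, w.ch u z n ∈ X.closed ⊓ 𝒪 n,
      ρ (MulOpposite.op (X.kcls u)) (X.clsHat z hz) = X.clsHat (w.ch u z) h

end Calc

end Bundles

end QPB

end

/-! The operator attached to the class of a representation `u` is the weighted sum, with weights `1
/ ((2πi)^k k!)`, of the operators `τ_k : [y] ↦ [tr_M(y D^{2k})]` of degree `2k` on `HZ(M)`. The
theorem amounts to the following facts about these operators.

They act on cohomology. Freeness, averaged against the Haar functional, yields dual families `(ν_k,
μ_k)` (`Bundle.exists_dual`); they present the bimodule of `u` as a finitely generated projective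
left module over `Ω(M)`, with idempotent `e = (⟨μ_k, ν_m⟩⁺)`. The trace does not depend on the
family and takes graded bimodule maps to `Z(M)`. Since `m_ω` is bijective, `D = h_ω d` is an
antiderivation of the horizontal forms which extends `d` on the base. Hence `D²` is a bimodule map,
and `d tr(T) = tr(D T - (-1)^p T D)` for `T` of parity `p` (`Compat.d_tr`), the correction to this
formula containing the factor `e (de) e = 0`. So `τ_k` respects closed and exact elements.

They do not depend on the connection. Two connections differ by an odd bimodule map `E`. Comparing
the two formulas for `d tr` shows that the trace against a closed `y` kills the anticommutators with
`E`; this replaces cyclicity of the trace, which is not available. Integrating the derivative of `(D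
+ tE)^{2k}` in `t` then exhibits the difference as a coboundary (`exists_transgression`,
`tr_sub_mem`). A transposable isomorphism carries `D` to another connection compatible with both
pairings, so the same argument covers equivalent bimodules (`tauFam_equiv`).

They are compatible with sums and products. The canonical intertwiner of a direct sum is block
diagonal and that of a product is the Kronecker product (`Rep.canon_add`, `Rep.canon_mul`). As `D²`
is an ungraded derivation, `D^{2m}` expands by binomial coefficients, and the trace of a product is
a nested trace, inner over the first factor (`tauL_mul`). The factorials turn this into
multiplicativity, in reversed order: a right action. The ring is generated by the classes, whence
uniqueness.

For (i), the structure equation gives `D² φ_j = -∑ φ_l R π(u_{lj})`. For (ii), the curvature is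
regular, so `R(ϑ)` can be moved past `μ_k`; the result is the curvature image of the trace of `(ϑ ∘
u) π(u)^k` weighted by `C_u⁻¹`, and this weight is exactly what undoes the conjugation by `u` in the
adjoint action (`IsInvariant.twist`). -/

noncomputable section

set_option linter.unusedSectionVars false

namespace QPB

/-! ### Corepresentation matrices -/

section Corep

variable {A : Type*} [Ring A] [HopfAlgebra ℂ A]

/-- The matrix `v` over `A` is a corepresentation: `φ v_{ij} = ∑ k, v_{ik} ⊗ v_{kj}` and
`ε v_{ij} = δ_{ij}`. -/
structure IsCorep {ι : Type} [Fintype ι] [DecidableEq ι] (v : Matrix ι ι A) : Prop where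
  comul : ∀ i j, Coalgebra.comul (R := ℂ) (v i j) = ∑ k, v i k ⊗ₜ[ℂ] v k j
  counit : ∀ i j, Coalgebra.counit (R := ℂ) (v i j) = if i = j then 1 else 0

/-- The matrix of the product of two corepresentations. -/
def prodMat {ι ι' : Type} (v : Matrix ι ι A) (w : Matrix ι' ι' A) : Matrix (ι × ι') (ι × ι') A :=
  Matrix.of fun p q => v p.1 q.1 * w p.2 q.2

variable {ι ι' : Type} [Fintype ι] [DecidableEq ι] [Fintype ι'] [DecidableEq ι']
  {v : Matrix ι ι A} {w : Matrix ι' ι' A}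

namespace IsCorep

lemma antip_mul (hv : IsCorep v) (i j : ι) :
    ∑ k, antip A (v i k) * v k j = if i = j then 1 else 0 := by
  have := HopfAlgebra.mul_antipode_rTensor_comul_apply (R := ℂ) (v i j)
  rw [hv.comul, hv.counit] at this
  simp only [map_sum, LinearMap.rTensor_tmul, LinearMap.mul'_apply] at this
  rw [this]; split_ifs <;> simp

lemma mul_antip (hv : IsCorep v) (i j : ι) :
    ∑ k, v i k * antip A (v k j) = if i = j then 1 else 0 := by
  have := HopfAlgebra.mul_antipode_lTensor_comul_apply (R := ℂ) (v i j)
  rw [hv.comul, hv.counit] at this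
  simp only [map_sum, LinearMap.lTensor_tmul, LinearMap.mul'_apply] at this
  rw [this]; split_ifs <;> simp

lemma map_antip_mul (hv : IsCorep v) : v.map (antip A) * v = 1 := by
  ext i j
  simpa [Matrix.mul_apply, Matrix.one_apply] using hv.antip_mul i j

lemma mul_map_antip (hv : IsCorep v) : v * v.map (antip A) = 1 := by
  ext i j
  simpa [Matrix.mul_apply, Matrix.one_apply] using hv.mul_antip i j

/-- The antipode gives the inverse matrix. -/
lemma antip_eq_of_mul_eq_one (hv : IsCorep v) {x : Matrix ι ι A} (h : v * x = 1) :
    v.map (antip A) = x := by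
  calc v.map (antip A) = v.map (antip A) * (v * x) := by rw [h, mul_one]
    _ = x := by rw [← mul_assoc, hv.map_antip_mul, one_mul]

lemma prod (hv : IsCorep v) (hw : IsCorep w) : IsCorep (prodMat v w) where
  comul := by
    rintro ⟨i, i'⟩ ⟨j, j'⟩
    simp only [prodMat, Matrix.of_apply]
    rw [Bialgebra.comul_mul, hv.comul, hw.comul, Finset.sum_mul_sum, Fintype.sum_prod_type]
    simp [Algebra.TensorProduct.tmul_mul_tmul]
  counit := by
    rintro ⟨i, i'⟩ ⟨j, j'⟩
    simp only [prodMat, Matrix.of_apply]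
    rw [Bialgebra.counit_mul, hv.counit, hw.counit]
    simp only [Prod.mk.injEq]
    split_ifs <;> simp_all

/-- The entries on the right form a right inverse of `prodMat v w`, and for a corepresentation a
right inverse is the matrix of antipodes. -/
lemma antip_mul_rev (hv : IsCorep v) (hw : IsCorep w) (i j : ι) (k l : ι') :
    antip A (v i j * w k l) = antip A (w k l) * antip A (v i j) := by
  have h : prodMat v w * (Matrix.of fun p q => antip A (w p.2 q.2) * antip A (v p.1 q.1)) = 1 := by
    ext ⟨i, i'⟩ ⟨j, j'⟩
    simp only [prodMat, Matrix.mul_apply, Matrix.of_apply, Fintype.sum_prod_type]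
    have h1 : ∀ x y, v i x * w i' y * (antip A (w y j') * antip A (v x j))
        = v i x * ((w i' y * antip A (w y j')) * antip A (v x j)) := by
      intro x y; simp only [mul_assoc]
    simp only [h1, ← Finset.mul_sum, ← Finset.sum_mul, hw.mul_antip]
    by_cases h : i' = j' <;> simp [h, hv.mul_antip, Matrix.one_apply]
  have := congrFun (congrFun ((hv.prod hw).antip_eq_of_mul_eq_one h) (i, k)) (j, l)
  simpa [prodMat] using this

/-- The transposed antipode of a corepresentation. -/
lemma contra (hv : IsCorep v) : IsCorep (Matrix.of fun i j => antip A (v j i)) where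
  comul := by
    -- The coproduct is multiplicative, so it takes the inverse matrix of `v` to a right inverse of
    -- `φ(v)`; `h2` verifies that the expected matrix is a left inverse, and the two must agree.
    have h1 : v.map (Bialgebra.comulAlgHom ℂ A) * (v.map (antip A)).map (Bialgebra.comulAlgHom ℂ A)
        = 1 := by
      rw [← Matrix.map_mul, hv.mul_map_antip]; simp
    have h2 : (Matrix.of fun i j => ∑ k, antip A (v k j) ⊗ₜ[ℂ] antip A (v i k) :
        Matrix ι ι (A ⊗[ℂ] A)) * v.map (Bialgebra.comulAlgHom ℂ A) = 1 := by
      ext i j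
      simp only [Matrix.mul_apply, Matrix.of_apply, Matrix.map_apply,
        Bialgebra.comulAlgHom_apply, hv.comul, Finset.sum_mul_sum,
        Algebra.TensorProduct.tmul_mul_tmul]
      rw [Finset.sum_comm]
      have : ∀ k, ∑ x, ∑ l, (antip A (v k x) * v x l) ⊗ₜ[ℂ] (antip A (v i k) * v l j)
          = 1 ⊗ₜ[ℂ] (antip A (v i k) * v k j) := by
        intro k
        rw [Finset.sum_comm]
        simp only [← TensorProduct.sum_tmul, hv.antip_mul]
        rw [Finset.sum_eq_single k] <;> simp +contextual [eq_comm]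
      simp only [this, ← TensorProduct.tmul_sum, hv.antip_mul]
      rw [Matrix.one_apply]
      split_ifs <;> simp [Algebra.TensorProduct.one_def]
    have h3 := left_inv_eq_right_inv h2 h1
    intro i j
    have := congrFun (congrFun h3 j) i
    simpa using this.symm
  counit := by
    intro i j
    simp [hv.counit, eq_comm]

end IsCorep

variable (A) in
/-- The span of the matrix elements of a matrix. -/
def coeffs {ι ι' : Type} (v : Matrix ι ι' A) : Submodule ℂ A :=
  Submodule.span ℂ {a | ∃ i j, a = v i j}

end Corep

section Reps

variable {A : Type*} [Ring A] [HopfAlgebra ℂ A] [StarRing A]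

namespace Rep

lemma isCorep (u : Rep A) : IsCorep u.mat := ⟨u.comul_mat, u.counit_mat⟩

lemma isCorep_contra (u : Rep A) : IsCorep u.contra := u.isCorep.contra

lemma antip_mat (u : Rep A) (i j : u.ι) : antip A (u.mat i j) = star (u.mat j i) := by
  have := congrFun (congrFun (u.isCorep.antip_eq_of_mul_eq_one u.unitary_right) i) j
  simpa using this

end Rep

variable [StarModule ℂ A]

namespace Rep

lemma coeffs_le_add_left (u v : Rep A) : coeffs A u.mat ≤ coeffs A (u.add v).mat := by
  refine Submodule.span_le.2 ?_
  rintro _ ⟨i, j, rfl⟩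
  exact Submodule.subset_span ⟨Sum.inl i, Sum.inl j, rfl⟩

lemma coeffs_le_add_right (u v : Rep A) : coeffs A v.mat ≤ coeffs A (u.add v).mat := by
  refine Submodule.span_le.2 ?_
  rintro _ ⟨i, j, rfl⟩
  exact Submodule.subset_span ⟨Sum.inr i, Sum.inr j, rfl⟩

lemma mul_mem_coeffs (u v : Rep A) {a b : A} (ha : a ∈ coeffs A u.mat) (hb : b ∈ coeffs A v.mat) :
    a * b ∈ coeffs A (u.mul v).mat := by
  have h : coeffs A u.mat * coeffs A v.mat ≤ coeffs A (u.mul v).mat := by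
    unfold coeffs
    rw [Submodule.span_mul_span]
    refine Submodule.span_mono ?_
    rintro _ ⟨_, ⟨i, j, rfl⟩, _, ⟨k, l, rfl⟩, rfl⟩
    exact ⟨(i, k), (j, l), rfl⟩
  exact h (Submodule.mul_mem_mul ha hb)

/-- Every element of `A` is a combination of matrix elements of one unitary representation. -/
lemma exists_mem_coeffs [IsCompactMatrixQuantumGroup A] (a : A) :
    ∃ u : Rep A, a ∈ coeffs A u.mat := by
  obtain ⟨u, hu⟩ := IsCompactMatrixQuantumGroup.exists_generator (A := A)
  have ha : a ∈ Algebra.adjoin ℂ {a : A | ∃ i j, a = u.mat i j} := hu ▸ Algebra.mem_top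
  induction ha using Algebra.adjoin_induction with
  | mem x hx => exact ⟨u, Submodule.subset_span hx⟩
  | algebraMap r =>
    refine ⟨triv, ?_⟩
    rw [Algebra.algebraMap_eq_smul_one]
    exact Submodule.smul_mem _ _ (Submodule.subset_span ⟨(), (), rfl⟩)
  | add x y _ _ hx hy =>
    obtain ⟨u, hu⟩ := hx
    obtain ⟨v, hv⟩ := hy
    exact ⟨u.add v, add_mem (coeffs_le_add_left u v hu) (coeffs_le_add_right u v hv)⟩
  | mul x y _ _ hx hy =>
    obtain ⟨u, hu⟩ := hx
    obtain ⟨v, hv⟩ := hy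
    exact ⟨u.mul v, mul_mem_coeffs u v hu hv⟩

/-- Linear statements about `A` can be checked on matrix elements. -/
lemma ext_mat [IsCompactMatrixQuantumGroup A] {M : Type*} [AddCommMonoid M] [Module ℂ M]
    {f g : A →ₗ[ℂ] M} (h : ∀ (u : Rep A) i j, f (u.mat i j) = g (u.mat i j)) : f = g := by
  ext a
  obtain ⟨u, hu⟩ := exists_mem_coeffs a
  induction hu using Submodule.span_induction with
  | mem x hx => obtain ⟨i, j, rfl⟩ := hx; exact h u i j
  | zero => simp
  | add x y _ _ hx hy => simp [hx, hy]
  | smul r x _ hx => simp [hx]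

/-- A finite family in `A` has all its members among the combinations of matrix elements of one
unitary representation. -/
lemma exists_forall_mem_coeffs [IsCompactMatrixQuantumGroup A] {κ : Type*} [Finite κ]
    (a : κ → A) : ∃ u : Rep A, ∀ k, a k ∈ coeffs A u.mat := by
  classical
  cases nonempty_fintype κ
  suffices h : ∀ s : Finset κ, ∃ u : Rep A, ∀ k ∈ s, a k ∈ coeffs A u.mat by
    obtain ⟨u, hu⟩ := h Finset.univ
    exact ⟨u, fun k => hu k (Finset.mem_univ k)⟩
  intro s
  induction s using Finset.induction_on with
  | empty => exact ⟨triv, by simp⟩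
  | insert k s _ ih =>
    obtain ⟨u, hu⟩ := ih
    obtain ⟨v, hv⟩ := exists_mem_coeffs (a k)
    refine ⟨u.add v, fun l hl => ?_⟩
    rcases Finset.mem_insert.1 hl with rfl | hl
    · exact coeffs_le_add_right u v hv
    · exact coeffs_le_add_left u v (hu l hl)

/-! ### The Haar functional -/

/-- The matrix `(f(u_{ij}))`. -/
def fmat (u : Rep A) : (A →ₗ[ℂ] ℂ) →ₗ[ℂ] (u.ι × u.ι → ℂ) where
  toFun f p := f (u.mat p.1 p.2)
  map_add' _ _ := rfl
  map_smul' _ _ := rfl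

/-- The functional `a ↦ conj (f (star (κ a)))`. -/
def starFun (f : A →ₗ[ℂ] ℂ) : A →ₗ[ℂ] ℂ where
  toFun a := star (f (star (antip A a)))
  map_add' a b := by simp
  map_smul' r a := by simp [star_smul]

/-- By unitarity the involution on functionals becomes the adjoint of matrices. Thus `f ↦
(f(u_{ij}))` sends convolution to the matrix product and `starFun` to the adjoint, and Hilbert space
arguments become available. -/
lemma starFun_mat (u : Rep A) (f : A →ₗ[ℂ] ℂ) (i j : u.ι) :
    starFun f (u.mat i j) = star (f (u.mat j i)) := by
  simp [starFun, antip_mat]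

/-- The convolution of two functionals. -/
def conv (f g : A →ₗ[ℂ] ℂ) : A →ₗ[ℂ] ℂ :=
  LinearMap.mul' ℂ ℂ ∘ₗ TensorProduct.map f g ∘ₗ Coalgebra.comul

lemma conv_mat (u : Rep A) (f g : A →ₗ[ℂ] ℂ) (i j : u.ι) :
    conv f g (u.mat i j) = ∑ k, f (u.mat i k) * g (u.mat k j) := by
  simp [conv, u.comul_mat]

lemma conv_one (f g : A →ₗ[ℂ] ℂ) : conv f g (1 : A) = f 1 * g 1 := by
  simp [conv, Bialgebra.comul_one, Algebra.TensorProduct.one_def]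

/-- Split the matrix of the counit orthogonally along the matrices of the functionals vanishing at
`1`; the remainder is the matrix of some `g` with `g(1) = 1`. If `f(1) = 0`, then `f* * f * g` also
vanishes at `1`, so the remainder is orthogonal to its matrix, which says that the norm of `f(u)
g(u)` is zero. The general case follows by subtracting `f(1) ε`. -/
lemma exists_left_invariant (u : Rep A) : ∃ g : A →ₗ[ℂ] ℂ, g 1 = 1 ∧
    ∀ (f : A →ₗ[ℂ] ℂ) i j, ∑ k, f (u.mat i k) * g (u.mat k j) = f 1 * g (u.mat i j) := by
  let E := EuclideanSpace ℂ (u.ι × u.ι)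
  let M : (A →ₗ[ℂ] ℂ) →ₗ[ℂ] E := (WithLp.linearEquiv 2 ℂ (u.ι × u.ι → ℂ)).symm.toLinearMap ∘ₗ u.fmat
  have hM : ∀ f p, M f p = f (u.mat p.1 p.2) := fun f p => rfl
  let ev : (A →ₗ[ℂ] ℂ) →ₗ[ℂ] ℂ := LinearMap.applyₗ (1 : A)
  let S : Submodule ℂ E := (LinearMap.ker ev).map M
  let e : A →ₗ[ℂ] ℂ := Coalgebra.counit
  obtain ⟨y, hy, z, hz, hyz⟩ := S.exists_add_mem_mem_orthogonal (M e)
  obtain ⟨g0, hg0, rfl⟩ := hy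
  have hg1 : g0 1 = 0 := hg0
  have key : ∀ f : A →ₗ[ℂ] ℂ, f 1 = 0 → ∀ i j,
      ∑ k, f (u.mat i k) * (e - g0) (u.mat k j) = 0 := by
    intro f hf i j
    have hz' : z = M (e - g0) := by rw [map_sub, hyz]; abel
    set g := e - g0
    have h1 : inner ℂ (M (conv (starFun f) (conv f g))) z = 0 := by
      refine (Submodule.mem_orthogonal _ _).1 hz _ ⟨_, ?_, rfl⟩
      change conv (starFun f) (conv f g) 1 = 0
      rw [conv_one, conv_one, hf]; simp
    have h2 : inner ℂ (M (conv f g)) (M (conv f g)) = (0 : ℂ) := by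
      have hin : ∀ a b : A →ₗ[ℂ] ℂ, inner ℂ (M a) (M b)
          = ((u.mat.map a)ᴴ * u.mat.map b).trace := by
        intro a b
        rw [PiLp.inner_apply, Fintype.sum_prod_type, Finset.sum_comm]
        simp [Matrix.trace, Matrix.mul_apply, hM, mul_comm]
      have hconv : ∀ a b : A →ₗ[ℂ] ℂ, u.mat.map (conv a b) = u.mat.map a * u.mat.map b := by
        intro a b; ext i j; simp [Matrix.mul_apply, conv_mat]
      have hstar : u.mat.map (starFun f) = (u.mat.map f)ᴴ := by
        ext i j; simp [starFun_mat]
      rw [← h1, hz', hin, hin, hconv, hconv, hconv, hstar]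
      simp only [Matrix.conjTranspose_mul, Matrix.conjTranspose_conjTranspose, Matrix.mul_assoc]
    have h3 := congrArg (fun x : E => x (i, j)) (inner_self_eq_zero.1 h2)
    simpa [hM, conv_mat] using h3
  refine ⟨e - g0, ?_, fun f i j => ?_⟩
  · rw [LinearMap.sub_apply, hg1]
    simp [e]
  · have := key (f - f 1 • e) (by simp [e]) i j
    simp only [LinearMap.sub_apply, LinearMap.smul_apply, sub_mul, Finset.sum_sub_distrib,
      sub_eq_zero, smul_eq_mul] at this ⊢
    rw [this]
    simp [e, u.counit_mat]

/-- The span of the elements `f(a₍₁₎) a₍₂₎ - f(1) a`, for matrix elements `a` of `u`. -/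
def nonInv (u : Rep A) : Submodule ℂ A :=
  Submodule.span ℂ {a | ∃ (f : A →ₗ[ℂ] ℂ) (i j : u.ι),
    a = ∑ k, f (u.mat i k) • u.mat k j - f 1 • u.mat i j}

lemma nonInv_le_add_left (u v : Rep A) : u.nonInv ≤ (u.add v).nonInv := by
  refine Submodule.span_le.2 ?_
  rintro _ ⟨f, i, j, rfl⟩
  refine Submodule.subset_span ⟨f, Sum.inl i, Sum.inl j, ?_⟩
  have : (∑ k, f ((u.add v).mat (Sum.inl i) k) • (u.add v).mat k (Sum.inl j))
      = ∑ k, f (u.mat i k) • u.mat k j := by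
    refine (Fintype.sum_sum_type _).trans ?_
    simp [add]
  rw [this]; rfl

lemma nonInv_le_add_right (u v : Rep A) : v.nonInv ≤ (u.add v).nonInv := by
  refine Submodule.span_le.2 ?_
  rintro _ ⟨f, i, j, rfl⟩
  refine Submodule.subset_span ⟨f, Sum.inr i, Sum.inr j, ?_⟩
  have : (∑ k, f ((u.add v).mat (Sum.inr i) k) • (u.add v).mat k (Sum.inr j))
      = ∑ k, f (v.mat i k) • v.mat k j := by
    refine (Fintype.sum_sum_type _).trans ?_
    simp [add]
  rw [this]; rfl

lemma one_notMem_nonInv (u : Rep A) : (1 : A) ∉ u.nonInv := by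
  intro h
  obtain ⟨g, hg, hinv⟩ := u.exists_left_invariant
  have : u.nonInv ≤ LinearMap.ker g := by
    refine Submodule.span_le.2 ?_
    rintro _ ⟨f, i, j, rfl⟩
    simp [hinv]
  have := LinearMap.mem_ker.1 (this h)
  rw [hg] at this
  exact one_ne_zero this

variable (A) in
/-- The Haar functional exists. -/
lemma exists_haar : ∃ h : A →ₗ[ℂ] ℂ, h 1 = 1 ∧
    ∀ (u : Rep A) i j, ∑ k, h (u.mat k j) • u.mat i k = h (u.mat i j) • (1 : A) := by
  have hdir : Directed (· ≤ ·) (nonInv (A := A)) := fun u v =>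
    ⟨u.add v, nonInv_le_add_left u v, nonInv_le_add_right u v⟩
  have : Nonempty (Rep A) := ⟨triv⟩
  -- The family is directed, so membership of `1` in the supremum would occur already in a single
  -- `nonInv u`. The functionals found for the separate representations need not be compatible with
  -- each other.
  have h1 : (1 : A) ∉ ⨆ u : Rep A, u.nonInv := by
    rw [Submodule.mem_iSup_of_directed _ hdir]
    rintro ⟨u, hu⟩
    exact u.one_notMem_nonInv hu
  obtain ⟨h, hh1, hh⟩ := Submodule.exists_le_ker_of_notMem h1
  refine ⟨(h 1)⁻¹ • h, by simp [hh1], fun u i j => ?_⟩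
  rw [← sub_eq_zero]
  -- Equality in `A` is tested on functionals; for each `f` it says that `h` vanishes on a generator
  -- of `nonInv u`.
  refine (Module.forall_dual_apply_eq_zero_iff ℂ _).1 fun f => ?_
  have hm : ∑ k, f (u.mat i k) • u.mat k j - f 1 • u.mat i j ∈ LinearMap.ker h :=
    hh (le_iSup nonInv u (Submodule.subset_span ⟨f, i, j, rfl⟩))
  rw [LinearMap.mem_ker] at hm
  simp only [map_sub, map_sum, map_smul, smul_eq_mul, LinearMap.smul_apply] at hm ⊢
  have : ∑ x, (h 1)⁻¹ * h (u.mat x j) * f (u.mat i x) - (h 1)⁻¹ * h (u.mat i j) * f 1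
      = (h 1)⁻¹ * (∑ x, f (u.mat i x) * h (u.mat x j) - f 1 * h (u.mat i j)) := by
    rw [mul_sub, Finset.mul_sum]
    congr 1
    · exact Finset.sum_congr rfl fun x _ => by ring
    · ring
  rw [this, hm, mul_zero]

variable (A) in
/-- The Haar functional. -/
def haar : A →ₗ[ℂ] ℂ := (exists_haar A).choose

lemma haar_one : haar A 1 = 1 := (exists_haar A).choose_spec.1

lemma haar_inv_mat (u : Rep A) (i j : u.ι) :
    ∑ k, haar A (u.mat k j) • u.mat i k = haar A (u.mat i j) • (1 : A) :=
  (exists_haar A).choose_spec.2 u i j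

/-- Left invariance of the Haar functional: `a₍₁₎ h(a₍₂₎) = h(a) 1`. -/
lemma haar_inv [IsCompactMatrixQuantumGroup A] (a : A) :
    TensorProduct.rid ℂ A ((haar A).lTensor A (Coalgebra.comul a)) = haar A a • (1 : A) := by
  have : (TensorProduct.rid ℂ A).toLinearMap ∘ₗ (haar A).lTensor A ∘ₗ Coalgebra.comul
      = (haar A).smulRight (1 : A) := by
    refine ext_mat fun u i j => ?_
    simpa [u.comul_mat] using u.haar_inv_mat i j
  exact LinearMap.congr_fun this a

/-- Left invariance for a product of matrix elements of two corepresentations. -/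
lemma haar_inv_mul [IsCompactMatrixQuantumGroup A] {ι ι' : Type} [Fintype ι] [DecidableEq ι]
    [Fintype ι'] [DecidableEq ι'] {v : Matrix ι ι A} {w : Matrix ι' ι' A} (hv : IsCorep v)
    (hw : IsCorep w) (i j : ι) (k l : ι') :
    ∑ p, ∑ q, haar A (v p j * w q l) • (v i p * w k q) = haar A (v i j * w k l) • (1 : A) := by
  have := haar_inv (v i j * w k l)
  rw [Bialgebra.comul_mul, hv.comul, hw.comul, Finset.sum_mul_sum] at this
  simpa [Algebra.TensorProduct.tmul_mul_tmul] using this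

end Rep

end Reps
end QPB

namespace QPB

/-! ### Existence of the canonical intertwiner -/

section MatrixLemmas

variable {n : Type} [Fintype n] [DecidableEq n]

/-- With `M = Bᴴ B` an entry is an inner product of two columns of `B`, and the trace bounds the
squared norm of each column. This makes a set of positive matrices with bounded trace bounded, as
needed for compactness. -/
lemma norm_apply_le_trace {M : Matrix n n ℂ} (hM : M.PosSemidef) (i j : n) :
    ‖M i j‖ ≤ M.trace.re := by
  obtain ⟨B, rfl⟩ : ∃ B : Matrix n n ℂ, M = Bᴴ * B := by
    open scoped MatrixOrder in
    exact CStarAlgebra.nonneg_iff_eq_star_mul_self.mp hM.nonneg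
  have hd : ∀ i, ((Bᴴ * B) i i).re = ∑ k, ‖B k i‖ ^ 2 := by
    intro i
    simp only [Matrix.mul_apply, Matrix.conjTranspose_apply, Complex.re_sum]
    refine Finset.sum_congr rfl fun k _ => ?_
    rw [← Complex.normSq_eq_norm_sq, Complex.star_def, mul_comm, Complex.mul_conj,
      Complex.ofReal_re]
  have hle : ∀ i, ∑ k, ‖B k i‖ ^ 2 ≤ (Bᴴ * B).trace.re := by
    intro i
    simp only [Matrix.trace, Matrix.diag, Complex.re_sum, hd]
    exact Finset.single_le_sum (f := fun i => ∑ k, ‖B k i‖ ^ 2)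
      (fun i _ => Finset.sum_nonneg fun k _ => sq_nonneg _) (Finset.mem_univ i)
  calc ‖(Bᴴ * B) i j‖ ≤ ∑ k, ‖B k i‖ * ‖B k j‖ := by
        rw [Matrix.mul_apply]
        refine (norm_sum_le _ _).trans (le_of_eq (Finset.sum_congr rfl fun k _ => ?_))
        simp
    _ ≤ ∑ k, (‖B k i‖ ^ 2 + ‖B k j‖ ^ 2) / 2 := by
        refine Finset.sum_le_sum fun k _ => ?_
        nlinarith [sq_nonneg (‖B k i‖ - ‖B k j‖)]
    _ = (∑ k, ‖B k i‖ ^ 2 + ∑ k, ‖B k j‖ ^ 2) / 2 := by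
        rw [← Finset.sum_add_distrib, Finset.sum_div]
    _ ≤ (Bᴴ * B).trace.re := by linarith [hle i, hle j]

lemma isClosed_posSemidef : IsClosed {M : Matrix n n ℂ | M.PosSemidef} := by
  have : {M : Matrix n n ℂ | M.PosSemidef}
      = {M | Mᴴ = M} ∩ ⋂ x : n → ℂ, {M | 0 ≤ star x ⬝ᵥ (M *ᵥ x)} := by
    ext M
    simp only [Set.mem_ofPred_eq, Set.mem_inter_iff, Set.mem_iInter,
      Matrix.posSemidef_iff_dotProduct_mulVec, Matrix.IsHermitian]
  rw [this]
  refine IsClosed.inter (isClosed_eq (by fun_prop) continuous_id) (isClosed_iInter fun x => ?_)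
  refine isClosed_le continuous_const ?_
  exact Continuous.dotProduct continuous_const (Continuous.matrix_mulVec continuous_id continuous_const)

open Filter Topology in
attribute [local instance] Matrix.linftyOpNormedRing Matrix.linftyOpNormedAlgebra in
-- The first-order condition at a minimum. Along `g = 1 + t f` the two traces have derivatives `2 Re
-- tr(C f)` and `-2 Re tr(D f)` at `t = 0`. It is used with `D = C⁻¹`.
lemma trace_re_eq_of_eventually_le {C D f : Matrix n n ℂ} (hC : C.IsHermitian) (hD : D.IsHermitian)
    (h : ∀ᶠ t : ℝ in 𝓝 0, C.trace.re + D.trace.re ≤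
      ((1 + t • f)ᴴ * C * (1 + t • f)).trace.re
        + ((1 + t • f)⁻¹ * D * ((1 + t • f)⁻¹)ᴴ).trace.re) :
    (C * f).trace.re = (D * f).trace.re := by
  have hg : HasDerivAt (fun t : ℝ => (1 : Matrix n n ℂ) + t • f) f 0 := by
    have := ((hasDerivAt_id (0 : ℝ)).smul_const f).const_add (1 : Matrix n n ℂ)
    rw [one_smul] at this
    exact this
  have hgi : HasDerivAt (fun t : ℝ => ((1 : Matrix n n ℂ) + t • f)⁻¹) (-f) 0 := by
    simp only [Matrix.nonsing_inv_eq_ringInverse]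
    have h1 : HasFDerivAt (𝕜 := ℝ) Ring.inverse
        (-ContinuousLinearMap.mulLeftRight ℝ (Matrix n n ℂ) ↑(1 : (Matrix n n ℂ)ˣ)⁻¹
          ↑(1 : (Matrix n n ℂ)ˣ)⁻¹) ((1 : Matrix n n ℂ) + (0 : ℝ) • f) := by
      rw [zero_smul, add_zero]
      exact hasFDerivAt_ringInverse (𝕜 := ℝ) (1 : (Matrix n n ℂ)ˣ)
    have h2 := h1.comp_hasDerivAt 0 hg
    have e : (-ContinuousLinearMap.mulLeftRight ℝ (Matrix n n ℂ) ↑(1 : (Matrix n n ℂ)ˣ)⁻¹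
          ↑(1 : (Matrix n n ℂ)ˣ)⁻¹) f = -f := by simp
    rw [e] at h2
    exact h2
  have htr : ∀ {F : ℝ → Matrix n n ℂ} {F'}, HasDerivAt F F' 0 →
      HasDerivAt (fun t => (F t).trace.re) F'.trace.re 0 := by
    intro F F' hF
    let L : Matrix n n ℂ →L[ℝ] ℝ := LinearMap.toContinuousLinearMap
      (Complex.reLm ∘ₗ (Matrix.traceLinearMap n ℝ ℂ))
    exact L.hasFDerivAt.comp_hasDerivAt 0 hF
  have hct : ∀ {F : ℝ → Matrix n n ℂ} {F'}, HasDerivAt F F' 0 →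
      HasDerivAt (fun t => (F t)ᴴ) F'ᴴ 0 := by
    intro F F' hF
    let L : Matrix n n ℂ →L[ℝ] Matrix n n ℂ := LinearMap.toContinuousLinearMap
      (Matrix.conjTransposeLinearEquiv n n ℝ ℂ).toLinearMap
    exact L.hasFDerivAt.comp_hasDerivAt 0 hF
  have h1 := (htr (((hct hg).mul_const C).mul hg)).add (htr ((hgi.mul_const D).mul (hct hgi)))
  have h2 : IsLocalMin ((fun t : ℝ => ((1 + t • f)ᴴ * C * (1 + t • f)).trace.re)
        + fun t : ℝ => ((1 + t • f)⁻¹ * D * ((1 + t • f)⁻¹)ᴴ).trace.re) 0 := by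
    filter_upwards [h] with t ht
    simpa using ht
  have h3 := h2.hasDerivAt_eq_zero h1
  have hre : ∀ M : Matrix n n ℂ, M.IsHermitian → (fᴴ * M).trace.re = (M * f).trace.re := by
    intro M hM
    have : (fᴴ * M).trace = star (M * f).trace := by
      rw [← Matrix.trace_conjTranspose, Matrix.conjTranspose_mul, hM.eq]
    rw [this]; simp
  simp [Matrix.trace_add, hre C hC, Matrix.trace_mul_comm f D, Matrix.trace_mul_comm D fᴴ,
    hre D hD] at h3
  linarith

end MatrixLemmas

section Canonical

variable {A : Type*} [Ring A] [HopfAlgebra ℂ A] [StarRing A] [StarModule ℂ A]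

namespace Rep

/-- The matrix `f` intertwines `u` with itself. -/
def Mor (u : Rep A) (f : Matrix u.ι u.ι ℂ) : Prop :=
  u.mat * f.map (algebraMap ℂ A) = f.map (algebraMap ℂ A) * u.mat

/-- The matrix `C` intertwines `u` and its second contragradient. -/
def Intertwines (u : Rep A) (C : Matrix u.ι u.ι ℂ) : Prop :=
  (u.mat.map fun a => antip A (antip A a)) * C.map (algebraMap ℂ A)
    = C.map (algebraMap ℂ A) * u.mat

lemma map_algebraMap_conjTranspose {m n : Type} (f : Matrix m n ℂ) :
    (f.map (algebraMap ℂ A))ᴴ = fᴴ.map (algebraMap ℂ A) := by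
  ext i j
  simp only [Matrix.conjTranspose_apply, Matrix.map_apply]
  exact (algebraMap_star_comm _).symm

/-- Unitarity: taking adjoints in `u f = f u` gives a relation for `uᴴ`, and multiplication by `u`
on both sides turns it back into one for `u`. -/
lemma Mor.conjTranspose {u : Rep A} {f : Matrix u.ι u.ι ℂ} (hf : u.Mor f) : u.Mor fᴴ := by
  have h := congrArg Matrix.conjTranspose hf
  rw [Matrix.conjTranspose_mul, Matrix.conjTranspose_mul, map_algebraMap_conjTranspose] at h
  have h2 : u.mat * (fᴴ.map (algebraMap ℂ A) * u.matᴴ) * u.mat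
      = u.mat * (u.matᴴ * fᴴ.map (algebraMap ℂ A)) * u.mat := by rw [h]
  rw [← Matrix.mul_assoc u.mat u.matᴴ, u.unitary_right, Matrix.one_mul, Matrix.mul_assoc,
    Matrix.mul_assoc, u.unitary_left, Matrix.mul_one] at h2
  exact h2

lemma Mor.map_antip {u : Rep A} {f : Matrix u.ι u.ι ℂ} (hf : u.Mor f) :
    (u.mat.map fun a => antip A (antip A a)) * f.map (algebraMap ℂ A)
      = f.map (algebraMap ℂ A) * (u.mat.map fun a => antip A (antip A a)) := by
  ext i j
  have h := congrArg (fun a => antip A (antip A a)) (congrFun (congrFun hf i) j)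
  simpa [Matrix.mul_apply, ← Algebra.commutes, ← Algebra.smul_def, map_sum] using h

lemma Intertwines.conj {u : Rep A} {C f : Matrix u.ι u.ι ℂ} (hC : u.Intertwines C)
    (hf : u.Mor f) : u.Intertwines (fᴴ * C * f) := by
  unfold Intertwines Mor at *
  have h := (Mor.conjTranspose (u := u) hf).map_antip
  rw [Matrix.map_mul, Matrix.map_mul, ← Matrix.mul_assoc, ← Matrix.mul_assoc, h,
    Matrix.mul_assoc (fᴴ.map _), hC, Matrix.mul_assoc, Matrix.mul_assoc, Matrix.mul_assoc,
    Matrix.mul_assoc, hf]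

/-- The space of intertwiners between `u` and its second contragradient. -/
def intertwiners (u : Rep A) : Submodule ℂ (Matrix u.ι u.ι ℂ) where
  carrier := {C | u.Intertwines C}
  zero_mem' := by simp [Intertwines]
  add_mem' := by
    intro C D hC hD
    simp only [Set.mem_ofPred_eq, Intertwines] at *
    rw [Matrix.map_add _ (map_add _), mul_add, add_mul, hC, hD]
  smul_mem' := by
    intro r C hC
    simp only [Set.mem_ofPred_eq, Intertwines] at *
    have : (r • C).map (algebraMap ℂ A) = r • C.map (algebraMap ℂ A) := by
      ext i j
      simp only [Matrix.map_apply, Matrix.smul_apply, smul_eq_mul, map_mul]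
      rw [Algebra.smul_def]
    rw [this, mul_smul_comm, smul_mul_assoc, hC]

/-- The algebra of self-intertwiners. -/
def morphisms (u : Rep A) : Submodule ℂ (Matrix u.ι u.ι ℂ) where
  carrier := {C | u.Mor C}
  zero_mem' := by simp [Mor]
  add_mem' := by
    intro C D hC hD
    simp only [Set.mem_ofPred_eq, Mor] at *
    rw [Matrix.map_add _ (map_add _), mul_add, add_mul, hC, hD]
  smul_mem' := by
    intro r C hC
    simp only [Set.mem_ofPred_eq, Mor] at *
    have : (r • C).map (algebraMap ℂ A) = r • C.map (algebraMap ℂ A) := by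
      ext i j
      simp only [Matrix.map_apply, Matrix.smul_apply, smul_eq_mul, map_mul]
      rw [Algebra.smul_def]
    rw [this, mul_smul_comm, smul_mul_assoc, hC]

lemma mor_one (u : Rep A) : u.Mor 1 := by simp [Mor]

/-- Choose a unitary `v` whose matrix elements span a space containing those of `u^c`. Haar averages
give a matrix `Y` intertwining a multiple of `v` with `u^c`, and `Y` has independent rows. Since `v`
is unitary, `Q = Y Yᴴ` is positive definite with `Q = u^c Q u^T`; multiplying by `κ(u^c)` and
transposing shows that `(Q^T)⁻¹` intertwines `u` with `u^{cc}`. -/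
lemma exists_posDef_intertwines [IsCompactMatrixQuantumGroup A] (u : Rep A) :
    ∃ C, C.PosDef ∧ u.Intertwines C := by
  obtain ⟨v, hv⟩ := exists_forall_mem_coeffs (fun p : u.ι × u.ι => u.contra p.1 p.2)
  let Y : Matrix u.ι (v.ι × (u.ι × v.ι)) ℂ := Matrix.of fun i p =>
    haar A (u.contra i p.2.1 * antip A (v.mat p.2.2 p.1))
  have hY : Y.map (algebraMap ℂ A) * Matrix.blockDiagonal (fun _ : u.ι × v.ι => v.mat)
      = u.contra * Y.map (algebraMap ℂ A) := by
    ext i ⟨m, q, r⟩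
    have h := fun j => haar_inv_mul u.isCorep_contra v.isCorep_contra i q j r
    have h1 : ∑ j, haar A (u.contra i q * antip A (v.mat r j)) • v.mat j m
        = ∑ p, haar A (u.contra p q * antip A (v.mat r m)) • u.contra i p := by
      have h2 : ∀ j, haar A (u.contra i q * antip A (v.mat r j)) • v.mat j m
          = ∑ p, ∑ s, haar A (u.contra p q * antip A (v.mat r s)) •
            (u.contra i p * (antip A (v.mat s j) * v.mat j m)) := by
        intro j
        have := congrArg (· * v.mat j m) (h j)
        simp only [contra, Finset.sum_mul, smul_mul_assoc, mul_assoc, one_mul] at this ⊢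
        exact this.symm
      simp only [h2]
      rw [Finset.sum_comm]
      refine Finset.sum_congr rfl fun p _ => ?_
      rw [Finset.sum_comm]
      simp only [← Finset.smul_sum, ← Finset.mul_sum, v.isCorep.antip_mul]
      simp
    simp only [Matrix.mul_apply, Matrix.map_apply, Y, Matrix.of_apply, Fintype.sum_prod_type,
      Matrix.blockDiagonal_apply, ← Algebra.smul_def, ← Algebra.commutes (R := ℂ)]
    rw [← h1]
    refine Finset.sum_congr rfl fun j _ => ?_
    rw [Finset.sum_eq_single q, Finset.sum_eq_single r]
    · simp
    · simp +contextual
    · simp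
    · intro q' _ hq'
      exact Finset.sum_eq_zero fun r' _ => by simp [hq']
    · simp
  have hinj : Function.Injective Y.vecMul := by
    intro w w' hw
    rw [← sub_eq_zero]
    have hw0 : Y.vecMul (w - w') = 0 := by
      rw [Matrix.sub_vecMul]; exact sub_eq_zero.2 hw
    set x := w - w'
    have h1 : ∀ q, ∀ b ∈ coeffs A v.mat, ∑ i, x i * haar A (u.contra i q * antip A b) = 0 := by
      intro q b hb
      induction hb using Submodule.span_induction with
      | mem b hb =>
        obtain ⟨r, j, rfl⟩ := hb
        exact congrFun hw0 (j, q, r)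
      | zero => simp
      | add b b' _ _ hb hb' => simp [mul_add, Finset.sum_add_distrib, hb, hb']
      | smul r b _ hb =>
        simp only [map_smul, mul_smul_comm, smul_eq_mul, mul_left_comm _ r, ← Finset.mul_sum, hb,
          mul_zero]
    ext i'
    -- Here `b` is specialized to the matrix element of `u^c` at `(q, i')`, which the choice of `v`
    -- allows. Summing over `q` contracts `u^c` with its antipode, and `h(1) = 1` leaves the
    -- coordinate of `x` at `i'`.
    have h2 := Finset.sum_congr rfl fun q (_ : q ∈ Finset.univ) => h1 q _ (hv (q, i'))
    rw [Finset.sum_comm] at h2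
    simp only [← Finset.mul_sum, ← map_sum, u.isCorep_contra.mul_antip] at h2
    simpa [apply_ite, haar_one] using h2
  have hQ : (Y * Yᴴ).PosDef := Matrix.PosDef.mul_conjTranspose_self Y hinj
  set Q := Y * Yᴴ with hQdef
  have hinv : Q.map (algebraMap ℂ A) = u.contra * Q.map (algebraMap ℂ A) * u.matᵀ := by
    set V := Matrix.blockDiagonal (fun _ : u.ι × v.ι => v.mat)
    have hV : V * Vᴴ = 1 := by
      rw [Matrix.blockDiagonal_conjTranspose, ← Matrix.blockDiagonal_mul]
      simp [v.unitary_right, ← Matrix.blockDiagonal_one]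
      rfl
    have hstar : u.contraᴴ = u.matᵀ := by
      ext i j
      simp [contra, antip_mat]
    have h2 := congrArg Matrix.conjTranspose hY
    rw [Matrix.conjTranspose_mul, Matrix.conjTranspose_mul, map_algebraMap_conjTranspose,
      hstar] at h2
    rw [hQdef, Matrix.map_mul]
    calc Y.map (algebraMap ℂ A) * Yᴴ.map (algebraMap ℂ A)
        = Y.map (algebraMap ℂ A) * (V * Vᴴ) * Yᴴ.map (algebraMap ℂ A) := by
          rw [hV, Matrix.mul_one]
      _ = (Y.map (algebraMap ℂ A) * V) * (Vᴴ * Yᴴ.map (algebraMap ℂ A)) := by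
          simp only [Matrix.mul_assoc]
      _ = _ := by rw [hY, h2]; simp only [Matrix.mul_assoc]
  refine ⟨(Qᵀ)⁻¹, hQ.transpose.inv, ?_⟩
  have h3 : u.contra.map (antip A) * Q.map (algebraMap ℂ A)
      = Q.map (algebraMap ℂ A) * u.matᵀ := by
    conv_lhs => rw [hinv]
    rw [← Matrix.mul_assoc, ← Matrix.mul_assoc, u.isCorep_contra.map_antip_mul, Matrix.one_mul]
  have h4 : Qᵀ.map (algebraMap ℂ A) * (u.mat.map fun a => antip A (antip A a))
      = u.mat * Qᵀ.map (algebraMap ℂ A) := by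
    ext i j
    have := congrFun (congrFun h3 j) i
    simp only [Matrix.mul_apply, Matrix.map_apply, Matrix.transpose_apply, contra] at this ⊢
    simpa only [← Algebra.commutes (R := ℂ)] using this
  have hu : IsUnit Qᵀ.det := (Matrix.isUnit_iff_isUnit_det _).1 hQ.transpose.isUnit
  have h5 : Qᵀ.map (algebraMap ℂ A) * (Qᵀ)⁻¹.map (algebraMap ℂ A) = 1 := by
    rw [← Matrix.map_mul, Matrix.mul_nonsing_inv _ hu]; simp
  have h6 : (Qᵀ)⁻¹.map (algebraMap ℂ A) * Qᵀ.map (algebraMap ℂ A) = 1 := by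
    rw [← Matrix.map_mul, Matrix.nonsing_inv_mul _ hu]; simp
  unfold Intertwines
  calc _ = (Qᵀ)⁻¹.map (algebraMap ℂ A) * (Qᵀ.map (algebraMap ℂ A)
        * (u.mat.map fun a => antip A (antip A a))) * (Qᵀ)⁻¹.map (algebraMap ℂ A) := by
        rw [← Matrix.mul_assoc, h6, Matrix.one_mul]
    _ = _ := by rw [h4, Matrix.mul_assoc, Matrix.mul_assoc, h5, Matrix.mul_one]

/-- A positive intertwiner of minimal `tr C + tr C⁻¹` is canonical. -/
lemma exists_isCanonical [IsCompactMatrixQuantumGroup A] (u : Rep A) : ∃ C, u.IsCanonical C := by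
  obtain ⟨C₀, hC₀, hi₀⟩ := u.exists_posDef_intertwines
  let r : ℝ := C₀.trace.re + (C₀⁻¹).trace.re
  -- The inverse is carried along as a second matrix: the conditions are then closed, positive
  -- semidefiniteness suffices, and the trace bound makes the set compact. The relation `C D = 1`
  -- restores definiteness at the minimum.
  let S : Set (Matrix u.ι u.ι ℂ × Matrix u.ι u.ι ℂ) :=
    {p | p.1.PosSemidef ∧ p.2.PosSemidef ∧ p.1 * p.2 = 1 ∧ u.Intertwines p.1 ∧
      p.1.trace.re + p.2.trace.re ≤ r}
  have hmul : ∀ {C : Matrix u.ι u.ι ℂ}, C.PosDef → C * C⁻¹ = 1 := fun hC =>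
    Matrix.mul_nonsing_inv _ ((Matrix.isUnit_iff_isUnit_det _).1 hC.isUnit)
  have hcont : Continuous fun p : Matrix u.ι u.ι ℂ × Matrix u.ι u.ι ℂ =>
      p.1.trace.re + p.2.trace.re :=
    (Complex.continuous_re.comp (Continuous.matrix_trace continuous_fst)).add
      (Complex.continuous_re.comp (Continuous.matrix_trace continuous_snd))
  have hS : IsCompact S := by
    have hB : IsCompact (Set.univ.pi fun _ : u.ι => Set.univ.pi fun _ : u.ι =>
        Metric.closedBall (0 : ℂ) r) :=
      isCompact_univ_pi fun _ => isCompact_univ_pi fun _ => isCompact_closedBall _ _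
    refine (hB.prod hB).of_isClosed_subset ?_ ?_
    · refine (isClosed_posSemidef.preimage continuous_fst).inter
        ((isClosed_posSemidef.preimage continuous_snd).inter (IsClosed.inter ?_
          (IsClosed.inter ?_ (isClosed_le hcont continuous_const))))
      · exact isClosed_eq (continuous_fst.matrix_mul continuous_snd) continuous_const
      · exact (Submodule.closed_of_finiteDimensional u.intertwiners).preimage continuous_fst
    · rintro ⟨(C : Matrix u.ι u.ι ℂ), (D : Matrix u.ι u.ι ℂ)⟩ ⟨hC, hD, -, -, hr⟩
      change C.PosSemidef at hC
      change D.PosSemidef at hD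
      change C.trace.re + D.trace.re ≤ r at hr
      have hC' : 0 ≤ C.trace.re := (Complex.nonneg_iff.1 hC.trace_nonneg).1
      have hD' : 0 ≤ D.trace.re := (Complex.nonneg_iff.1 hD.trace_nonneg).1
      refine ⟨fun i _ j _ => ?_, fun i _ j _ => ?_⟩
      · rw [mem_closedBall_zero_iff]
        exact (norm_apply_le_trace hC i j).trans (by linarith)
      · rw [mem_closedBall_zero_iff]
        exact (norm_apply_le_trace hD i j).trans (by linarith)
  obtain ⟨⟨C, D⟩, ⟨hC, hD, hCD, hi, hr⟩, hmin⟩ := hS.exists_isMinOn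
    ⟨(C₀, C₀⁻¹), hC₀.posSemidef, hC₀.inv.posSemidef, hmul hC₀, hi₀, le_rfl⟩ hcont.continuousOn
  simp only at hC hD hCD hi hr
  have hDC : D = C⁻¹ := (Matrix.inv_eq_right_inv hCD).symm
  have hCpd : C.PosDef :=
    hC.posDef_iff_isUnit.2 (IsUnit.of_mul_eq_one _ hCD)
  have hre : ∀ f, u.Mor f → (C * f).trace.re = (D * f).trace.re := by
    intro f hf
    refine trace_re_eq_of_eventually_le hC.isHermitian hD.isHermitian ?_
    have hev : ∀ᶠ t : ℝ in nhds 0, IsUnit (1 + t • f).det := by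
      have hc : Continuous fun t : ℝ => (1 + t • f).det := by
        fun_prop
      have := hc.continuousAt.eventually_ne (x := (0 : ℝ)) (y := (0 : ℂ)) (by simp)
      filter_upwards [this] with t ht
      exact isUnit_iff_ne_zero.2 ht
    filter_upwards [hev] with t ht
    set g := 1 + t • f
    have hg : u.Mor g := u.morphisms.add_mem u.mor_one
      (by
        have : t • f = (t : ℂ) • f := by ext i j; simp
        rw [this]
        exact u.morphisms.smul_mem _ hf)
    -- If the transformed pair violates the bound `r`, its value exceeds the minimum anyway;
    -- otherwise it lies in `S` and minimality applies.
    by_cases hle : (gᴴ * C * g).trace.re + (g⁻¹ * D * (g⁻¹)ᴴ).trace.re ≤ r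
    · refine isMinOn_iff.1 hmin (gᴴ * C * g, g⁻¹ * D * (g⁻¹)ᴴ)
        ⟨hC.conjTranspose_mul_mul_same g, hD.mul_mul_conjTranspose_same g⁻¹, ?_, hi.conj hg, hle⟩
      have h1 : g * g⁻¹ = 1 := Matrix.mul_nonsing_inv _ ht
      have h2 : gᴴ * (g⁻¹)ᴴ = 1 := by
        rw [← Matrix.conjTranspose_mul, Matrix.nonsing_inv_mul _ ht, Matrix.conjTranspose_one]
      calc gᴴ * C * g * (g⁻¹ * D * (g⁻¹)ᴴ) = gᴴ * C * (g * g⁻¹) * D * (g⁻¹)ᴴ := by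
            simp only [Matrix.mul_assoc]
        _ = gᴴ * (C * D) * (g⁻¹)ᴴ := by rw [h1, Matrix.mul_one]; simp only [Matrix.mul_assoc]
        _ = 1 := by rw [hCD, Matrix.mul_one, h2]
    · linarith
  refine ⟨C, hCpd, hi, fun f hf => ?_⟩
  -- Minimality controls only real parts; the intertwiner `i f` supplies the imaginary part.
  have h1 := hre f hf
  have h2 := hre (Complex.I • f) (u.morphisms.smul_mem _ hf)
  rw [← hDC]
  apply Complex.ext h1
  simpa using h2

end Rep
end Canonical
end QPB

/-! ### Uniqueness of the canonical intertwiner and its value on sums and products. -/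

namespace QPB

section Canonical

variable {A : Type*} [Ring A] [HopfAlgebra ℂ A] [StarRing A] [StarModule ℂ A]

namespace Rep

lemma _root_.Matrix.PosDef.mul_inv_self {n : Type} [Fintype n] [DecidableEq n]
    {C : Matrix n n ℂ} (hC : C.PosDef) : C * C⁻¹ = 1 :=
  Matrix.mul_nonsing_inv _ ((Matrix.isUnit_iff_isUnit_det _).1 hC.isUnit)

lemma _root_.Matrix.PosDef.inv_mul_self {n : Type} [Fintype n] [DecidableEq n]
    {C : Matrix n n ℂ} (hC : C.PosDef) : C⁻¹ * C = 1 :=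
  Matrix.nonsing_inv_mul _ ((Matrix.isUnit_iff_isUnit_det _).1 hC.isUnit)

lemma Intertwines.inv {u : Rep A} {C : Matrix u.ι u.ι ℂ} (hC : u.Intertwines C)
    (hp : C.PosDef) : u.mat * C⁻¹.map (algebraMap ℂ A)
      = C⁻¹.map (algebraMap ℂ A) * u.mat.map fun a => antip A (antip A a) := by
  have h5 : C.map (algebraMap ℂ A) * C⁻¹.map (algebraMap ℂ A) = 1 := by
    rw [← Matrix.map_mul, hp.mul_inv_self]; simp
  have h6 : C⁻¹.map (algebraMap ℂ A) * C.map (algebraMap ℂ A) = 1 := by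
    rw [← Matrix.map_mul, hp.inv_mul_self]; simp
  calc u.mat * C⁻¹.map (algebraMap ℂ A)
      = C⁻¹.map (algebraMap ℂ A) * (C.map (algebraMap ℂ A) * u.mat) * C⁻¹.map (algebraMap ℂ A) := by
        rw [← Matrix.mul_assoc, h6, Matrix.one_mul]
    _ = _ := by rw [← hC, Matrix.mul_assoc, Matrix.mul_assoc, h5, Matrix.mul_one]

lemma Intertwines.mor {u : Rep A} {C C' : Matrix u.ι u.ι ℂ} (hC : u.Intertwines C)
    (hp : C.PosDef) (hC' : u.Intertwines C') : u.Mor (C⁻¹ * C') := by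
  have h := hC.inv hp
  unfold Intertwines Mor at *
  rw [Matrix.map_mul, ← Matrix.mul_assoc, h, Matrix.mul_assoc, hC', Matrix.mul_assoc]

/-- Put `g = C⁻¹ C'`, a self-intertwiner with inverse `g' = C'⁻¹ C`, and `f = g - g'`. The trace
condition of `C` at `g f` and that of `C'` at `f` combine to `tr(C⁻¹ f²) = 0`. Writing `f = Lᴴ` and
`f C⁻¹ = C⁻¹ L`, this is the trace of the positive matrix `Lᴴ C⁻¹ L`, so `f = 0` and `g² = 1`. As `C
(1 + g) = C + C'` is invertible, `g = 1`. -/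
lemma IsCanonical.unique {u : Rep A} {C C' : Matrix u.ι u.ι ℂ} (hC : u.IsCanonical C)
    (hC' : u.IsCanonical C') : C = C' := by
  have p := hC.posDef
  have p' := hC'.posDef
  have h1 : u.Mor (C⁻¹ * C') := Intertwines.mor hC.intertwines p hC'.intertwines
  have h2 : u.Mor (C'⁻¹ * C) := Intertwines.mor hC'.intertwines p' hC.intertwines
  have hf : u.Mor (C⁻¹ * C' - C'⁻¹ * C) := u.morphisms.sub_mem h1 h2
  set g := C⁻¹ * C' with hg
  set g' := C'⁻¹ * C with hg'
  have hgg' : g * g' = 1 := by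
    rw [hg, hg', Matrix.mul_assoc, ← Matrix.mul_assoc C', p'.mul_inv_self, Matrix.one_mul,
      p.inv_mul_self]
  have hg'g : g' * g = 1 := mul_eq_one_comm.1 hgg'
  have hmul : ∀ {a b : Matrix u.ι u.ι ℂ}, u.Mor a → u.Mor b → u.Mor (a * b) := by
    intro a b ha hb
    unfold Mor at *
    rw [Matrix.map_mul, ← Matrix.mul_assoc, ha, Matrix.mul_assoc, hb, Matrix.mul_assoc]
  have t1 := hC.trace_eq _ (hmul h1 hf)
  have t2 := hC'.trace_eq _ hf
  have e1 : C * (g * (g - g')) = C' * (g - g') := by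
    rw [← Matrix.mul_assoc, hg, ← Matrix.mul_assoc, p.mul_inv_self, Matrix.one_mul]
  have e2 : (C'⁻¹ * (g - g')).trace = (C⁻¹ * (g' * (g - g'))).trace := by
    have : C'⁻¹ = g' * C⁻¹ := by rw [hg', Matrix.mul_assoc, p.mul_inv_self, Matrix.mul_one]
    rw [this, Matrix.mul_assoc, Matrix.trace_mul_comm, Matrix.mul_assoc]
    congr 2
    rw [Matrix.sub_mul, Matrix.mul_sub, hgg', hg'g]
  rw [e1, t2, e2] at t1
  have t3 : (C⁻¹ * ((g - g') * (g - g'))).trace = 0 := by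
    rw [Matrix.sub_mul, Matrix.mul_sub, Matrix.trace_sub, ← t1, sub_self]
  set L := (C' - C * C'⁻¹ * C) * C⁻¹ with hL
  have hK : (C' - C * C'⁻¹ * C)ᴴ = C' - C * C'⁻¹ * C := by
    rw [Matrix.conjTranspose_sub, Matrix.conjTranspose_mul, Matrix.conjTranspose_mul,
      p.isHermitian.eq, p'.isHermitian.eq, p'.inv.isHermitian.eq, Matrix.mul_assoc]
  have hgL : g - g' = Lᴴ := by
    rw [hL, Matrix.conjTranspose_mul, hK, p.inv.isHermitian.eq, Matrix.mul_sub, ← hg,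
      ← Matrix.mul_assoc, ← Matrix.mul_assoc, p.inv_mul_self, Matrix.one_mul]
  have hgL' : (g - g') * C⁻¹ = C⁻¹ * L := by
    have : g - g' = C⁻¹ * (C' - C * C'⁻¹ * C) := by
      rw [hgL, hL, Matrix.conjTranspose_mul, hK, p.inv.isHermitian.eq]
    rw [this, hL, Matrix.mul_assoc]
  have t4 : (Lᴴ * C⁻¹ * L).trace = 0 := by
    rw [Matrix.mul_assoc, ← hgL', ← hgL, ← t3, Matrix.trace_mul_comm C⁻¹, Matrix.mul_assoc]
  have t5 : Lᴴ * C⁻¹ * L = 0 :=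
    (p.inv.posSemidef.conjTranspose_mul_mul_same L).trace_eq_zero_iff.1 t4
  have hL0 : L = 0 := by
    ext i j
    by_contra hne
    have hx : L *ᵥ Pi.single j 1 ≠ 0 := fun h0 => hne (by
      have := congrFun h0 i
      simpa using this)
    have hpos := p.inv.dotProduct_mulVec_pos hx
    rw [Matrix.star_mulVec, ← Matrix.dotProduct_mulVec, Matrix.mulVec_mulVec, Matrix.mulVec_mulVec,
      t5, Matrix.zero_mulVec, dotProduct_zero] at hpos
    exact lt_irrefl _ hpos
  have hgeq : g = g' := by rw [← sub_eq_zero, hgL, hL0, Matrix.conjTranspose_zero]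
  have h7 : (C + C') * (g - 1) = 0 := by
    have : (C + C') * (g - 1) = C * ((1 + g) * (g - 1)) := by
      rw [← Matrix.mul_assoc, Matrix.mul_add, Matrix.mul_one, hg, ← Matrix.mul_assoc C,
        p.mul_inv_self, Matrix.one_mul]
    rw [this]
    have : (1 + g) * (g - 1) = 0 := by
      rw [Matrix.add_mul, Matrix.one_mul, Matrix.mul_sub, Matrix.mul_one]
      nth_rw 3 [hgeq]
      rw [hgg']; abel
    rw [this, Matrix.mul_zero]
  have h8 : g - 1 = 0 := by
    have := congrArg ((C + C')⁻¹ * ·) h7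
    simpa only [← Matrix.mul_assoc, (p.add p').inv_mul_self, Matrix.one_mul, Matrix.mul_zero]
      using this
  have h9 : g = 1 := sub_eq_zero.1 h8
  have := congrArg (C * ·) h9
  simp only [hg, ← Matrix.mul_assoc, p.mul_inv_self, Matrix.one_mul, Matrix.mul_one] at this
  exact this.symm

lemma isCanonical_canon [IsCompactMatrixQuantumGroup A] (u : Rep A) : u.IsCanonical u.canon := by
  have h := u.exists_isCanonical
  unfold canon
  rw [dif_pos h]
  exact h.choose_spec

lemma IsCanonical.canon_eq [IsCompactMatrixQuantumGroup A] {u : Rep A} {C : Matrix u.ι u.ι ℂ}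
    (hC : u.IsCanonical C) : u.canon = C := u.isCanonical_canon.unique hC

/-- The inverse of the canonical intertwiner cancels `κ(u)` against `u`. -/
lemma sum_canon_inv [IsCompactMatrixQuantumGroup A] (u : Rep A) (k l : u.ι) :
    ∑ i, ∑ j, u.canon⁻¹ j i • (antip A (u.mat i k) * u.mat l j) = u.canon⁻¹ l k • (1 : A) := by
  have hu := u.isCanonical_canon
  have h := Intertwines.inv hu.intertwines hu.posDef
  have h1 : ∀ i, ∑ j, u.canon⁻¹ j i • u.mat l j
      = ∑ m, u.canon⁻¹ l m • antip A (antip A (u.mat m i)) := by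
    intro i
    have := congrFun (congrFun h l) i
    simp only [Matrix.mul_apply, Matrix.map_apply, ← Algebra.smul_def,
      ← Algebra.commutes (R := ℂ)] at this
    exact this
  have h2 : ∀ i, ∑ j, u.canon⁻¹ j i • (antip A (u.mat i k) * u.mat l j)
      = ∑ m, u.canon⁻¹ l m • (u.contra k i * antip A (u.contra i m)) := by
    intro i
    simp only [← mul_smul_comm, ← Finset.mul_sum, h1]
    rfl
  simp only [h2]
  rw [Finset.sum_comm]
  simp only [← Finset.smul_sum, u.isCorep_contra.mul_antip]
  simp

/-- The canonical intertwiner cancels `v` against `κ(v)`. -/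
lemma sum_canon [IsCompactMatrixQuantumGroup A] (v : Rep A) (r l : v.ι) :
    ∑ s, ∑ k, v.canon s k • (v.mat k r * antip A (v.mat l s)) = v.canon l r • (1 : A) := by
  have hv := v.isCanonical_canon
  have h := hv.intertwines
  have h1 : ∀ s, ∑ k, v.canon s k • v.mat k r
      = ∑ m, v.canon m r • antip A (antip A (v.mat s m)) := by
    intro s
    have := congrFun (congrFun h s) r
    simp only [Matrix.mul_apply, Matrix.map_apply, ← Algebra.smul_def,
      ← Algebra.commutes (R := ℂ)] at this
    exact this.symm
  have h2 : ∀ s, ∑ k, v.canon s k • (v.mat k r * antip A (v.mat l s))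
      = ∑ m, v.canon m r • (antip A (v.contra m s) * v.contra s l) := by
    intro i
    simp only [← smul_mul_assoc, ← Finset.sum_mul, h1]
    rfl
  simp only [h2]
  rw [Finset.sum_comm]
  simp only [← Finset.smul_sum, v.isCorep_contra.antip_mul]
  simp

lemma canon_triv [IsCompactMatrixQuantumGroup A] :
    (triv : Rep A).canon = (1 : Matrix Unit Unit ℂ) := by
  refine IsCanonical.canon_eq (u := triv) ⟨Matrix.PosDef.one, ?_, fun f _ => ?_⟩
  · have : (1 : Matrix Unit Unit A).map (fun a => antip A (antip A a))
        * (1 : Matrix Unit Unit ℂ).map (algebraMap ℂ A)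
        = (1 : Matrix Unit Unit ℂ).map (algebraMap ℂ A) * 1 := by
      ext i j
      simp [HopfAlgebra.antipode_one]
    exact this
  · have : ∀ f : Matrix Unit Unit ℂ, (1 * f).trace = (1⁻¹ * f).trace := by simp
    exact this f

/-- Only the diagonal blocks of a self-intertwiner of the sum enter the traces, and these are
self-intertwiners of the summands. -/
lemma canon_add [IsCompactMatrixQuantumGroup A] (u v : Rep A) :
    (u.add v).canon = (Matrix.fromBlocks u.canon 0 0 v.canon :
      Matrix (u.ι ⊕ v.ι) (u.ι ⊕ v.ι) ℂ) := by
  have hu := u.isCanonical_canon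
  have hv := v.isCanonical_canon
  have hmul : Matrix.fromBlocks u.canon 0 0 v.canon * Matrix.fromBlocks u.canon⁻¹ 0 0 v.canon⁻¹
      = 1 := by
    rw [Matrix.fromBlocks_multiply]
    simp [hu.posDef.mul_inv_self, hv.posDef.mul_inv_self]
  have hinv := Matrix.inv_eq_right_inv hmul
  refine IsCanonical.canon_eq (u := u.add v) ⟨?_, ?_, fun f hf => ?_⟩
  · have h : (Matrix.fromBlocks u.canon 0 0 v.canon).PosSemidef := by
      have := hu.posDef.isUnit.invertible
      have h := (hu.posDef.fromBlocks₁₁ 0 v.canon).2 (by simpa using hv.posDef.posSemidef)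
      simpa using h
    have hp : (Matrix.fromBlocks u.canon 0 0 v.canon).PosDef :=
      h.posDef_iff_isUnit.2 (IsUnit.of_mul_eq_one _ hmul)
    exact hp
  · have : (Matrix.fromBlocks u.mat 0 0 v.mat).map (fun a => antip A (antip A a))
          * (Matrix.fromBlocks u.canon 0 0 v.canon).map (algebraMap ℂ A)
        = (Matrix.fromBlocks u.canon 0 0 v.canon).map (algebraMap ℂ A)
          * Matrix.fromBlocks u.mat 0 0 v.mat := by
      have h0 : (0 : Matrix u.ι v.ι ℂ).map (algebraMap ℂ A) = 0 := by ext; simp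
      have h0' : (0 : Matrix v.ι u.ι ℂ).map (algebraMap ℂ A) = 0 := by ext; simp
      have h1 : (0 : Matrix u.ι v.ι A).map (fun a => antip A (antip A a)) = 0 := by ext; simp
      have h1' : (0 : Matrix v.ι u.ι A).map (fun a => antip A (antip A a)) = 0 := by ext; simp
      rw [Matrix.fromBlocks_map, Matrix.fromBlocks_map, Matrix.fromBlocks_multiply,
        Matrix.fromBlocks_multiply, h0, h0', h1, h1', hu.intertwines, hv.intertwines]
      simp
    exact this
  · have : ∀ f : Matrix (u.ι ⊕ v.ι) (u.ι ⊕ v.ι) ℂ,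
        Matrix.fromBlocks u.mat 0 0 v.mat * f.map (algebraMap ℂ A)
          = f.map (algebraMap ℂ A) * Matrix.fromBlocks u.mat 0 0 v.mat →
        (Matrix.fromBlocks u.canon 0 0 v.canon * f).trace
          = ((Matrix.fromBlocks u.canon 0 0 v.canon)⁻¹ * f).trace := by
      intro f hf
      rw [hinv]
      rw [← Matrix.fromBlocks_toBlocks f] at hf ⊢
      simp only [Matrix.fromBlocks_map, Matrix.fromBlocks_multiply, Matrix.fromBlocks_inj,
        Matrix.zero_mul, Matrix.mul_zero, add_zero, zero_add] at hf
      have ht : ∀ (a : Matrix u.ι u.ι ℂ) (b : Matrix u.ι v.ι ℂ) (c : Matrix v.ι u.ι ℂ)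
          (d : Matrix v.ι v.ι ℂ), (Matrix.fromBlocks a b c d).trace = a.trace + d.trace := by
        intros; simp [Matrix.trace, Fintype.sum_sum_type]
      simp only [Matrix.fromBlocks_multiply, ht, Matrix.zero_mul, add_zero, zero_add]
      rw [hu.trace_eq _ hf.1, hv.trace_eq _ hf.2.2.2]
    exact this f hf

/-- The trace condition is reduced to the factors by partial traces of `f`: the one over the second
factor weighted by `C_v` is a self-intertwiner `F` of `u`, the one over the first factor weighted by
`C_u⁻¹` a self-intertwiner `G` of `v`. The weights are needed because `κ` and `u` must be contracted
in the order where only `sum_canon` or `sum_canon_inv` applies. -/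
lemma canon_mul [IsCompactMatrixQuantumGroup A] (u v : Rep A) :
    (u.mul v).canon = (Matrix.kroneckerMap (· * ·) u.canon v.canon :
      Matrix (u.ι × v.ι) (u.ι × v.ι) ℂ) := by
  have hu := u.isCanonical_canon
  have hv := v.isCanonical_canon
  refine IsCanonical.canon_eq (u := u.mul v) ⟨?_, ?_, fun f hf => ?_⟩
  · have : (Matrix.kroneckerMap (· * ·) u.canon v.canon).PosDef := hu.posDef.kronecker hv.posDef
    exact this
  · have : (prodMat u.mat v.mat).map (fun a => antip A (antip A a))
          * (Matrix.kroneckerMap (· * ·) u.canon v.canon).map (algebraMap ℂ A)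
        = (Matrix.kroneckerMap (· * ·) u.canon v.canon).map (algebraMap ℂ A)
          * prodMat u.mat v.mat := by
      ext ⟨i, k⟩ ⟨j, l⟩
      have h1 := congrFun (congrFun hu.intertwines i) j
      have h2 := congrFun (congrFun hv.intertwines k) l
      simp only [Matrix.mul_apply, Matrix.map_apply] at h1 h2
      have hk : ∀ p q, antip A (antip A (u.mat i p * v.mat k q))
          = antip A (antip A (u.mat i p)) * antip A (antip A (v.mat k q)) := by
        intro p q
        rw [u.isCorep.antip_mul_rev v.isCorep]
        exact v.isCorep_contra.antip_mul_rev u.isCorep_contra q k p i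
      simp only [Matrix.mul_apply, Matrix.map_apply, prodMat, Matrix.of_apply,
        Matrix.kroneckerMap_apply, Fintype.sum_prod_type, hk, map_mul]
      calc _ = (∑ p, antip A (antip A (u.mat i p)) * algebraMap ℂ A (u.canon p j))
            * ∑ q, antip A (antip A (v.mat k q)) * algebraMap ℂ A (v.canon q l) := by
            rw [Finset.sum_mul_sum]
            refine Finset.sum_congr rfl fun p _ => Finset.sum_congr rfl fun q _ => ?_
            simp only [mul_assoc]
            congr 1
            rw [← mul_assoc, ← mul_assoc, Algebra.commutes]
        _ = _ := by
            rw [h1, h2, Finset.sum_mul_sum]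
            refine Finset.sum_congr rfl fun p _ => Finset.sum_congr rfl fun q _ => ?_
            simp only [mul_assoc]
            congr 1
            rw [← mul_assoc, ← mul_assoc, Algebra.commutes]
    exact this
  · have : ∀ f : Matrix (u.ι × v.ι) (u.ι × v.ι) ℂ,
        prodMat u.mat v.mat * f.map (algebraMap ℂ A)
          = f.map (algebraMap ℂ A) * prodMat u.mat v.mat →
        (Matrix.kroneckerMap (· * ·) u.canon v.canon * f).trace
          = ((Matrix.kroneckerMap (· * ·) u.canon v.canon)⁻¹ * f).trace := by
      intro f hf
      have hf' : ∀ i k j l, ∑ p, ∑ r, f (p, r) (j, l) • (u.mat i p * v.mat k r)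
          = ∑ p, ∑ r, f (i, k) (p, r) • (u.mat p j * v.mat r l) := by
        intro i k j l
        have := congrFun (congrFun hf (i, k)) (j, l)
        simpa only [Matrix.mul_apply, Matrix.map_apply, prodMat, Matrix.of_apply,
          Fintype.sum_prod_type, ← Algebra.commutes (R := ℂ), ← Algebra.smul_def] using this
      let F : Matrix u.ι u.ι ℂ := Matrix.of fun i j => ∑ k, ∑ l, f (i, k) (j, l) * v.canon l k
      let G : Matrix v.ι v.ι ℂ := Matrix.of fun k l => ∑ i, ∑ j, f (i, k) (j, l) * u.canon⁻¹ j i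
      have hF : u.Mor F := by
        have e1 : ∀ i k j s, ∑ l, (∑ p, ∑ r, f (p, r) (j, l) • (u.mat i p * v.mat k r))
            * antip A (v.mat l s) = ∑ p, f (i, k) (p, s) • u.mat p j := by
          intro i k j s
          simp only [hf', Finset.sum_mul, smul_mul_assoc, mul_assoc]
          rw [Finset.sum_comm]
          refine Finset.sum_congr rfl fun p _ => ?_
          rw [Finset.sum_comm]
          simp only [← Finset.smul_sum, ← Finset.mul_sum, v.isCorep.mul_antip]
          simp
        ext i j
        simp only [Matrix.mul_apply, Matrix.map_apply, ← Algebra.commutes (R := ℂ),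
          ← Algebra.smul_def, F, Matrix.of_apply]
        calc _ = ∑ s, ∑ k, v.canon s k • ∑ l, (∑ p, ∑ r, f (p, r) (j, l) • (u.mat i p * v.mat k r))
              * antip A (v.mat l s) := by
              have : ∀ s k, v.canon s k • ∑ l, (∑ p, ∑ r, f (p, r) (j, l) •
                  (u.mat i p * v.mat k r)) * antip A (v.mat l s)
                  = ∑ p, ∑ r, ∑ l, f (p, r) (j, l) • (u.mat i p * (v.canon s k •
                    (v.mat k r * antip A (v.mat l s)))) := by
                intro s k
                simp only [Finset.sum_mul, smul_mul_assoc, mul_assoc, mul_smul_comm,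
                  Finset.smul_sum, smul_comm (v.canon s k)]
                rw [Finset.sum_comm]
                refine Finset.sum_congr rfl fun p _ => ?_
                rw [Finset.sum_comm]
              simp only [this]
              rw [Finset.sum_congr rfl fun s _ => Finset.sum_comm, Finset.sum_comm]
              refine Finset.sum_congr rfl fun p _ => ?_
              rw [Finset.sum_smul]
              rw [Finset.sum_congr rfl fun s _ => Finset.sum_comm, Finset.sum_comm]
              refine Finset.sum_congr rfl fun r _ => ?_
              rw [Finset.sum_smul]
              rw [Finset.sum_congr rfl fun s _ => Finset.sum_comm, Finset.sum_comm]
              refine Finset.sum_congr rfl fun l _ => ?_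
              simp only [← Finset.smul_sum, ← Finset.mul_sum, v.sum_canon]
              simp [smul_smul]
        _ = _ := by
              simp only [e1, Finset.smul_sum, Finset.sum_smul, smul_smul]
              rw [Finset.sum_congr rfl fun s _ => Finset.sum_comm, Finset.sum_comm]
              refine Finset.sum_congr rfl fun p _ => ?_
              rw [Finset.sum_comm]
              refine Finset.sum_congr rfl fun k _ => Finset.sum_congr rfl fun l _ => ?_
              rw [mul_comm]
      have hG : v.Mor G := by
        have e1 : ∀ s k j l, ∑ i, antip A (u.mat s i)
            * (∑ p, ∑ r, f (i, k) (p, r) • (u.mat p j * v.mat r l))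
            = ∑ r, f (s, r) (j, l) • v.mat k r := by
          intro s k j l
          simp only [← hf', Finset.mul_sum, mul_smul_comm, ← mul_assoc]
          rw [Finset.sum_comm]
          simp only [Finset.sum_comm (s := (Finset.univ : Finset u.ι)) (t := (Finset.univ : Finset v.ι)),
            ← Finset.smul_sum, ← Finset.sum_mul, u.isCorep.antip_mul]
          rw [Finset.sum_comm]
          simp
        ext k l
        simp only [Matrix.mul_apply, Matrix.map_apply, ← Algebra.commutes (R := ℂ),
          ← Algebra.smul_def, G, Matrix.of_apply]
        calc _ = ∑ s, ∑ j, u.canon⁻¹ j s • ∑ i, antip A (u.mat s i)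
              * (∑ p, ∑ r, f (i, k) (p, r) • (u.mat p j * v.mat r l)) := by
              simp only [e1, Finset.smul_sum, Finset.sum_smul, smul_smul]
              rw [Finset.sum_comm]
              refine Finset.sum_congr rfl fun i _ => ?_
              rw [Finset.sum_comm]
              refine Finset.sum_congr rfl fun j _ => Finset.sum_congr rfl fun r _ => ?_
              rw [mul_comm]
        _ = _ := by
              have : ∀ s j, u.canon⁻¹ j s • ∑ i, antip A (u.mat s i)
                  * (∑ p, ∑ r, f (i, k) (p, r) • (u.mat p j * v.mat r l))
                  = ∑ r, ∑ i, ∑ p, f (i, k) (p, r) • ((u.canon⁻¹ j s •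
                    (antip A (u.mat s i) * u.mat p j)) * v.mat r l) := by
                intro s j
                simp only [Finset.mul_sum, smul_mul_assoc, mul_assoc, mul_smul_comm,
                  Finset.smul_sum, smul_comm (u.canon⁻¹ j s)]
                rw [Finset.sum_congr rfl fun s _ => Finset.sum_comm, Finset.sum_comm]
              simp only [this]
              rw [Finset.sum_congr rfl fun s _ => Finset.sum_comm, Finset.sum_comm]
              refine Finset.sum_congr rfl fun r _ => ?_
              rw [Finset.sum_smul]
              rw [Finset.sum_congr rfl fun s _ => Finset.sum_comm, Finset.sum_comm]
              refine Finset.sum_congr rfl fun i _ => ?_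
              rw [Finset.sum_smul]
              rw [Finset.sum_congr rfl fun s _ => Finset.sum_comm, Finset.sum_comm]
              refine Finset.sum_congr rfl fun p _ => ?_
              simp only [← Finset.smul_sum, ← Finset.sum_mul, u.sum_canon_inv]
              simp [smul_smul]
      have hinv : (Matrix.kroneckerMap (· * ·) u.canon v.canon)⁻¹
          = Matrix.kroneckerMap (· * ·) u.canon⁻¹ v.canon⁻¹ := Matrix.inv_kronecker _ _
      have t1 : ∀ C : Matrix u.ι u.ι ℂ, (Matrix.kroneckerMap (· * ·) C v.canon * f).trace
          = (C * F).trace := by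
        intro C
        simp only [Matrix.trace, Matrix.diag, Matrix.mul_apply, Matrix.kroneckerMap_apply,
          Fintype.sum_prod_type, F, Matrix.of_apply, Finset.mul_sum]
        refine Finset.sum_congr rfl fun i _ => ?_
        rw [Finset.sum_comm]
        refine Finset.sum_congr rfl fun j _ => ?_
        rw [Finset.sum_comm]
        refine Finset.sum_congr rfl fun k _ => Finset.sum_congr rfl fun l _ => by ring
      have t2 : ∀ C : Matrix v.ι v.ι ℂ, (Matrix.kroneckerMap (· * ·) u.canon⁻¹ C * f).trace
          = (C * G).trace := by
        intro C
        simp only [Matrix.trace, Matrix.diag, Matrix.mul_apply, Matrix.kroneckerMap_apply,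
          Fintype.sum_prod_type, G, Matrix.of_apply, Finset.mul_sum]
        rw [Finset.sum_comm]
        refine Finset.sum_congr rfl fun k _ => ?_
        rw [Finset.sum_congr rfl fun s _ => Finset.sum_comm, Finset.sum_comm]
        refine Finset.sum_congr rfl fun l _ => ?_
        rw [Finset.sum_comm]
        refine Finset.sum_congr rfl fun i _ => Finset.sum_congr rfl fun j _ => by ring
      -- The passage goes through the mixed weight `C_u⁻¹ ⊗ C_v`: the condition for `u` inverts the
      -- first factor, the one for `v` then the second.
      rw [hinv, t1, hu.trace_eq F hF, ← t1, t2, hv.trace_eq G hG, ← t2]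
    exact this f hf

end Rep
end Canonical
end QPB

namespace QPB

section Bundles

open FODC

variable {A Γ : Type*} [Ring A] [HopfAlgebra ℂ A] [StarRing A] [StarModule ℂ A]
    [AddCommGroup Γ] [Module ℂ Γ] [Module A Γ] [Module Aᵐᵒᵖ Γ] [SMulCommClass A Aᵐᵒᵖ Γ]
    [IsScalarTower ℂ A Γ] [IsScalarTower ℂ Aᵐᵒᵖ Γ]

namespace FODC

variable (c : FODC A Γ)

/-! ### The left coaction on the envelope -/

/-- The inclusion of `A` into `Γ^∧` as a homomorphism. -/
def inAHom : A →ₐ[ℂ] c.Env := AlgHom.ofLinearMap c.inA c.inA_one c.inA_mul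

/-- The map `a ↦ a₍₁₎ ⊗ a₍₂₎` with values in `A ⊗ Γ^∧`. -/
def lamA : A →ₐ[ℂ] A ⊗[ℂ] c.Env :=
  (Algebra.TensorProduct.map (AlgHom.id ℂ A) c.inAHom).comp (Bialgebra.comulAlgHom ℂ A)

/-- The map `a ↦ a₍₁₎ ⊗ d a₍₂₎`. -/
def lamD : A →ₗ[ℂ] A ⊗[ℂ] c.Env :=
  TensorProduct.map LinearMap.id (c.inΓ ∘ₗ c.d) ∘ₗ Coalgebra.comul

lemma lamD_mul (x y : A) : c.lamD (x * y) = c.lamA x * c.lamD y + c.lamD x * c.lamA y := by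
  have h : ∀ s r : A ⊗[ℂ] A, TensorProduct.map LinearMap.id (c.inΓ ∘ₗ c.d) (s * r)
      = Algebra.TensorProduct.map (AlgHom.id ℂ A) c.inAHom s
          * TensorProduct.map LinearMap.id (c.inΓ ∘ₗ c.d) r
        + TensorProduct.map LinearMap.id (c.inΓ ∘ₗ c.d) s
          * Algebra.TensorProduct.map (AlgHom.id ℂ A) c.inAHom r := by
    intro s r
    induction s with
    | zero => simp
    | add s s' hs hs' => simp only [add_mul, map_add, hs, hs']; abel
    | tmul a b =>
      induction r with
      | zero => simp
      | add r r' hr hr' => simp only [mul_add, map_add, hr, hr']; abel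
      | tmul a' b' =>
        simp [c.leibniz, inΓ_left, inΓ_right, inAHom, TensorProduct.tmul_add]
  simp only [lamD, lamA, LinearMap.comp_apply, AlgHom.comp_apply, Bialgebra.comulAlgHom_apply,
    Bialgebra.comul_mul, h]

/-- The map `a ⊗ b ↦ a₍₁₎ b₍₁₎ ⊗ a₍₂₎ d b₍₂₎` with values in `A ⊗ Γ`. -/
def lamPre : A ⊗[ℂ] A →ₗ[ℂ] A ⊗[ℂ] Γ :=
  TensorProduct.map (LinearMap.mul' ℂ A) (formMap c.d)
    ∘ₗ (TensorProduct.tensorTensorTensorComm ℂ A A A A).toLinearMap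
    ∘ₗ TensorProduct.map Coalgebra.comul Coalgebra.comul

lemma lamPre_eq_zero (t : A ⊗[ℂ] A) (h : formMap c.d t = 0) : c.lamPre t = 0 := c.left_cov t h

lemma lTensor_lamPre (x y : A) : c.inΓ.lTensor A (c.lamPre (x ⊗ₜ y)) = c.lamA x * c.lamD y := by
  have h : ∀ s r : A ⊗[ℂ] A, c.inΓ.lTensor A (TensorProduct.map (LinearMap.mul' ℂ A)
      (formMap c.d) (TensorProduct.tensorTensorTensorComm ℂ A A A A (s ⊗ₜ r)))
      = Algebra.TensorProduct.map (AlgHom.id ℂ A) c.inAHom s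
          * TensorProduct.map LinearMap.id (c.inΓ ∘ₗ c.d) r := by
    intro s r
    induction s with
    | zero => simp
    | add s s' hs hs' => simp only [TensorProduct.add_tmul, add_mul, map_add, hs, hs']
    | tmul a b =>
      induction r with
      | zero => simp
      | add r r' hr hr' => simp only [TensorProduct.tmul_add, mul_add, map_add, hr, hr']
      | tmul a' b' =>
        simp [formMap, inΓ_left, inAHom]
  simpa [lamPre, lamD, lamA] using h (Coalgebra.comul x) (Coalgebra.comul y)

/-- The left coaction on one-forms. -/
def lamΓ : Γ →ₗ[ℂ] A ⊗[ℂ] c.Env :=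
  c.inΓ.lTensor A ∘ₗ
    (LinearMap.ker (formMap c.d)).liftQ c.lamPre (fun t ht => c.lamPre_eq_zero t ht)
    ∘ₗ ((formMap c.d).quotKerEquivOfSurjective c.spanned).symm.toLinearMap

lemma lamΓ_formMap (t : A ⊗[ℂ] A) : c.lamΓ (formMap c.d t) = c.inΓ.lTensor A (c.lamPre t) := by
  have : ((formMap c.d).quotKerEquivOfSurjective c.spanned).symm (formMap c.d t)
      = Submodule.Quotient.mk t := by
    rw [LinearEquiv.symm_apply_eq]; rfl
  simp only [lamΓ, LinearMap.comp_apply, LinearEquiv.coe_coe, this]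
  rfl

lemma lamΓ_smul_d (x y : A) : c.lamΓ (x • c.d y) = c.lamA x * c.lamD y := by
  have := c.lamΓ_formMap (x ⊗ₜ y)
  rw [lTensor_lamPre] at this
  simpa [formMap] using this

lemma lamΓ_d (y : A) : c.lamΓ (c.d y) = c.lamD y := by
  have := c.lamΓ_smul_d 1 y
  simpa using this

/-- The left coaction `Γ^∧ → A ⊗ Γ^∧`. -/
def lam : c.Env →ₐ[ℂ] A ⊗[ℂ] c.Env :=
  c.envLift c.lamA.toLinearMap c.lamΓ (by simp) (by simp)
    (by
      intro a γ
      obtain ⟨t, rfl⟩ := c.spanned γ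
      induction t with
      | zero => simp
      | add x y hx hy => simp only [map_add, smul_add, hx, hy, mul_add]
      | tmul x y =>
        simp only [formMap, TensorProduct.lift.tmul, LinearMap.mk₂_apply, ← mul_smul,
          lamΓ_smul_d, map_mul, AlgHom.toLinearMap_apply, mul_assoc])
    (by
      intro a γ
      obtain ⟨t, rfl⟩ := c.spanned γ
      induction t with
      | zero => simp
      | add x y hx hy => simp only [map_add, smul_add, hx, hy, add_mul]
      | tmul x y =>
        have h0 : MulOpposite.op a • x • c.d y = x • c.d (y * a) - (x * y) • c.d a := by
          rw [c.leibniz, smul_add, mul_smul, ← smul_comm x (MulOpposite.op a)]; abel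
        simp only [formMap, TensorProduct.lift.tmul, LinearMap.mk₂_apply, h0, map_sub,
          lamΓ_smul_d, map_mul, AlgHom.toLinearMap_apply, lamD_mul]
        noncomm_ring)
    (by
      intro t ht
      have h : ∀ t : A ⊗[ℂ] A, mulMap (c.lamΓ ∘ₗ c.d) (c.lamΓ ∘ₗ c.d) t
          = c.dOne.lTensor A (c.lamPre t) := by
        intro t
        induction t with
        | zero => simp
        | add x y hx hy => simp only [map_add, hx, hy]
        | tmul x y =>
          have h : ∀ s r : A ⊗[ℂ] A, c.dOne.lTensor A (TensorProduct.map (LinearMap.mul' ℂ A)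
              (formMap c.d) (TensorProduct.tensorTensorTensorComm ℂ A A A A (s ⊗ₜ r)))
              = TensorProduct.map LinearMap.id (c.inΓ ∘ₗ c.d) s
                  * TensorProduct.map LinearMap.id (c.inΓ ∘ₗ c.d) r := by
            intro s r
            induction s with
            | zero => simp
            | add s s' hs hs' => simp only [TensorProduct.add_tmul, add_mul, map_add, hs, hs']
            | tmul a b =>
              induction r with
              | zero => simp
              | add r r' hr hr' => simp only [TensorProduct.tmul_add, mul_add, map_add, hr, hr']
              | tmul a' b' => simp [dOne_formMap, mulMap]
          simpa [mulMap, lamΓ_d, lamPre, lamD] using (h (Coalgebra.comul x) (Coalgebra.comul y)).symm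
      rw [h, lamPre_eq_zero c t ht, map_zero])

lemma lam_inA (a : A) : c.lam (c.inA a) = c.lamA a := c.envLift_inA _ _ _ _ _ _ _ a

lemma lam_inΓ (γ : Γ) : c.lam (c.inΓ γ) = c.lamΓ γ := c.envLift_inΓ _ _ _ _ _ _ _ γ

section
variable {ι : Type} [Fintype ι] [DecidableEq ι] {v : Matrix ι ι A}

lemma lamA_corep (hv : IsCorep v) (i j : ι) :
    c.lamA (v i j) = ∑ k, v i k ⊗ₜ[ℂ] c.inA (v k j) := by
  simp [lamA, hv.comul, inAHom]

lemma lamD_corep (hv : IsCorep v) (i j : ι) :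
    c.lamD (v i j) = ∑ k, v i k ⊗ₜ[ℂ] c.inΓ (c.d (v k j)) := by
  simp [lamD, hv.comul]

lemma piEnv_corep (hv : IsCorep v) (i j : ι) :
    c.piEnv (v i j) = ∑ k, c.inA (antip A (v i k)) * c.inΓ (c.d (v k j)) := by
  simp [piEnv, hv.comul, mulMap]

lemma sum_inA_mul_piEnv (hv : IsCorep v) (i j : ι) :
    ∑ k, c.inA (v i k) * c.piEnv (v k j) = c.inΓ (c.d (v i j)) := by
  simp only [c.piEnv_corep hv, Finset.mul_sum, ← mul_assoc, ← c.inA_mul]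
  rw [Finset.sum_comm]
  simp only [← Finset.sum_mul, ← map_sum, hv.mul_antip]
  rw [Finset.sum_eq_single i] <;> simp +contextual [c.inA_one, eq_comm]

/-- In the coaction of `∑ κ(v_{ik}) d v_{kj}` the left legs contract to `κ(v) v = 1`. -/
lemma lam_piEnv_corep (hv : IsCorep v) (i j : ι) :
    c.lam (c.piEnv (v i j)) = 1 ⊗ₜ c.piEnv (v i j) := by
  have h : ∀ k, c.lam (c.inA (antip A (v i k)))
      = ∑ l, antip A (v l k) ⊗ₜ[ℂ] c.inA (antip A (v i l)) := fun k => by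
    rw [lam_inA]; exact c.lamA_corep hv.contra k i
  rw [c.piEnv_corep hv]
  simp only [map_sum, map_mul, h, lam_inΓ, lamΓ_d, c.lamD_corep hv, Finset.sum_mul_sum,
    Algebra.TensorProduct.tmul_mul_tmul]
  rw [Finset.sum_comm, TensorProduct.tmul_sum]
  refine Finset.sum_congr rfl fun l _ => ?_
  rw [Finset.sum_comm]
  simp only [← TensorProduct.sum_tmul, hv.antip_mul]
  rw [Finset.sum_eq_single l] <;> simp +contextual [eq_comm]

end

/-- The map `x ↦ κ(x₍₋₁₎) x₍₀₎` onto the left-invariant forms. -/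
def invProj : c.Env →ₗ[ℂ] c.Env := mulMap (c.inA ∘ₗ antip A) LinearMap.id ∘ₗ c.lam.toLinearMap

lemma dEnv_inA (a : A) : c.dEnv (c.inA a) = c.inΓ (c.d a) := by
  change c.dHom (c.inA a) 0 1 = _
  rw [dHom, envLift_inA]
  rfl

lemma proj_inA (a : A) : c.proj (c.inA a) = a := c.envLift_inA _ _ _ _ _ _ _ a

lemma proj_inΓ (γ : Γ) : c.proj (c.inΓ γ) = 0 := c.envLift_inΓ _ _ _ _ _ _ _ γ

lemma proj_grading {n : ℕ} (hn : n ≠ 0) {x : c.Env} (hx : x ∈ c.grading n) : c.proj x = 0 := by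
  obtain ⟨n, rfl⟩ := Nat.exists_eq_succ_of_ne_zero hn
  unfold grading at hx
  rw [pow_succ, ← mul_assoc] at hx
  induction hx using Submodule.mul_induction_on' with
  | mem_mul_mem m hm z hz =>
    obtain ⟨γ, rfl⟩ := hz
    rw [map_mul, proj_inΓ, mul_zero]
  | add x _ y _ hx hy => rw [map_add, hx, hy, add_zero]

lemma piEnv_mem (a : A) : c.piEnv a ∈ c.grading 1 := by
  have : ∀ t, mulMap (c.inA ∘ₗ antip A) (c.inΓ ∘ₗ c.d) t ∈ c.grading 1 := by
    intro t
    induction t with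
    | zero => simp
    | add x y hx hy => rw [map_add]; exact add_mem hx hy
    | tmul x y =>
      have := SetLike.mul_mem_graded (c.inA_mem (antip A x)) (c.inΓ_mem (c.d y))
      rw [zero_add] at this
      simpa [mulMap] using this
  exact this _

variable [IsCompactMatrixQuantumGroup A]

lemma lam_piEnv (a : A) : c.lam (c.piEnv a) = 1 ⊗ₜ c.piEnv a := by
  have : c.lam.toLinearMap ∘ₗ c.piEnv = TensorProduct.mk ℂ A c.Env 1 ∘ₗ c.piEnv :=
    Rep.ext_mat fun u i j => c.lam_piEnv_corep u.isCorep i j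
  exact LinearMap.congr_fun this a

lemma lam_invWedge {θ : c.Env} (hθ : θ ∈ c.invWedge) : c.lam θ = 1 ⊗ₜ θ := by
  induction hθ using Algebra.adjoin_induction with
  | mem x hx => obtain ⟨a, rfl⟩ := hx; exact c.lam_piEnv a
  | algebraMap r => simp [Algebra.algebraMap_eq_smul_one, Algebra.TensorProduct.one_def]
  | add x y _ _ hx hy => rw [map_add, hx, hy, TensorProduct.tmul_add]
  | mul x y _ _ hx hy => rw [map_mul, hx, hy, Algebra.TensorProduct.tmul_mul_tmul, one_mul]

/-- The coaction sends `a θ` to `a₍₁₎ ⊗ a₍₂₎ θ` because `θ` is invariant, and `κ(a₍₁₎) a₍₂₎ = ε(a)`.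
So `invProj` strips the group factor off a form; this inverts `m_ω` on leading terms below. -/
lemma invProj_mul {θ : c.Env} (hθ : θ ∈ c.invWedge) (a : A) :
    c.invProj (c.inA a * θ) = Coalgebra.counit (R := ℂ) a • θ := by
  have : c.invProj ∘ₗ LinearMap.mulRight ℂ θ ∘ₗ c.inA
      = (Coalgebra.counit (R := ℂ) (A := A)).smulRight θ := by
    refine Rep.ext_mat fun u i j => ?_
    simp only [LinearMap.comp_apply, LinearMap.mulRight_apply, invProj, AlgHom.toLinearMap_apply,
      map_mul, lam_inA, c.lamA_corep u.isCorep, c.lam_invWedge hθ, Finset.sum_mul,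
      Algebra.TensorProduct.tmul_mul_tmul, mul_one, map_sum, mulMap, TensorProduct.map_tmul,
      LinearMap.mul'_apply, LinearMap.id_apply, LinearMap.smulRight_apply]
    simp only [← mul_assoc, ← c.inA_mul, ← Finset.sum_mul, ← map_sum, u.isCorep.antip_mul,
      u.isCorep.counit]
    split_ifs <;> simp [c.inA_one]
  exact LinearMap.congr_fun this a

end FODC

end Bundles
end QPB

namespace QPB

section Bundles

open FODC

variable {A Γ : Type*} [Ring A] [HopfAlgebra ℂ A] [StarRing A] [StarModule ℂ A]
    [AddCommGroup Γ] [Module ℂ Γ] [Module A Γ] [Module Aᵐᵒᵖ Γ] [SMulCommClass A Aᵐᵒᵖ Γ]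
    [IsScalarTower ℂ A Γ] [IsScalarTower ℂ Aᵐᵒᵖ Γ]

variable {B Ω : Type*} [Ring B] [Algebra ℂ B] [StarRing B] [StarModule ℂ B]
  [Ring Ω] [Algebra ℂ Ω]

namespace Calc

variable {c : FODC A Γ} {P : Bundle A B} {𝒪 : ℕ → Submodule ℂ Ω} [GradedAlgebra 𝒪]

/-! ### The product of `Ω(P) ⊗̂ Γ^∧` and the action of the group -/

variable (c 𝒪) in
/-- The product of `Ω(P) ⊗̂ Γ^∧` on the underlying space. -/
def gmul : Ω ⊗[ℂ] c.Env →ₗ[ℂ] Ω ⊗[ℂ] c.Env →ₗ[ℂ] Ω ⊗[ℂ] c.Env :=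
  ((LinearMap.mul ℂ (𝒪 ᵍ⊗[ℂ] c.grading)).compl₁₂
    (GradedTensorProduct.of ℂ 𝒪 c.grading).toLinearMap
    (GradedTensorProduct.of ℂ 𝒪 c.grading).toLinearMap).compr₂
    (GradedTensorProduct.of ℂ 𝒪 c.grading).symm.toLinearMap

lemma gmul_tmul {i j : ℕ} (x : Ω) {a : c.Env} (ha : a ∈ c.grading i) {y : Ω} (hy : y ∈ 𝒪 j)
    (b : c.Env) :
    gmul c 𝒪 (x ⊗ₜ a) (y ⊗ₜ b) = (-1 : ℂ) ^ (i * j) • ((x * y) ⊗ₜ (a * b)) := by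
  have := GradedTensorProduct.tmul_coe_mul_coe_tmul (R := ℂ) 𝒪 c.grading x ⟨a, ha⟩ ⟨y, hy⟩ b
  have h := congrArg (GradedTensorProduct.of ℂ 𝒪 c.grading).symm this
  refine h.trans ?_
  rw [Units.smul_def, ← Int.cast_smul_eq_zsmul ℂ, map_smul]
  simp only [GradedTensorProduct.of_symm_of]
  congr 1
  rcases Nat.even_or_odd (i * j) with he | he
  · simp [he.neg_one_pow]
  · simp [he.neg_one_pow]

lemma gmul_inA (x : Ω) (a : A) (y : Ω) (b : c.Env) :
    gmul c 𝒪 (x ⊗ₜ c.inA a) (y ⊗ₜ b) = (x * y) ⊗ₜ (c.inA a * b) := by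
  induction y using DirectSum.Decomposition.inductionOn 𝒪 with
  | zero => simp
  | add y y' hy hy' => simp only [TensorProduct.add_tmul, map_add, hy, hy', mul_add]
  | homogeneous y => rw [gmul_tmul x (c.inA_mem a) y.2]; simp

lemma gmul_one_right (x : Ω) (a b : c.Env) :
    gmul c 𝒪 (x ⊗ₜ a) (1 ⊗ₜ b) = x ⊗ₜ (a * b) := by
  induction a using DirectSum.Decomposition.inductionOn c.grading with
  | zero => simp
  | add y y' hy hy' =>
    simp only [TensorProduct.tmul_add, map_add, hy, hy', add_mul, LinearMap.add_apply]
  | homogeneous y => rw [gmul_tmul x y.2 (SetLike.GradedOne.one_mem : (1 : Ω) ∈ 𝒪 0)]; simp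

/-- The sign in `(x ⊗ a)(y ⊗ b)` can be nontrivial only when `a` has positive degree, and then `p_*`
kills the product. Hence `F^∧` is multiplicative for the ordinary tensor product of algebras. -/
lemma map_proj_gmul (s r : Ω ⊗[ℂ] c.Env) :
    TensorProduct.map LinearMap.id c.proj.toLinearMap (gmul c 𝒪 s r)
      = TensorProduct.map LinearMap.id c.proj.toLinearMap s
        * TensorProduct.map LinearMap.id c.proj.toLinearMap r := by
  induction s with
  | zero => simp
  | add s s' hs hs' => simp only [map_add, LinearMap.add_apply, hs, hs', add_mul]
  | tmul x a =>
    induction r with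
    | zero => simp
    | add r r' hr hr' => simp only [map_add, hr, hr', mul_add]
    | tmul y b =>
      induction y using DirectSum.Decomposition.inductionOn 𝒪 with
      | zero => simp
      | add y y' hy hy' => simp only [TensorProduct.add_tmul, map_add, hy, hy', mul_add]
      | homogeneous y =>
        induction a using DirectSum.Decomposition.inductionOn c.grading with
        | zero => simp
        | add y y' hy hy' =>
          simp only [TensorProduct.tmul_add, map_add, hy, hy', add_mul, LinearMap.add_apply]
        | @homogeneous i a =>
          rw [gmul_tmul x a.2 y.2]
          rcases eq_or_ne i 0 with rfl | hi
          · simp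
          · simp [c.proj_grading hi a.2]

variable (X : Calc c P 𝒪)

lemma hat_mul (x y : Ω) : X.hat (x * y) = gmul c 𝒪 (X.hat x) (X.hat y) := by
  change (GradedTensorProduct.of ℂ 𝒪 c.grading).symm (X.Fhat (x * y)) = _
  rw [map_mul]; rfl

lemma hat_one : X.hat 1 = 1 ⊗ₜ 1 := by
  change (GradedTensorProduct.of ℂ 𝒪 c.grading).symm (X.Fhat 1) = _
  rw [map_one]; rfl

lemma hat_d (x : Ω) : X.hat (X.d x) = TensorProduct.map X.d LinearMap.id (X.hat x)
    + TensorProduct.map (parity 𝒪) c.dEnv (X.hat x) := X.Fhat_d x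

lemma hat_j (b : B) : X.hat (X.j b) = TensorProduct.map X.j.toLinearMap c.inA (P.F b) := X.Fhat_j b

/-- The right action as a homomorphism. -/
def actHom : Ω →ₐ[ℂ] Ω ⊗[ℂ] A :=
  AlgHom.ofLinearMap X.act (by simp [act, hat_one, Algebra.TensorProduct.one_def])
    (fun x y => by
      change TensorProduct.map LinearMap.id c.proj.toLinearMap (X.hat (x * y)) = _
      rw [hat_mul, map_proj_gmul]; rfl)

lemma act_mul (x y : Ω) : X.act (x * y) = X.act x * X.act y := X.actHom.map_mul x y

lemma act_one : X.act 1 = 1 ⊗ₜ 1 := X.actHom.map_one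

lemma act_of_hat {x : Ω} {t : Ω ⊗[ℂ] A} (h : X.hat x = TensorProduct.map LinearMap.id c.inA t) :
    X.act x = t := by
  change TensorProduct.map LinearMap.id c.proj.toLinearMap (X.hat x) = t
  rw [h]
  have : TensorProduct.map LinearMap.id c.proj.toLinearMap ∘ₗ TensorProduct.map LinearMap.id c.inA
      = (LinearMap.id : Ω ⊗[ℂ] A →ₗ[ℂ] Ω ⊗[ℂ] A) := by
    ext x a; simp [c.proj_inA]
  exact LinearMap.congr_fun this t

lemma hat_of_mem_hor {x : Ω} (hx : x ∈ X.hor) :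
    X.hat x = TensorProduct.map LinearMap.id c.inA (X.act x) := by
  obtain ⟨t, ht⟩ := hx
  rw [X.act_of_hat ht.symm, ht]

lemma act_j (b : B) : X.act (X.j b) = TensorProduct.map X.j.toLinearMap LinearMap.id (P.F b) := by
  apply X.act_of_hat
  rw [hat_j]
  induction P.F b with
  | zero => simp
  | add x y hx hy => simp only [map_add, hx, hy]
  | tmul x y => simp

/-- Both sides are algebra homomorphisms in `x`, so it is enough to treat `b` and `db`. On `db` the
vertical part of `F̂(db)` has positive degree in `Γ^∧` and is removed by `p_*`; what is left is the
counit axiom of `F`. -/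
lemma act_counit (x : Ω) : TensorProduct.rid ℂ Ω
    ((Coalgebra.counit (R := ℂ) (A := A)).lTensor Ω (X.act x)) = x := by
  let f : Ω →ₐ[ℂ] Ω := ((Algebra.TensorProduct.rid ℂ ℂ Ω).toAlgHom.comp
    (Algebra.TensorProduct.map (AlgHom.id ℂ Ω) (Bialgebra.counitAlgHom ℂ A))).comp X.actHom
  have hf : f = AlgHom.id ℂ Ω := by
    refine AlgHom.ext_of_adjoin_eq_top X.generated ?_
    have hF : ∀ (g : B →ₗ[ℂ] Ω) b, TensorProduct.rid ℂ Ω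
        ((Coalgebra.counit (R := ℂ) (A := A)).lTensor Ω
          (TensorProduct.map g LinearMap.id (P.F b))) = g b := by
      intro g b
      have h := congrArg g (P.counit b)
      refine Eq.trans ?_ h
      induction P.F b with
      | zero => simp
      | add x y hx hy => simp only [map_add, hx, hy]
      | tmul x y => simp
    rintro _ (⟨b, rfl⟩ | ⟨b, rfl⟩)
    · refine Eq.trans ?_ (hF X.j.toLinearMap b)
      rw [← act_j]; rfl
    · refine Eq.trans ?_ (hF (X.d ∘ₗ X.j.toLinearMap) b)
      have : X.act (X.d (X.j b))
          = TensorProduct.map (X.d ∘ₗ X.j.toLinearMap) LinearMap.id (P.F b) := by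
        change TensorProduct.map LinearMap.id c.proj.toLinearMap (X.hat _) = _
        rw [hat_d, hat_j, map_add]
        induction P.F b with
        | zero => simp
        | add x y hx hy => 
          simp only [map_add] at hx hy ⊢
          rw [← hx, ← hy]; abel
        | tmul x y => simp [c.proj_inA, c.dEnv_inA, c.proj_inΓ]
      rw [← this]; rfl
  exact AlgHom.congr_fun hf x

/-! ### Intertwiners -/

section
variable {ι ι' : Type} [Fintype ι] [DecidableEq ι] [Fintype ι'] [DecidableEq ι']
  {v : Matrix ι ι A} {w : Matrix ι' ι' A}

lemma hat_bimod {x : ι → Ω} (hx : x ∈ X.bimod v) (i : ι) :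
    X.hat (x i) = ∑ k, x k ⊗ₜ[ℂ] c.inA (v k i) := by
  rw [X.hat_of_mem_hor (hx i).1, (hx i).2]; simp

/-- A single equation for `F̂` encodes both horizontality and covariance, so intertwiners are
recognized without treating `F^∧` separately. -/
lemma mem_bimod_iff {x : ι → Ω} :
    x ∈ X.bimod v ↔ ∀ i, X.hat (x i) = ∑ k, x k ⊗ₜ[ℂ] c.inA (v k i) := by
  refine ⟨fun hx i => X.hat_bimod hx i, fun hx i => ?_⟩
  have h : X.hat (x i) = TensorProduct.map LinearMap.id c.inA (∑ k, x k ⊗ₜ[ℂ] v k i) := by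
    rw [hx i]; simp
  exact ⟨⟨_, h.symm⟩, X.act_of_hat h⟩

lemma mul_mem_hor {x y : Ω} (hx : x ∈ X.hor) (hy : y ∈ X.hor) : x * y ∈ X.hor := by
  refine ⟨X.act (x * y), ?_⟩
  rw [X.hat_mul, X.hat_of_mem_hor hx, X.hat_of_mem_hor hy, act_mul]
  induction X.act x with
  | zero => simp
  | add s s' hs hs' => simp only [map_add, LinearMap.add_apply, hs, hs', add_mul]
  | tmul x a =>
    induction X.act y with
    | zero => simp
    | add r r' hr hr' => simp only [map_add, hr, hr', mul_add]
    | tmul y b => simp [gmul_inA, c.inA_mul]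

lemma one_mem_hor : (1 : Ω) ∈ X.hor :=
  ⟨1 ⊗ₜ 1, by rw [hat_one]; simp [c.inA_one]⟩

lemma mul_mem_bimod {x : ι → Ω} {y : ι' → Ω} (hx : x ∈ X.bimod v) (hy : y ∈ X.bimod w) :
    (fun p : ι × ι' => x p.1 * y p.2) ∈ X.bimod (prodMat v w) := by
  rintro ⟨i, j⟩
  refine ⟨X.mul_mem_hor (hx i).1 (hy j).1, ?_⟩
  rw [act_mul, (hx i).2, (hy j).2, Finset.sum_mul_sum, Fintype.sum_prod_type]
  simp [prodMat]

lemma mem_base_iff {x : Ω} : x ∈ X.base ↔ X.hat x = x ⊗ₜ 1 := by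
  simp [base, sub_eq_zero]

lemma mem_base_iff' {x : Ω} : x ∈ X.base ↔ x ∈ X.hor ∧ X.act x = x ⊗ₜ 1 := by
  rw [mem_base_iff]
  constructor
  · intro h
    have h' : X.hat x = TensorProduct.map LinearMap.id c.inA (x ⊗ₜ (1 : A)) := by
      rw [h]; simp [c.inA_one]
    exact ⟨⟨_, h'.symm⟩, X.act_of_hat h'⟩
  · rintro ⟨h1, h2⟩
    rw [X.hat_of_mem_hor h1, h2]; simp [c.inA_one]

lemma base_le_hor : X.base ≤ X.hor := fun _ hx => (X.mem_base_iff'.1 hx).1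

lemma one_mem_base : (1 : Ω) ∈ X.base := X.mem_base_iff.2 X.hat_one

lemma base_mul_mem_bimod {α : Ω} (hα : α ∈ X.base) {x : ι → Ω} (hx : x ∈ X.bimod v) :
    (fun i => α * x i) ∈ X.bimod v := by
  intro i
  refine ⟨X.mul_mem_hor (X.base_le_hor hα) (hx i).1, ?_⟩
  rw [act_mul, (X.mem_base_iff'.1 hα).2, (hx i).2, Finset.mul_sum]
  simp

lemma bimod_mul_base_mem {α : Ω} (hα : α ∈ X.base) {x : ι → Ω} (hx : x ∈ X.bimod v) :
    (fun i => x i * α) ∈ X.bimod v := by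
  intro i
  refine ⟨X.mul_mem_hor (hx i).1 (X.base_le_hor hα), ?_⟩
  rw [act_mul, (X.mem_base_iff'.1 hα).2, (hx i).2, Finset.sum_mul]
  simp

end

end Calc

end Bundles
end QPB

namespace QPB

section Bundles

open FODC

variable {A Γ : Type*} [Ring A] [HopfAlgebra ℂ A] [StarRing A] [StarModule ℂ A]
    [AddCommGroup Γ] [Module ℂ Γ] [Module A Γ] [Module Aᵐᵒᵖ Γ] [SMulCommClass A Aᵐᵒᵖ Γ]
    [IsScalarTower ℂ A Γ] [IsScalarTower ℂ Aᵐᵒᵖ Γ]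

variable {B Ω : Type*} [Ring B] [Algebra ℂ B] [StarRing B] [StarModule ℂ B]
  [Ring Ω] [Algebra ℂ Ω]

/-! ### Finiteness of the coaction -/

namespace Bundle

variable (P : Bundle A B)

/-- The fundamental theorem of comodules: every element of the bundle is a combination of the
components of a finite-dimensional corepresentation. -/
lemma exists_corep (b : B) : ∃ (n : ℕ) (x : Fin n → B) (v : Matrix (Fin n) (Fin n) A),
    IsCorep v ∧ (∀ j, P.F (x j) = ∑ k, x k ⊗ₜ[ℂ] v k j) ∧ b ∈ Submodule.span ℂ (Set.range x) := by
  classical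
  let e := Module.Basis.ofVectorSpace ℂ A
  let t := TensorProduct.equivFinsuppOfBasisRight (M := B) e (P.F b)
  have ht : P.F b = ∑ i ∈ t.support, t i ⊗ₜ[ℂ] e i := by
    have := (TensorProduct.equivFinsuppOfBasisRight (M := B) e).symm_apply_apply (P.F b)
    rw [TensorProduct.equivFinsuppOfBasisRight_symm_apply] at this
    exact this.symm
  -- `W` is spanned by the coefficients of `F(b)` along a basis of `A`. The counit puts `b` in `W`,
  -- and applying a coordinate to the last leg in coassociativity shows that `F` maps `W` to `W ⊗
  -- A`.
  let W : Submodule ℂ B := Submodule.span ℂ (t '' t.support)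
  have htW : ∀ i ∈ t.support, t i ∈ W := fun i hi => Submodule.subset_span ⟨i, hi, rfl⟩
  have hW : FiniteDimensional ℂ W :=
    FiniteDimensional.span_of_finite ℂ (t.support.finite_toSet.image _)
  have hbW : b ∈ W := by
    rw [← P.counit b, ht]
    simp only [map_sum, LinearMap.lTensor_tmul, TensorProduct.rid_tmul]
    exact sum_mem fun i hi => Submodule.smul_mem _ _ (htW i hi)
  have hF : ∀ y ∈ W, P.F y ∈ LinearMap.range (W.subtype.rTensor A) := by
    intro y hy
    refine (Submodule.span_le (p := (LinearMap.range (W.subtype.rTensor A)).comap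
      P.F.toLinearMap)).2 ?_ hy
    rintro _ ⟨i, hi, rfl⟩
    have h1 := congrArg (TensorProduct.map (LinearMap.id : B →ₗ[ℂ] B)
      ((TensorProduct.rid ℂ A).toLinearMap ∘ₗ (e.coord i).lTensor A)) (P.coassoc b)
    have h2 : TensorProduct.map (LinearMap.id : B →ₗ[ℂ] B)
        ((TensorProduct.rid ℂ A).toLinearMap ∘ₗ (e.coord i).lTensor A)
        (TensorProduct.assoc ℂ B A A (P.F.toLinearMap.rTensor A (P.F b))) = P.F (t i) := by
      have h3 : ∀ (s : B ⊗[ℂ] A) (a : A), TensorProduct.map (LinearMap.id : B →ₗ[ℂ] B)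
          ((TensorProduct.rid ℂ A).toLinearMap ∘ₗ (e.coord i).lTensor A)
          (TensorProduct.assoc ℂ B A A (s ⊗ₜ a)) = e.coord i a • s := by
        intro s a
        induction s with
        | zero => simp
        | add x y hx hy => simp only [TensorProduct.add_tmul, map_add, hx, hy, smul_add]
        | tmul x y => simp
      rw [ht]
      simp only [map_sum, LinearMap.rTensor_tmul, h3]
      rw [Finset.sum_eq_single i]
      · simp
      · intro j _ hj
        simp [hj]
      · intro h; exact absurd hi h
    rw [h2] at h1
    change P.F (t i) ∈ LinearMap.range _
    rw [h1, ht]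
    simp only [map_sum, LinearMap.lTensor_tmul, TensorProduct.map_tmul, LinearMap.id_apply]
    exact sum_mem fun j hj => ⟨⟨t j, htW j hj⟩ ⊗ₜ _, rfl⟩
  let x := Module.finBasis ℂ W
  have hv : ∀ j, ∃ a : Fin (Module.finrank ℂ W) → A,
      P.F (x j : B) = ∑ k, (x k : B) ⊗ₜ[ℂ] a k := by
    intro j
    obtain ⟨s, hs⟩ := hF _ (x j).2
    rw [← hs]
    clear hs
    induction s with
    | zero => exact ⟨0, by simp⟩
    | add s s' hs hs' =>
      obtain ⟨a, ha⟩ := hs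
      obtain ⟨a', ha'⟩ := hs'
      exact ⟨a + a', by rw [map_add, ha, ha']; simp [TensorProduct.tmul_add, Finset.sum_add_distrib]⟩
    | tmul y a =>
      refine ⟨fun k => x.repr y k • a, ?_⟩
      have hy : (y : B) = ∑ k, x.repr y k • (x k : B) := by
        have := congrArg W.subtype (x.sum_repr y)
        rw [map_sum] at this
        exact this.symm
      simp only [LinearMap.rTensor_tmul, Submodule.subtype_apply, TensorProduct.tmul_smul,
        TensorProduct.smul_tmul', ← TensorProduct.sum_tmul, ← hy]
  choose v hv using hv
  -- A retraction onto `W` extends the coordinates to functionals on `B`; these extract the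
  -- corepresentation identities from coassociativity and the counit axiom.
  obtain ⟨g, hg⟩ := LinearMap.exists_leftInverse_of_injective W.subtype
    (LinearMap.ker_eq_bot.2 W.injective_subtype)
  let f : Fin (Module.finrank ℂ W) → B →ₗ[ℂ] ℂ := fun k => x.coord k ∘ₗ g
  have hf : ∀ k l, f k (x l) = if l = k then 1 else 0 := by
    intro k l
    have : g (x l : B) = x l := LinearMap.congr_fun hg (x l)
    simp [f, this, Finsupp.single_apply]
  refine ⟨_, fun j => (x j : B), Matrix.of fun k j => v j k, ⟨fun i j => ?_, fun i j => ?_⟩,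
    hv, ?_⟩
  · have h := P.coassoc (x j : B)
    rw [hv] at h
    simp only [map_sum, LinearMap.rTensor_tmul, AlgHom.toLinearMap_apply, hv,
      LinearMap.lTensor_tmul, TensorProduct.sum_tmul, TensorProduct.assoc_tmul] at h
    have h' := congrArg (fun s => TensorProduct.lid ℂ (A ⊗[ℂ] A) ((f i).rTensor (A ⊗[ℂ] A) s)) h
    simpa [hf] using h'.symm
  · have h := congrArg (f i) (P.counit (x j : B))
    rw [hv] at h
    simpa [hf, eq_comm] using h
  · have : W = Submodule.span ℂ (Set.range fun j => (x j : B)) := by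
      have := congrArg (Submodule.map W.subtype) x.span_eq
      rw [Submodule.map_span, Submodule.map_subtype_top, ← Set.range_comp] at this
      exact this.symm
    rw [← this]; exact hbW

end Bundle

end Bundles
end QPB

namespace QPB

section Bundles

open FODC

variable {A Γ : Type*} [Ring A] [HopfAlgebra ℂ A] [StarRing A] [StarModule ℂ A]
    [AddCommGroup Γ] [Module ℂ Γ] [Module A Γ] [Module Aᵐᵒᵖ Γ] [SMulCommClass A Aᵐᵒᵖ Γ]
    [IsScalarTower ℂ A Γ] [IsScalarTower ℂ Aᵐᵒᵖ Γ]

variable {B Ω : Type*} [Ring B] [Algebra ℂ B] [StarRing B] [StarModule ℂ B]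
  [Ring Ω] [Algebra ℂ Ω]

namespace Calc

variable {c : FODC A Γ} {P : Bundle A B} {𝒪 : ℕ → Submodule ℂ Ω} [GradedAlgebra 𝒪]

/-! ### The vertical decomposition -/

lemma parity_of_mem {n : ℕ} {x : Ω} (hx : x ∈ 𝒪 n) : parity 𝒪 x = (-1 : ℂ) ^ n • x := by
  lift x to 𝒪 n using hx
  simp [parity, DirectSum.decompose_coe, DirectSum.decomposeLinearEquiv, ← DirectSum.lof_eq_of ℂ,
    DirectSum.toModule_lof]

section
variable {ι ι' : Type} [Fintype ι] [DecidableEq ι] [Fintype ι'] [DecidableEq ι']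
  {v : Matrix ι ι A} {v' : Matrix ι' ι' A}

lemma ad_corep (hv : IsCorep v) (i j : ι) :
    ad A (v i j) = ∑ p, ∑ q, v p q ⊗ₜ[ℂ] (antip A (v i p) * v q j) := by
  simp only [ad, LinearMap.comp_apply, hv.comul, map_sum, TensorProduct.map_tmul,
    LinearMap.id_apply, TensorProduct.tmul_sum, LinearEquiv.coe_coe, TensorProduct.leftComm_tmul,
    LinearMap.mul'_apply]

namespace RegularConnection

variable {X : Calc c P 𝒪} (w : X.RegularConnection)

/-- The matrix of connection forms `ω π(v_{ij})`. -/
def form (v : Matrix ι ι A) (i j : ι) : Ω := w.ω (c.pi (v i j))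

lemma hat_form (hv : IsCorep v) (i j : ι) :
    X.hat (w.form v i j) = ∑ p, ∑ q, w.form v p q ⊗ₜ[ℂ] c.inA (antip A (v i p) * v q j)
      + 1 ⊗ₜ[ℂ] c.piEnv (v i j) := by
  rw [form, w.hat_ω, ad_corep hv]
  simp only [map_sum, TensorProduct.map_tmul]
  rfl

/-- The covariant derivative of intertwiners of degree `n`. -/
def nabla (n : ℕ) (v : Matrix ι ι A) (x : ι → Ω) (j : ι) : Ω :=
  X.d (x j) - (-1 : ℂ) ^ n • ∑ k, x k * w.form v k j

lemma nabla_mem {n : ℕ} {x : ι → Ω} (hn : ∀ i, x i ∈ 𝒪 n) (j : ι) :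
    w.nabla n v x j ∈ 𝒪 (n + 1) :=
  sub_mem (X.d_mem n _ (hn j)) (Submodule.smul_mem _ _ (sum_mem fun k _ =>
    SetLike.mul_mem_graded (hn k) (w.ω_mem _)))

/-- In `F̂(d x_j)` the vertical term is `± ∑ x_l ⊗ d v_{lj}`, and `d v = v π(v)`. The inhomogeneous
part `1 ⊗ π(v_{kj})` of `F̂ ω` contributes the same sum through `x_k ω π(v_{kj})`, so it cancels in
the difference; the remaining terms transform by `v`. -/
lemma nabla_mem_bimod (hv : IsCorep v) {n : ℕ} {x : ι → Ω} (hx : x ∈ X.bimod v)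
    (hn : ∀ i, x i ∈ 𝒪 n) : w.nabla n v x ∈ X.bimod v := by
  rw [mem_bimod_iff]
  intro j
  have h1 : X.hat (X.d (x j)) = ∑ k, X.d (x k) ⊗ₜ[ℂ] c.inA (v k j)
      + (-1 : ℂ) ^ n • ∑ l, ∑ k, x l ⊗ₜ[ℂ] (c.inA (v l k) * c.piEnv (v k j)) := by
    rw [hat_d, X.hat_bimod hx]
    simp only [map_sum, TensorProduct.map_tmul, LinearMap.id_apply, c.dEnv_inA,
      parity_of_mem (hn _), ← TensorProduct.tmul_sum, c.sum_inA_mul_piEnv hv, Finset.smul_sum,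
      TensorProduct.smul_tmul']
  have h2 : ∀ k, X.hat (x k * w.form v k j)
      = ∑ l, (∑ p, ∑ q, (x l * w.form v p q) ⊗ₜ[ℂ] c.inA (v l k * antip A (v k p) * v q j)
        + x l ⊗ₜ[ℂ] (c.inA (v l k) * c.piEnv (v k j))) := by
    intro k
    rw [hat_mul, X.hat_bimod hx, w.hat_form hv]
    simp only [map_sum, LinearMap.sum_apply, map_add, gmul_inA, mul_one, ← c.inA_mul, mul_assoc,
      Finset.sum_add_distrib]
    congr 1
    exact (Finset.sum_congr rfl fun p _ => Finset.sum_comm).trans Finset.sum_comm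
  have h3 : ∑ k, X.hat (x k * w.form v k j)
      = ∑ q, (∑ l, x l * w.form v l q) ⊗ₜ[ℂ] c.inA (v q j)
        + ∑ l, ∑ k, x l ⊗ₜ[ℂ] (c.inA (v l k) * c.piEnv (v k j)) := by
    simp only [h2, Finset.sum_add_distrib]
    congr 1
    · rw [Finset.sum_comm]
      have : ∀ l, ∑ k, ∑ p, ∑ q, (x l * w.form v p q) ⊗ₜ[ℂ]
          c.inA (v l k * antip A (v k p) * v q j)
          = ∑ q, (x l * w.form v l q) ⊗ₜ[ℂ] c.inA (v q j) := by
        intro l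
        rw [Finset.sum_comm]
        have h4 : ∀ p, ∑ k, ∑ q, (x l * w.form v p q) ⊗ₜ[ℂ]
            c.inA (v l k * antip A (v k p) * v q j)
            = if l = p then ∑ q, (x l * w.form v p q) ⊗ₜ[ℂ] c.inA (v q j) else 0 := by
          intro p
          rw [Finset.sum_comm]
          simp only [← TensorProduct.tmul_sum, ← map_sum, ← Finset.sum_mul, hv.mul_antip]
          split_ifs <;> simp
        simp [h4]
      simp only [this, TensorProduct.sum_tmul]
      rw [Finset.sum_comm]
    · rw [Finset.sum_comm]
  simp only [nabla, map_sub, map_smul, map_sum, h1, h3, TensorProduct.sub_tmul,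
    Finset.sum_sub_distrib, ← TensorProduct.smul_tmul', smul_add, ← Finset.smul_sum]
  abel

end RegularConnection

variable (X : Calc c P 𝒪)

/-- The components of homogeneous intertwiners. -/
def components : Set Ω :=
  {a | ∃ (ι : Type) (_ : Fintype ι) (_ : DecidableEq ι) (v : Matrix ι ι A) (_ : IsCorep v)
    (x : ι → Ω) (_ : x ∈ X.bimod v) (n : ℕ) (_ : ∀ i, x i ∈ 𝒪 n) (i : ι), a = x i}

/-- The span of the components of homogeneous intertwiners. -/
def compSpan : Submodule ℂ Ω := Submodule.span ℂ X.components

lemma mem_compSpan (hv : IsCorep v) {x : ι → Ω} (hx : x ∈ X.bimod v) {n : ℕ}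
    (hn : ∀ i, x i ∈ 𝒪 n) (i : ι) : x i ∈ X.compSpan :=
  Submodule.subset_span ⟨ι, _, _, v, hv, x, hx, n, hn, i, rfl⟩

lemma compSpan_le_hor : X.compSpan ≤ X.hor := by
  refine Submodule.span_le.2 ?_
  rintro _ ⟨ι, _, _, v, hv, x, hx, n, hn, i, rfl⟩
  exact (hx i).1

lemma compSpan_mul : X.compSpan * X.compSpan ≤ X.compSpan := by
  unfold compSpan
  rw [Submodule.span_mul_span]
  refine Submodule.span_mono ?_
  rintro _ ⟨_, ⟨ι, _, _, v, hv, x, hx, n, hn, i, rfl⟩, _,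
    ⟨ι', _, _, v', hv', x', hx', n', hn', i', rfl⟩, rfl⟩
  exact ⟨ι × ι', inferInstance, inferInstance, _, hv.prod hv', _, X.mul_mem_bimod hx hx', n + n',
    fun p => SetLike.mul_mem_graded (hn _) (hn' _), (i, i'), rfl⟩

lemma j_mem (b : B) : X.j b ∈ 𝒪 0 := by
  rw [← X.j_range]; exact ⟨b, rfl⟩

lemma j_mem_bimod {x : ι → B} (hx : ∀ j, P.F (x j) = ∑ k, x k ⊗ₜ[ℂ] v k j) :
    (fun i => X.j (x i)) ∈ X.bimod v := by
  rw [mem_bimod_iff]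
  intro i
  rw [hat_j, hx]; simp

lemma j_mem_compSpan (b : B) : X.j b ∈ X.compSpan := by
  obtain ⟨n, x, v, hv, hx, hb⟩ := P.exists_corep b
  refine (Submodule.span_le (p := X.compSpan.comap X.j.toLinearMap)).2 ?_ hb
  rintro _ ⟨i, rfl⟩
  exact X.mem_compSpan hv (X.j_mem_bimod hx) (fun i => X.j_mem _) i

namespace RegularConnection

variable {X} (w : X.RegularConnection)

/-- The image of `Γ_inv^∧` in `Ω(P)`. -/
def vert : Submodule ℂ Ω := LinearMap.range w.wedge.toLinearMap

lemma vert_mul : w.vert * w.vert ≤ w.vert := by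
  rw [Submodule.mul_le]
  rintro _ ⟨a, rfl⟩ _ ⟨b, rfl⟩
  exact ⟨a * b, map_mul w.wedge _ _⟩

lemma one_mem_vert : (1 : Ω) ∈ w.vert := ⟨1, map_one w.wedge⟩

lemma ω_mem_vert (θ : c.inv) : w.ω θ ∈ w.vert := ⟨_, w.wedge_ω θ⟩

lemma ω_mul (a : A) {n : ℕ} {x : ι → Ω} (hx : x ∈ X.bimod v) (hn : ∀ i, x i ∈ 𝒪 n) (j : ι) :
    w.ω (c.pi a) * x j = (-1 : ℂ) ^ n • ∑ k, x k *
      w.ω (c.pi (a * v k j - Coalgebra.counit (R := ℂ) a • v k j)) := by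
  rw [w.regular a n _ ⟨(hx j).1, hn j⟩, (hx j).2]
  simp [mulMap]

/-- Regularity moves one connection form to the right of a component of an intertwiner, leaving
components of the same intertwiner; products of connection forms follow by iteration. -/
lemma vert_mul_compSpan : w.vert * X.compSpan ≤ X.compSpan * w.vert := by
  rw [Submodule.mul_le]
  rintro _ ⟨⟨θ, hθ⟩, rfl⟩ s hs
  have hgen : ∀ θ : c.inv, ∀ s ∈ X.compSpan, w.ω θ * s ∈ X.compSpan * w.vert := by
    intro θ s hs
    obtain ⟨_, a, rfl⟩ := θ
    induction hs using Submodule.span_induction with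
    | zero => simp
    | add x y _ _ hx hy => rw [mul_add]; exact add_mem hx hy
    | smul r x _ hx => rw [mul_smul_comm]; exact Submodule.smul_mem _ _ hx
    | mem s hs =>
      obtain ⟨ι, _, _, v, hv, x, hx, n, hn, i, rfl⟩ := hs
      have := w.ω_mul a hx hn i
      refine (congrArg (· ∈ X.compSpan * w.vert) this).mpr ?_
      exact Submodule.smul_mem _ _ (sum_mem fun k _ => Submodule.mul_mem_mul
        (X.mem_compSpan hv hx hn k) (w.ω_mem_vert _))
  induction hθ using Algebra.adjoin_induction generalizing s with
  | mem x hx =>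
    have := hgen ⟨x, hx⟩ s hs
    rwa [← w.wedge_ω] at this
  | algebraMap r =>
    have : w.wedge.toLinearMap ⟨algebraMap ℂ c.Env r, Subalgebra.algebraMap_mem _ r⟩
        = algebraMap ℂ Ω r := w.wedge.commutes r
    rw [this, ← Algebra.smul_def, ← mul_one (r • s)]
    exact Submodule.mul_mem_mul (Submodule.smul_mem _ _ hs) w.one_mem_vert
  | add x y hx hy ihx ihy =>
    have : w.wedge.toLinearMap ⟨x + y, add_mem hx hy⟩
        = w.wedge.toLinearMap ⟨x, hx⟩ + w.wedge.toLinearMap ⟨y, hy⟩ :=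
      map_add w.wedge ⟨x, hx⟩ ⟨y, hy⟩
    rw [this, add_mul]
    exact add_mem (ihx s hs) (ihy s hs)
  | mul x y hx hy ihx ihy =>
    have : w.wedge.toLinearMap ⟨x * y, mul_mem hx hy⟩
        = w.wedge.toLinearMap ⟨x, hx⟩ * w.wedge.toLinearMap ⟨y, hy⟩ :=
      map_mul w.wedge ⟨x, hx⟩ ⟨y, hy⟩
    rw [this, mul_assoc]
    have h1 := ihy s hs
    refine Submodule.mul_induction_on h1 (fun s' hs' l hl => ?_) (fun a b ha hb => ?_)
    · rw [← mul_assoc]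
      have h2 := Submodule.mul_mem_mul (ihx s' hs') hl
      rw [mul_assoc] at h2
      exact mul_le_mul' le_rfl w.vert_mul h2
    · rw [mul_add]; exact add_mem ha hb

/-- By the commutation rule just proved the product is closed under multiplication. It contains `B`,
and also every `db`, since the differential of a component is its covariant derivative plus a
combination of components times connection forms. These elements generate `Ω(P)`. -/
lemma compSpan_mul_vert : X.compSpan * w.vert = ⊤ := by
  have hmul : (X.compSpan * w.vert) * (X.compSpan * w.vert) ≤ X.compSpan * w.vert :=
    calc (X.compSpan * w.vert) * (X.compSpan * w.vert)
        = X.compSpan * (w.vert * X.compSpan) * w.vert := by simp only [mul_assoc]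
      _ ≤ X.compSpan * (X.compSpan * w.vert) * w.vert := by
        exact mul_le_mul' (mul_le_mul' le_rfl w.vert_mul_compSpan) le_rfl
      _ = (X.compSpan * X.compSpan) * (w.vert * w.vert) := by simp only [mul_assoc]
      _ ≤ X.compSpan * w.vert := by
        exact mul_le_mul' X.compSpan_mul w.vert_mul
  have hj : ∀ b, X.j b ∈ X.compSpan * w.vert := fun b => by
    have := Submodule.mul_mem_mul (X.j_mem_compSpan b) w.one_mem_vert
    rwa [mul_one] at this
  have hdj : ∀ b, X.d (X.j b) ∈ X.compSpan * w.vert := by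
    intro b
    obtain ⟨n, x, v, hv, hx, hb⟩ := P.exists_corep b
    refine (Submodule.span_le (p := (X.compSpan * w.vert).comap
      (X.d ∘ₗ X.j.toLinearMap))).2 ?_ hb
    rintro _ ⟨i, rfl⟩
    have hx' := X.j_mem_bimod hx
    have hn : ∀ i, X.j (x i) ∈ 𝒪 0 := fun i => X.j_mem _
    have h : X.d (X.j (x i)) = w.nabla 0 v (fun i => X.j (x i)) i
        + ∑ k, X.j (x k) * w.form v k i := by simp [nabla]
    change X.d (X.j (x i)) ∈ X.compSpan * w.vert
    rw [h]
    refine add_mem ?_ (sum_mem fun k _ => Submodule.mul_mem_mul (X.j_mem_compSpan _)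
      (w.ω_mem_vert _))
    have := Submodule.mul_mem_mul (X.mem_compSpan hv (w.nabla_mem_bimod hv hx' hn)
      (w.nabla_mem hn) i) w.one_mem_vert
    rwa [mul_one] at this
  rw [eq_top_iff]
  intro y _
  have hy : y ∈ Algebra.adjoin ℂ (Set.range X.j ∪ Set.range fun b => X.d (X.j b)) :=
    X.generated ▸ Algebra.mem_top
  induction hy using Algebra.adjoin_induction with
  | mem x hx => rcases hx with ⟨b, rfl⟩ | ⟨b, rfl⟩ <;> simp only [hj, hdj]
  | algebraMap r =>
    have := Submodule.smul_mem _ r (hj 1)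
    rwa [map_one, ← Algebra.algebraMap_eq_smul_one] at this
  | add x y _ _ hx hy => exact add_mem (hx trivial) (hy trivial)
  | mul x y _ _ hx hy => exact hmul (Submodule.mul_mem_mul (hx trivial) (hy trivial))

lemma m_tmul (φ : X.hor) (θ : c.invWedge) : w.m (φ ⊗ₜ θ) = φ * w.wedge θ := rfl

lemma m_surjective : Function.Surjective w.m := by
  intro y
  have hy : y ∈ X.compSpan * w.vert := w.compSpan_mul_vert ▸ Submodule.mem_top
  refine Submodule.mul_induction_on hy ?_ ?_
  · rintro s hs _ ⟨θ, rfl⟩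
    exact ⟨⟨s, X.compSpan_le_hor hs⟩ ⊗ₜ θ, rfl⟩
  · rintro _ _ ⟨s, rfl⟩ ⟨t, rfl⟩
    exact ⟨s + t, map_add _ _ _⟩

end RegularConnection

end

end Calc

end Bundles
end QPB

namespace QPB

section Bundles

open FODC

variable {A Γ : Type*} [Ring A] [HopfAlgebra ℂ A] [StarRing A] [StarModule ℂ A]
    [AddCommGroup Γ] [Module ℂ Γ] [Module A Γ] [Module Aᵐᵒᵖ Γ] [SMulCommClass A Aᵐᵒᵖ Γ]
    [IsScalarTower ℂ A Γ] [IsScalarTower ℂ Aᵐᵒᵖ Γ]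

/-! ### Homogeneous components in a graded algebra. -/

section Graded

variable {E : Type*} [Ring E] [Algebra ℂ E] (𝒢 : ℕ → Submodule ℂ E) [GradedAlgebra 𝒢]

/-- The component of degree `n`. -/
abbrev gpr (n : ℕ) : E →ₗ[ℂ] E := GradedAlgebra.proj 𝒢 n

lemma gpr_mem (n : ℕ) (x : E) : gpr 𝒢 n x ∈ 𝒢 n := SetLike.coe_mem _

variable {𝒢}

lemma gpr_same {n : ℕ} {x : E} (hx : x ∈ 𝒢 n) : gpr 𝒢 n x = x :=
  DirectSum.decompose_of_mem_same 𝒢 hx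

lemma gpr_ne {n m : ℕ} {x : E} (hx : x ∈ 𝒢 n) (h : n ≠ m) : gpr 𝒢 m x = 0 :=
  DirectSum.decompose_of_mem_ne 𝒢 hx h

lemma gpr_mul_right (m : ℕ) {i : ℕ} (a : E) {b : E} (hb : b ∈ 𝒢 i) :
    gpr 𝒢 (m + i) (a * b) = gpr 𝒢 m a * b :=
  DirectSum.coe_decompose_mul_add_of_right_mem 𝒢 hb

lemma gpr_mul_left (m : ℕ) {i : ℕ} {a : E} (ha : a ∈ 𝒢 i) (b : E) :
    gpr 𝒢 (i + m) (a * b) = a * gpr 𝒢 m b :=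
  DirectSum.coe_decompose_mul_add_of_left_mem 𝒢 ha

lemma gpr_comp (m n : ℕ) (x : E) : gpr 𝒢 m (gpr 𝒢 n x) = if n = m then gpr 𝒢 n x else 0 := by
  split_ifs with h
  · subst h; exact gpr_same (gpr_mem 𝒢 n x)
  · exact gpr_ne (gpr_mem 𝒢 n x) h

variable (𝒢) in
lemma exists_gpr_bound (x : E) : ∃ N, ∀ n, N ≤ n → gpr 𝒢 n x = 0 := by
  classical
  refine ⟨(DirectSum.decompose 𝒢 x).support.sup id + 1, fun n hn => ?_⟩
  have : n ∉ (DirectSum.decompose 𝒢 x).support := fun h => by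
    have := Finset.le_sup (f := id) h
    simp at this; omega
  simpa using this

lemma sum_gpr {x : E} {N : ℕ} (hN : ∀ n, N ≤ n → gpr 𝒢 n x = 0) :
    ∑ n ∈ Finset.range N, gpr 𝒢 n x = x := by
  classical
  conv_rhs => rw [← DirectSum.sum_support_decompose 𝒢 x]
  symm
  refine Finset.sum_subset (fun n hn => ?_) (fun n _ hn => by simpa using hn)
  rw [Finset.mem_range]
  by_contra h
  have := hN n (not_lt.1 h)
  simp at hn this
  exact hn this

variable (𝒢) in
lemma exists_sum_gpr (x : E) : ∃ N, ∑ n ∈ Finset.range N, gpr 𝒢 n x = x := by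
  obtain ⟨N, hN⟩ := exists_gpr_bound 𝒢 x
  exact ⟨N, sum_gpr hN⟩

end Graded

variable {B Ω : Type*} [Ring B] [Algebra ℂ B] [StarRing B] [StarModule ℂ B]
  [Ring Ω] [Algebra ℂ Ω]

namespace Calc

variable {c : FODC A Γ} {P : Bundle A B} {𝒪 : ℕ → Submodule ℂ Ω} [GradedAlgebra 𝒪]

/-! ### Injectivity of the decomposition map -/

variable (c) in
/-- The component of `Ω(P) ⊗ Γ^∧` of degree `m` in the second factor. -/
def vpr (m : ℕ) : Ω ⊗[ℂ] c.Env →ₗ[ℂ] Ω ⊗[ℂ] c.Env := (gpr c.grading m).lTensor Ω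

lemma vpr_gmul_right (m : ℕ) {i : ℕ} (t : Ω ⊗[ℂ] c.Env) (y : Ω) {b : c.Env}
    (hb : b ∈ c.grading i) :
    vpr c (m + i) (gmul c 𝒪 t (y ⊗ₜ b)) = gmul c 𝒪 (vpr c m t) (y ⊗ₜ b) := by
  induction t with
  | zero => simp
  | add t t' h h' => simp only [map_add, LinearMap.add_apply, h, h']
  | tmul x a =>
    induction y using DirectSum.Decomposition.inductionOn 𝒪 with
    | zero => simp
    | add y y' hy hy' => simp only [TensorProduct.add_tmul, map_add, hy, hy']
    | homogeneous y =>
      induction a using DirectSum.Decomposition.inductionOn c.grading with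
      | zero => simp
      | add y y' hy hy' =>
        simp only [TensorProduct.tmul_add, map_add, hy, hy', LinearMap.add_apply]
      | @homogeneous k a =>
        rw [gmul_tmul x a.2 y.2, map_smul]
        simp only [vpr, LinearMap.lTensor_tmul]
        rw [gpr_mul_right m _ hb]
        rcases eq_or_ne k m with rfl | hk
        · rw [gpr_same a.2, gmul_tmul x a.2 y.2]
        · rw [gpr_ne a.2 hk]; simp

lemma vpr_gmul_inA (m : ℕ) (x : Ω) (a : A) (t : Ω ⊗[ℂ] c.Env) :
    vpr c m (gmul c 𝒪 (x ⊗ₜ c.inA a) t) = gmul c 𝒪 (x ⊗ₜ c.inA a) (vpr c m t) := by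
  induction t with
  | zero => simp
  | add t t' h h' => simp only [map_add, h, h']
  | tmul y b =>
    rw [gmul_inA]
    simp only [vpr, LinearMap.lTensor_tmul]
    rw [gmul_inA, ← gpr_mul_left m (c.inA_mem a) b, zero_add]

lemma inv_pow_le_grading (n : ℕ) : c.inv ^ n ≤ c.grading n := by
  induction n with
  | zero =>
    rw [pow_zero, Submodule.one_le]; exact SetLike.GradedOne.one_mem
  | succ n ih =>
    rw [pow_succ, Submodule.mul_le]
    rintro a ha _ ⟨b, rfl⟩
    exact SetLike.mul_mem_graded (ih ha) (c.piEnv_mem b)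

lemma inv_pow_le_invWedge (n : ℕ) : c.inv ^ n ≤ Subalgebra.toSubmodule c.invWedge := by
  induction n with
  | zero => rw [pow_zero, Submodule.one_le]; exact one_mem c.invWedge
  | succ n ih =>
    rw [pow_succ, Submodule.mul_le]
    exact fun a ha b hb => mul_mem (S := Subalgebra ℂ c.Env) (ih ha) (Algebra.subset_adjoin hb)

lemma invWedge_le : Subalgebra.toSubmodule c.invWedge ≤ ⨆ n, c.inv ^ n := by
  intro x hx
  have hx' : x ∈ Algebra.adjoin ℂ (c.inv : Set c.Env) := hx
  clear hx
  induction hx' using Algebra.adjoin_induction with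
  | mem x hx => exact Submodule.mem_iSup_of_mem 1 (by rwa [pow_one])
  | algebraMap r =>
    refine Submodule.mem_iSup_of_mem 0 ?_
    rw [pow_zero]; exact Submodule.algebraMap_mem r
  | add x y _ _ hx hy => exact add_mem hx hy
  | mul x y _ _ hx hy =>
    have : (⨆ n, c.inv ^ n) * (⨆ n, c.inv ^ n) ≤ ⨆ n, c.inv ^ n := by
      rw [Submodule.iSup_mul]
      refine iSup_le fun i => ?_
      rw [Submodule.mul_iSup]
      refine iSup_le fun j => ?_
      rw [← pow_add]
      exact le_iSup (fun n => c.inv ^ n) (i + j)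
    exact this (Submodule.mul_mem_mul hx hy)

lemma gpr_mem_inv_pow (n : ℕ) {x : c.Env} (hx : x ∈ c.invWedge) :
    gpr c.grading n x ∈ c.inv ^ n := by
  have h := invWedge_le hx
  refine Submodule.iSup_induction _ (motive := fun x => gpr c.grading n x ∈ c.inv ^ n) h
    (fun i x hx => ?_) (by simp) (fun x y hx hy => by rw [map_add]; exact add_mem hx hy)
  rcases eq_or_ne i n with rfl | hi
  · rwa [gpr_same (inv_pow_le_grading _ hx)]
  · rw [gpr_ne (inv_pow_le_grading _ hx) hi]; exact zero_mem _

variable (c) in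
/-- The homogeneous components of left-invariant forms. -/
def invPr (n : ℕ) : c.invWedge →ₗ[ℂ] c.invWedge :=
  (gpr c.grading n ∘ₗ c.invWedge.val.toLinearMap).codRestrict (Subalgebra.toSubmodule c.invWedge)
    fun x => inv_pow_le_invWedge n (gpr_mem_inv_pow n x.2)

lemma coe_invPr (n : ℕ) (θ : c.invWedge) : (invPr c n θ : c.Env) = gpr c.grading n θ := rfl

namespace RegularConnection

variable {X : Calc c P 𝒪} (w : X.RegularConnection)

/-- `F̂ ω(ϑ)` is a term of vertical degree `0` plus `1 ⊗ ϑ`. In a product of `n` such factors the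
top vertical degree `n` is reached only by taking the second term each time, and nothing lies above
it. -/
lemma vpr_hat_wedge (n : ℕ) (θ : c.invWedge) (hθ : (θ : c.Env) ∈ c.inv ^ n) (m : ℕ)
    (hm : n ≤ m) : vpr c m (X.hat (w.wedge θ)) = 1 ⊗ₜ gpr c.grading m (θ : c.Env) := by
  obtain ⟨θ, hθ'⟩ := θ
  simp only at hθ ⊢
  induction n generalizing θ m with
  | zero =>
    rw [pow_zero, Submodule.mem_one] at hθ
    obtain ⟨r, rfl⟩ := hθ
    have : w.wedge ⟨algebraMap ℂ c.Env r, hθ'⟩ = r • 1 := by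
      rw [← Algebra.algebraMap_eq_smul_one]
      exact w.wedge.commutes r
    rw [this, map_smul, hat_one, Algebra.algebraMap_eq_smul_one]
    simp [vpr]
  | succ n ih =>
    rw [pow_succ] at hθ
    obtain ⟨m, rfl⟩ : ∃ k, m = k + 1 := ⟨m - 1, by omega⟩
    have hle : c.inv ^ n * c.inv ≤ Subalgebra.toSubmodule c.invWedge := by
      rw [← pow_succ]; exact inv_pow_le_invWedge _
    induction hθ using Submodule.mul_induction_on' with
    | mem_mul_mem x hx y hy =>
      obtain ⟨a, rfl⟩ := hy
      have h1 : w.wedge ⟨x * c.piEnv a, hθ'⟩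
          = w.wedge ⟨x, inv_pow_le_invWedge n hx⟩ * w.ω (c.pi a) := by
        rw [← w.wedge_ω, ← map_mul]; rfl
      have ihm := ih m (by omega) x (inv_pow_le_invWedge n hx) hx
      have ihm' := ih (m + 1) (by omega) x (inv_pow_le_invWedge n hx) hx
      rw [h1, hat_mul, w.hat_ω, map_add, map_add]
      have h2 : ∀ s : A ⊗[ℂ] A, vpr c (m + 1) (gmul c 𝒪 (X.hat (w.wedge
          ⟨x, inv_pow_le_invWedge n hx⟩)) (TensorProduct.map (w.ω ∘ₗ c.pi) c.inA s)) = 0 := by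
        intro s
        induction s with
        | zero => simp
        | add s s' h h' => simp only [map_add, h, h', add_zero]
        | tmul p q =>
          rw [TensorProduct.map_tmul]
          have := vpr_gmul_right (𝒪 := 𝒪) (m + 1) (X.hat (w.wedge
            ⟨x, inv_pow_le_invWedge n hx⟩)) ((w.ω ∘ₗ c.pi) p) (c.inA_mem q)
          rw [add_zero, ihm', gpr_ne (inv_pow_le_grading _ hx) (by omega)] at this
          simpa using this
      rw [h2, zero_add]
      have h3 := vpr_gmul_right (𝒪 := 𝒪) m (X.hat (w.wedge
            ⟨x, inv_pow_le_invWedge n hx⟩)) 1 (c.piEnv_mem a)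
      refine h3.trans ?_
      rw [ihm, gmul_one_right, ← gpr_mul_right m x (c.piEnv_mem a)]
    | add x hx y hy ihx ihy =>
      have h1 : w.wedge ⟨x + y, hθ'⟩ = w.wedge ⟨x, hle hx⟩ + w.wedge ⟨y, hle hy⟩ := by
        rw [← map_add]; rfl
      rw [h1, map_add, map_add, ihx (hle hx), ihy (hle hy), map_add, TensorProduct.tmul_add]

variable [IsCompactMatrixQuantumGroup A]

/-- In vertical degree `N` the image of `φ ω^∧(ϑ)` is `φ₍₀₎ ⊗ φ₍₁₎ ϑ_N`. Removing `φ₍₁₎` by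
`invProj` and applying the counit axiom recovers `φ ⊗ ϑ_N`, with no contribution from lower `n`. -/
lemma invProj_hat {N n : ℕ} (hn : n ≤ N) (φ : X.hor) (θ : c.invWedge) :
    c.invProj.lTensor Ω (vpr c N (X.hat (w.m (φ ⊗ₜ invPr c n θ))))
      = if n = N then (φ : Ω) ⊗ₜ (invPr c n θ : c.Env) else 0 := by
  have h := w.vpr_hat_wedge n (invPr c n θ) (gpr_mem_inv_pow n θ.2) N hn
  rw [w.m_tmul, hat_mul, X.hat_of_mem_hor φ.2]
  have key : ∀ t : Ω ⊗[ℂ] A, c.invProj.lTensor Ω (vpr c N (gmul c 𝒪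
      (TensorProduct.map LinearMap.id c.inA t) (X.hat (w.wedge (invPr c n θ)))))
      = (TensorProduct.rid ℂ Ω ((Coalgebra.counit (R := ℂ) (A := A)).lTensor Ω t)) ⊗ₜ
          gpr c.grading N (invPr c n θ : c.Env) := by
    intro t
    induction t with
    | zero => simp
    | add s s' h h' => simp only [map_add, LinearMap.add_apply, h, h', TensorProduct.add_tmul]
    | tmul x a =>
      rw [TensorProduct.map_tmul, vpr_gmul_inA, h]
      simp only [LinearMap.id_apply]
      rw [gmul_inA, LinearMap.lTensor_tmul, c.invProj_mul
        (inv_pow_le_invWedge N (gpr_mem_inv_pow N (invPr c n θ).2))]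
      simp [TensorProduct.smul_tmul]
  rw [key, act_counit, coe_invPr, gpr_comp]
  split_ifs <;> simp

/-- An element of the kernel has finitely many vertical components, and the leading one can be read
off from its image, so it vanishes. -/
lemma m_injective : Function.Injective w.m := by
  rw [injective_iff_map_eq_zero]
  intro T hT
  have hbound : ∀ T : X.hor ⊗[ℂ] c.invWedge, ∃ N, (∀ n, N ≤ n → (invPr c n).lTensor X.hor T = 0) ∧
      ∑ n ∈ Finset.range N, (invPr c n).lTensor X.hor T = T := by
    have hs : ∀ T : X.hor ⊗[ℂ] c.invWedge, ∀ N M,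
        (∀ n, N ≤ n → (invPr c n).lTensor X.hor T = 0) → N ≤ M →
        ∑ n ∈ Finset.range M, (invPr c n).lTensor X.hor T
          = ∑ n ∈ Finset.range N, (invPr c n).lTensor X.hor T := by
      intro T N M h hNM
      symm
      refine Finset.sum_subset (Finset.range_mono hNM) (fun n _ hn => h n ?_)
      simpa using hn
    intro T
    induction T with
    | zero => exact ⟨0, by simp, by simp⟩
    | add s t hs' ht' =>
      obtain ⟨N, h1, h2⟩ := hs'
      obtain ⟨M, h3, h4⟩ := ht'
      refine ⟨max N M, fun n hn => ?_, ?_⟩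
      · rw [map_add, h1 n (le_trans (le_max_left _ _) hn), h3 n (le_trans (le_max_right _ _) hn),
          add_zero]
      · simp only [map_add, Finset.sum_add_distrib]
        rw [hs s N _ h1 (le_max_left _ _), hs t M _ h3 (le_max_right _ _), h2, h4]
    | tmul φ θ =>
      obtain ⟨N, hN⟩ := exists_gpr_bound c.grading (θ : c.Env)
      refine ⟨N, fun n hn => ?_, ?_⟩
      · have : invPr c n θ = 0 := Subtype.ext (hN n hn)
        simp [this]
      · simp only [LinearMap.lTensor_tmul, ← TensorProduct.tmul_sum]
        congr 1
        refine Subtype.ext ?_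
        rw [← c.invWedge.coe_val, map_sum]
        exact sum_gpr hN
  obtain ⟨N, hN, hsum⟩ := hbound T
  -- Over a field the inclusions stay injective after tensoring, so vanishing may be tested in `Ω(P)
  -- ⊗ Γ^∧`.
  have hinj : Function.Injective (TensorProduct.map X.hor.subtype
      c.invWedge.val.toLinearMap) :=
    TensorProduct.map_injective_of_flat_flat _ _ X.hor.injective_subtype Subtype.val_injective
  have key : ∀ N n, n ≤ N → ∀ T : X.hor ⊗[ℂ] c.invWedge,
      c.invProj.lTensor Ω (vpr c N (X.hat (w.m ((invPr c n).lTensor X.hor T))))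
        = if n = N then TensorProduct.map X.hor.subtype c.invWedge.val.toLinearMap
            ((invPr c n).lTensor X.hor T) else 0 := by
    intro N n hn T
    induction T with
    | zero => simp
    | add s t hs ht => simp only [map_add, hs, ht]; split_ifs <;> simp
    | tmul φ θ => exact w.invProj_hat hn φ θ
  clear hsum
  -- Descending induction: the bound `N` on the vertical degrees occurring in `T` is lowered by one
  -- each time.
  induction N with
  | zero =>
    obtain ⟨M, _, hM⟩ := hbound T
    rw [← hM]
    exact Finset.sum_eq_zero fun n _ => hN n (Nat.zero_le n)
  | succ N ih =>
    refine ih fun n hn => ?_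
    rcases Nat.lt_or_ge N n with h | h
    · exact hN n h
    obtain rfl : n = N := le_antisymm h hn
    obtain ⟨M, hM0, hM⟩ := hbound T
    have hT' : T = ∑ k ∈ Finset.range (n + 1), (invPr c k).lTensor X.hor T := by
      conv_lhs => rw [← hM]
      rcases le_total M (n + 1) with h' | h'
      · exact Finset.sum_subset (Finset.range_mono h') fun k _ hk => hM0 k (by simpa using hk)
      · exact (Finset.sum_subset (Finset.range_mono h') fun k _ hk =>
          hN k (by simpa using hk)).symm
    have h1 : c.invProj.lTensor Ω (vpr c n (X.hat (w.m T)))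
        = TensorProduct.map X.hor.subtype c.invWedge.val.toLinearMap
            ((invPr c n).lTensor X.hor T) := by
      conv_lhs => rw [hT']
      simp only [map_sum]
      rw [Finset.sum_eq_single n]
      · rw [key n n le_rfl T, if_pos rfl]
      · intro k hk hkn
        rw [key n k (by simpa [Nat.lt_succ_iff] using hk) T, if_neg hkn]
      · simp
    rw [hT, map_zero, map_zero, map_zero] at h1
    exact hinj (by rw [← h1, map_zero])

lemma m_bijective : Function.Bijective w.m := ⟨w.m_injective, w.m_surjective⟩

lemma h_mul_wedge {φ : Ω} (hφ : φ ∈ X.hor) (θ : c.invWedge) :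
    w.h (φ * w.wedge θ) = Coalgebra.counit (R := ℂ) (c.proj (θ : c.Env)) • φ := by
  have h1 : (LinearEquiv.ofBijective w.m w.m_bijective).symm (φ * w.wedge θ)
      = (⟨φ, hφ⟩ : X.hor) ⊗ₜ θ := by
    rw [LinearEquiv.symm_apply_eq]; rfl
  rw [h, dif_pos w.m_bijective, LinearMap.comp_apply, LinearEquiv.coe_coe, h1]
  simp

lemma h_of_mem_hor {φ : Ω} (hφ : φ ∈ X.hor) : w.h φ = φ := by
  have := w.h_mul_wedge hφ 1
  simpa using this

lemma h_mul_wedge_inv {φ : Ω} (hφ : φ ∈ X.hor) {n : ℕ} (hn : n ≠ 0) (θ : c.invWedge)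
    (hθ : (θ : c.Env) ∈ c.grading n) : w.h (φ * w.wedge θ) = 0 := by
  rw [w.h_mul_wedge hφ, c.proj_grading hn hθ]; simp

lemma h_mul_ω {φ : Ω} (hφ : φ ∈ X.hor) (a : A) : w.h (φ * w.ω (c.pi a)) = 0 := by
  rw [← w.wedge_ω]
  exact w.h_mul_wedge_inv hφ one_ne_zero _ (c.piEnv_mem a)

/-- This is where multiplicativity enters: the product is `ω^∧` of an element of degree two, which
the horizontal projection kills. Without it the product would not be controlled by `m_ω`. -/
lemma h_ω_mul_ω (a b : A) : w.h (w.ω (c.pi a) * w.ω (c.pi b)) = 0 := by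
  have hm : c.piEnv a * c.piEnv b ∈ c.grading (1 + 1) :=
    SetLike.mul_mem_graded (c.piEnv_mem a) (c.piEnv_mem b)
  have hw : c.piEnv a * c.piEnv b ∈ c.invWedge :=
    mul_mem (Algebra.subset_adjoin (c.pi a).2) (Algebra.subset_adjoin (c.pi b).2)
  have h1 : w.ω (c.pi a) * w.ω (c.pi b) = w.wedge ⟨c.piEnv a * c.piEnv b, hw⟩ := by
    rw [← w.wedge_ω, ← w.wedge_ω, ← map_mul]; rfl
  rw [h1, ← one_mul (w.wedge _)]
  exact w.h_mul_wedge_inv X.one_mem_hor (by omega) _ hm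

/-- The horizontal forms are the combinations of components of homogeneous intertwiners. -/
lemma hor_le_compSpan (w : X.RegularConnection) : X.hor ≤ X.compSpan := by
  intro φ hφ
  have h1 : φ ∈ X.compSpan * w.vert := w.compSpan_mul_vert ▸ Submodule.mem_top
  -- The horizontal projection fixes `φ`, and it sends each `s ω^∧(ϑ)` in a decomposition of `φ` to
  -- a scalar multiple of `s`.
  rw [← w.h_of_mem_hor hφ]
  refine Submodule.mul_induction_on h1 ?_ ?_
  · rintro s hs _ ⟨θ, rfl⟩
    have := w.h_mul_wedge (X.compSpan_le_hor hs) θ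
    refine (congrArg (· ∈ X.compSpan) this).mpr (Submodule.smul_mem _ _ hs)
  · intro x y hx hy
    rw [map_add]; exact add_mem hx hy

end RegularConnection

end Calc

end Bundles
end QPB

namespace QPB

section Bundles

open FODC

variable {A Γ : Type*} [Ring A] [HopfAlgebra ℂ A] [StarRing A] [StarModule ℂ A]
    [AddCommGroup Γ] [Module ℂ Γ] [Module A Γ] [Module Aᵐᵒᵖ Γ] [SMulCommClass A Aᵐᵒᵖ Γ]
    [IsScalarTower ℂ A Γ] [IsScalarTower ℂ Aᵐᵒᵖ Γ]

variable {B Ω : Type*} [Ring B] [Algebra ℂ B] [StarRing B] [StarModule ℂ B]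
  [Ring Ω] [Algebra ℂ Ω]

namespace Calc

variable {c : FODC A Γ} {P : Bundle A B} {𝒪 : ℕ → Submodule ℂ Ω} [GradedAlgebra 𝒪]

/-! ### The covariant derivative -/

namespace RegularConnection

variable {X : Calc c P 𝒪} (w : X.RegularConnection) [IsCompactMatrixQuantumGroup A]

section
variable {ι ι' : Type} [Fintype ι] [DecidableEq ι] [Fintype ι'] [DecidableEq ι']
  {v : Matrix ι ι A} {v' : Matrix ι' ι' A}

include w in
/-- Linear statements about horizontal forms can be checked on components of homogeneous
intertwiners. -/
lemma hor_ext {M : Type*} [AddCommGroup M] [Module ℂ M] {f g : Ω →ₗ[ℂ] M}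
    (h : ∀ (ι : Type) [Fintype ι] [DecidableEq ι] (v : Matrix ι ι A), IsCorep v →
      ∀ x ∈ X.bimod v, ∀ n, (∀ i, x i ∈ 𝒪 n) → ∀ i, f (x i) = g (x i)) {φ : Ω} (hφ : φ ∈ X.hor) :
    f φ = g φ := by
  have h1 : X.compSpan ≤ LinearMap.eqLocus f g := by
    refine Submodule.span_le.2 ?_
    rintro _ ⟨ι, _, _, v, hv, x, hx, n, hn, i, rfl⟩
    exact h ι v hv x hx n hn i
  exact h1 (w.hor_le_compSpan hφ)

/-- The differential differs from `nabla` by terms `x_k ω(ϑ)`, killed by the horizontal projection,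
while `nabla` is already horizontal. This gives `D` a formula without `m_ω⁻¹`. -/
lemma D_nabla (hv : IsCorep v) {n : ℕ} {x : ι → Ω} (hx : x ∈ X.bimod v)
    (hn : ∀ i, x i ∈ 𝒪 n) (j : ι) : w.D (x j) = w.nabla n v x j := by
  have h1 : X.d (x j) = w.nabla n v x j + (-1 : ℂ) ^ n • ∑ k, x k * w.form v k j := by
    simp [nabla]
  have h2 : ∀ k, w.h (x k * w.form v k j) = 0 := fun k => w.h_mul_ω (hx k).1 _
  rw [D, LinearMap.comp_apply, h1, map_add, map_smul, map_sum,
    w.h_of_mem_hor (w.nabla_mem_bimod hv hx hn j).1]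
  simp [h2]

include w in
-- On homogeneous intertwiners the action only introduces coefficients from `A`, so it respects
-- degrees. Consequently homogeneous components of horizontal forms, intertwiners and base forms are
-- again of the same kind.
lemma act_gpr (n : ℕ) {φ : Ω} (hφ : φ ∈ X.hor) :
    X.hat (gpr 𝒪 n φ) = TensorProduct.map (gpr 𝒪 n) c.inA (X.act φ) := by
  refine w.hor_ext (f := X.hat ∘ₗ gpr 𝒪 n)
    (g := TensorProduct.map (gpr 𝒪 n) c.inA ∘ₗ X.act) ?_ hφ
  intro ι _ _ v hv x hx m hm i
  simp only [LinearMap.comp_apply, (hx i).2, map_sum, TensorProduct.map_tmul]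
  rcases eq_or_ne m n with rfl | h
  · simp only [gpr_same (hm _)]; exact X.hat_bimod hx i
  · simp only [gpr_ne (hm _) h]; simp

include w in
lemma gpr_mem_bimod (n : ℕ) {x : ι → Ω} (hx : x ∈ X.bimod v) :
    (fun i => gpr 𝒪 n (x i)) ∈ X.bimod v := by
  rw [mem_bimod_iff]
  intro i
  rw [w.act_gpr n (hx i).1, (hx i).2]; simp

include w in
lemma gpr_mem_base (n : ℕ) {α : Ω} (hα : α ∈ X.base) : gpr 𝒪 n α ∈ X.base := by
  rw [mem_base_iff, w.act_gpr n (X.base_le_hor hα), (X.mem_base_iff'.1 hα).2]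
  simp [c.inA_one]

lemma hat_D {φ : Ω} (hφ : φ ∈ X.hor) :
    X.hat (w.D φ) = TensorProduct.map w.D c.inA (X.act φ) := by
  refine w.hor_ext (f := X.hat ∘ₗ w.D) (g := TensorProduct.map w.D c.inA ∘ₗ X.act) ?_ hφ
  intro ι _ _ v hv x hx m hm i
  simp only [LinearMap.comp_apply, (hx i).2, map_sum, TensorProduct.map_tmul,
    w.D_nabla hv hx hm]
  exact X.hat_bimod (w.nabla_mem_bimod hv hx hm) i

lemma D_mem_bimod {x : ι → Ω} (hx : x ∈ X.bimod v) : (fun i => w.D (x i)) ∈ X.bimod v := by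
  rw [mem_bimod_iff]
  intro i
  rw [w.hat_D (hx i).1, (hx i).2]; simp

lemma D_mem_hor {φ : Ω} (hφ : φ ∈ X.hor) : w.D φ ∈ X.hor := by
  refine ⟨TensorProduct.map w.D LinearMap.id (X.act φ), ?_⟩
  rw [w.hat_D hφ]
  induction X.act φ with
  | zero => simp
  | add s t hs ht => simp only [map_add, hs, ht]
  | tmul x a => simp

lemma D_mem {n : ℕ} {φ : Ω} (hφ : φ ∈ X.hor) (hn : φ ∈ 𝒪 n) : w.D φ ∈ 𝒪 (n + 1) := by
  have h : gpr 𝒪 (n + 1) (w.D φ) = w.D (gpr 𝒪 n φ) := by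
    refine w.hor_ext (f := gpr 𝒪 (n + 1) ∘ₗ w.D) (g := w.D ∘ₗ gpr 𝒪 n) ?_ hφ
    intro ι _ _ v hv x hx m hm i
    simp only [LinearMap.comp_apply, w.D_nabla hv hx hm]
    have h1 := w.nabla_mem (v := v) hm i
    rcases eq_or_ne m n with rfl | h
    · rw [gpr_same h1, gpr_same (hm i), w.D_nabla hv hx hm]
    · rw [gpr_ne h1 (by omega), gpr_ne (hm i) h, map_zero]
  rw [gpr_same hn] at h
  rw [← h]; exact gpr_mem 𝒪 _ _

/-- The covariant derivative is an antiderivation on horizontal forms. -/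
lemma D_mul_parity {φ ψ : Ω} (hφ : φ ∈ X.hor) (hψ : ψ ∈ X.hor) :
    w.D (φ * ψ) = w.D φ * ψ + parity 𝒪 φ * w.D ψ := by
  refine w.hor_ext (f := w.D ∘ₗ LinearMap.mulRight ℂ ψ)
    (g := LinearMap.mulRight ℂ ψ ∘ₗ w.D + LinearMap.mulRight ℂ (w.D ψ) ∘ₗ parity 𝒪) ?_ hφ
  intro ι _ _ v hv x hx n hn i
  refine w.hor_ext (f := w.D ∘ₗ LinearMap.mulLeft ℂ (x i))
    (g := LinearMap.mulLeft ℂ (w.D (x i)) + LinearMap.mulLeft ℂ (parity 𝒪 (x i)) ∘ₗ w.D) ?_ hψ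
  intro ι' _ _ v' hv' y hy m hm j
  simp only [LinearMap.comp_apply, LinearMap.add_apply, LinearMap.mulLeft_apply]
  have hxy := X.mul_mem_bimod hx hy
  have hnm : ∀ p : ι × ι', x p.1 * y p.2 ∈ 𝒪 (n + m) :=
    fun p => SetLike.mul_mem_graded (hn _) (hm _)
  rw [w.D_nabla (hv.prod hv') hxy hnm (i, j), w.D_nabla hv hx hn, w.D_nabla hv' hy hm,
    parity_of_mem (hn i)]
  -- The identity `π(a b) = π(a) ∘ b + ε(a) π(b)` splits the connection matrix of a product;
  -- regularity (`h2`) then moves the first part in front of `y`.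
  have h1 : ∀ k l, w.form (prodMat v v') (k, l) (i, j)
      = w.ω (c.pi (v k i * v' l j - Coalgebra.counit (R := ℂ) (v k i) • v' l j))
        + (if k = i then (1 : ℂ) else 0) • w.form v' l j := by
    intro k l
    rw [map_sub, map_sub, map_smul, map_smul, hv.counit]
    simp [form, prodMat]
  have h2 : ∀ k, ∑ l, y l * w.ω (c.pi (v k i * v' l j - Coalgebra.counit (R := ℂ) (v k i) • v' l j))
      = (-1 : ℂ) ^ m • (w.form v k i * y j) := by
    intro k
    rw [form, w.ω_mul (v k i) hy hm j, smul_smul, ← mul_pow]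
    simp
  have h3 : ∑ p : ι × ι', x p.1 * y p.2 * w.form (prodMat v v') p (i, j)
      = (-1 : ℂ) ^ m • (∑ k, x k * (w.form v k i * y j))
        + x i * ∑ l, y l * w.form v' l j := by
    rw [Fintype.sum_prod_type]
    simp only [h1, mul_add, Finset.sum_add_distrib, mul_assoc, ← Finset.mul_sum, h2]
    congr 1
    · simp [Finset.smul_sum]
    · rw [Finset.sum_eq_single i]
      · simp
      · intro k _ hk; simp [hk]
      · simp
  simp only [nabla, h3, X.d_mul n _ (hn i)]
  simp only [mul_sub, sub_mul, smul_add, smul_smul, Finset.mul_sum, Finset.sum_mul,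
    mul_smul_comm, smul_mul_assoc, mul_assoc, Finset.smul_sum]
  have h4 : ((-1 : ℂ) ^ (n + m) * (-1) ^ m) = (-1) ^ n := by
    rw [pow_add, mul_assoc, ← mul_pow]; simp
  rw [h4, pow_add, mul_comm ((-1 : ℂ) ^ m) ((-1) ^ n)]
  abel

lemma D_mul {φ ψ : Ω} {n : ℕ} (hφ : φ ∈ X.hor) (hn : φ ∈ 𝒪 n) (hψ : ψ ∈ X.hor) :
    w.D (φ * ψ) = w.D φ * ψ + (-1 : ℂ) ^ n • (φ * w.D ψ) := by
  rw [w.D_mul_parity hφ hψ, parity_of_mem hn, smul_mul_assoc]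

lemma pi_one : c.pi (1 : A) = 0 := by
  refine Subtype.ext ?_
  change c.piEnv 1 = 0
  simp [piEnv, Bialgebra.comul_one, Algebra.TensorProduct.one_def, mulMap, c.d_one]

/-- On the base the covariant derivative is the differential. -/
lemma D_base {α : Ω} (hα : α ∈ X.base) : w.D α = X.d α := by
  have hom : ∀ n, ∀ α ∈ X.base, α ∈ 𝒪 n → w.D α = X.d α := by
    intro n α hα hn
    -- Forms on the base are intertwiners of the trivial corepresentation, whose connection matrix
    -- is `ω π(1) = 0`.
    have hv : IsCorep (1 : Matrix Unit Unit A) :=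
      ⟨by simp [Algebra.TensorProduct.one_def], by simp⟩
    have hx : (fun _ : Unit => α) ∈ X.bimod (1 : Matrix Unit Unit A) := by
      rw [mem_bimod_iff]
      intro i
      rw [X.mem_base_iff.1 hα]; simp [c.inA_one]
    rw [w.D_nabla hv hx (fun _ => hn) ()]
    simp [nabla, form, pi_one]
  obtain ⟨N, hN⟩ := exists_sum_gpr 𝒪 α
  rw [← hN, map_sum, map_sum]
  exact Finset.sum_congr rfl fun n _ => hom n _ (w.gpr_mem_base n hα) (gpr_mem 𝒪 n α)

include w in
lemma d_mem_base {α : Ω} (hα : α ∈ X.base) : X.d α ∈ X.base := by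
  rw [← w.D_base hα, mem_base_iff, w.hat_D (X.base_le_hor hα), (X.mem_base_iff'.1 hα).2]
  simp [c.inA_one]

/-- The form `d ω π(a) + ω π(a₍₁₎) ω π(a₍₂₎)`. -/
def curvA : A →ₗ[ℂ] Ω :=
  X.d ∘ₗ w.ω ∘ₗ c.pi + mulMap (w.ω ∘ₗ c.pi) (w.ω ∘ₗ c.pi) ∘ₗ Coalgebra.comul

lemma curvA_corep (hv : IsCorep v) (i j : ι) :
    w.curvA (v i j) = X.d (w.form v i j) + ∑ k, w.form v i k * w.form v k j := by
  simp [curvA, hv.comul, mulMap, form]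

/-- The square of the covariant derivative, `D² φ = - φ₍₀₎ R π(φ₍₁₎)`. -/
lemma D_D_curvA {φ : Ω} (hφ : φ ∈ X.hor) :
    w.D (w.D φ) = -mulMap LinearMap.id w.curvA (X.act φ) := by
  refine w.hor_ext (f := w.D ∘ₗ w.D) (g := -(mulMap LinearMap.id w.curvA ∘ₗ X.act)) ?_ hφ
  intro ι _ _ v hv x hx n hn j
  simp only [LinearMap.comp_apply, LinearMap.neg_apply, (hx j).2, map_sum]
  rw [w.D_nabla hv hx hn, w.D_nabla hv (w.nabla_mem_bimod hv hx hn) (w.nabla_mem hn)]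
  simp only [mulMap, LinearMap.comp_apply, TensorProduct.map_tmul, LinearMap.mul'_apply,
    LinearMap.id_apply, w.curvA_corep hv]
  simp only [nabla, map_sub, map_smul, map_sum, X.d_d, X.d_mul n _ (hn _), zero_sub, sub_mul,
    Finset.sum_sub_distrib, Finset.sum_add_distrib, smul_add, smul_sub, smul_mul_assoc,
    Finset.sum_mul, mul_add, Finset.mul_sum, smul_smul, Finset.smul_sum, mul_assoc]
  -- With these signs the mixed terms `d x_k ω π(v_{kj})` cancel, and `- x dω - x ω ω` remains.
  have h4 : ((-1 : ℂ) ^ n * (-1) ^ n) = 1 := by rw [← mul_pow]; simp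
  have h5 : ((-1 : ℂ) ^ (n + 1) * (-1) ^ n) = -1 := by rw [pow_succ, mul_right_comm, h4]; simp
  rw [h4, h5, pow_succ]
  simp only [one_smul, neg_smul, mul_neg, mul_one, Finset.sum_neg_distrib]
  rw [Finset.sum_comm (f := fun a b => x b * (w.form v b a * w.form v a j))]
  abel

end

end RegularConnection

end Calc

end Bundles
end QPB

namespace QPB

section Bundles

open FODC

variable {A Γ : Type*} [Ring A] [HopfAlgebra ℂ A] [StarRing A] [StarModule ℂ A]
    [AddCommGroup Γ] [Module ℂ Γ] [Module A Γ] [Module Aᵐᵒᵖ Γ] [SMulCommClass A Aᵐᵒᵖ Γ]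
    [IsScalarTower ℂ A Γ] [IsScalarTower ℂ Aᵐᵒᵖ Γ]

variable {B Ω : Type*} [Ring B] [Algebra ℂ B] [StarRing B] [StarModule ℂ B]
  [Ring Ω] [Algebra ℂ Ω]

/-! ### Freeness of the action and dual families of intertwiners on the bundle. -/

namespace Bundle

variable (P : Bundle A B) [IsCompactMatrixQuantumGroup A]

/-- Averaging against the Haar functional: `q ↦ q₍₀₎ h(q₍₁₎ a)`. -/
def avgRight (a : A) : B →ₗ[ℂ] B :=
  (TensorProduct.rid ℂ B).toLinearMap ∘ₗ (Rep.haar A ∘ₗ LinearMap.mulRight ℂ a).lTensor B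
    ∘ₗ P.F.toLinearMap

/-- Averaging against the Haar functional: `q ↦ q₍₀₎ h(a q₍₁₎)`. -/
def avgLeft (a : A) : B →ₗ[ℂ] B :=
  (TensorProduct.rid ℂ B).toLinearMap ∘ₗ (Rep.haar A ∘ₗ LinearMap.mulLeft ℂ a).lTensor B
    ∘ₗ P.F.toLinearMap

/-- Linear statements on the bundle can be checked on components of corepresentations. -/
lemma corep_ext {M : Type*} [AddCommGroup M] [Module ℂ M] {f g : B →ₗ[ℂ] M}
    (h : ∀ (n : ℕ) (x : Fin n → B) (v : Matrix (Fin n) (Fin n) A), IsCorep v →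
      (∀ j, P.F (x j) = ∑ k, x k ⊗ₜ[ℂ] v k j) → ∀ i, f (x i) = g (x i)) : f = g := by
  ext b
  obtain ⟨n, x, v, hv, hx, hb⟩ := P.exists_corep b
  refine (Submodule.span_le (p := LinearMap.eqLocus f g)).2 ?_ hb
  rintro _ ⟨i, rfl⟩
  exact h n x v hv hx i

lemma avgRight_corep {n : ℕ} {x : Fin n → B} {v : Matrix (Fin n) (Fin n) A}
    (hx : ∀ j, P.F (x j) = ∑ k, x k ⊗ₜ[ℂ] v k j) (a : A) (j : Fin n) :
    P.avgRight a (x j) = ∑ k, Rep.haar A (v k j * a) • x k := by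
  simp [avgRight, hx]

lemma avgLeft_corep {n : ℕ} {x : Fin n → B} {v : Matrix (Fin n) (Fin n) A}
    (hx : ∀ j, P.F (x j) = ∑ k, x k ⊗ₜ[ℂ] v k j) (a : A) (j : Fin n) :
    P.avgLeft a (x j) = ∑ k, Rep.haar A (a * v k j) • x k := by
  simp [avgLeft, hx]

/-- Left invariance of the Haar functional, applied to the product of a coefficient of `q` with one
of `u^c`, trades the coefficient of `q` for a coefficient of `u`. For fixed `j` the averages are
thus the components of an element of `Mor(u, F)`. -/
lemma F_avgRight (u : Rep A) (j m : u.ι) (q : B) :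
    P.F (P.avgRight (u.contra m j) q)
      = ∑ k, P.avgRight (u.contra k j) q ⊗ₜ[ℂ] u.mat k m := by
  have : P.F.toLinearMap ∘ₗ P.avgRight (u.contra m j)
      = ∑ k, (TensorProduct.mk ℂ B A).flip (u.mat k m) ∘ₗ P.avgRight (u.contra k j) := by
    refine P.corep_ext fun n x v hv hx r => ?_
    simp only [LinearMap.comp_apply, LinearMap.sum_apply, P.avgRight_corep hx,
      AlgHom.toLinearMap_apply, map_sum, map_smul, LinearMap.flip_apply, TensorProduct.mk_apply, hx]
    have h1 : ∀ t, ∑ s, Rep.haar A (v s r * u.contra m j) • v t s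
        = ∑ k, Rep.haar A (v t r * u.contra k j) • u.mat k m := by
      intro t
      have h2 : ∀ k, (∑ p, ∑ q, Rep.haar A (v p r * u.contra q j) • (v t p * u.contra k q))
            * u.mat k m = Rep.haar A (v t r * u.contra k j) • u.mat k m := by
        intro k
        rw [Rep.haar_inv_mul hv u.isCorep_contra, smul_mul_assoc, one_mul]
      simp only [← h2, Finset.sum_mul, smul_mul_assoc, mul_assoc]
      rw [Finset.sum_comm]
      refine Finset.sum_congr rfl fun p _ => ?_
      rw [Finset.sum_comm]
      simp only [← Finset.smul_sum, ← Finset.mul_sum]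
      have h3 : ∀ q, ∑ k, u.contra k q * u.mat k m = if q = m then 1 else 0 :=
        fun q => u.isCorep.antip_mul q m
      simp [h3]
    simp only [Finset.smul_sum]
    rw [Finset.sum_comm]
    simp only [← TensorProduct.tmul_smul, ← TensorProduct.tmul_sum, h1]
    simp only [TensorProduct.tmul_sum, TensorProduct.tmul_smul]
    rw [Finset.sum_comm]
  simpa using LinearMap.congr_fun this q

lemma F_avgLeft (u : Rep A) (r l : u.ι) (q : B) :
    P.F (P.avgLeft (u.mat r l) q) = ∑ s, P.avgLeft (u.mat s l) q ⊗ₜ[ℂ] u.contra s r := by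
  have : P.F.toLinearMap ∘ₗ P.avgLeft (u.mat r l)
      = ∑ s, (TensorProduct.mk ℂ B A).flip (u.contra s r) ∘ₗ P.avgLeft (u.mat s l) := by
    refine P.corep_ext fun n x v hv hx j => ?_
    simp only [LinearMap.comp_apply, LinearMap.sum_apply, P.avgLeft_corep hx,
      AlgHom.toLinearMap_apply, map_sum, map_smul, LinearMap.flip_apply, TensorProduct.mk_apply, hx]
    have h1 : ∀ t, ∑ k, Rep.haar A (u.mat r l * v k j) • v t k
        = ∑ s, Rep.haar A (u.mat s l * v t j) • u.contra s r := by
      intro t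
      have h2 : ∀ s, u.contra s r * (∑ p, ∑ q, Rep.haar A (u.mat p l * v q j) •
            (u.mat s p * v t q)) = Rep.haar A (u.mat s l * v t j) • u.contra s r := by
        intro k
        rw [Rep.haar_inv_mul u.isCorep hv, mul_smul_comm, mul_one]
      simp only [← h2, Finset.mul_sum, mul_smul_comm, ← mul_assoc]
      rw [Finset.sum_comm]
      have h3 : ∀ p, ∑ s, u.contra s r * u.mat s p = if r = p then 1 else 0 :=
        fun p => u.isCorep.antip_mul r p
      have h4 : ∀ p, ∑ s, ∑ q, Rep.haar A (u.mat p l * v q j) • (u.contra s r * u.mat s p * v t q)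
          = if r = p then ∑ q, Rep.haar A (u.mat p l * v q j) • v t q else 0 := by
        intro p
        rw [Finset.sum_comm]
        simp only [← Finset.smul_sum, ← Finset.sum_mul, h3]
        split_ifs <;> simp
      simp [h4]
    simp only [Finset.smul_sum]
    rw [Finset.sum_comm]
    simp only [← TensorProduct.tmul_smul, ← TensorProduct.tmul_sum, h1]
    simp only [TensorProduct.tmul_sum, TensorProduct.tmul_smul]
    rw [Finset.sum_comm]
  simpa using LinearMap.congr_fun this q

/-- Freeness in terms of intertwiners. -/
lemma exists_dual (u : Rep A) : ∃ (κ : Type) (_ : Fintype κ) (ν μ : κ → u.ι → B),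
    (∀ k r, P.F (ν k r) = ∑ s, ν k s ⊗ₜ[ℂ] u.contra s r) ∧
    (∀ k m, P.F (μ k m) = ∑ s, μ k s ⊗ₜ[ℂ] u.mat s m) ∧
    ∀ r m, ∑ k, ν k r * μ k m = if r = m then 1 else 0 := by
  -- Freeness gives `∑ b F(q) = 1 ⊗ u_{lj}` for every matrix element.
  have hfree : ∀ a : A, ∃ (N : ℕ) (b q : Fin N → B),
      ∑ s, (b s ⊗ₜ[ℂ] (1 : A)) * P.F (q s) = 1 ⊗ₜ[ℂ] a := by
    intro a
    obtain ⟨t, ht⟩ := P.free (1 ⊗ₜ a)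
    obtain ⟨S, rfl⟩ := TensorProduct.exists_finset t
    refine ⟨S.card, fun s => (S.equivFin.symm s).1.1, fun s => (S.equivFin.symm s).1.2, ?_⟩
    rw [← ht, map_sum, ← Finset.sum_coe_sort S, ← Equiv.sum_comp S.equivFin.symm]
    simp [mulMap]
  choose N b q hbq using fun p : u.ι × u.ι => hfree (u.mat p.1 p.2)
  have h0 : ∀ (x y : B) (a : A), (TensorProduct.rid ℂ B)
      ((Rep.haar A ∘ₗ LinearMap.mulRight ℂ a).lTensor B ((x ⊗ₜ[ℂ] (1 : A)) * P.F y))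
      = x * P.avgRight a y := by
    intro x y a
    simp only [avgRight, LinearMap.comp_apply, AlgHom.toLinearMap_apply, LinearEquiv.coe_coe]
    induction P.F y with
    | zero => simp
    | add s t hs ht => simp only [mul_add, map_add, hs, ht]
    | tmul y c => simp
  have h0' : ∀ (x y : B) (a : A), (TensorProduct.rid ℂ B)
      ((Rep.haar A ∘ₗ LinearMap.mulLeft ℂ a).lTensor B (P.F x * (y ⊗ₜ[ℂ] (1 : A))))
      = P.avgLeft a x * y := by
    intro x y a
    simp only [avgLeft, LinearMap.comp_apply, AlgHom.toLinearMap_apply, LinearEquiv.coe_coe]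
    induction P.F x with
    | zero => simp
    | add s t hs ht => simp only [add_mul, map_add, hs, ht]
    | tmul y c => simp
  -- Averaging the second leg turns the `q` into components of intertwiners `μ` and gives `∑ b μ_m =
  -- δ_{lm}`. The `b` are not intertwiners yet.
  have h1 : ∀ l m, ∑ j, ∑ s, b (l, j) s * P.avgRight (u.contra m j) (q (l, j) s)
      = if l = m then 1 else 0 := by
    intro l m
    have h2 : ∀ j, ∑ s, b (l, j) s * P.avgRight (u.contra m j) (q (l, j) s)
        = Rep.haar A (u.mat l j * u.contra m j) • 1 := by
      intro j
      have := congrArg (fun t => TensorProduct.rid ℂ B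
        ((Rep.haar A ∘ₗ LinearMap.mulRight ℂ (u.contra m j)).lTensor B t)) (hbq (l, j))
      simp only [map_sum, h0] at this
      simpa using this
    simp only [h2, ← Finset.sum_smul, ← map_sum]
    have h3 : ∑ j, u.mat l j * u.contra m j = if l = m then 1 else 0 := u.isCorep.mul_antip l m
    rw [h3]
    split_ifs <;> simp [Rep.haar_one]
  -- Applying `F` to the previous identity and cancelling the coefficients of the `μ` against `u^c`
  -- isolates `F(b)`. It can now be averaged, which replaces `b` by components `ν` of elements of
  -- `Mor(u^c, F)`.
  have h2 : ∀ l m, ∑ j, ∑ s, P.F (b (l, j) s)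
      * (P.avgRight (u.contra m j) (q (l, j) s) ⊗ₜ[ℂ] (1 : A)) = 1 ⊗ₜ[ℂ] u.contra m l := by
    intro l m
    have h3 : ∀ m', ∑ j, ∑ s, ∑ p, P.F (b (l, j) s) *
        (P.avgRight (u.contra p j) (q (l, j) s) ⊗ₜ[ℂ] (u.mat p m' * u.contra m m'))
        = if l = m' then 1 ⊗ₜ[ℂ] u.contra m m' else 0 := by
      intro m'
      have := congrArg (fun t => P.F t * (1 ⊗ₜ[ℂ] u.contra m m')) (h1 l m')
      simp only [map_sum, map_mul, P.F_avgRight, Finset.mul_sum, Finset.sum_mul, mul_assoc,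
        Algebra.TensorProduct.tmul_mul_tmul, mul_one] at this
      rw [this]
      split_ifs <;> simp [Algebra.TensorProduct.one_def]
    have h4 := congrArg (fun f => ∑ m', f m') (funext h3)
    simp only [Finset.sum_ite_eq, Finset.mem_univ, if_true] at h4
    rw [← h4, Finset.sum_comm]
    refine Finset.sum_congr rfl fun j _ => ?_
    rw [Finset.sum_comm]
    refine Finset.sum_congr rfl fun s _ => ?_
    rw [Finset.sum_comm]
    have h5 : ∀ p, ∑ m', u.mat p m' * u.contra m m' = if p = m then 1 else 0 :=
      fun p => u.isCorep.mul_antip p m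
    simp only [← Finset.mul_sum, ← TensorProduct.tmul_sum, h5]
    rw [Finset.sum_eq_single m]
    · simp
    · intro p _ hp; simp [hp]
    · simp
  refine ⟨Σ p : u.ι × u.ι, Fin (N p), inferInstance,
    fun k r => P.avgLeft (u.mat r k.1.1) (b k.1 k.2),
    fun k m => P.avgRight (u.contra m k.1.2) (q k.1 k.2),
    fun k r => P.F_avgLeft u r _ _, fun k m => P.F_avgRight u _ m _, fun r m => ?_⟩
  rw [Fintype.sum_sigma, Fintype.sum_prod_type]
  -- The averages leave `h(u_{rl} κ(u_{lm}))`; summing over `l` gives `δ_{rm} h(1)`.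
  have h3 : ∀ l, ∑ j, ∑ s, P.avgLeft (u.mat r l) (b (l, j) s)
      * P.avgRight (u.contra m j) (q (l, j) s) = Rep.haar A (u.mat r l * u.contra m l) • 1 := by
    intro l
    have := congrArg (fun t => TensorProduct.rid ℂ B
      ((Rep.haar A ∘ₗ LinearMap.mulLeft ℂ (u.mat r l)).lTensor B t)) (h2 l m)
    simp only [map_sum, h0'] at this
    simpa using this
  simp only [h3, ← Finset.sum_smul, ← map_sum]
  have h4 : ∑ j, u.mat r j * u.contra m j = if r = m then 1 else 0 := u.isCorep.mul_antip r m
  rw [h4]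
  split_ifs <;> simp [Rep.haar_one]

end Bundle

/-! ### Dual families on the calculus and the structure equation of the curvature. -/

namespace Calc

variable {c : FODC A Γ} {P : Bundle A B} {𝒪 : ℕ → Submodule ℂ Ω} [GradedAlgebra 𝒪]

section
variable (X : Calc c P 𝒪)

/-- A family of dual intertwiners indexed by a finite type. -/
structure DualFam (u : Rep A) where
  κ : Type
  [fin : Fintype κ]
  ν : κ → X.bimod u.contra
  μ : κ → X.bimod u.mat
  ν_zero : ∀ k i, (ν k).1 i ∈ 𝒪 0
  μ_zero : ∀ k i, (μ k).1 i ∈ 𝒪 0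
  sum_eq : ∀ i j, ∑ k, (ν k).1 i * (μ k).1 j = if i = j then 1 else 0

attribute [instance] DualFam.fin

variable {X}

/-- A dual family as an indexed family. -/
def DualFamily.fam {u : Rep A} (S : X.DualFamily u) : X.DualFam u where
  κ := Fin S.N
  ν := S.ν
  μ := S.μ
  ν_zero := S.ν_zero
  μ_zero := S.μ_zero
  sum_eq := S.sum_eq

/-- An indexed family of dual intertwiners as a dual family. -/
def DualFam.family {u : Rep A} (S : X.DualFam u) : X.DualFamily u where
  N := Fintype.card S.κ
  ν k := S.ν ((Fintype.equivFin S.κ).symm k)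
  μ k := S.μ ((Fintype.equivFin S.κ).symm k)
  ν_zero k := S.ν_zero _
  μ_zero k := S.μ_zero _
  sum_eq i j := by
    rw [← S.sum_eq i j]
    exact Equiv.sum_comp (Fintype.equivFin S.κ).symm fun k => (S.ν k).1 i * (S.μ k).1 j

variable (X) in
lemma nonempty_dualFamily [IsCompactMatrixQuantumGroup A] (u : Rep A) :
    Nonempty (X.DualFamily u) := by
  obtain ⟨κ, _, ν, μ, hν, hμ, h⟩ := P.exists_dual u
  refine ⟨DualFam.family ⟨κ, fun k => ⟨_, X.j_mem_bimod (hν k)⟩, fun k => ⟨_, X.j_mem_bimod (hμ k)⟩,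
    fun k i => X.j_mem _, fun k i => X.j_mem _, fun i j => ?_⟩⟩
  have := congrArg X.j (h i j)
  simp only [map_sum, map_mul] at this
  rw [this]; split_ifs <;> simp

namespace RegularConnection

variable (w : X.RegularConnection) [IsCompactMatrixQuantumGroup A]

/-- Since `D² μ_k = -∑ μ_k(e_l) curvA(u_{lj})`, the duality relation solves for the curvature:
`curvA(u_{ij}) = -∑ ν_k D² μ_k`, a combination of products of horizontal forms. -/
lemma curvA_mem_hor (a : A) : w.curvA a ∈ X.hor := by
  obtain ⟨u, hu⟩ := Rep.exists_mem_coeffs a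
  have h : coeffs A u.mat ≤ X.hor.comap w.curvA := by
    refine Submodule.span_le.2 ?_
    rintro _ ⟨i, j, rfl⟩
    obtain ⟨S⟩ := X.nonempty_dualFamily u
    have h1 : ∀ k, w.D (w.D ((S.μ k).1 j)) = -∑ l, (S.μ k).1 l * w.curvA (u.mat l j) := by
      intro k
      rw [w.D_D_curvA ((S.μ k).2 j).1, ((S.μ k).2 j).2]
      simp [mulMap]
    have h2 : w.curvA (u.mat i j) = -∑ k, (S.ν k).1 i * w.D (w.D ((S.μ k).1 j)) := by
      simp only [h1, mul_neg, Finset.sum_neg_distrib, neg_neg, Finset.mul_sum, ← mul_assoc]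
      rw [Finset.sum_comm]
      simp only [← Finset.sum_mul, S.sum_eq]
      simp
    change w.curvA (u.mat i j) ∈ X.hor
    rw [h2]
    exact neg_mem (sum_mem fun k _ => X.mul_mem_hor ((S.ν k).2 i).1
      (w.D_mem_hor (w.D_mem_hor ((S.μ k).2 j).1)))
  exact h hu

/-- The structure equation `R π(a) = d ω π(a) + ω π(a₍₁₎) ω π(a₍₂₎)`. -/
lemma R_pi (a : A) : w.R (c.pi a) = w.curvA a := by
  -- The horizontal projection fixes `curvA` and kills its quadratic part, so what remains is `h_ω d
  -- ω π = R π`.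
  have h1 : ∀ t : A ⊗[ℂ] A, w.h (mulMap (w.ω ∘ₗ c.pi) (w.ω ∘ₗ c.pi) t) = 0 := by
    intro t
    induction t with
    | zero => simp
    | add s t hs ht => rw [map_add, map_add, hs, ht, add_zero]
    | tmul x y => exact w.h_ω_mul_ω x y
  rw [← w.h_of_mem_hor (w.curvA_mem_hor a), curvA, LinearMap.add_apply, map_add]
  rw [LinearMap.comp_apply (mulMap _ _), h1, add_zero]
  rfl

lemma D_D {ι : Type} [Fintype ι] {v : Matrix ι ι A} {x : ι → Ω} (hx : x ∈ X.bimod v) (j : ι) :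
    w.D (w.D (x j)) = -∑ l, x l * w.R (c.pi (v l j)) := by
  rw [w.D_D_curvA (hx j).1, (hx j).2]
  simp [mulMap, R_pi]

end RegularConnection

end

end Calc

end Bundles
end QPB

namespace QPB

section Bundles

open FODC

variable {A Γ : Type*} [Ring A] [HopfAlgebra ℂ A] [StarRing A] [StarModule ℂ A]
    [AddCommGroup Γ] [Module ℂ Γ] [Module A Γ] [Module Aᵐᵒᵖ Γ] [SMulCommClass A Aᵐᵒᵖ Γ]
    [IsScalarTower ℂ A Γ] [IsScalarTower ℂ Aᵐᵒᵖ Γ]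

variable {B Ω : Type*} [Ring B] [Algebra ℂ B] [StarRing B] [StarModule ℂ B]
  [Ring Ω] [Algebra ℂ Ω]

namespace Calc

variable {c : FODC A Γ} {P : Bundle A B} {𝒪 : ℕ → Submodule ℂ Ω} [GradedAlgebra 𝒪]

/-! ### Pairings and operators on the bimodules of intertwiners -/

section
variable {ι : Type} [Fintype ι]

lemma pairMinus_mul_right (u : Rep A) (α : Ω) (ψ φ : u.ι → Ω) :
    pairMinus u ψ (fun i => φ i * α) = pairMinus u ψ φ * α := by
  simp [pairMinus, Finset.sum_mul, mul_assoc]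

lemma pairMinus_mul_left (u : Rep A) (α : Ω) (ψ φ : u.ι → Ω) :
    pairMinus u (fun i => α * ψ i) φ = α * pairMinus u ψ φ := by
  simp [pairMinus, Finset.mul_sum, mul_assoc]

lemma pairMinus_mul_mid (u : Rep A) (α : Ω) (ψ φ : u.ι → Ω) :
    pairMinus u ψ (fun i => α * φ i) = pairMinus u (fun i => ψ i * α) φ := by
  simp [pairMinus, mul_assoc]

/-- The pairing `⟨ ⟩⁻` as a bilinear map. -/
def pairMinusL (u : Rep A) : (u.ι → Ω) →ₗ[ℂ] (u.ι → Ω) →ₗ[ℂ] Ω :=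
  LinearMap.mk₂ ℂ (pairMinus u)
    (fun x y z => by
      simp [pairMinus, add_mul, Finset.sum_add_distrib])
    (fun r x y => by simp [pairMinus, Finset.smul_sum, smul_comm r])
    (fun x y z => by
      simp [pairMinus, mul_add, Finset.sum_add_distrib])
    (fun r x y => by simp [pairMinus, Finset.smul_sum, smul_comm r])

lemma pairMinusL_apply (u : Rep A) (x y : u.ι → Ω) : pairMinusL u x y = pairMinus u x y := rfl

end

variable (X : Calc c P 𝒪)

lemma pairPlus_mem_base (u : Rep A) {x φ : u.ι → Ω} (hx : x ∈ X.bimod u.mat)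
    (hφ : φ ∈ X.bimod u.contra) : pairPlus x φ ∈ X.base := by
  rw [mem_base_iff']
  refine ⟨sum_mem fun i _ => X.mul_mem_hor (hx i).1 (hφ i).1, ?_⟩
  have h : ∀ k l, ∑ i, u.mat k i * u.contra l i = if k = l then 1 else 0 :=
    fun k l => u.isCorep.mul_antip k l
  simp only [pairPlus, map_sum, act_mul, (hx _).2, (hφ _).2, Finset.sum_mul_sum,
    Algebra.TensorProduct.tmul_mul_tmul]
  rw [Finset.sum_comm, TensorProduct.sum_tmul]
  refine Finset.sum_congr rfl fun k _ => ?_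
  rw [Finset.sum_comm]
  simp only [← TensorProduct.tmul_sum, h]
  rw [Finset.sum_eq_single k]
  · simp
  · intro l _ hl; simp [hl.symm]
  · simp

/-- The factors now stand in the order `u^c` before `u`, where an unweighted sum need not be
invariant; the weight `C_u⁻¹` makes the contraction trivial through `sum_canon_inv`. -/
lemma pairMinus_mem_base [IsCompactMatrixQuantumGroup A] (u : Rep A) {x φ : u.ι → Ω}
    (hx : x ∈ X.bimod u.mat) (hφ : φ ∈ X.bimod u.contra) : pairMinus u φ x ∈ X.base := by
  rw [mem_base_iff']
  refine ⟨sum_mem fun i _ => sum_mem fun j _ => Submodule.smul_mem _ _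
    (X.mul_mem_hor (hφ i).1 (hx j).1), ?_⟩
  have h : ∀ k l, ∑ i, ∑ j, u.canon⁻¹ j i • (u.contra k i * u.mat l j)
      = u.canon⁻¹ l k • (1 : A) := fun k l => u.sum_canon_inv k l
  simp only [pairMinus, map_sum, map_smul, act_mul, (hx _).2, (hφ _).2, Finset.sum_mul_sum,
    Algebra.TensorProduct.tmul_mul_tmul, TensorProduct.sum_tmul, ← TensorProduct.tmul_smul,
    Finset.smul_sum, ← TensorProduct.smul_tmul']
  have h1 : ∀ k l, ∑ i, ∑ j, (φ k * x l) ⊗ₜ[ℂ] (u.canon⁻¹ j i • (u.contra k i * u.mat l j))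
      = (φ k * x l) ⊗ₜ[ℂ] (u.canon⁻¹ l k • (1 : A)) := by
    intro k l; simp only [← TensorProduct.tmul_sum, h]
  simp only [← h1]
  calc _ = ∑ i, ∑ k, ∑ j, ∑ l, (φ k * x l) ⊗ₜ[ℂ] (u.canon⁻¹ j i • (u.contra k i * u.mat l j)) :=
        Finset.sum_congr rfl fun i _ => Finset.sum_comm
    _ = ∑ k, ∑ i, ∑ j, ∑ l, (φ k * x l) ⊗ₜ[ℂ] (u.canon⁻¹ j i • (u.contra k i * u.mat l j)) :=
        Finset.sum_comm
    _ = _ := Finset.sum_congr rfl fun k _ =>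
        (Finset.sum_congr rfl fun i _ => Finset.sum_comm).trans Finset.sum_comm

/-- Left multiplication by forms on the base. -/
def lmul (u : Rep A) : X.base →ₗ[ℂ] Module.End ℂ (X.bimod u.mat) :=
  LinearMap.mk₂ ℂ (fun α x => ⟨fun i => α * x.1 i, X.base_mul_mem_bimod α.2 x.2⟩)
    (fun x y z => by ext i; simp [add_mul]) (fun r x y => by ext i; simp)
    (fun x y z => by ext i; simp [mul_add]) (fun r x y => by ext i; simp)

/-- Right multiplication by forms on the base. -/
def rmul (u : Rep A) : X.base →ₗ[ℂ] Module.End ℂ (X.bimod u.mat) :=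
  LinearMap.mk₂ ℂ (fun α x => ⟨fun i => x.1 i * α, X.bimod_mul_base_mem α.2 x.2⟩)
    (fun x y z => by ext i; simp [mul_add]) (fun r x y => by ext i; simp)
    (fun x y z => by ext i; simp [add_mul]) (fun r x y => by ext i; simp)

variable {X} {u : Rep A}

@[simp] lemma lmul_apply (α : X.base) (x : X.bimod u.mat) (i : u.ι) :
    (X.lmul u α x).1 i = α * x.1 i := rfl

@[simp] lemma rmul_apply (α : X.base) (x : X.bimod u.mat) (i : u.ι) :
    (X.rmul u α x).1 i = x.1 i * α := rfl

variable (X) in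
/-- The pairing `⟨ ⟩⁺` with values in the forms on the base. -/
def pp (u : Rep A) (x : X.bimod u.mat) (φ : X.bimod u.contra) : X.base :=
  ⟨pairPlus x.1 φ.1, X.pairPlus_mem_base u x.2 φ.2⟩

namespace DualFam

variable (S : X.DualFam u)

lemma sum_ν_mul_pairPlus (φ : u.ι → Ω) (i : u.ι) :
    ∑ k, (S.ν k).1 i * pairPlus (S.μ k).1 φ = φ i := by
  simp only [pairPlus, Finset.mul_sum, ← mul_assoc]
  rw [Finset.sum_comm]
  simp only [← Finset.sum_mul, S.sum_eq]
  simp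

/-- A dual basis for the left module: `x` has coordinates `⟨x, ν_k⟩⁺` with respect to the `μ_k`. A
left-linear operator is therefore determined by its values on the `μ_k`. -/
lemma sum_lmul (x : X.bimod u.mat) : ∑ k, X.lmul u (X.pp u x (S.ν k)) (S.μ k) = x := by
  ext i
  have h : ∀ k, (X.lmul u (X.pp u x (S.ν k)) (S.μ k)).1 i
      = ∑ l, x.1 l * ((S.ν k).1 l * (S.μ k).1 i) := by
    intro k; simp [pp, pairPlus, Finset.sum_mul, mul_assoc]
  rw [Submodule.coe_sum, Finset.sum_apply]
  simp only [h]
  rw [Finset.sum_comm]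
  simp only [← Finset.mul_sum, S.sum_eq]
  simp

/-- The trace `∑ k, ⟨ν_k, T μ_k⟩⁻`. -/
def tr : Module.End ℂ (X.bimod u.mat) →ₗ[ℂ] Ω where
  toFun T := ∑ k, pairMinus u (S.ν k).1 (T (S.μ k)).1
  map_add' T T' := by
    simp only [← pairMinusL_apply, LinearMap.add_apply, Submodule.coe_add, map_add,
      Finset.sum_add_distrib]
  map_smul' r T := by
    simp only [← pairMinusL_apply, LinearMap.smul_apply, Submodule.coe_smul, map_smul,
      Finset.smul_sum, RingHom.id_apply]

lemma tr_apply (T : Module.End ℂ (X.bimod u.mat)) :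
    S.tr T = ∑ k, pairMinus u (S.ν k).1 (T (S.μ k)).1 := rfl

lemma tr_mem_base [IsCompactMatrixQuantumGroup A] (T : Module.End ℂ (X.bimod u.mat)) :
    S.tr T ∈ X.base :=
  sum_mem fun k _ => X.pairMinus_mem_base u (T (S.μ k)).2 (S.ν k).2

end DualFam

/-- `T` is a graded left-linear operator of parity `p`. -/
def IsLeft (p : ℕ) (T : Module.End ℂ (X.bimod u.mat)) : Prop :=
  ∀ q, ∀ α : X.base, (α : Ω) ∈ 𝒪 q → T * X.lmul u α = (-1 : ℂ) ^ (p * q) • (X.lmul u α * T)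

lemma IsLeft.apply {p : ℕ} {T : Module.End ℂ (X.bimod u.mat)} (hT : IsLeft p T) {q : ℕ}
    {α : X.base} (hα : (α : Ω) ∈ 𝒪 q) (x : X.bimod u.mat) :
    T (X.lmul u α x) = (-1 : ℂ) ^ (p * q) • X.lmul u α (T x) :=
  LinearMap.congr_fun (hT q α hα) x

namespace DualFam

/-- Expand `μ_k α` in the second family and pull the coefficients out of `T`. They can be moved
across `⟨ ⟩⁻` to `ν_k`, where the first family collapses to `α ν'_m`. With `α = 1` this gives
independence of the family, in general the centrality of the trace. -/
lemma tr_rmul (S S' : X.DualFam u) {p : ℕ} {T : Module.End ℂ (X.bimod u.mat)} (hT : IsLeft p T)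
    {q : ℕ} {α : X.base} (hα : (α : Ω) ∈ 𝒪 q) :
    S.tr (T * X.rmul u α) = (-1 : ℂ) ^ (p * q) • ((α : Ω) * S'.tr T) := by
  have h1 : ∀ k m, ((X.pp u (X.rmul u α (S.μ k)) (S'.ν m) : X.base) : Ω) ∈ 𝒪 q := by
    intro k m
    refine sum_mem fun i _ => ?_
    have := SetLike.mul_mem_graded (SetLike.mul_mem_graded (S.μ_zero k i) hα) (S'.ν_zero m i)
    simpa using this
  have h2 : ∀ k, (T (X.rmul u α (S.μ k))).1 = ∑ m, (-1 : ℂ) ^ (p * q) •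
      fun i => pairPlus (X.rmul u α (S.μ k)).1 (S'.ν m).1 * (T (S'.μ m)).1 i := by
    intro k
    conv_lhs => rw [← S'.sum_lmul (X.rmul u α (S.μ k)), map_sum]
    simp only [hT.apply (h1 k _)]
    rw [Submodule.coe_sum]; rfl
  have h3 : ∀ m, ∑ k, pairMinus u (S.ν k).1
      (fun i => pairPlus (X.rmul u α (S.μ k)).1 (S'.ν m).1 * (T (S'.μ m)).1 i)
      = α * pairMinus u (S'.ν m).1 (T (S'.μ m)).1 := by
    intro m
    simp only [pairMinus_mul_mid]
    simp only [← pairMinusL_apply, ← LinearMap.sum_apply, ← map_sum]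
    rw [pairMinusL_apply, pairMinusL_apply, ← pairMinus_mul_left]
    congr 1
    ext i
    have := S.sum_ν_mul_pairPlus (fun l => α * (S'.ν m).1 l) i
    simp only [pairPlus, ← mul_assoc] at this
    rw [Finset.sum_apply, ← this]
    simp [pairPlus]
  rw [tr_apply]
  simp only [Module.End.mul_apply, h2]
  simp only [← pairMinusL_apply, map_sum, map_smul]
  rw [Finset.sum_comm]
  simp only [← Finset.smul_sum, pairMinusL_apply, h3]
  rw [← Finset.mul_sum, tr_apply]

/-- The trace does not depend on the choice of the family. -/
lemma tr_eq (S S' : X.DualFam u) {p : ℕ} {T : Module.End ℂ (X.bimod u.mat)} (hT : IsLeft p T) :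
    S.tr T = S'.tr T := by
  have h := tr_rmul S S' hT (q := 0) (α := ⟨1, X.one_mem_base⟩) SetLike.GradedOne.one_mem
  have h1 : X.rmul u ⟨1, X.one_mem_base⟩ = 1 := by
    ext x i; simp
  simpa [h1] using h

/-- If `T` commutes with right multiplication by `α`, the factor `α` can be extracted on either side
of the trace. -/
lemma tr_mul_base (S : X.DualFam u) {p : ℕ} {T : Module.End ℂ (X.bimod u.mat)} (hT : IsLeft p T)
    {q : ℕ} {α : X.base} (hα : (α : Ω) ∈ 𝒪 q) (hT' : T * X.rmul u α = X.rmul u α * T) :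
    S.tr T * α = (-1 : ℂ) ^ (p * q) • ((α : Ω) * S.tr T) := by
  rw [← S.tr_rmul S hT hα, hT', tr_apply, tr_apply, Finset.sum_mul]
  refine Finset.sum_congr rfl fun k _ => ?_
  rw [← pairMinus_mul_right]; rfl

/-- The compatibility of a connection on the bimodule with the dual family: `η_k` plays the role of
the derivative of `ν_k`. -/
structure Compat (S : X.DualFam u) (n : Module.End ℂ (X.bimod u.mat)) (η : S.κ → u.ι → Ω) :
    Prop where
  plus : ∀ k m, X.d (pairPlus (S.μ k).1 (S.ν m).1)
    = pairPlus (n (S.μ k)).1 (S.ν m).1 + pairPlus (S.μ k).1 (η m)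
  minus : ∀ k x, X.d (pairMinus u (S.ν k).1 (Subtype.val x))
    = pairMinus u (η k) x.1 + pairMinus u (S.ν k).1 (n x).1
  mem : ∀ k m, pairPlus (n (S.μ k)).1 (S.ν m).1 ∈ 𝒪 1

/-- Differentiating `∑ ⟨ν_k, T μ_k⟩⁻` gives `tr(n T)` and a term with `η_k`. Expressed through the
family, `η` consists of a part with `ν (de)` and a part with `⟨n μ, ν⟩⁺`. The second gives `tr(T n)`
up to sign; the first vanishes because it meets the idempotent `e` on both sides. -/
lemma Compat.d_tr {S : X.DualFam u} {n : Module.End ℂ (X.bimod u.mat)} {η : S.κ → u.ι → Ω}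
    (h : S.Compat n η) {p : ℕ} {T : Module.End ℂ (X.bimod u.mat)} (hT : IsLeft p T) :
    X.d (S.tr T) = S.tr (n * T) - (-1 : ℂ) ^ p • S.tr (T * n) := by
  classical
  let e : Matrix S.κ S.κ Ω := Matrix.of fun k m => pairPlus (S.μ k).1 (S.ν m).1
  let de : Matrix S.κ S.κ Ω := Matrix.of fun k m => X.d (e k m)
  have he0 : ∀ k m, e k m ∈ 𝒪 0 := fun k m => sum_mem fun i _ => by
    simpa using SetLike.mul_mem_graded (S.μ_zero k i) (S.ν_zero m i)
  have hνe : ∀ m i, ∑ k, (S.ν k).1 i * e k m = (S.ν m).1 i := fun m i => S.sum_ν_mul_pairPlus _ i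
  have hee : e * e = e := by
    ext k m
    rw [Matrix.mul_apply]
    change ∑ a, pairPlus (S.μ k).1 (S.ν a).1 * e a m = pairPlus (S.μ k).1 (S.ν m).1
    simp only [pairPlus, Finset.sum_mul, mul_assoc]
    rw [Finset.sum_comm]
    simp only [← Finset.mul_sum, hνe]
  have hde : de = de * e + e * de := by
    ext k m
    have h1 := congrArg X.d (congrFun (congrFun hee k) m)
    rw [Matrix.mul_apply, map_sum] at h1
    simp only [X.d_mul 0 _ (he0 _ _), pow_zero, one_smul, Finset.sum_add_distrib] at h1
    rw [Matrix.add_apply, Matrix.mul_apply, Matrix.mul_apply]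
    exact h1.symm
  -- The usual identity for idempotents: multiply `de = (de) e + e (de)` by `e` on both sides.
  have hzero : e * de * e = 0 := by
    have h1 : e * de * e = e * (de * e + e * de) * e := by rw [← hde]
    rw [mul_add, add_mul] at h1
    have h2 : e * (de * e) * e = e * de * e := by simp only [mul_assoc, hee]
    have h3 : e * (e * de) * e = e * de * e := by rw [← mul_assoc e e de, hee]
    rw [h2, h3] at h1
    simpa using h1
  have hTμ : ∀ m, (T (S.μ m)).1 = ∑ b, fun i => e m b * (T (S.μ b)).1 i := by
    intro m
    conv_lhs => rw [← S.sum_lmul (S.μ m), map_sum]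
    have h1 : ∀ k, T (X.lmul u (X.pp u (S.μ m) (S.ν k)) (S.μ k))
        = X.lmul u (X.pp u (S.μ m) (S.ν k)) (T (S.μ k)) := by
      intro k
      rw [hT.apply (he0 m k)]; simp
    simp only [h1]
    rw [Submodule.coe_sum]; rfl
  have hvan : ∑ m, pairMinus u (fun i => ∑ k, (S.ν k).1 i * de k m) (T (S.μ m)).1 = 0 := by
    have h1 : ∀ m, pairMinus u (fun i => ∑ k, (S.ν k).1 i * de k m) (T (S.μ m)).1
        = ∑ b, pairMinus u (fun i => ∑ k, (S.ν k).1 i * de k m * e m b) (T (S.μ b)).1 := by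
      intro m
      rw [hTμ m, ← pairMinusL_apply, map_sum]
      refine Finset.sum_congr rfl fun b _ => ?_
      rw [pairMinusL_apply, pairMinus_mul_mid]
      simp only [Finset.sum_mul]
    simp only [h1]
    rw [Finset.sum_comm]
    refine Finset.sum_eq_zero fun b _ => ?_
    simp only [← pairMinusL_apply, ← LinearMap.sum_apply, ← map_sum]
    have h2 : (∑ m, fun i => ∑ k, (S.ν k).1 i * de k m * e m b) = 0 := by
      ext i
      have h3 : ∀ a, ∑ k, ∑ m, e a k * de k m * e m b = 0 := by
        intro a
        have := congrFun (congrFun hzero a) b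
        rw [Matrix.mul_apply] at this
        simp only [Matrix.mul_apply, Finset.sum_mul, Matrix.zero_apply] at this
        rw [Finset.sum_comm]; exact this
      rw [Finset.sum_apply]
      have h4 : ∀ k m, (S.ν k).1 i * de k m * e m b
          = ∑ a, (S.ν a).1 i * (e a k * de k m * e m b) := by
        intro k m
        conv_lhs => rw [← hνe k i]
        simp only [Finset.sum_mul, mul_assoc]
      simp only [h4]
      calc _ = ∑ a, (S.ν a).1 i * ∑ k, ∑ m, e a k * de k m * e m b := by
            simp only [Finset.mul_sum]
            rw [Finset.sum_comm]
            exact (Finset.sum_congr rfl fun k _ => Finset.sum_comm).trans Finset.sum_comm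
        _ = _ := by simp [h3]
    rw [h2, map_zero, LinearMap.zero_apply]
  -- The coordinates of `n μ_k` have degree one, so pulling them out of `T` costs the sign `(-1)^p`,
  -- which cancels the one on the left.
  have hTn : (-1 : ℂ) ^ p • S.tr (T * n)
      = ∑ m, pairMinus u (fun i => ∑ k, (S.ν k).1 i * pairPlus (n (S.μ k)).1 (S.ν m).1)
          (T (S.μ m)).1 := by
    have h1 : ∀ k, (T (n (S.μ k))).1 = ∑ m, (-1 : ℂ) ^ p •
        fun i => pairPlus (n (S.μ k)).1 (S.ν m).1 * (T (S.μ m)).1 i := by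
      intro k
      conv_lhs => rw [← S.sum_lmul (n (S.μ k)), map_sum]
      have h2 : ∀ m, T (X.lmul u (X.pp u (n (S.μ k)) (S.ν m)) (S.μ m))
          = (-1 : ℂ) ^ p • X.lmul u (X.pp u (n (S.μ k)) (S.ν m)) (T (S.μ m)) := by
        intro m
        have := hT.apply (α := X.pp u (n (S.μ k)) (S.ν m)) (h.mem k m) (S.μ m)
        rwa [mul_one] at this
      simp only [h2]
      rw [Submodule.coe_sum]; rfl
    rw [tr_apply]
    simp only [Module.End.mul_apply, h1]
    have hs : (-1 : ℂ) ^ p * (-1) ^ p = 1 := by rw [← mul_pow]; simp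
    simp only [← pairMinusL_apply, map_sum, map_smul]
    simp only [← Finset.smul_sum]
    rw [smul_smul, hs, one_smul, Finset.sum_comm]
    refine Finset.sum_congr rfl fun m _ => ?_
    simp only [pairMinusL_apply, pairMinus_mul_mid]
    simp only [← pairMinusL_apply, ← LinearMap.sum_apply, ← map_sum]
    congr 2
    ext i; simp
  have hη : ∀ m i, η m i = ∑ k, (S.ν k).1 i * de k m
      - ∑ k, (S.ν k).1 i * pairPlus (n (S.μ k)).1 (S.ν m).1 := by
    intro m i
    rw [← S.sum_ν_mul_pairPlus (η m) i, ← Finset.sum_sub_distrib]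
    refine Finset.sum_congr rfl fun k _ => ?_
    rw [← mul_sub]
    congr 1
    change _ = X.d (pairPlus (S.μ k).1 (S.ν m).1) - _
    rw [h.plus]; abel
  have hη' : ∑ m, pairMinus u (η m) (T (S.μ m)).1 = -((-1 : ℂ) ^ p • S.tr (T * n)) := by
    have h1 : ∀ m, η m = (fun i => ∑ k, (S.ν k).1 i * de k m)
      - fun i => ∑ k, (S.ν k).1 i * pairPlus (n (S.μ k)).1 (S.ν m).1 :=
      fun m => funext fun i => hη m i
    simp only [h1, ← pairMinusL_apply, map_sub, LinearMap.sub_apply, Finset.sum_sub_distrib]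
    simp only [pairMinusL_apply]
    rw [hvan, hTn, zero_sub]
  rw [tr_apply, map_sum]
  simp only [h.minus, Finset.sum_add_distrib]
  rw [hη', tr_apply S (n * T)]
  simp only [Module.End.mul_apply]
  abel

end DualFam

end Calc

end Bundles
end QPB

namespace QPB

section Bundles

open FODC

variable {A Γ : Type*} [Ring A] [HopfAlgebra ℂ A] [StarRing A] [StarModule ℂ A]
    [AddCommGroup Γ] [Module ℂ Γ] [Module A Γ] [Module Aᵐᵒᵖ Γ] [SMulCommClass A Aᵐᵒᵖ Γ]
    [IsScalarTower ℂ A Γ] [IsScalarTower ℂ Aᵐᵒᵖ Γ]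

variable {B Ω : Type*} [Ring B] [Algebra ℂ B] [StarRing B] [StarModule ℂ B]
  [Ring Ω] [Algebra ℂ Ω]

namespace Calc

/-! ### Transgression in an abstract algebra -/

section
variable {R : Type*} [Semiring R] [Algebra ℂ R]

lemma sq_commute_of_leibniz {n L L' : R} {s : ℂ} (h : n * L = L' + s • (L * n))
    (h' : n * L' = (-1 * s) • (L' * n)) (hs : s * s = 1) : n * n * L = L * (n * n) := by
  rw [mul_assoc, h, mul_add, mul_smul_comm, ← mul_assoc, h', h]
  simp only [add_mul, smul_add, smul_mul_assoc, smul_smul, hs, mul_assoc]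
  module

lemma sq_commute_of_right_leibniz {n r r' π : R} (h : n * r = r * n + r' * π)
    (h' : n * r' = r' * n) (hπ : n * π = (-1 : ℂ) • (π * n)) : n * n * r = r * (n * n) := by
  rw [mul_assoc, h, mul_add, ← mul_assoc, h, ← mul_assoc, h', add_mul, mul_assoc r' n, hπ]
  simp only [mul_smul_comm, mul_assoc]
  module

lemma sq_commute_of_anticommute {n π : R} (h : n * π = (-1 : ℂ) • (π * n)) :
    n * n * π = π * (n * n) := by
  rw [mul_assoc, h, mul_smul_comm, ← mul_assoc, h, smul_mul_assoc, smul_smul, mul_assoc]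
  simp

lemma leibniz_diff {R : Type*} [Ring R] [Algebra ℂ R] {n E L L' : R} {s : ℂ} (h : n * L = L' + s • (L * n))
    (h' : (n + E) * L = L' + s • (L * (n + E))) : E * L = s • (L * E) := by
  rw [add_mul, h, mul_add, smul_add, ← add_assoc] at h'
  exact add_left_cancel h'

lemma right_leibniz_diff {R : Type*} [Ring R] [Algebra ℂ R] {n E r r' π : R} (h : n * r = r * n + r' * π)
    (h' : (n + E) * r = r * (n + E) + r' * π) : E * r = r * E := by
  rw [add_mul, h, mul_add, add_right_comm] at h'
  exact add_left_cancel ((add_right_comm _ _ _).trans (h'.trans (by abel)))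

lemma anticommute_diff {R : Type*} [Ring R] [Algebra ℂ R] {n E π : R} (h : n * π = (-1 : ℂ) • (π * n))
    (h' : (n + E) * π = (-1 : ℂ) • (π * (n + E))) : E * π = (-1 : ℂ) • (π * E) := by
  rw [add_mul, h, mul_add, smul_add] at h'
  exact add_left_cancel h'

lemma anticomm_commute {n T L L' : R} {s : ℂ} (h : n * L = L' + s • (L * n))
    (hT : T * L = s • (L * T)) (hT' : T * L' = (-1 * s) • (L' * T)) (hs : s * s = 1) :
    (n * T + T * n) * L = L * (n * T + T * n) := by
  have h1 : n * T * L = s • (L' * T) + L * (n * T) := by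
    rw [mul_assoc, hT, mul_smul_comm, ← mul_assoc, h, add_mul, smul_add, smul_mul_assoc, smul_smul,
      hs, one_smul, mul_assoc]
  have h2 : T * n * L = (-1 * s) • (L' * T) + L * (T * n) := by
    rw [mul_assoc, h, mul_add, hT', mul_smul_comm, ← mul_assoc, hT, smul_mul_assoc, smul_smul,
      hs, one_smul, mul_assoc]
  rw [add_mul, h1, h2, mul_add]
  module

lemma anticomm_right_commute {n T r r' π : R} (h : n * r = r * n + r' * π) (hT : T * r = r * T)
    (hT' : T * r' = r' * T) (hπ : T * π = (-1 : ℂ) • (π * T)) :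
    (n * T + T * n) * r = r * (n * T + T * n) := by
  have h1 : n * T * r = r * (n * T) + r' * (π * T) := by
    rw [mul_assoc, hT, ← mul_assoc, h, add_mul, mul_assoc, mul_assoc]
  have h2 : T * n * r = r * (T * n) + (-1 : ℂ) • (r' * (π * T)) := by
    rw [mul_assoc, h, mul_add, ← mul_assoc, hT, ← mul_assoc, hT', mul_assoc, mul_assoc, hπ,
      mul_smul_comm]
  rw [add_mul, h1, h2, mul_add]
  module

lemma anticomm_commute_of_anticommute {n T π : R} (h : n * π = (-1 : ℂ) • (π * n))
    (h' : T * π = (-1 : ℂ) • (π * T)) : (n * T + T * n) * π = π * (n * T + T * n) := by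
  have h1 : n * T * π = π * (n * T) := by
    rw [mul_assoc, h', mul_smul_comm, ← mul_assoc, h, smul_mul_assoc, smul_smul, mul_assoc]
    simp
  have h2 : T * n * π = π * (T * n) := by
    rw [mul_assoc, h, mul_smul_comm, ← mul_assoc, h', smul_mul_assoc, smul_smul, mul_assoc]
    simp
  rw [add_mul, h1, h2, mul_add]

open Polynomial

/-- The transgression polynomials of the segment from `n` to `n + E`. -/
def segY (n E : R) : ℕ → R[X]
  | 0 => 0
  | k + 1 => segY n E k * (C n + X * C E) ^ 2 + ((C n + X * C E) ^ 2) ^ k * C E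

/-- The derivative of an even power of `D_t = n + t E` is an anticommutator of `D_t` with an odd
element. The recursion for `segY` is the Leibniz rule together with `(D_t²)' = D_t E + E D_t`. -/
lemma derivative_seg (n E : R) (k : ℕ) : derivative (((C n + X * C E) ^ 2) ^ k)
      = (C n + X * C E) * segY n E k + segY n E k * (C n + X * C E) := by
  have hE : derivative (C n + X * C E : R[X]) = C E := by
    simp
  set Dt : R[X] := C n + X * C E with hDt
  induction k with
  | zero => simp [segY]
  | succ k ih =>
    have hcomm : Dt * (Dt ^ 2) ^ k = (Dt ^ 2) ^ k * Dt := by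
      rw [← pow_mul, ← pow_succ, ← pow_succ']
    rw [pow_succ, derivative_mul, ih, sq, derivative_mul, hE, segY, ← hDt]
    rw [sq] at hcomm ⊢
    simp only [add_mul, mul_add, mul_assoc]
    rw [← mul_assoc Dt ((Dt * Dt) ^ k), hcomm]
    simp only [mul_assoc]
    abel

section
variable (L : ℕ → Submodule ℂ R) [SetLike.GradedMonoid L] (hL : L 2 = L 0)

lemma coeff_mul_mem {p q : ℕ} {f g : R[X]} (hf : ∀ k, f.coeff k ∈ L p)
    (hg : ∀ k, g.coeff k ∈ L q) (k : ℕ) : (f * g).coeff k ∈ L (p + q) := by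
  rw [coeff_mul]
  exact sum_mem fun i _ => SetLike.mul_mem_graded (hf _) (hg _)

variable {L} {n E : R}
include hL

/-- A connection `n` is not itself in the graded family, so the square has to be expanded: only `n
n`, `n E + E n` and `E E` occur. The hypothesis `hL` says that the grading is by parity. -/
lemma seg_sq_mem (hn : n * n ∈ L 0) (hE : E ∈ L 1) (hnE : n * E + E * n ∈ L 0) (k : ℕ) :
    ((C n + X * C E) ^ 2 : R[X]).coeff k ∈ L 0 := by
  have h : ((C n + X * C E) ^ 2 : R[X])
      = C (n * n) + C (n * E + E * n) * X + C (E * E) * X ^ 2 := by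
    rw [sq]
    simp only [X_mul_C, map_add, map_mul, add_mul, mul_add, mul_assoc, sq]
    rw [← mul_assoc X (C E), X_mul_C, mul_assoc]
    abel
  rw [h]
  simp only [coeff_add, coeff_C, coeff_C_mul, coeff_X, coeff_X_pow]
  refine add_mem (add_mem ?_ ?_) ?_
  · split_ifs
    · exact hn
    · exact zero_mem _
  · split_ifs
    · rw [mul_one]; exact hnE
    · rw [mul_zero]; exact zero_mem _
  · split_ifs
    · rw [mul_one, ← hL]; exact SetLike.mul_mem_graded hE hE
    · rw [mul_zero]; exact zero_mem _

lemma seg_pow_mem (hn : n * n ∈ L 0) (hE : E ∈ L 1) (hnE : n * E + E * n ∈ L 0) (m k : ℕ) :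
    (((C n + X * C E) ^ 2) ^ m : R[X]).coeff k ∈ L 0 := by
  induction m generalizing k with
  | zero =>
    rw [pow_zero, coeff_one]
    split_ifs
    · exact SetLike.GradedOne.one_mem
    · exact zero_mem _
  | succ m ih =>
    rw [pow_succ]
    exact coeff_mul_mem L ih (seg_sq_mem hL hn hE hnE) k

lemma segY_mem (hn : n * n ∈ L 0) (hE : E ∈ L 1) (hnE : n * E + E * n ∈ L 0) (m k : ℕ) :
    (segY n E m).coeff k ∈ L 1 := by
  induction m generalizing k with
  | zero => rw [segY, coeff_zero]; exact zero_mem _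
  | succ m ih =>
    rw [segY, coeff_add]
    refine add_mem (coeff_mul_mem L ih (seg_sq_mem hL hn hE hnE) k) ?_
    rw [← zero_add 1]
    refine coeff_mul_mem L (seg_pow_mem hL hn hE hnE m) (fun k => ?_) k
    rw [coeff_C]
    split_ifs
    · exact hE
    · exact zero_mem _

/-- If `t` transgresses the graded commutators with `n` to `t'` and kills those with `E`, then its
values at `(n + E)^{2m}` and `n^{2m}` differ by a value of `t'`. -/
lemma exists_transgression {V : Type*} [AddCommGroup V] [Module ℂ V] (hn : n * n ∈ L 0)
    (hE : E ∈ L 1) (hnE : n * E + E * n ∈ L 0) {t t' : R →ₗ[ℂ] V}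
    (h1 : ∀ T ∈ L 1, t (n * T + T * n) = t' T) (h2 : ∀ T ∈ L 1, t (E * T + T * E) = 0) (m : ℕ) :
    ∃ T ∈ L 1, t ((n + E) ^ (2 * m)) - t (n ^ (2 * m)) = t' T := by
  set f : R[X] := ((C n + X * C E) ^ 2) ^ m with hf
  -- Coefficientwise, the anticommutator with `n` is converted to `t'`; that with `E`, coming from
  -- the preceding coefficient, is killed.
  have hder : ∀ k, t ((derivative f).coeff k) = t' ((segY n E m).coeff k) := by
    intro k
    have hY := segY_mem hL hn hE hnE m
    rw [hf, derivative_seg, ← h1 _ (hY k)]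
    set Y := segY n E m
    cases k with
    | zero => simp [add_mul, mul_add, mul_coeff_zero]
    | succ k =>
      have h3 : ((C n + X * C E) * Y + Y * (C n + X * C E)).coeff (k + 1)
          = (n * Y.coeff (k + 1) + Y.coeff (k + 1) * n) + (E * Y.coeff k + Y.coeff k * E) := by
        have h4 : Y * (X * C E) = X * (Y * C E) := by
          rw [← mul_assoc, ← mul_assoc, X_mul]
        rw [add_mul, mul_add, h4, mul_assoc]
        simp only [coeff_add, coeff_C_mul, coeff_mul_C, coeff_X_mul]
        abel
      rw [h3, map_add, h2 _ (hY k), add_zero]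
  have h0 : f.coeff 0 = n ^ (2 * m) := by
    change constantCoeff f = _
    rw [hf, ← pow_mul, map_pow]
    simp
  have h3 : ∑ i ∈ Finset.range (f.natDegree + 1), f.coeff i = (n + E) ^ (2 * m) := by
    let φ := eval₂RingHom' (RingHom.id R) 1 (fun a => Commute.one_right _)
    have h2 : φ f = ∑ i ∈ Finset.range (f.natDegree + 1), f.coeff i := by
      change eval₂ _ _ f = _
      rw [eval₂_eq_sum_range]; simp
    rw [← h2, hf, ← pow_mul, map_pow]
    congr 1
    change eval₂ _ _ _ = _
    rw [eval₂_add, eval₂_C, X_mul_C, eval₂_mul_X, eval₂_C]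
    simp
  -- Termwise integral of the transgression polynomial over `[0, 1]`: the coefficient of degree `k`
  -- is divided by `k + 1`.
  refine ⟨∑ k ∈ Finset.range f.natDegree, ((k : ℂ) + 1)⁻¹ • (segY n E m).coeff k,
    sum_mem fun k _ => Submodule.smul_mem _ _ (segY_mem hL hn hE hnE m k), ?_⟩
  rw [← h3, ← h0, Finset.sum_range_succ', map_add, add_sub_cancel_right, map_sum, map_sum]
  refine Finset.sum_congr rfl fun k _ => ?_
  have h4 := hder k
  rw [coeff_derivative] at h4
  have h5 : f.coeff (k + 1) * ((k : R) + 1) = ((k : ℂ) + 1) • f.coeff (k + 1) := by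
    rw [mul_add, mul_one, add_smul, one_smul, ← nsmul_eq_mul', Nat.cast_smul_eq_nsmul]
  have h6 : ((k : ℂ) + 1) ≠ 0 := by exact_mod_cast Nat.succ_ne_zero k
  rw [h5, map_smul] at h4
  rw [map_smul, ← h4, smul_smul, inv_mul_cancel₀ h6, one_smul]

end

end

variable {c : FODC A Γ} {P : Bundle A B} {𝒪 : ℕ → Submodule ℂ Ω} [GradedAlgebra 𝒪]

/-! ### Connections on the bimodules and transgression -/

lemma parity_mul (x y : Ω) : parity 𝒪 (x * y) = parity 𝒪 x * parity 𝒪 y := by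
  induction x using DirectSum.Decomposition.inductionOn 𝒪 with
  | zero => simp
  | add x x' hx hx' => simp only [add_mul, map_add, hx, hx']
  | @homogeneous m x =>
    induction y using DirectSum.Decomposition.inductionOn 𝒪 with
    | zero => simp
    | add y y' hy hy' => simp only [mul_add, map_add, hy, hy']
    | @homogeneous n y =>
      rw [parity_of_mem (SetLike.mul_mem_graded x.2 y.2), parity_of_mem x.2, parity_of_mem y.2,
        smul_mul_smul_comm, pow_add]

lemma parity_pow_of_mem {n : ℕ} {x : Ω} (hx : parity 𝒪 x = (-1 : ℂ) ^ n • x) (q : ℕ) :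
    ((parity 𝒪) ^ q) x = (-1 : ℂ) ^ (n * q) • x := by
  induction q with
  | zero => simp
  | succ q ih =>
    rw [pow_succ, Module.End.mul_apply, hx, map_smul, ih, smul_smul, Nat.mul_succ, pow_add,
      mul_comm]

lemma gpr_parity (n : ℕ) (x : Ω) : gpr 𝒪 n (parity 𝒪 x) = parity 𝒪 (gpr 𝒪 n x) := by
  induction x using DirectSum.Decomposition.inductionOn 𝒪 with
  | zero => simp
  | add x x' hx hx' => simp only [map_add, hx, hx']
  | @homogeneous m x =>
    rw [parity_of_mem x.2, map_smul]
    rcases eq_or_ne m n with rfl | h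
    · rw [gpr_same x.2, parity_of_mem x.2]
    · rw [gpr_ne x.2 h]; simp

lemma Z_mul {X : Calc c P 𝒪} {y : Ω} (hy : y ∈ X.Z) {p q : ℕ} (hp : y ∈ 𝒪 p) {α : Ω}
    (hα : α ∈ X.base) (hq : α ∈ 𝒪 q) : y * α = (-1 : ℂ) ^ (p * q) • (α * y) := by
  rw [hy.2 q α ⟨hα, hq⟩, parity_pow_of_mem (parity_of_mem hp), mul_smul_comm]

lemma neg_one_pow_mul_self (p : ℕ) : (-1 : ℂ) ^ p * (-1) ^ p = 1 := by rw [← mul_pow]; simp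

namespace RegularConnection

variable {X : Calc c P 𝒪} (w : X.RegularConnection) [IsCompactMatrixQuantumGroup A]

include w in
lemma parity_mem_bimod {ι : Type} [Fintype ι] [DecidableEq ι] {v : Matrix ι ι A} {x : ι → Ω}
    (hx : x ∈ X.bimod v) : (fun i => parity 𝒪 (x i)) ∈ X.bimod v := by
  rw [mem_bimod_iff]
  intro i
  have : X.hat (parity 𝒪 (x i)) = TensorProduct.map (parity 𝒪) c.inA (X.act (x i)) := by
    refine w.hor_ext (f := X.hat ∘ₗ parity 𝒪)
      (g := TensorProduct.map (parity 𝒪) c.inA ∘ₗ X.act) ?_ (hx i).1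
    intro ι' _ _ v' hv' y hy m hm j
    simp only [LinearMap.comp_apply, (hy j).2, map_sum, TensorProduct.map_tmul,
      parity_of_mem (hm _), map_smul, X.hat_bimod hy, Finset.smul_sum, TensorProduct.smul_tmul']
  rw [this, (hx i).2]; simp

/-- The parity operator on the bimodule of `u`. -/
def par (u : Rep A) : Module.End ℂ (X.bimod u.mat) where
  toFun x := ⟨fun i => parity 𝒪 (x.1 i), w.parity_mem_bimod x.2⟩
  map_add' x y := by ext i; simp
  map_smul' r x := by ext i; simp

/-- The covariant derivative on the bimodule of `u`. -/
def DM (u : Rep A) : Module.End ℂ (X.bimod u.mat) where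
  toFun x := ⟨fun i => w.D (x.1 i), w.D_mem_bimod x.2⟩
  map_add' x y := by ext i; simp
  map_smul' r x := by ext i; simp

/-- The differential on the base. -/
def dB : X.base →ₗ[ℂ] X.base := X.d.restrict fun _ h => w.d_mem_base h

variable {u : Rep A}

@[simp] lemma par_apply (x : X.bimod u.mat) (i : u.ι) : (w.par u x).1 i = parity 𝒪 (x.1 i) := rfl

@[simp] lemma DM_apply (x : X.bimod u.mat) (i : u.ι) : (w.DM u x).1 i = w.D (x.1 i) := rfl

@[simp] lemma coe_dB (α : X.base) : (w.dB α : Ω) = X.d α := rfl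

lemma dB_dB (α : X.base) : w.dB (w.dB α) = 0 := Subtype.ext (X.d_d α)

lemma dB_mem {α : X.base} {q : ℕ} (hα : (α : Ω) ∈ 𝒪 q) : (w.dB α : Ω) ∈ 𝒪 (q + 1) :=
  X.d_mem q _ hα

variable (u) in
/-- The graded bimodule operators of parity `p`. -/
def Lin (p : ℕ) : Submodule ℂ (Module.End ℂ (X.bimod u.mat)) where
  carrier := {T | IsLeft p T ∧ (∀ α, T * X.rmul u α = X.rmul u α * T) ∧
    T * w.par u = (-1 : ℂ) ^ p • (w.par u * T)}
  zero_mem' := ⟨fun q α _ => by simp, fun α => by simp, by simp⟩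
  add_mem' := by
    rintro S T ⟨h1, h2, h3⟩ ⟨h4, h5, h6⟩
    refine ⟨fun q α hα => ?_, fun α => ?_, ?_⟩
    · rw [add_mul, h1 q α hα, h4 q α hα, mul_add, smul_add]
    · rw [add_mul, h2, h5, mul_add]
    · rw [add_mul, h3, h6, mul_add, smul_add]
  smul_mem' := by
    rintro r T ⟨h1, h2, h3⟩
    refine ⟨fun q α hα => ?_, fun α => ?_, ?_⟩
    · rw [smul_mul_assoc, h1 q α hα, mul_smul_comm, smul_comm]
    · rw [smul_mul_assoc, h2, mul_smul_comm]
    · rw [smul_mul_assoc, h3, mul_smul_comm, smul_comm]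

lemma Lin_add_two (p : ℕ) : w.Lin u (p + 2) = w.Lin u p := by
  ext T
  have h1 : ∀ q, (-1 : ℂ) ^ ((p + 2) * q) = (-1) ^ (p * q) := fun q => by
    rw [add_mul, pow_add, pow_mul (-1 : ℂ) 2 q]; simp
  have h2 : (-1 : ℂ) ^ (p + 2) = (-1) ^ p := by rw [pow_add]; simp
  simp only [Lin, IsLeft, Submodule.mem_mk, AddSubmonoid.mem_mk, AddSubsemigroup.mem_mk,
    Set.mem_ofPred_eq, h1, h2]

lemma Lin_mul {p q : ℕ} {S T : Module.End ℂ (X.bimod u.mat)} (hS : S ∈ w.Lin u p)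
    (hT : T ∈ w.Lin u q) : S * T ∈ w.Lin u (p + q) := by
  obtain ⟨h1, h2, h3⟩ := hS
  obtain ⟨h4, h5, h6⟩ := hT
  refine ⟨fun r α hα => ?_, fun α => ?_, ?_⟩
  · rw [mul_assoc, h4 r α hα, mul_smul_comm, ← mul_assoc, h1 r α hα, smul_mul_assoc, smul_smul,
      add_mul, pow_add, mul_comm, mul_assoc]
  · rw [mul_assoc, h5, ← mul_assoc, h2, mul_assoc]
  · rw [mul_assoc, h6, mul_smul_comm, ← mul_assoc, h3, smul_mul_assoc, smul_smul, pow_add,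
      mul_comm, mul_assoc]

lemma one_mem_Lin : (1 : Module.End ℂ (X.bimod u.mat)) ∈ w.Lin u 0 :=
  ⟨fun q α _ => by simp, fun α => by simp, by simp⟩

lemma lmul_mem_Lin {y : X.base} (hy : (y : Ω) ∈ X.Z) {p : ℕ} (hp : (y : Ω) ∈ 𝒪 p) :
    X.lmul u y ∈ w.Lin u p := by
  refine ⟨fun q α hα => ?_, fun α => ?_, ?_⟩
  · ext x i
    simp [← mul_assoc, Z_mul hy hp α.2 hα]
  · ext x i
    simp [mul_assoc]
  · ext x i
    simp [parity_mul, parity_of_mem hp, smul_smul, neg_one_pow_mul_self]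

/-- A connection on the bimodule of `u`. -/
structure IsConn (n : Module.End ℂ (X.bimod u.mat)) : Prop where
  left : ∀ q, ∀ α : X.base, (α : Ω) ∈ 𝒪 q →
    n * X.lmul u α = X.lmul u (w.dB α) + (-1 : ℂ) ^ q • (X.lmul u α * n)
  right : ∀ α : X.base, n * X.rmul u α = X.rmul u α * n + X.rmul u (w.dB α) * w.par u
  par : n * w.par u = (-1 : ℂ) • (w.par u * n)

/-- The inhomogeneous terms of the Leibniz rules occur twice with opposite signs, and those with
`d(dα)` vanish. So the curvature of a connection is a bimodule map. -/
lemma IsConn.sq_mem {n : Module.End ℂ (X.bimod u.mat)} (hn : w.IsConn n) : n * n ∈ w.Lin u 0 := by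
  refine ⟨fun q α hα => ?_, fun α => ?_, ?_⟩
  · rw [zero_mul, pow_zero, one_smul]
    refine sq_commute_of_leibniz (R := Module.End ℂ (X.bimod u.mat)) (hn.left q α hα) ?_ (neg_one_pow_mul_self q)
    rw [hn.left (q + 1) _ (w.dB_mem hα), w.dB_dB, map_zero, zero_add, pow_succ, mul_neg_one,
      ← neg_one_mul]
  · refine sq_commute_of_right_leibniz (R := Module.End ℂ (X.bimod u.mat)) (hn.right α) ?_ hn.par
    rw [hn.right, w.dB_dB, map_zero, zero_mul, add_zero]
  · rw [pow_zero, one_smul]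
    exact sq_commute_of_anticommute (R := Module.End ℂ (X.bimod u.mat)) hn.par

lemma IsConn.sub_mem {n E : Module.End ℂ (X.bimod u.mat)} (hn : w.IsConn n)
    (hn' : w.IsConn (n + E)) : E ∈ w.Lin u 1 := by
  refine ⟨fun q α hα => ?_, fun α => ?_, ?_⟩
  · rw [one_mul]
    exact leibniz_diff (R := Module.End ℂ (X.bimod u.mat)) (hn.left q α hα) (hn'.left q α hα)
  · exact right_leibniz_diff (R := Module.End ℂ (X.bimod u.mat)) (hn.right α) (hn'.right α)
  · rw [pow_one]
    exact anticommute_diff (R := Module.End ℂ (X.bimod u.mat)) hn.par hn'.par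

/-- The graded commutator with an odd operator is even. -/
lemma IsConn.anticomm_mem {n T : Module.End ℂ (X.bimod u.mat)} (hn : w.IsConn n)
    (hT : T ∈ w.Lin u 1) : n * T + T * n ∈ w.Lin u 0 := by
  obtain ⟨h1, h2, h3⟩ := hT
  rw [pow_one] at h3
  refine ⟨fun q α hα => ?_, fun α => ?_, ?_⟩
  · rw [zero_mul, pow_zero, one_smul]
    have h4 := h1 q α hα
    have h5 := h1 (q + 1) _ (w.dB_mem hα)
    rw [one_mul] at h4
    rw [one_mul, pow_succ, mul_neg_one, ← neg_one_mul] at h5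
    exact anticomm_commute (R := Module.End ℂ (X.bimod u.mat)) (hn.left q α hα) h4 h5 (neg_one_pow_mul_self q)
  · exact anticomm_right_commute (R := Module.End ℂ (X.bimod u.mat)) (hn.right α) (h2 α) (h2 _) h3
  · rw [pow_zero, one_smul]
    exact anticomm_commute_of_anticommute (R := Module.End ℂ (X.bimod u.mat)) hn.par h3

/-- The family has degree zero, so the trace has the parity of `T`, and only parity matters for
graded commutation; `tr_mul_base` provides it. -/
lemma tr_mem_Z (S : X.DualFam u) {p : ℕ} {T : Module.End ℂ (X.bimod u.mat)}
    (hT : T ∈ w.Lin u p) : S.tr T ∈ X.Z := by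
  obtain ⟨h1, h2, h3⟩ := hT
  refine ⟨S.tr_mem_base T, fun q α hα => ?_⟩
  have hpar : parity 𝒪 (S.tr T) = (-1 : ℂ) ^ p • S.tr T := by
    have hμ : ∀ k, w.par u (S.μ k) = S.μ k := fun k => by
      ext i; simp [parity_of_mem (S.μ_zero k i)]
    have h4 : ∀ k, (-1 : ℂ) ^ p • w.par u (T (S.μ k)) = T (S.μ k) := fun k => by
      have := LinearMap.congr_fun h3 (S.μ k)
      simp only [Module.End.mul_apply, LinearMap.smul_apply, hμ] at this
      exact this.symm
    have h5 : ∀ k, w.par u (T (S.μ k)) = (-1 : ℂ) ^ p • T (S.μ k) := fun k => by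
      rw [← h4 k, smul_smul, neg_one_pow_mul_self, one_smul]
      congr 1; exact h4 k
    have h6 : ∀ k j, parity 𝒪 ((T (S.μ k)).1 j) = (-1 : ℂ) ^ p • (T (S.μ k)).1 j :=
      fun k j => congrFun (congrArg Subtype.val (h5 k)) j
    simp only [DualFam.tr_apply, pairMinus, map_sum, map_smul, parity_mul,
      parity_of_mem (S.ν_zero _ _), pow_zero, one_smul, h6, mul_smul_comm]
    simp only [Finset.smul_sum]
    exact Finset.sum_congr rfl fun k _ => Finset.sum_congr rfl fun i _ =>
      Finset.sum_congr rfl fun j _ => smul_comm _ _ _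
  rw [parity_pow_of_mem hpar, mul_smul_comm]
  exact S.tr_mul_base h1 (α := ⟨α, hα.1⟩) hα.2 (h2 _)

/-! ### Transgression between two connections on the same bimodule. -/

section transgression

variable {S : X.DualFam u} {n E : Module.End ℂ (X.bimod u.mat)} {η η' : S.κ → u.ι → Ω}
  {y : X.base} {p : ℕ}

instance : SetLike.GradedMonoid (w.Lin u) where
  one_mem := w.one_mem_Lin
  mul_mem _ _ _ _ := w.Lin_mul

lemma IsConn.lmul_closed (hn : w.IsConn n) (hyd : w.dB y = 0) (hp : (y : Ω) ∈ 𝒪 p) :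
    n * X.lmul u y = (-1 : ℂ) ^ p • (X.lmul u y * n) := by
  rw [hn.left p y hp, hyd, map_zero, zero_add]

/-- For closed `y` the connection graded-commutes with multiplication by `y`, so `d tr(y T)` is the
trace of `y` times the anticommutator, up to sign. -/
lemma tr_anticomm (hn : w.IsConn n) (hS : S.Compat n η) (hy : (y : Ω) ∈ X.Z)
    (hp : (y : Ω) ∈ 𝒪 p) (hyd : w.dB y = 0) {T : Module.End ℂ (X.bimod u.mat)}
    (hT : T ∈ w.Lin u 1) :
    S.tr (X.lmul u y * (n * T + T * n)) = (-1 : ℂ) ^ p • X.d (S.tr (X.lmul u y * T)) := by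
  rw [hS.d_tr (w.Lin_mul (w.lmul_mem_Lin hy hp) hT).1, ← mul_assoc n, hn.lmul_closed w hyd hp,
    smul_mul_assoc, map_smul, smul_sub, smul_smul, smul_smul, neg_one_pow_mul_self, pow_succ,
    mul_neg_one, mul_neg, neg_one_pow_mul_self]
  simp only [one_smul, neg_smul, sub_neg_eq_add, mul_add, mul_assoc, map_add]

/-- The classes of the traces of the powers of the curvature do not depend on the connection. -/
lemma tr_sub_mem (hn : w.IsConn n) (hS : S.Compat n η) (hn' : w.IsConn (n + E))
    (hS' : S.Compat (n + E) η') (hy : (y : Ω) ∈ X.Z) (hp : (y : Ω) ∈ 𝒪 p) (hyd : w.dB y = 0)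
    (m : ℕ) :
    S.tr (X.lmul u y * (n + E) ^ (2 * m)) - S.tr (X.lmul u y * n ^ (2 * m)) ∈ X.Z.map X.d := by
  have hE := hn.sub_mem w hn'
  -- The right side of `tr_anticomm` does not mention the connection. Comparing it for `n` and `n +
  -- E` makes the anticommutators with `E` traceless, a substitute for cyclicity.
  have h0 : ∀ T ∈ w.Lin u 1, S.tr (X.lmul u y * (E * T + T * E)) = 0 := by
    intro T hT
    have h1 := w.tr_anticomm hn hS hy hp hyd hT
    have h2 := w.tr_anticomm hn' hS' hy hp hyd hT
    rw [← h1] at h2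
    have h3 : X.lmul u y * ((n + E) * T + T * (n + E))
        = X.lmul u y * (n * T + T * n) + X.lmul u y * (E * T + T * E) := by
      rw [← mul_add, add_mul, mul_add T, add_add_add_comm]
    rw [h3, map_add] at h2
    exact left_eq_add.mp h2.symm
  obtain ⟨T, hT, h⟩ := exists_transgression (R := Module.End ℂ (X.bimod u.mat)) (L := w.Lin u)
    (n := n) (E := E) (t := S.tr ∘ₗ LinearMap.mulLeft ℂ (X.lmul u y))
    (t' := (-1 : ℂ) ^ p • (X.d ∘ₗ S.tr ∘ₗ LinearMap.mulLeft ℂ (X.lmul u y)))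
    (w.Lin_add_two 0) hn.sq_mem hE (hn.anticomm_mem w hE)
    (fun T hT => w.tr_anticomm hn hS hy hp hyd hT) h0 m
  refine ⟨(-1 : ℂ) ^ p • S.tr (X.lmul u y * T), Submodule.smul_mem _ _
    (w.tr_mem_Z S (w.Lin_mul (w.lmul_mem_Lin hy hp) hT)), ?_⟩
  rw [map_smul]
  exact h.symm

end transgression

end RegularConnection

end Calc

end Bundles
end QPB

namespace QPB

section Bundles

open FODC

variable {A Γ : Type*} [Ring A] [HopfAlgebra ℂ A] [StarRing A] [StarModule ℂ A]
    [AddCommGroup Γ] [Module ℂ Γ] [Module A Γ] [Module Aᵐᵒᵖ Γ] [SMulCommClass A Aᵐᵒᵖ Γ]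
    [IsScalarTower ℂ A Γ] [IsScalarTower ℂ Aᵐᵒᵖ Γ]

variable {B Ω : Type*} [Ring B] [Algebra ℂ B] [StarRing B] [StarModule ℂ B]
  [Ring Ω] [Algebra ℂ Ω]

namespace Calc

variable {c : FODC A Γ} {P : Bundle A B} {𝒪 : ℕ → Submodule ℂ Ω} [GradedAlgebra 𝒪]

namespace RegularConnection

variable {X : Calc c P 𝒪} (w : X.RegularConnection) [IsCompactMatrixQuantumGroup A]

/-! ### The covariant derivative as a connection -/

lemma D_parity {φ : Ω} (hφ : φ ∈ X.hor) :
    w.D (parity 𝒪 φ) = (-1 : ℂ) • parity 𝒪 (w.D φ) := by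
  refine w.hor_ext (f := w.D ∘ₗ parity 𝒪) (g := (-1 : ℂ) • (parity 𝒪 ∘ₗ w.D)) ?_ hφ
  intro ι _ _ v hv x hx n hn i
  simp only [LinearMap.comp_apply, LinearMap.smul_apply, parity_of_mem (hn i), map_smul,
    parity_of_mem (w.D_mem (hx i).1 (hn i)), smul_smul, pow_succ]
  congr 1; ring

lemma isConn_DM (u : Rep A) : w.IsConn (w.DM u) where
  left q α hα := by
    ext x i
    have := w.D_mul (X.base_le_hor α.2) hα (x.2 i).1
    rw [w.D_base α.2] at this
    simpa using this
  right α := by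
    ext x i
    have := w.D_mul_parity (x.2 i).1 (X.base_le_hor α.2)
    rw [w.D_base α.2] at this
    simpa using this
  par := by
    ext x i
    simpa using w.D_parity (x.2 i).1

/-- The pairings have values in the base, where `D` is `d`, so both identities are the Leibniz rule
for `D` with a first factor of degree zero. -/
lemma compat_DM {u : Rep A} (S : X.DualFam u) :
    S.Compat (w.DM u) fun k i => w.D ((S.ν k).1 i) where
  plus k m := by
    rw [← w.D_base (X.pairPlus_mem_base u (S.μ k).2 (S.ν m).2), pairPlus, map_sum, pairPlus,
      pairPlus, ← Finset.sum_add_distrib]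
    refine Finset.sum_congr rfl fun i _ => ?_
    rw [w.D_mul ((S.μ k).2 i).1 (S.μ_zero k i) ((S.ν m).2 i).1]
    simp
  minus k x := by
    rw [← w.D_base (X.pairMinus_mem_base u x.2 (S.ν k).2), pairMinus, map_sum, pairMinus,
      pairMinus, ← Finset.sum_add_distrib]
    refine Finset.sum_congr rfl fun i _ => ?_
    rw [map_sum, ← Finset.sum_add_distrib]
    refine Finset.sum_congr rfl fun j _ => ?_
    rw [map_smul, w.D_mul ((S.ν k).2 i).1 (S.ν_zero k i) (x.2 j).1]
    simp
  mem k m := sum_mem fun i _ => by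
    simpa using SetLike.mul_mem_graded (w.D_mem ((S.μ k).2 i).1 (S.μ_zero k i)) (S.ν_zero m i)

lemma D_D_mul {φ ψ : Ω} {n : ℕ} (hφ : φ ∈ X.hor) (hn : φ ∈ 𝒪 n) (hψ : ψ ∈ X.hor) :
    w.D (w.D (φ * ψ)) = w.D (w.D φ) * ψ + φ * w.D (w.D ψ) := by
  rw [w.D_mul hφ hn hψ, map_add, map_smul, w.D_mul (w.D_mem_hor hφ) (w.D_mem hφ hn) hψ,
    w.D_mul hφ hn (w.D_mem_hor hψ), smul_add, smul_smul, neg_one_pow_mul_self, one_smul, pow_succ,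
    mul_neg_one, neg_smul]
  abel

/-- The curvature is regular: `R(ϑ) φ = ∑ φ_k R(ϑ ∘ c_k)` for horizontal `φ`. -/
lemma R_mul {ι : Type} [Fintype ι] [DecidableEq ι] {v : Matrix ι ι A} {x : ι → Ω}
    (hx : x ∈ X.bimod v) (a : A) (j : ι) : w.R (c.pi a) * x j
      = ∑ l, x l * w.R (c.pi (a * v l j - Coalgebra.counit (R := ℂ) a • v l j)) := by
  let f : A →ₗ[ℂ] Ω := LinearMap.mulRight ℂ (x j) ∘ₗ w.R ∘ₗ c.pi
  let g : A →ₗ[ℂ] Ω := ∑ l, LinearMap.mulLeft ℂ (x l) ∘ₗ w.R ∘ₗ c.pi ∘ₗ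
    (LinearMap.mulRight ℂ (v l j) - (Coalgebra.counit (R := ℂ) (A := A)).smulRight (v l j))
  suffices h : f = g by
    have := LinearMap.congr_fun h a
    simpa [f, g] using this
  refine Rep.ext_mat fun u p q => ?_
  obtain ⟨S⟩ := X.nonempty_dualFamily u
  let S := S.fam
  -- Compute `D²` on the product intertwiner `μ_k x` in two ways: through the curvature of the
  -- product representation, and through the derivation property of `D²`.
  have h1 : ∀ k, ∑ p, (S.μ k).1 p * (w.R (c.pi (u.mat p q)) * x j)
      = ∑ p, (S.μ k).1 p * ∑ l, x l * w.R (c.pi (u.mat p q * v l j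
          - Coalgebra.counit (R := ℂ) (u.mat p q) • v l j)) := by
    intro k
    have h2 := w.D_D (X.mul_mem_bimod (S.μ k).2 hx) (q, j)
    rw [w.D_D_mul ((S.μ k).2 q).1 (S.μ_zero k q) (hx j).1, w.D_D (S.μ k).2, w.D_D hx,
      Fintype.sum_prod_type] at h2
    have h3 : ∑ p, ∑ l, (S.μ k).1 p * (x l * w.R (c.pi (u.mat p q * v l j)))
        = ∑ p, (S.μ k).1 p * (w.R (c.pi (u.mat p q)) * x j)
          + ∑ l, (S.μ k).1 q * (x l * w.R (c.pi (v l j))) := by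
      rw [← neg_inj]
      simp only [prodMat, Matrix.of_apply, neg_mul, mul_neg, Finset.sum_mul, Finset.mul_sum,
        mul_assoc] at h2
      rw [neg_add]
      exact h2.symm
    rw [← add_right_cancel_iff (a := ∑ l, (S.μ k).1 q * (x l * w.R (c.pi (v l j)))), ← h3]
    have h4 : ∑ l, (S.μ k).1 q * (x l * w.R (c.pi (v l j)))
        = ∑ p, ∑ l, Coalgebra.counit (R := ℂ) (u.mat p q) •
            ((S.μ k).1 p * (x l * w.R (c.pi (v l j)))) := by
      simp only [u.counit_mat]
      rw [Finset.sum_eq_single q]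
      · simp
      · intro p _ hp; simp [hp]
      · simp
    rw [h4, ← Finset.sum_add_distrib]
    refine Finset.sum_congr rfl fun p _ => ?_
    rw [Finset.mul_sum, ← Finset.sum_add_distrib]
    refine Finset.sum_congr rfl fun l _ => ?_
    rw [map_sub, map_sub, map_smul, map_smul, mul_sub, mul_sub, mul_smul_comm, mul_smul_comm,
      sub_add_cancel]
  -- The dual family allows the factor `μ_k` to be cancelled on the left.
  have h2 : ∀ φ : u.ι → Ω, ∀ r, ∑ k, (S.ν k).1 r * ∑ p, (S.μ k).1 p * φ p = φ r :=
    fun φ r => S.sum_ν_mul_pairPlus φ r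
  have h3 := h2 (fun p => w.R (c.pi (u.mat p q)) * x j) p
  simp only [h1] at h3
  rw [h2 (fun p => ∑ l, x l * w.R (c.pi (u.mat p q * v l j
          - Coalgebra.counit (R := ℂ) (u.mat p q) • v l j)))] at h3
  simpa [f, g] using h3.symm

/-- The even powers of the covariant derivative in terms of the curvature. -/
lemma DM_pow (u : Rep A) (m : ℕ) (x : X.bimod u.mat) (j : u.ι) :
    ((w.DM u ^ (2 * m)) x).1 j = (-1 : ℂ) ^ m • ∑ l, x.1 l * (w.curv u ^ m) l j := by
  induction m generalizing x with
  | zero =>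
    simp [Matrix.one_apply]
  | succ m ih =>
    have h1 : w.DM u ^ (2 * (m + 1)) = w.DM u ^ (2 * m) * (w.DM u * w.DM u) := by
      rw [mul_add, mul_one, pow_add, sq]
    have h2 : ∀ l, ((w.DM u * w.DM u) x).1 l = -∑ k, x.1 k * w.curv u k l :=
      fun l => w.D_D x.2 l
    rw [h1, Module.End.mul_apply, ih]
    simp only [h2, pow_succ', Matrix.mul_apply, Finset.mul_sum, neg_mul, Finset.sum_mul,
      Finset.sum_neg_distrib, smul_neg, neg_smul, one_mul, mul_assoc]
    rw [Finset.sum_comm]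

lemma compOp_D_pow (u : Rep A) (z : X.base) (m : ℕ) (x : X.bimod u.mat) :
    X.compOp u (LinearMap.mulLeft ℂ (z : Ω) ∘ₗ w.D ^ m) x
      = ((X.lmul u z * w.DM u ^ m) x).1 := by
  have h : ∀ i, (w.D ^ m) (x.1 i) = ((w.DM u ^ m) x).1 i := by
    induction m with
    | zero => intro i; rfl
    | succ m ih =>
      intro i
      rw [pow_succ', pow_succ', Module.End.mul_apply, ih]; rfl
  ext i
  change z * (w.D ^ m) (x.1 i) = z * ((w.DM u ^ m) x).1 i
  rw [h]

end RegularConnection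

end Calc

end Bundles
end QPB

namespace QPB

section Bundles

open FODC

variable {A Γ : Type*} [Ring A] [HopfAlgebra ℂ A] [StarRing A] [StarModule ℂ A]
    [AddCommGroup Γ] [Module ℂ Γ] [Module A Γ] [Module Aᵐᵒᵖ Γ] [SMulCommClass A Aᵐᵒᵖ Γ]
    [IsScalarTower ℂ A Γ] [IsScalarTower ℂ Aᵐᵒᵖ Γ]

variable {B Ω : Type*} [Ring B] [Algebra ℂ B] [StarRing B] [StarModule ℂ B]
  [Ring Ω] [Algebra ℂ Ω]

namespace Calc

variable {c : FODC A Γ} {P : Bundle A B} {𝒪 : ℕ → Submodule ℂ Ω} [GradedAlgebra 𝒪]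

/-! ### Characteristic operators on the cohomology of the graded centre -/

section
variable {X : Calc c P 𝒪}

include X in
lemma gpr_d (n : ℕ) (x : Ω) : gpr 𝒪 (n + 1) (X.d x) = X.d (gpr 𝒪 n x) := by
  induction x using DirectSum.Decomposition.inductionOn 𝒪 with
  | zero => simp
  | add x y hx hy => simp only [map_add, hx, hy]
  | @homogeneous m x =>
    rcases eq_or_ne m n with rfl | h
    · rw [gpr_same x.2, gpr_same (X.d_mem _ _ x.2)]
    · rw [gpr_ne x.2 h, gpr_ne (X.d_mem _ _ x.2) (by omega), map_zero]

lemma parity_gpr_pow (n q : ℕ) (x : Ω) :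
    gpr 𝒪 n ((parity 𝒪 ^ q) x) = (parity 𝒪 ^ q) (gpr 𝒪 n x) := by
  induction q with
  | zero => rfl
  | succ q ih =>
    rw [pow_succ', Module.End.mul_apply, Module.End.mul_apply, ← ih, gpr_parity]

end

namespace RegularConnection

variable {X : Calc c P 𝒪} (w : X.RegularConnection) [IsCompactMatrixQuantumGroup A]

include w in
lemma gpr_mem_Z (n : ℕ) {z : Ω} (hz : z ∈ X.Z) : gpr 𝒪 n z ∈ X.Z := by
  refine ⟨w.gpr_mem_base n hz.1, fun q α hα => ?_⟩
  have h := congrArg (gpr 𝒪 (n + q)) (hz.2 q α hα)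
  rw [gpr_mul_right n z hα.2, add_comm n q, gpr_mul_left n hα.2, parity_gpr_pow] at h
  exact h

include w in
lemma gpr_mem_closed (n : ℕ) {z : Ω} (hz : z ∈ X.closed) : gpr 𝒪 n z ∈ X.closed := by
  refine ⟨w.gpr_mem_Z n hz.1, ?_⟩
  change X.d (gpr 𝒪 n z) = 0
  rw [← gpr_d, LinearMap.mem_ker.1 hz.2, map_zero]

/-- The trace `tr(y D^{2k})` as a function of `y`. -/
def tauL {u : Rep A} (S : X.DualFam u) (k : ℕ) : X.base →ₗ[ℂ] Ω :=
  S.tr ∘ₗ LinearMap.mulRight ℂ (w.DM u ^ (2 * k)) ∘ₗ X.lmul u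

variable {u : Rep A} (S : X.DualFam u)

lemma tauL_apply (k : ℕ) (y : X.base) : w.tauL S k y = S.tr (X.lmul u y * w.DM u ^ (2 * k)) := rfl

lemma DM_pow_mem_Lin (k : ℕ) : w.DM u ^ (2 * k) ∈ w.Lin u 0 := by
  rw [pow_mul, sq]
  induction k with
  | zero => exact w.one_mem_Lin
  | succ k ih => exact w.Lin_mul ih (w.isConn_DM u).sq_mem

lemma lmul_DM_mem_Lin {y : X.base} (hy : (y : Ω) ∈ X.Z) {p : ℕ} (hp : (y : Ω) ∈ 𝒪 p) (k : ℕ) :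
    X.lmul u y * w.DM u ^ (2 * k) ∈ w.Lin u p :=
  w.Lin_mul (w.lmul_mem_Lin hy hp) (w.DM_pow_mem_Lin k)

lemma DM_pow_mem {x : X.bimod u.mat} {n : ℕ} (hx : ∀ i, x.1 i ∈ 𝒪 n) (k : ℕ) (i : u.ι) :
    ((w.DM u ^ k) x).1 i ∈ 𝒪 (n + k) := by
  induction k generalizing i with
  | zero => exact hx i
  | succ k ih =>
    rw [pow_succ', Module.End.mul_apply]
    exact w.D_mem (((w.DM u ^ k) x).2 i).1 (ih i)

lemma tauL_mem {y : X.base} {p : ℕ} (hp : (y : Ω) ∈ 𝒪 p) (k : ℕ) :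
    w.tauL S k y ∈ 𝒪 (p + 2 * k) := by
  refine sum_mem fun m _ => sum_mem fun i _ => sum_mem fun j _ => Submodule.smul_mem _ _ ?_
  have h1 := w.DM_pow_mem (S.μ_zero m) (2 * k) j
  have h2 := SetLike.mul_mem_graded (S.ν_zero m i) (SetLike.mul_mem_graded hp h1)
  simpa using h2

/-- Linear identities on a subspace stable under the projections to the homogeneous components
can be checked on homogeneous elements. -/
lemma ext_of_gpr {N : Submodule ℂ Ω} (hN : ∀ n, ∀ x ∈ N, gpr 𝒪 n x ∈ N) {V : Type*}
    [AddCommMonoid V] [Module ℂ V] {f g : N →ₗ[ℂ] V}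
    (h : ∀ n, ∀ x : N, (x : Ω) ∈ 𝒪 n → f x = g x) : f = g := by
  ext x
  obtain ⟨M, hM⟩ := exists_sum_gpr (𝒢 := 𝒪) (x : Ω)
  have : x = ∑ n ∈ Finset.range M, (⟨gpr 𝒪 n x, hN n x x.2⟩ : N) := by
    apply Subtype.ext
    rw [Submodule.coe_sum]; exact hM.symm
  rw [this, map_sum, map_sum]
  exact Finset.sum_congr rfl fun n _ => h n _ (gpr_mem 𝒪 n _)

lemma Z_le_base : X.Z ≤ X.base := fun _ h => h.1

lemma tauL_mem_Z (k : ℕ) {y : X.base} (hy : (y : Ω) ∈ X.Z) : w.tauL S k y ∈ X.Z := by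
  have h : X.Z.mkQ ∘ₗ w.tauL S k ∘ₗ Submodule.inclusion Z_le_base = 0 := by
    refine ext_of_gpr (𝒪 := 𝒪) (fun n x hx => w.gpr_mem_Z n hx) fun n x hn => ?_
    exact (Submodule.Quotient.mk_eq_zero _).2
      (w.tr_mem_Z S (w.lmul_DM_mem_Lin (y := ⟨x, x.2.1⟩) x.2 hn k))
  exact (Submodule.Quotient.mk_eq_zero _).1 (LinearMap.congr_fun h ⟨y, hy⟩)

/-- As `D` commutes with `D^{2k}`, the graded commutator of `D` with `y D^{2k}` is `(dy) D^{2k}`.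
Thus closed elements go to closed ones and boundaries to boundaries. -/
lemma d_tauL (k : ℕ) {y : X.base} (hy : (y : Ω) ∈ X.Z) :
    X.d (w.tauL S k y) = w.tauL S k (w.dB y) := by
  have h : X.d ∘ₗ w.tauL S k ∘ₗ Submodule.inclusion Z_le_base
      = w.tauL S k ∘ₗ w.dB ∘ₗ Submodule.inclusion Z_le_base := by
    refine ext_of_gpr (𝒪 := 𝒪) (fun n x hx => w.gpr_mem_Z n hx) fun n x hn => ?_
    set y : X.base := ⟨x, x.2.1⟩
    have h1 := (w.compat_DM S).d_tr (w.lmul_DM_mem_Lin (y := y) x.2 hn k).1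
    have h2 : w.DM u * (X.lmul u y * w.DM u ^ (2 * k))
        = X.lmul u (w.dB y) * w.DM u ^ (2 * k)
          + (-1 : ℂ) ^ n • (X.lmul u y * w.DM u ^ (2 * k) * w.DM u) := by
      rw [← mul_assoc, (w.isConn_DM u).left n y hn, add_mul, smul_mul_assoc, mul_assoc, mul_assoc,
        ← pow_succ', ← pow_succ]
    rw [h2, map_add, map_smul, add_sub_cancel_right] at h1
    exact h1
  exact LinearMap.congr_fun h ⟨y, hy⟩

lemma tauL_mem_closed (k : ℕ) {y : X.base} (hy : (y : Ω) ∈ X.closed) :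
    w.tauL S k y ∈ X.closed := by
  refine ⟨w.tauL_mem_Z S k hy.1, ?_⟩
  change X.d (w.tauL S k y) = 0
  rw [w.d_tauL S k hy.1]
  have : w.dB y = 0 := Subtype.ext hy.2
  rw [this, map_zero]

lemma closed_le_base : X.closed ≤ X.base := fun _ h => h.1.1

/-- The trace `tr(y D^{2k})` on closed elements. -/
def tauC (k : ℕ) : X.closed →ₗ[ℂ] X.closed :=
  LinearMap.codRestrict X.closed (w.tauL S k ∘ₗ Submodule.inclusion closed_le_base)
    fun y => w.tauL_mem_closed S k (y := ⟨y, closed_le_base y.2⟩) y.2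

lemma coe_tauC (k : ℕ) (y : X.closed) :
    (w.tauC S k y : Ω) = w.tauL S k ⟨y, closed_le_base y.2⟩ := rfl

/-- The operator `[y] ↦ [tr(y D^{2k})]`. -/
def tauFam (k : ℕ) : Module.End ℂ X.HZ :=
  Submodule.mapQ _ _ (w.tauC S k) (by
    rintro ⟨_, hy⟩ ⟨z, hz, rfl⟩
    refine ⟨w.tauL S k ⟨z, hz.1⟩, w.tauL_mem_Z S k hz, ?_⟩
    exact w.d_tauL S k (y := ⟨z, hz.1⟩) hz)

lemma tauFam_cls (k : ℕ) (y : X.closed) : w.tauFam S k (X.cls y) = X.cls (w.tauC S k y) := rfl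

lemma tauFam_mem (k p : ℕ) {ξ : X.HZ} (hξ : ξ ∈ X.HZdeg p) :
    w.tauFam S k ξ ∈ X.HZdeg (p + 2 * k) := by
  obtain ⟨y, hy, rfl⟩ := hξ
  exact ⟨w.tauC S k y, w.tauL_mem S (y := ⟨y, closed_le_base y.2⟩) hy k, rfl⟩

lemma cls_eq {x y : X.closed} (h : (x : Ω) - y ∈ X.Z.map X.d) : X.cls x = X.cls y :=
  (Submodule.Quotient.eq _).2 h

include w in
lemma HZ_end_ext {f g : Module.End ℂ X.HZ}
    (h : ∀ n, ∀ y : X.closed, (y : Ω) ∈ 𝒪 n → f (X.cls y) = g (X.cls y)) : f = g := by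
  refine LinearMap.ext fun ξ => ?_
  obtain ⟨y, rfl⟩ := Submodule.mkQ_surjective _ ξ
  have : f ∘ₗ X.cls = g ∘ₗ X.cls :=
    ext_of_gpr (𝒪 := 𝒪) (fun n x hx => w.gpr_mem_closed n hx) h
  exact LinearMap.congr_fun this y

/-- One family may serve for both connections, the trace being independent of it; then the
transgression `tr_sub_mem` applies on representatives. -/
lemma tauFam_eq_of_conn {w' : X.RegularConnection} {S S' : X.DualFam u}
    {E : Module.End ℂ (X.bimod u.mat)} (hE : w'.DM u = w.DM u + E) (k : ℕ) :
    w'.tauFam S' k = w.tauFam S k := by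
  refine w.HZ_end_ext fun n y hy => ?_
  rw [tauFam_cls, tauFam_cls]
  refine cls_eq ?_
  rw [coe_tauC, coe_tauC]
  set z : X.base := ⟨y, closed_le_base y.2⟩
  rw [tauL_apply, tauL_apply, S'.tr_eq S (w'.lmul_DM_mem_Lin (y := z) y.2.1 hy k).1, hE]
  have h1 : w.IsConn (w.DM u + E) := by
    rw [← hE]
    exact ⟨(w'.isConn_DM u).left, (w'.isConn_DM u).right, (w'.isConn_DM u).par⟩
  have h2 := w'.compat_DM S
  rw [hE] at h2
  exact w.tr_sub_mem (w.isConn_DM u) (w.compat_DM S) h1 h2 (y := z) y.2.1 hy (Subtype.ext y.2.2) k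

/-- The operator does not depend on the connection and on the family. -/
lemma tauFam_eq (w' : X.RegularConnection) (S S' : X.DualFam u) (k : ℕ) :
    w'.tauFam S' k = w.tauFam S k := by
  refine w.tauFam_eq_of_conn (E := w'.DM u + (-1 : ℂ) • w.DM u) ?_ k
  ext x i
  simp

end RegularConnection

end Calc

end Bundles
end QPB

namespace QPB

section Bundles

open FODC

variable {A Γ : Type*} [Ring A] [HopfAlgebra ℂ A] [StarRing A] [StarModule ℂ A]
    [AddCommGroup Γ] [Module ℂ Γ] [Module A Γ] [Module Aᵐᵒᵖ Γ] [SMulCommClass A Aᵐᵒᵖ Γ]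
    [IsScalarTower ℂ A Γ] [IsScalarTower ℂ Aᵐᵒᵖ Γ]

variable {B Ω : Type*} [Ring B] [Algebra ℂ B] [StarRing B] [StarModule ℂ B]
  [Ring Ω] [Algebra ℂ Ω]

namespace Calc

variable {c : FODC A Γ} {P : Bundle A B} {𝒪 : ℕ → Submodule ℂ Ω} [GradedAlgebra 𝒪]

/-! ### Invariance of the characteristic operators under equivalence -/

namespace RegularConnection

variable {X : Calc c P 𝒪} (w : X.RegularConnection) [IsCompactMatrixQuantumGroup A]

/-- The projection of the bimodule of `u` to its part of degree `n`. -/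
def gprM (u : Rep A) (n : ℕ) : Module.End ℂ (X.bimod u.mat) where
  toFun x := ⟨fun i => gpr 𝒪 n (x.1 i), w.gpr_mem_bimod n x.2⟩
  map_add' x y := by ext i; simp
  map_smul' r x := by ext i; simp

variable {u v : Rep A}

@[simp] lemma gprM_apply (n : ℕ) (x : X.bimod u.mat) (i : u.ι) :
    (w.gprM u n x).1 i = gpr 𝒪 n (x.1 i) := rfl

lemma exists_sum_gprM (x : X.bimod u.mat) : ∃ N, ∑ n ∈ Finset.range N, w.gprM u n x = x := by
  choose N hN using fun i => exists_gpr_bound (𝒢 := 𝒪) (x.1 i)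
  refine ⟨∑ i, N i, ?_⟩
  ext i
  rw [Submodule.coe_sum, Finset.sum_apply]
  refine sum_gpr fun n hn => hN i n (le_trans ?_ hn)
  exact Finset.single_le_sum (fun _ _ => Nat.zero_le _) (Finset.mem_univ i)

lemma gprM_comm {J : X.bimod u.mat →ₗ[ℂ] X.bimod v.mat}
    (hJ : ∀ n, ∀ x : X.bimod u.mat, (∀ i, x.1 i ∈ 𝒪 n) → ∀ i, (J x).1 i ∈ 𝒪 n) (n : ℕ)
    (x : X.bimod u.mat) : w.gprM v n (J x) = J (w.gprM u n x) := by
  obtain ⟨N, hN⟩ := w.exists_sum_gprM x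
  have h : ∀ m, ∀ y : X.bimod u.mat, (∀ i, y.1 i ∈ 𝒪 m) →
      w.gprM v n (J y) = J (w.gprM u n y) := by
    intro m y hy
    rcases eq_or_ne m n with rfl | hm
    · have h1 : w.gprM u m y = y := by ext i; exact gpr_same (hy i)
      rw [h1]; ext i; exact gpr_same (hJ m y hy i)
    · have h1 : w.gprM u n y = 0 := by ext i; exact gpr_ne (hy i) hm
      rw [h1, map_zero]; ext i; exact gpr_ne (hJ m y hy i) hm
  rw [← hN, map_sum, map_sum, map_sum, map_sum]
  exact Finset.sum_congr rfl fun m _ => h m _ fun i => gpr_mem 𝒪 m _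

lemma par_comm {J : X.bimod u.mat →ₗ[ℂ] X.bimod v.mat}
    (hJ : ∀ n, ∀ x : X.bimod u.mat, (∀ i, x.1 i ∈ 𝒪 n) → ∀ i, (J x).1 i ∈ 𝒪 n)
    (x : X.bimod u.mat) : w.par v (J x) = J (w.par u x) := by
  obtain ⟨N, hN⟩ := w.exists_sum_gprM x
  have h : ∀ m, ∀ y : X.bimod u.mat, (∀ i, y.1 i ∈ 𝒪 m) → w.par v (J y) = J (w.par u y) := by
    intro m y hy
    have h1 : w.par u y = (-1 : ℂ) ^ m • y := by ext i; exact parity_of_mem (hy i)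
    rw [h1, map_smul]; ext i; exact parity_of_mem (hJ m y hy i)
  rw [← hN, map_sum, map_sum, map_sum, map_sum]
  exact Finset.sum_congr rfl fun m _ => h m _ fun i => gpr_mem 𝒪 m _

include w in
-- A linear map preserving degrees commutes with the projections to homogeneous parts, and
-- injectivity passes this to the inverse.
lemma symm_mem {J : X.bimod u.mat ≃ₗ[ℂ] X.bimod v.mat}
    (hJ : ∀ n, ∀ x : X.bimod u.mat, (∀ i, x.1 i ∈ 𝒪 n) → ∀ i, (J x).1 i ∈ 𝒪 n) {n : ℕ}
    {y : X.bimod v.mat} (hy : ∀ i, y.1 i ∈ 𝒪 n) (i : u.ι) : (J.symm y).1 i ∈ 𝒪 n := by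
  have h1 : w.gprM u n (J.symm y) = J.symm y := by
    apply J.injective
    rw [← LinearEquiv.coe_toLinearMap, ← w.gprM_comm (J := J.toLinearMap) hJ,
      LinearEquiv.coe_toLinearMap, J.apply_symm_apply]
    ext i; exact gpr_same (hy i)
  rw [← h1]
  exact gpr_mem 𝒪 n _

/-- The transport of a dual family along an equivalence. -/
def transport (S : X.DualFam v) (J : X.bimod u.mat ≃ₗ[ℂ] X.bimod v.mat)
    (T : X.bimod v.contra →ₗ[ℂ] X.bimod u.contra)
    (hl : ∀ (α : X.base) x, J (X.lmul u α x) = X.lmul v α (J x))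
    (hd : ∀ n, ∀ x : X.bimod u.mat, (∀ i, x.1 i ∈ 𝒪 n) → ∀ i, (J x).1 i ∈ 𝒪 n)
    (hp : ∀ x φ, pairPlus (J x).1 φ.1 = pairPlus x.1 (T φ).1) : X.DualFam u where
  κ := S.κ
  fin := S.fin
  ν k := T (S.ν k)
  μ k := J.symm (S.μ k)
  -- Nothing is assumed about the degree of the transposed map. It is recovered by expanding `T ν_k`
  -- in a family of `u`: the coefficients `⟨μ'_m, T ν_k⟩⁺ = ⟨J μ'_m, ν_k⟩⁺` have degree zero.
  ν_zero k i := by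
    obtain ⟨S'⟩ := X.nonempty_dualFamily u
    rw [← S'.fam.sum_ν_mul_pairPlus (T (S.ν k)).1 i]
    refine sum_mem fun m _ => ?_
    rw [← hp]
    have h : pairPlus (J (S'.fam.μ m)).1 (S.ν k).1 ∈ 𝒪 0 := sum_mem fun l _ => by
      simpa using SetLike.mul_mem_graded (hd 0 _ (S'.fam.μ_zero m) l) (S.ν_zero k l)
    simpa using SetLike.mul_mem_graded (S'.fam.ν_zero m i) h
  μ_zero k := w.symm_mem hd (S.μ_zero k)
  sum_eq r j := by
    obtain ⟨S'⟩ := X.nonempty_dualFamily u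
    -- The transported elements reproduce every `x`. Evaluated on the intertwiners of another family
    -- and cancelled by its `ν'`, this yields the duality relation for the matrices themselves.
    have h1 : ∀ x : X.bimod u.mat,
        ∑ k, X.lmul u (X.pp u x (T (S.ν k))) (J.symm (S.μ k)) = x := by
      intro x
      apply J.injective
      rw [map_sum]
      simp only [hl, J.apply_symm_apply]
      conv_rhs => rw [← S.sum_lmul (J x)]
      refine Finset.sum_congr rfl fun k _ => ?_
      congr 2
      exact Subtype.ext (hp _ _).symm
    have h2 : ∀ x : X.bimod u.mat,
        ∑ i, x.1 i * ∑ k, (T (S.ν k)).1 i * (J.symm (S.μ k)).1 j = x.1 j := by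
      intro x
      have h3 := congrFun (congrArg Subtype.val (h1 x)) j
      rw [Submodule.coe_sum, Finset.sum_apply] at h3
      conv_rhs => rw [← h3]
      simp only [lmul_apply, pp, pairPlus, Finset.sum_mul, Finset.mul_sum, mul_assoc]
      exact Finset.sum_comm
    have h3 := S'.fam.sum_ν_mul_pairPlus
      (fun i => ∑ k, (T (S.ν k)).1 i * (J.symm (S.μ k)).1 j) r
    simp only [pairPlus, h2] at h3
    rw [← h3]
    exact S'.fam.sum_eq r j

/-- The characteristic operators of equivalent bimodules coincide. -/
lemma tauFam_equiv (h : X.Equivalent u v) (S : X.DualFam u) (S' : X.DualFam v) (k : ℕ) :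
    w.tauFam S k = w.tauFam S' k := by
  obtain ⟨J, T, hl, hr, hd, hp, hm⟩ := h
  replace hl : ∀ (α : X.base) x, J (X.lmul u α x) = X.lmul v α (J x) := fun α x =>
    Subtype.ext (funext (hl α α.2 x (X.lmul u α x) fun _ => rfl))
  replace hr : ∀ (α : X.base) x, J (X.rmul u α x) = X.rmul v α (J x) := fun α x =>
    Subtype.ext (funext (hr α α.2 x (X.rmul u α x) fun _ => rfl))
  have hpar : ∀ x, J (w.par u x) = w.par v (J x) := fun x =>
    (w.par_comm (J := J.toLinearMap) hd x).symm
  rw [w.tauFam_eq w (w.transport S' J T hl hd hp) S]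
  set S₁ := w.transport S' J T hl hd hp with hS₁
  -- The conjugate of the covariant derivative of `v` by `J` is a second connection on the bimodule
  -- of `u`, to be compared with the given one by transgression.
  let n : Module.End ℂ (X.bimod u.mat) := J.symm.toLinearMap ∘ₗ w.DM v ∘ₗ J.toLinearMap
  have hn : ∀ x, J (n x) = w.DM v (J x) := fun x => J.apply_symm_apply _
  have hnpow : ∀ m x, J ((n ^ m) x) = (w.DM v ^ m) (J x) := by
    intro m
    induction m with
    | zero => intro x; rfl
    | succ m ih =>
      intro x
      rw [pow_succ', pow_succ', Module.End.mul_apply, Module.End.mul_apply, hn, ih]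
  have hconn : w.IsConn n := by
    have h1 := w.isConn_DM v
    refine ⟨fun q α hα => ?_, fun α => ?_, ?_⟩
    · refine LinearMap.ext fun x => J.injective ?_
      have := LinearMap.congr_fun (h1.left q α hα) (J x)
      simp only [Module.End.mul_apply, LinearMap.add_apply, LinearMap.smul_apply] at this
      simp only [Module.End.mul_apply, LinearMap.add_apply, LinearMap.smul_apply, map_add,
        map_smul, hn, hl, this]
    · refine LinearMap.ext fun x => J.injective ?_
      have := LinearMap.congr_fun (h1.right α) (J x)
      simp only [Module.End.mul_apply, LinearMap.add_apply] at this
      simp only [Module.End.mul_apply, LinearMap.add_apply, map_add, hn, hr, this, hpar]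
    · refine LinearMap.ext fun x => J.injective ?_
      have := LinearMap.congr_fun h1.par (J x)
      simp only [Module.End.mul_apply, LinearMap.smul_apply] at this
      simp only [Module.End.mul_apply, LinearMap.smul_apply, map_smul, hn, this, hpar]
  -- Transposability is used here: the same `T` is transposed to `J` for both pairings, so one `η`
  -- serves in `plus` and in `minus`.
  have hcompat : S₁.Compat n fun k => (T ⟨_, w.D_mem_bimod (S'.ν k).2⟩).1 := by
    have h1 := w.compat_DM S'
    have hμ : ∀ k, J (S₁.μ k) = S'.μ k := fun k => J.apply_symm_apply _
    have hν : ∀ k, S₁.ν k = T (S'.ν k) := fun k => rfl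
    refine ⟨fun k m => ?_, fun k x => ?_, fun k m => ?_⟩
    · rw [hν, ← hp, ← hp, ← hp, hn, hμ]
      exact h1.plus k m
    · rw [hν, ← hm, ← hm, ← hm, hn]
      exact h1.minus k (J x)
    · rw [hν, ← hp, hn, hμ]
      exact h1.mem k m
  obtain ⟨E, hE⟩ : ∃ E, n = w.DM u + E :=
    ⟨n + (-1 : ℂ) • w.DM u, by ext x i; simp⟩
  refine w.HZ_end_ext fun p y hy => ?_
  rw [tauFam_cls, tauFam_cls]
  symm
  refine cls_eq ?_
  rw [coe_tauC, coe_tauC, tauL_apply, tauL_apply]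
  set z : X.base := ⟨y, closed_le_base y.2⟩
  have htr : S'.tr (X.lmul v z * w.DM v ^ (2 * k)) = S₁.tr (X.lmul u z * n ^ (2 * k)) := by
    rw [DualFam.tr_apply, DualFam.tr_apply]
    refine Finset.sum_congr rfl fun m _ => ?_
    change _ = pairMinus u (T (S'.ν m)).1 _
    rw [← hm, Module.End.mul_apply, Module.End.mul_apply, hl, hnpow]
    change _ = pairMinus v _ (X.lmul v z ((w.DM v ^ (2 * k)) (J (J.symm (S'.μ m))))).1
    rw [J.apply_symm_apply]
  rw [htr, hE]
  rw [hE] at hconn hcompat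
  exact w.tr_sub_mem (w.isConn_DM u) (w.compat_DM S₁) hconn hcompat (y := z) y.2.1 hy
    (Subtype.ext y.2.2) k

end RegularConnection

end Calc

end Bundles
end QPB

namespace QPB

section Bundles

open FODC

variable {A Γ : Type*} [Ring A] [HopfAlgebra ℂ A] [StarRing A] [StarModule ℂ A]
    [AddCommGroup Γ] [Module ℂ Γ] [Module A Γ] [Module Aᵐᵒᵖ Γ] [SMulCommClass A Aᵐᵒᵖ Γ]
    [IsScalarTower ℂ A Γ] [IsScalarTower ℂ Aᵐᵒᵖ Γ]

variable {B Ω : Type*} [Ring B] [Algebra ℂ B] [StarRing B] [StarModule ℂ B]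
  [Ring Ω] [Algebra ℂ Ω]

namespace Calc

variable {c : FODC A Γ} {P : Bundle A B} {𝒪 : ℕ → Submodule ℂ Ω} [GradedAlgebra 𝒪]

/-! ### Sums, products and the unit -/

namespace RegularConnection

variable {X : Calc c P 𝒪} (w : X.RegularConnection) [IsCompactMatrixQuantumGroup A]

lemma D_pow_eq {u : Rep A} (m : ℕ) (x : X.bimod u.mat) (i : u.ι) :
    ((w.DM u ^ m) x).1 i = (w.D ^ m) (x.1 i) := by
  induction m with
  | zero => rfl
  | succ m ih => rw [pow_succ', pow_succ', Module.End.mul_apply, Module.End.mul_apply, ← ih]; rfl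

lemma tauL_eq_sum {u : Rep A} (S : X.DualFam u) (k : ℕ) (y : X.base) :
    w.tauL S k y
      = ∑ a, pairMinus u (S.ν a).1 fun j => y * (w.D ^ (2 * k)) ((S.μ a).1 j) := by
  rw [tauL_apply, DualFam.tr_apply]
  refine Finset.sum_congr rfl fun a _ => ?_
  congr 1
  ext j
  rw [Module.End.mul_apply, lmul_apply, D_pow_eq]

lemma tauL_mem_base {u : Rep A} (S : X.DualFam u) (k : ℕ) (y : X.base) :
    w.tauL S k y ∈ X.base :=
  S.tr_mem_base _

end RegularConnection

/-- The pairing `∑ ij, C_{ji} ψ_i φ_j`. -/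
def pairMat {ι : Type} [Fintype ι] (C : Matrix ι ι ℂ) (ψ φ : ι → Ω) : Ω :=
  ∑ i, ∑ k, C k i • (ψ i * φ k)

section
variable {ι ι' : Type} [Fintype ι] [Fintype ι']

lemma pairMat_sum_right {κ : Type*} (s : Finset κ) (n : κ → ℕ) (C : Matrix ι ι ℂ) (ψ : ι → Ω)
    (f : κ → ι → Ω) :
    pairMat C ψ (fun q => ∑ p ∈ s, n p • f p q) = ∑ p ∈ s, n p • pairMat C ψ (f p) := by
  simp only [pairMat, Finset.mul_sum, Finset.smul_sum, mul_smul_comm]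
  calc _ = ∑ i, ∑ p ∈ s, ∑ k, C k i • n p • (ψ i * f p k) :=
        Finset.sum_congr rfl fun i _ => Finset.sum_comm
    _ = _ := by
      rw [Finset.sum_comm]
      exact Finset.sum_congr rfl fun p _ => Finset.sum_congr rfl fun i _ =>
        Finset.sum_congr rfl fun k _ => smul_comm _ _ _

lemma pairMat_elim_left (C : Matrix ι ι ℂ) (D : Matrix ι' ι' ℂ) (ψ φ : ι → Ω) :
    pairMat (Matrix.fromBlocks C 0 0 D) (Sum.elim ψ 0) (Sum.elim φ 0) = pairMat C ψ φ := by
  simp [pairMat]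

lemma pairMat_elim_right (C : Matrix ι ι ℂ) (D : Matrix ι' ι' ℂ) (ψ φ : ι' → Ω) :
    pairMat (Matrix.fromBlocks C 0 0 D) (Sum.elim 0 ψ) (Sum.elim 0 φ) = pairMat D ψ φ := by
  simp [pairMat]

/-- The dual elements stand in the order `ψ φ`, so the pairing over the first factor is enclosed by
the one over the second: traces of products become nested traces. -/
lemma pairMat_kronecker (C : Matrix ι ι ℂ) (D : Matrix ι' ι' ℂ) (φ x : ι → Ω) (ψ z : ι' → Ω)
    (y : Ω) :
    pairMat (Matrix.kroneckerMap (· * ·) C D) (fun p => ψ p.2 * φ p.1)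
        (fun q => y * (x q.1 * z q.2))
      = pairMat D ψ fun j => pairMat C φ (fun i => y * x i) * z j := by
  simp only [pairMat, Fintype.sum_prod_type, Matrix.kroneckerMap_apply, Finset.sum_mul,
    Finset.mul_sum, Finset.smul_sum, smul_mul_assoc, mul_smul_comm, smul_smul]
  rw [Finset.sum_comm]
  refine Finset.sum_congr rfl fun j _ => ?_
  calc _ = ∑ i, ∑ j', ∑ i', (C i' i * D j' j) • (ψ j * φ i * (y * (x i' * z j'))) :=
        Finset.sum_congr rfl fun i _ => Finset.sum_comm
    _ = _ := by
      rw [Finset.sum_comm]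
      simp only [mul_assoc, mul_comm (D _ j)]

end

variable {X : Calc c P 𝒪} [IsCompactMatrixQuantumGroup A]

section add
variable {u v : Rep A}

lemma elim_mem_left {ι ι' : Type} [Fintype ι] [Fintype ι'] {v₁ : Matrix ι ι A} {x : ι → Ω}
    (hx : x ∈ X.bimod v₁) (v₂ : Matrix ι' ι' A) :
    (Sum.elim x 0 : ι ⊕ ι' → Ω) ∈ X.bimod (Matrix.fromBlocks v₁ 0 0 v₂) := by
  rintro (i | i)
  · exact ⟨(hx i).1, by rw [Sum.elim_inl, (hx i).2]; simp⟩
  · exact ⟨zero_mem _, by simp⟩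

lemma elim_mem_right {ι ι' : Type} [Fintype ι] [Fintype ι'] {v₂ : Matrix ι' ι' A} {x : ι' → Ω}
    (v₁ : Matrix ι ι A) (hx : x ∈ X.bimod v₂) :
    (Sum.elim 0 x : ι ⊕ ι' → Ω) ∈ X.bimod (Matrix.fromBlocks v₁ 0 0 v₂) := by
  rintro (i | i)
  · exact ⟨zero_mem _, by simp⟩
  · exact ⟨(hx i).1, by rw [Sum.elim_inr, (hx i).2]; simp⟩

variable (u v) in
lemma _root_.QPB.Rep.contra_add : (u.add v).contra
    = (Matrix.fromBlocks u.contra 0 0 v.contra : Matrix (u.ι ⊕ v.ι) (u.ι ⊕ v.ι) A) := by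
  funext i j
  rcases i with i | i <;> rcases j with j | j
  · rfl
  · exact map_zero _
  · exact map_zero _
  · rfl

/-- The dual family of a direct sum. -/
def DualFam.add (S : X.DualFam u) (S' : X.DualFam v) : X.DualFam (u.add v) where
  κ := S.κ ⊕ S'.κ
  ν := Sum.elim (fun k => ⟨Sum.elim (S.ν k).1 0, Rep.contra_add u v ▸ elim_mem_left (S.ν k).2 _⟩)
    fun k => ⟨Sum.elim 0 (S'.ν k).1, Rep.contra_add u v ▸ elim_mem_right _ (S'.ν k).2⟩
  μ := Sum.elim (fun k => ⟨Sum.elim (S.μ k).1 0, elim_mem_left (S.μ k).2 v.mat⟩)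
    fun k => ⟨Sum.elim 0 (S'.μ k).1, elim_mem_right u.mat (S'.μ k).2⟩
  ν_zero := by
    rintro (k | k) (i | i)
    · exact S.ν_zero k i
    · exact zero_mem _
    · exact zero_mem _
    · exact S'.ν_zero k i
  μ_zero := by
    rintro (k | k) (i | i)
    · exact S.μ_zero k i
    · exact zero_mem _
    · exact zero_mem _
    · exact S'.μ_zero k i
  sum_eq i j := by
    refine (Fintype.sum_sum_type _).trans ?_
    rcases i with i | i <;> rcases j with j | j
    · change ∑ k, (S.ν k).1 i * (S.μ k).1 j + ∑ k : S'.κ, (0 : Ω) * 0 = _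
      rw [S.sum_eq]
      by_cases h : i = j
      · subst h
        rw [if_pos rfl]
        exact Eq.trans (by simp) (if_pos rfl).symm
      · rw [if_neg h]
        exact Eq.trans (by simp) (if_neg fun h' => h (Sum.inl_injective h')).symm
    · change ∑ k, (S.ν k).1 i * 0 + ∑ k : S'.κ, 0 * (S'.μ k).1 j = _
      exact Eq.trans (by simp) (if_neg Sum.inl_ne_inr).symm
    · change ∑ k, 0 * (S.μ k).1 j + ∑ k : S'.κ, (S'.ν k).1 i * 0 = _
      exact Eq.trans (by simp) (if_neg Sum.inr_ne_inl).symm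
    · change ∑ k : S.κ, (0 : Ω) * 0 + ∑ k, (S'.ν k).1 i * (S'.μ k).1 j = _
      rw [S'.sum_eq]
      by_cases h : i = j
      · subst h
        rw [if_pos rfl]
        exact Eq.trans (by simp) (if_pos rfl).symm
      · rw [if_neg h]
        exact Eq.trans (by simp) (if_neg fun h' => h (Sum.inr_injective h')).symm

lemma inv_fromBlocks {ι ι' : Type} [Fintype ι] [Fintype ι'] [DecidableEq ι] [DecidableEq ι']
    {C : Matrix ι ι ℂ} {D : Matrix ι' ι' ℂ} (hC : C⁻¹ * C = 1) (hD : D⁻¹ * D = 1) :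
    (Matrix.fromBlocks C 0 0 D)⁻¹ = Matrix.fromBlocks C⁻¹ 0 0 D⁻¹ := by
  refine Matrix.inv_eq_left_inv ?_
  rw [Matrix.fromBlocks_multiply]
  simp [hC, hD]

lemma canon_add_inv (u v : Rep A) : (u.add v).canon⁻¹
    = (Matrix.fromBlocks u.canon⁻¹ 0 0 v.canon⁻¹ : Matrix (u.ι ⊕ v.ι) (u.ι ⊕ v.ι) ℂ) := by
  rw [Rep.canon_add]
  exact inv_fromBlocks u.isCanonical_canon.posDef.inv_mul_self
    v.isCanonical_canon.posDef.inv_mul_self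

lemma pairMinus_elim_left (ψ φ : u.ι → Ω) :
    pairMinus (u.add v) (Sum.elim ψ 0 : u.ι ⊕ v.ι → Ω) (Sum.elim φ 0 : u.ι ⊕ v.ι → Ω)
      = pairMinus u ψ φ :=
  (congrArg (fun C : Matrix (u.ι ⊕ v.ι) (u.ι ⊕ v.ι) ℂ =>
    pairMat C (Sum.elim ψ 0) (Sum.elim φ 0)) (canon_add_inv u v)).trans
    (pairMat_elim_left _ _ ψ φ)

lemma pairMinus_elim_right (ψ φ : v.ι → Ω) :
    pairMinus (u.add v) (Sum.elim 0 ψ : u.ι ⊕ v.ι → Ω) (Sum.elim 0 φ : u.ι ⊕ v.ι → Ω)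
      = pairMinus v ψ φ :=
  (congrArg (fun C : Matrix (u.ι ⊕ v.ι) (u.ι ⊕ v.ι) ℂ =>
    pairMat C (Sum.elim 0 ψ) (Sum.elim 0 φ)) (canon_add_inv u v)).trans
    (pairMat_elim_right _ _ ψ φ)

lemma RegularConnection.tauL_add (w : X.RegularConnection) (S : X.DualFam u) (S' : X.DualFam v)
    (k : ℕ) (y : X.base) : w.tauL (S.add S') k y = w.tauL S k y + w.tauL S' k y := by
  simp only [tauL_eq_sum]
  refine (Fintype.sum_sum_type _).trans ?_
  congr 1
  · refine Finset.sum_congr rfl fun a _ => ?_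
    refine Eq.trans ?_ (pairMinus_elim_left (u := u) (v := v) _ _)
    refine congrArg (pairMinus (u.add v) _) (funext fun j => ?_)
    rcases j with j | j
    · rfl
    · change (y : Ω) * (w.D ^ (2 * k)) 0 = 0
      rw [map_zero, mul_zero]
  · refine Finset.sum_congr rfl fun a _ => ?_
    refine Eq.trans ?_ (pairMinus_elim_right (u := u) (v := v) _ _)
    refine congrArg (pairMinus (u.add v) _) (funext fun j => ?_)
    rcases j with j | j
    · change (y : Ω) * (w.D ^ (2 * k)) 0 = 0
      rw [map_zero, mul_zero]
    · rfl

end add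

section mul
variable {u v : Rep A}

/-- The antipode reverses products, so the contragradient of `u × v` is matched by multiplying the
components in the opposite order. -/
lemma mul_mem_bimod_contra {φ : u.ι → Ω} {ψ : v.ι → Ω} (hφ : φ ∈ X.bimod u.contra)
    (hψ : ψ ∈ X.bimod v.contra) :
    (fun p : u.ι × v.ι => ψ p.2 * φ p.1) ∈ X.bimod (u.mul v).contra := by
  rintro ⟨i, j⟩
  refine ⟨X.mul_mem_hor (hψ j).1 (hφ i).1, ?_⟩
  change _ = ∑ k : u.ι × v.ι, _
  rw [X.act_mul, (hψ j).2, (hφ i).2, Finset.sum_mul_sum, Fintype.sum_prod_type, Finset.sum_comm]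
  refine Finset.sum_congr rfl fun k _ => Finset.sum_congr rfl fun l _ => ?_
  have : (u.mul v).contra (k, l) (i, j) = v.contra l j * u.contra k i :=
    u.isCorep.antip_mul_rev v.isCorep i k j l
  rw [Algebra.TensorProduct.tmul_mul_tmul, this]

/-- The dual family of a product. -/
def DualFam.mul (S : X.DualFam u) (S' : X.DualFam v) : X.DualFam (u.mul v) where
  κ := S.κ × S'.κ
  ν k := ⟨_, mul_mem_bimod_contra (S.ν k.1).2 (S'.ν k.2).2⟩
  μ k := ⟨_, X.mul_mem_bimod (S.μ k.1).2 (S'.μ k.2).2⟩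
  ν_zero k i := by
    simpa using SetLike.mul_mem_graded (S'.ν_zero k.2 i.2) (S.ν_zero k.1 i.1)
  μ_zero k i := by
    simpa using SetLike.mul_mem_graded (S.μ_zero k.1 i.1) (S'.μ_zero k.2 i.2)
  sum_eq i j := by
    refine (Fintype.sum_prod_type _).trans ?_
    rw [Finset.sum_comm]
    have h : ∀ a b, (S'.ν b).1 i.2 * (S.ν a).1 i.1 * ((S.μ a).1 j.1 * (S'.μ b).1 j.2)
        = (S'.ν b).1 i.2 * ((S.ν a).1 i.1 * (S.μ a).1 j.1) * (S'.μ b).1 j.2 := by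
      intro a b; simp only [mul_assoc]
    change ∑ b, ∑ a, (S'.ν b).1 i.2 * (S.ν a).1 i.1 * ((S.μ a).1 j.1 * (S'.μ b).1 j.2) = _
    simp only [h, ← Finset.sum_mul, ← Finset.mul_sum, S.sum_eq]
    by_cases hij : i.1 = j.1
    · rw [if_pos hij]
      simp only [mul_one, S'.sum_eq]
      by_cases hij' : i.2 = j.2
      · rw [if_pos hij']
        exact (if_pos (Prod.ext hij hij')).symm
      · rw [if_neg hij']
        exact (if_neg fun h => hij' (congrArg Prod.snd h)).symm
    · rw [if_neg hij]
      exact Eq.trans (by simp) (if_neg fun h => hij (congrArg Prod.fst h)).symm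

lemma pairMinus_mul (ψ φ : u.ι × v.ι → Ω) : pairMinus (u.mul v) ψ φ
    = pairMat (Matrix.kroneckerMap (· * ·) u.canon⁻¹ v.canon⁻¹) ψ φ := by
  have h : (u.mul v).canon⁻¹
      = (Matrix.kroneckerMap (· * ·) u.canon⁻¹ v.canon⁻¹ :
        Matrix (u.ι × v.ι) (u.ι × v.ι) ℂ) := by
    rw [Rep.canon_mul]
    exact Matrix.inv_kronecker _ _
  exact congrArg (fun C : Matrix (u.ι × v.ι) (u.ι × v.ι) ℂ => pairMat C ψ φ) h

namespace RegularConnection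
variable (w : X.RegularConnection)

lemma D_pow_mem {φ : Ω} {n : ℕ} (hφ : φ ∈ X.hor ⊓ 𝒪 n) (m : ℕ) :
    (w.D ^ m) φ ∈ X.hor ⊓ 𝒪 (n + m) := by
  induction m with
  | zero => exact hφ
  | succ m ih =>
    rw [pow_succ', Module.End.mul_apply]
    exact ⟨w.D_mem_hor ih.1, w.D_mem ih.1 ih.2⟩

lemma D_pow_mem_hor {φ : Ω} (hφ : φ ∈ X.hor) (m : ℕ) : (w.D ^ m) φ ∈ X.hor := by
  induction m with
  | zero => exact hφ
  | succ m ih =>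
    rw [pow_succ', Module.End.mul_apply]
    exact w.D_mem_hor ih

/-- The Leibniz rule for the even powers of the covariant derivative. -/
lemma D_pow_mul {φ ψ : Ω} {n : ℕ} (hφ : φ ∈ X.hor ⊓ 𝒪 n) (hψ : ψ ∈ X.hor) (m : ℕ) :
    (w.D ^ (2 * m)) (φ * ψ) = ∑ p ∈ Finset.HasAntidiagonal.antidiagonal m, m.choose p.1 •
      ((w.D ^ (2 * p.1)) φ * (w.D ^ (2 * p.2)) ψ) := by
  have h2 : ∀ (r : ℕ) (x : Ω), (w.D ^ (2 * (r + 1))) x = w.D (w.D ((w.D ^ (2 * r)) x)) := by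
    intro r x
    rw [mul_add, mul_one, pow_succ', pow_succ']; rfl
  induction m with
  | zero => simp
  | succ m ih =>
    rw [h2, ih, Finset.sum_antidiagonal_choose_succ_nsmul
      (fun r s => (w.D ^ (2 * r)) φ * (w.D ^ (2 * s)) ψ), map_sum, map_sum,
      ← Finset.sum_add_distrib]
    refine Finset.sum_congr rfl fun p hp => ?_
    have h3 := w.D_pow_mem hφ (2 * p.1)
    have h4 := w.D_pow_mem_hor hψ (2 * p.2)
    rw [map_nsmul, map_nsmul, w.D_D_mul h3.1 h3.2 h4, ← h2, ← h2, smul_add, add_comm,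
      Nat.choose_symm_of_eq_add (Finset.HasAntidiagonal.mem_antidiagonal.1 hp).symm]

lemma pairMat_D_pow (S : X.DualFam u) (S' : X.DualFam v) (m : ℕ) (y : Ω) (a : S.κ) (b : S'.κ) :
    pairMat (Matrix.kroneckerMap (· * ·) u.canon⁻¹ v.canon⁻¹)
    (fun q => (S'.ν b).1 q.2 * (S.ν a).1 q.1)
    (fun q => y * (w.D ^ (2 * m)) ((S.μ a).1 q.1 * (S'.μ b).1 q.2))
    = ∑ p ∈ Finset.HasAntidiagonal.antidiagonal m, m.choose p.1 • pairMinus v (S'.ν b).1 fun j =>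
      pairMinus u (S.ν a).1 (fun i => y * (w.D ^ (2 * p.1)) ((S.μ a).1 i))
        * (w.D ^ (2 * p.2)) ((S'.μ b).1 j) := by
  have h4 : ∀ i', (S.μ a).1 i' ∈ X.hor ⊓ 𝒪 0 := fun i' => ⟨((S.μ a).2 i').1, S.μ_zero a i'⟩
  simp only [w.D_pow_mul (h4 _) ((S'.μ b).2 _).1, Finset.mul_sum, mul_smul_comm]
  rw [pairMat_sum_right]
  exact Finset.sum_congr rfl fun p _ => congrArg _ (pairMat_kronecker _ _ _
    (fun i => (w.D ^ (2 * p.1)) ((S.μ a).1 i)) _ (fun j => (w.D ^ (2 * p.2)) ((S'.μ b).1 j)) _)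

lemma tauL_mul_eq (S : X.DualFam u) (S' : X.DualFam v) (m : ℕ) (y : X.base) :
    w.tauL (S.mul S') m y = ∑ a : S.κ, ∑ b : S'.κ,
      pairMat (Matrix.kroneckerMap (· * ·) u.canon⁻¹ v.canon⁻¹)
        (fun q => (S'.ν b).1 q.2 * (S.ν a).1 q.1)
        (fun q => y * (w.D ^ (2 * m)) ((S.μ a).1 q.1 * (S'.μ b).1 q.2)) := by
  have h := w.tauL_eq_sum (S.mul S') m y
  refine h.trans ?_
  exact (Fintype.sum_prod_type (α₁ := S.κ) (α₂ := S'.κ) _).trans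
    (Finset.sum_congr rfl fun a _ => Finset.sum_congr rfl fun b _ => pairMinus_mul
      (fun q => (S'.ν b).1 q.2 * (S.ν a).1 q.1)
      (fun q => y * (w.D ^ (2 * m)) ((S.μ a).1 q.1 * (S'.μ b).1 q.2)))

lemma sum_pairMinus_tauL (S : X.DualFam u) (k : ℕ) (y : X.base) (ψ φ : v.ι → Ω) :
    ∑ a, pairMinus v ψ (fun j =>
      pairMinus u (S.ν a).1 (fun i => y * (w.D ^ (2 * k)) ((S.μ a).1 i)) * φ j)
      = pairMinus v ψ fun j => w.tauL S k y * φ j := by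
  simp only [tauL_eq_sum, Finset.sum_mul]
  simp only [← pairMinusL_apply]
  rw [← map_sum]
  congr 1
  funext j
  rw [Finset.sum_apply]

/-- Expand `D^{2m}` on `μ_a μ'_b` by the Leibniz rule for the derivation `D²`, then evaluate the
inner pairing: its sum over `a` is the trace for `u`, a form on the base, which becomes the argument
of the trace for `v`. Hence `u` acts first. -/
lemma tauL_mul (S : X.DualFam u) (S' : X.DualFam v) (m : ℕ) (y : X.base) :
    w.tauL (S.mul S') m y = ∑ p ∈ Finset.HasAntidiagonal.antidiagonal m, m.choose p.1 •
      w.tauL S' p.2 ⟨w.tauL S p.1 y, w.tauL_mem_base S _ _⟩ := by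
  rw [tauL_mul_eq, Finset.sum_comm]
  simp only [pairMat_D_pow]
  have h6 : ∀ b, ∑ a, ∑ p ∈ Finset.HasAntidiagonal.antidiagonal m, m.choose p.1 •
      (pairMinus v (S'.ν b).1 fun j =>
        pairMinus u (S.ν a).1 (fun i => y * (w.D ^ (2 * p.1)) ((S.μ a).1 i))
          * (w.D ^ (2 * p.2)) ((S'.μ b).1 j))
      = ∑ p ∈ Finset.HasAntidiagonal.antidiagonal m, m.choose p.1 • pairMinus v (S'.ν b).1 fun j =>
        w.tauL S p.1 y * (w.D ^ (2 * p.2)) ((S'.μ b).1 j) := by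
    intro b
    rw [Finset.sum_comm]
    refine Finset.sum_congr rfl fun p _ => ?_
    rw [← Finset.smul_sum, sum_pairMinus_tauL]
  simp only [h6]
  rw [Finset.sum_comm]
  refine Finset.sum_congr rfl fun p _ => ?_
  rw [← Finset.smul_sum]
  exact congrArg _ (w.tauL_eq_sum S' p.2 ⟨w.tauL S p.1 y, w.tauL_mem_base S _ _⟩).symm

end RegularConnection
end mul

section triv

lemma one_mem_bimod_triv : (fun _ => 1 : Unit → Ω) ∈ X.bimod (Rep.triv : Rep A).mat := by
  intro i
  refine ⟨X.one_mem_hor, ?_⟩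
  refine X.act_one.trans ?_
  refine Eq.trans ?_ (Fintype.sum_unique (ι := Unit) _).symm
  rfl

lemma one_mem_bimod_triv_contra :
    (fun _ => 1 : Unit → Ω) ∈ X.bimod (Rep.triv : Rep A).contra := by
  intro i
  refine ⟨X.one_mem_hor, ?_⟩
  refine X.act_one.trans ?_
  refine Eq.trans ?_ (Fintype.sum_unique (ι := Unit) _).symm
  exact congrArg _ HopfAlgebra.antipode_one.symm

variable (X) in
/-- The dual family of the trivial representation. -/
def DualFam.triv : X.DualFam Rep.triv where
  κ := Unit
  ν _ := ⟨_, one_mem_bimod_triv_contra⟩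
  μ _ := ⟨_, one_mem_bimod_triv⟩
  ν_zero _ _ := SetLike.GradedOne.one_mem
  μ_zero _ _ := SetLike.GradedOne.one_mem
  sum_eq _ _ := (Fintype.sum_unique (ι := Unit) _).trans (mul_one _)

/-- The family consists of the unit alone, and `D 1 = d 1 = 0` leaves only `k = 0`. -/
lemma RegularConnection.tauL_triv (w : X.RegularConnection) (k : ℕ) (y : X.base) :
    w.tauL (DualFam.triv X) k y = if k = 0 then (y : Ω) else 0 := by
  have h : (w.D ^ (2 * k)) 1 = if k = 0 then 1 else 0 := by
    split_ifs with hk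
    · simp [hk]
    · obtain ⟨l, rfl⟩ := Nat.exists_eq_succ_of_ne_zero hk
      have hd : X.d 1 = 0 := by
        have := X.d_mul 0 1 SetLike.GradedOne.one_mem 1
        simpa using this
      have : w.D 1 = 0 := by rw [w.D_base X.one_mem_base, hd]
      rw [Nat.succ_eq_add_one, mul_add, mul_one, pow_succ, Module.End.mul_apply, this, map_zero]
  rw [tauL_eq_sum]
  refine (Fintype.sum_unique (ι := Unit) _).trans ?_
  have h2 : ((Rep.triv : Rep A).canon⁻¹ : Matrix Unit Unit ℂ) = 1 := by
    rw [Rep.canon_triv, inv_one]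
  refine (congrArg (fun C : Matrix Unit Unit ℂ => pairMat C (fun _ => (1 : Ω))
    (fun _ => y * (w.D ^ (2 * k)) 1)) h2).trans ?_
  rw [h]
  simp [pairMat]

end triv

end Calc

end Bundles
end QPB

namespace QPB

section Bundles

open FODC

variable {A Γ : Type*} [Ring A] [HopfAlgebra ℂ A] [StarRing A] [StarModule ℂ A]
    [AddCommGroup Γ] [Module ℂ Γ] [Module A Γ] [Module Aᵐᵒᵖ Γ] [SMulCommClass A Aᵐᵒᵖ Γ]
    [IsScalarTower ℂ A Γ] [IsScalarTower ℂ Aᵐᵒᵖ Γ]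

variable {B Ω : Type*} [Ring B] [Algebra ℂ B] [StarRing B] [StarModule ℂ B]
  [Ring Ω] [Algebra ℂ Ω]

namespace Calc

variable {c : FODC A Γ} {P : Bundle A B} {𝒪 : ℕ → Submodule ℂ Ω} [GradedAlgebra 𝒪]

/-! ### The action of the K-ring -/

/-- The coefficients `1 / ((2πi)^k k!)`. -/
def chernCoeff (k : ℕ) : ℂ := 1 / ((2 * Real.pi * Complex.I) ^ k * (k.factorial : ℂ))

/-- The weights are those of an exponential series: they absorb the binomial coefficients of the
Leibniz rule and turn it into a Cauchy product. -/
lemma chernCoeff_mul_choose {m : ℕ} {p : ℕ × ℕ}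
    (hp : p ∈ Finset.HasAntidiagonal.antidiagonal m) :
    chernCoeff m * m.choose p.1 = chernCoeff p.1 * chernCoeff p.2 := by
  obtain rfl := Finset.HasAntidiagonal.mem_antidiagonal.1 hp
  have h1 : (2 * Real.pi * Complex.I : ℂ) ≠ 0 := by simp [Real.pi_ne_zero]
  have h3 : ((p.1.factorial : ℕ) : ℂ) ≠ 0 := by exact_mod_cast Nat.factorial_ne_zero _
  have h4 : ((p.2.factorial : ℕ) : ℂ) ≠ 0 := by exact_mod_cast Nat.factorial_ne_zero _
  have h5 : (((p.1 + p.2).factorial : ℕ) : ℂ) ≠ 0 := by exact_mod_cast Nat.factorial_ne_zero _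
  have h6 : ((p.1 + p.2).choose p.1 : ℂ) * p.1.factorial * p.2.factorial
      = (p.1 + p.2).factorial := by rw [← Nat.add_choose_mul_factorial_mul_factorial p.1 p.2, ← Nat.choose_symm_add]; push_cast; rfl
  simp only [chernCoeff]
  field_simp
  rw [← h6]; ring

section
variable {X : Calc c P 𝒪}

/-- The ring is generated by the classes, so statements about its action need checking only on
integers and classes. The hypotheses keep sums and products separate because the action is by
operators that compose. -/
lemma K_induction {p : X.K → Prop} (h0 : ∀ n : ℤ, p n) (h1 : ∀ u, p (X.kcls u))
    (ha : ∀ x y, p x → p y → p (x + y)) (hm : ∀ x y, p x → p y → p (x * y)) (x : X.K) : p x := by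
  obtain ⟨y, rfl⟩ := RingQuot.mkRingHom_surjective X.KRel x
  induction y using FreeAlgebra.induction with
  | grade0 r =>
    have h : RingQuot.mkRingHom X.KRel (algebraMap ℤ (FreeAlgebra ℤ (Rep A)) r) = ((r : ℤ) : X.K) :=
      eq_intCast ((RingQuot.mkRingHom X.KRel).comp (algebraMap ℤ (FreeAlgebra ℤ (Rep A)))) r
    exact h ▸ h0 r
  | grade1 u => exact h1 u
  | mul a b ha' hb' =>
    rw [map_mul]; exact hm _ _ ha' hb'
  | add a b ha' hb' =>
    rw [map_add]; exact ha _ _ ha' hb'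

lemma exists_clsHat (ξ : X.HZhat) :
    ∃ (z : ℕ → Ω) (hz : ∀ n, z n ∈ X.closed ⊓ 𝒪 n), X.clsHat z hz = ξ := by
  choose z hz hξ using fun n => ξ.2 n trivial
  refine ⟨fun n => (z n : Ω), fun n => ⟨(z n).2, hz n⟩, ?_⟩
  exact Subtype.ext (funext hξ)

lemma exists_dualFam [IsCompactMatrixQuantumGroup A] (X : Calc c P 𝒪) (u : Rep A) :
    Nonempty (X.DualFam u) :=
  (X.nonempty_dualFamily u).map DualFamily.fam

end

namespace RegularConnection

variable {X : Calc c P 𝒪} (w : X.RegularConnection) [IsCompactMatrixQuantumGroup A]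

/-- The operator `[y] ↦ [tr_M(y D^{2k})]` of the bimodule of `u`. -/
def tau (u : Rep A) (k : ℕ) : Module.End ℂ X.HZ := w.tauFam (X.exists_dualFam u).some k

variable {u v : Rep A}

lemma tau_eq (w' : X.RegularConnection) (S : X.DualFam u) (k : ℕ) : w.tau u k = w'.tauFam S k :=
  w'.tauFam_eq w S _ k

lemma tau_add (u v : Rep A) (k : ℕ) : w.tau (u.add v) k = w.tau u k + w.tau v k := by
  obtain ⟨S⟩ := X.exists_dualFam u
  obtain ⟨S'⟩ := X.exists_dualFam v
  rw [w.tau_eq w (S.add S'), w.tau_eq w S, w.tau_eq w S']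
  refine w.HZ_end_ext fun p y hy => ?_
  rw [LinearMap.add_apply, tauFam_cls, tauFam_cls, tauFam_cls, ← map_add]
  exact congrArg _ (Subtype.ext (w.tauL_add S S' k _))

lemma tau_mul (u v : Rep A) (m : ℕ) : w.tau (u.mul v) m
    = ∑ p ∈ Finset.HasAntidiagonal.antidiagonal m,
      (m.choose p.1 : ℂ) • (w.tau v p.2 * w.tau u p.1) := by
  obtain ⟨S⟩ := X.exists_dualFam u
  obtain ⟨S'⟩ := X.exists_dualFam v
  rw [w.tau_eq w (S.mul S')]
  simp only [w.tau_eq w S, w.tau_eq w S']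
  refine w.HZ_end_ext fun p y hy => ?_
  rw [LinearMap.sum_apply, tauFam_cls]
  have h : w.tauC (S.mul S') m y = ∑ p ∈ Finset.HasAntidiagonal.antidiagonal m,
      (m.choose p.1 : ℂ) • w.tauC S' p.2 (w.tauC S p.1 y) := by
    refine Subtype.ext ?_
    rw [Submodule.coe_sum]
    refine (w.tauL_mul S S' m _).trans (Finset.sum_congr rfl fun q _ => ?_)
    exact (Nat.cast_smul_eq_nsmul ℂ _ _).symm
  rw [h, map_sum]
  rfl

lemma tau_triv (k : ℕ) : w.tau Rep.triv k = if k = 0 then 1 else 0 := by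
  rw [w.tau_eq w (DualFam.triv X)]
  refine w.HZ_end_ext fun p y hy => ?_
  rw [tauFam_cls]
  have h := w.tauL_triv k ⟨y, closed_le_base y.2⟩
  split_ifs at h ⊢ with hk
  · exact congrArg _ (Subtype.ext h)
  · exact (congrArg _ (Subtype.ext h : w.tauC (DualFam.triv X) k y = 0)).trans (map_zero _)

lemma tau_equiv (h : X.Equivalent u v) (k : ℕ) : w.tau u k = w.tau v k :=
  w.tauFam_equiv h _ _ k

lemma tau_mem (u : Rep A) {k p : ℕ} {ξ : X.HZ} (hξ : ξ ∈ X.HZdeg p) :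
    w.tau u k ξ ∈ X.HZdeg (p + 2 * k) :=
  w.tauFam_mem _ k p hξ

/-- The operator `ξ ↦ ξ ∘ [u]` on sequences of cohomology classes. -/
def chSeq (u : Rep A) : (ℕ → X.HZ) →ₗ[ℂ] ℕ → X.HZ where
  toFun ξ n := ∑ k ∈ Finset.range (n / 2 + 1), chernCoeff k • w.tau u k (ξ (n - 2 * k))
  map_add' ξ η := by
    funext n
    simp only [Pi.add_apply, map_add, smul_add, Finset.sum_add_distrib]
  map_smul' r ξ := by
    funext n
    simp only [Pi.smul_apply, map_smul, RingHom.id_apply, Finset.smul_sum]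
    exact Finset.sum_congr rfl fun k _ => smul_comm _ _ _

/-- The operator `ξ ↦ ξ ∘ [u]` on the completed cohomology. -/
def chOp (u : Rep A) : Module.End ℂ X.HZhat :=
  LinearMap.codRestrict X.HZhat (w.chSeq u ∘ₗ X.HZhat.subtype) (by
    intro ξ n _
    change ∑ k ∈ Finset.range (n / 2 + 1), chernCoeff k • w.tau u k (ξ.1 (n - 2 * k)) ∈ X.HZdeg n
    refine sum_mem fun k hk => Submodule.smul_mem _ _ ?_
    have h := w.tau_mem u (k := k) (ξ.2 (n - 2 * k) trivial)
    have h2 : n - 2 * k + 2 * k = n := by have := Finset.mem_range.1 hk; omega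
    rw [h2] at h
    exact h)

lemma chOp_apply (u : Rep A) (ξ : X.HZhat) (n : ℕ) : (w.chOp u ξ).1 n
    = ∑ k ∈ Finset.range (n / 2 + 1), chernCoeff k • w.tau u k (ξ.1 (n - 2 * k)) := rfl

lemma HZhat_ext {ξ η : X.HZhat} (h : ∀ n, ξ.1 n = η.1 n) : ξ = η := Subtype.ext (funext h)

lemma chOp_add (u v : Rep A) : w.chOp (u.add v) = w.chOp u + w.chOp v := by
  refine LinearMap.ext fun ξ => HZhat_ext fun n => ?_
  change _ = (w.chOp u ξ).1 n + (w.chOp v ξ).1 n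
  simp only [chOp_apply, tau_add, LinearMap.add_apply, smul_add, Finset.sum_add_distrib]

lemma chOp_triv : w.chOp Rep.triv = 1 := by
  refine LinearMap.ext fun ξ => HZhat_ext fun n => ?_
  rw [chOp_apply, Finset.sum_eq_single 0]
  · rw [tau_triv]; simp [chernCoeff]
  · intro k _ hk
    rw [tau_triv, if_neg hk]; simp
  · simp

lemma chOp_equiv (h : X.Equivalent u v) : w.chOp u = w.chOp v := by
  refine LinearMap.ext fun ξ => HZhat_ext fun n => ?_
  simp only [chOp_apply, w.tau_equiv h]

/-- Both sides are sums over pairs of exponents with total at most `n / 2`; grouping by the total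
`m` gives the binomial formula for `tau (u.mul v) m`. The factors come out reversed. -/
lemma chOp_mul (u v : Rep A) : w.chOp (u.mul v) = w.chOp v * w.chOp u := by
  refine LinearMap.ext fun ξ => HZhat_ext fun n => ?_
  rw [Module.End.mul_apply]
  simp only [chOp_apply, map_sum, map_smul, Finset.smul_sum]
  have h1 : ∀ k ∈ Finset.range (n / 2 + 1),
      ∑ l ∈ Finset.range ((n - 2 * k) / 2 + 1), chernCoeff k • chernCoeff l •
        w.tau v k (w.tau u l (ξ.1 (n - 2 * k - 2 * l)))
      = ∑ l ∈ Finset.range (n / 2 + 1 - k), chernCoeff k • chernCoeff l •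
        w.tau v k (w.tau u l (ξ.1 (n - 2 * (k + l)))) := by
    intro k hk
    have h2 : (n - 2 * k) / 2 + 1 = n / 2 + 1 - k := by have := Finset.mem_range.1 hk; omega
    rw [h2]
    refine Finset.sum_congr rfl fun l _ => ?_
    rw [Nat.sub_sub, ← mul_add]
  rw [Finset.sum_congr rfl h1, ← Finset.sum_range_diag_flip (n / 2 + 1) fun k l =>
    chernCoeff k • chernCoeff l • w.tau v k (w.tau u l (ξ.1 (n - 2 * (k + l))))]
  refine Finset.sum_congr rfl fun m _ => ?_
  rw [← Finset.Nat.sum_antidiagonal_eq_sum_range_succ fun k l =>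
    chernCoeff k • chernCoeff l • w.tau v k (w.tau u l (ξ.1 (n - 2 * (k + l))))]
  rw [← Finset.Nat.sum_antidiagonal_swap, tau_mul, LinearMap.sum_apply, Finset.smul_sum]
  refine Finset.sum_congr rfl fun p hp => ?_
  have h3 := Finset.HasAntidiagonal.mem_antidiagonal.1 hp
  rw [LinearMap.smul_apply, smul_smul, chernCoeff_mul_choose hp, smul_smul, mul_comm,
    Module.End.mul_apply, Prod.fst_swap, Prod.snd_swap, add_comm p.2, h3]

/-- The action of the free ring generated by the representations. -/
def chFree : FreeAlgebra ℤ (Rep A) →+* (Module.End ℂ X.HZhat)ᵐᵒᵖ :=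
  (FreeAlgebra.lift ℤ fun u => MulOpposite.op (w.chOp u) :
    FreeAlgebra ℤ (Rep A) →ₐ[ℤ] (Module.End ℂ X.HZhat)ᵐᵒᵖ)

/-- The action of the K-ring on the completed cohomology. -/
def chernRep : X.Kᵐᵒᵖ →+* Module.End ℂ X.HZhat :=
  -- Since products are reversed, the homomorphism defined on the free ring lands in the opposite
  -- ring of operators; taking opposites produces a homomorphism from the opposite of `K`, which is
  -- a right action.
  (RingEquiv.opOp (Module.End ℂ X.HZhat)).symm.toRingHom.comp <| RingHom.op <|
    RingQuot.lift ⟨w.chFree, by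
    intro x y h
    simp only [chFree, RingHom.coe_coe]
    cases h with
    | add u v => simp [chOp_add]
    | mul u v => simp [chOp_mul]
    | one => simp [chOp_triv]
    | equiv u v h => simp [w.chOp_equiv h]⟩

lemma chernRep_kcls (u : Rep A) : w.chernRep (MulOpposite.op (X.kcls u)) = w.chOp u := by
  have h : w.chFree (FreeAlgebra.ι ℤ u) = MulOpposite.op (w.chOp u) :=
    FreeAlgebra.lift_ι_apply _ _
  exact congrArg MulOpposite.unop ((RingQuot.lift_mkRingHom_apply _ _ _).trans h)

/-- The homogeneous components of the Chern character. -/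
lemma trM_eq (S : X.DualFam u) {z : Ω} {p : ℕ} (hz : z ∈ X.closed ⊓ 𝒪 p) (k : ℕ) :
    X.trM u (X.compOp u (LinearMap.mulLeft ℂ z ∘ₗ w.D ^ (2 * k)))
      = w.tauL S k ⟨z, closed_le_base hz.1⟩ := by
  have h := X.nonempty_dualFamily u
  -- The trace in the statement is built on an arbitrarily chosen family; independence of the family
  -- replaces it by `S`.
  rw [tauL_apply, S.tr_eq h.some.fam
    (w.lmul_DM_mem_Lin (y := ⟨z, closed_le_base hz.1⟩) hz.1.1 hz.2 k).1, trM, dif_pos h]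
  refine Finset.sum_congr rfl fun m _ => ?_
  exact congrArg _ (w.compOp_D_pow u ⟨z, closed_le_base hz.1⟩ _ _)

lemma ch_eq (S : X.DualFam u) {z : ℕ → Ω} (hz : ∀ n, z n ∈ X.closed ⊓ 𝒪 n) (n : ℕ) :
    w.ch u z n = ∑ k ∈ Finset.range (n / 2 + 1),
      chernCoeff k • w.tauL S k ⟨z (n - 2 * k), closed_le_base (hz _).1⟩ :=
  Finset.sum_congr rfl fun k _ => congrArg _ (w.trM_eq S (hz _) k)

lemma ch_mem (u : Rep A) {z : ℕ → Ω} (hz : ∀ n, z n ∈ X.closed ⊓ 𝒪 n) (n : ℕ) :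
    w.ch u z n ∈ X.closed ⊓ 𝒪 n := by
  obtain ⟨S⟩ := X.exists_dualFam u
  rw [w.ch_eq S hz]
  refine sum_mem fun k hk => Submodule.smul_mem _ _ ⟨w.tauL_mem_closed S k (hz _).1, ?_⟩
  have h := w.tauL_mem S (y := ⟨z (n - 2 * k), closed_le_base (hz _).1⟩) (hz _).2 k
  have h2 : n - 2 * k + 2 * k = n := by have := Finset.mem_range.1 hk; omega
  rwa [h2] at h

/-- The operator is built from `w` while the representative uses `w'`: independence of the
connection makes a single action valid for all of them. -/
lemma chOp_clsHat (w' : X.RegularConnection) (u : Rep A) {z : ℕ → Ω}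
    (hz : ∀ n, z n ∈ X.closed ⊓ 𝒪 n) :
    w.chOp u (X.clsHat z hz) = X.clsHat (w'.ch u z) (w'.ch_mem u hz) := by
  obtain ⟨S⟩ := X.exists_dualFam u
  refine HZhat_ext fun n => ?_
  rw [chOp_apply]
  simp only [w.tau_eq w' S]
  have h : (⟨w'.ch u z n, (w'.ch_mem u hz n).1⟩ : X.closed)
      = ∑ k ∈ Finset.range (n / 2 + 1),
        chernCoeff k • w'.tauC S k ⟨z (n - 2 * k), (hz _).1⟩ := by
    refine Subtype.ext ?_
    rw [Submodule.coe_sum]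
    exact w'.ch_eq S hz n
  refine Eq.trans ?_ (congrArg X.cls h).symm
  rw [map_sum]
  rfl

lemma isChernCharacter_chernRep : X.IsChernCharacter w.chernRep := by
  intro w' u z hz
  refine ⟨w'.ch_mem u hz, ?_⟩
  rw [chernRep_kcls]
  exact w.chOp_clsHat w' u hz

include w in
lemma _root_.QPB.Calc.IsChernCharacter.kcls_eq {ρ : X.Kᵐᵒᵖ →+* Module.End ℂ X.HZhat}
    (hρ : X.IsChernCharacter ρ) (u : Rep A) : ρ (MulOpposite.op (X.kcls u)) = w.chOp u := by
  refine LinearMap.ext fun ξ => ?_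
  obtain ⟨z, hz, rfl⟩ := exists_clsHat ξ
  obtain ⟨h, e⟩ := hρ w u z hz
  rw [e, w.chOp_clsHat w u hz]

include w in
-- Every formal series of classes has closed homogeneous representatives, so the defining formula
-- fixes the operator of each class, and the classes generate the ring.
lemma isChernCharacter_unique {ρ ρ' : X.Kᵐᵒᵖ →+* Module.End ℂ X.HZhat}
    (hρ : X.IsChernCharacter ρ) (hρ' : X.IsChernCharacter ρ') : ρ = ρ' := by
  refine RingHom.ext fun x => ?_
  induction x using MulOpposite.rec' with
  | h x =>
  induction x using K_induction with
  | h0 n => rw [MulOpposite.op_intCast, map_intCast, map_intCast]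
  | h1 u => rw [hρ.kcls_eq w, hρ'.kcls_eq w]
  | ha x y hx hy => rw [MulOpposite.op_add, map_add, map_add, hx, hy]
  | hm x y hx hy => rw [MulOpposite.op_mul, map_mul, map_mul, hx, hy]

end RegularConnection

end Calc

end Bundles
end QPB

namespace QPB

section Bundles

open FODC

variable {A Γ : Type*} [Ring A] [HopfAlgebra ℂ A] [StarRing A] [StarModule ℂ A]
    [AddCommGroup Γ] [Module ℂ Γ] [Module A Γ] [Module Aᵐᵒᵖ Γ] [SMulCommClass A Aᵐᵒᵖ Γ]
    [IsScalarTower ℂ A Γ] [IsScalarTower ℂ Aᵐᵒᵖ Γ]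

variable {B Ω : Type*} [Ring B] [Algebra ℂ B] [StarRing B] [StarModule ℂ B]
  [Ring Ω] [Algebra ℂ Ω]

namespace FODC

/-! ### The module structure and the adjoint action on the tensor algebra of invariant forms -/

variable (c : FODC A Γ)

/-- The right side depends on `a` only through `π(a)`. So `ϑ ∘ u_{ij}` is well defined on `Γ_inv`,
being conjugation by `u` inside `Γ^∧`. -/
lemma piEnv_shift [IsCompactMatrixQuantumGroup A] (u : Rep A) (a : A) (i j : u.ι) :
    c.piEnv (a * u.mat i j - Coalgebra.counit (R := ℂ) a • u.mat i j)
      = ∑ k, c.inA (antip A (u.mat i k)) * c.piEnv a * c.inA (u.mat k j) := by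
  let f : A →ₗ[ℂ] c.Env := c.piEnv ∘ₗ (LinearMap.mulRight ℂ (u.mat i j)
    - (Coalgebra.counit (R := ℂ) (A := A)).smulRight (u.mat i j))
  let g : A →ₗ[ℂ] c.Env := ∑ k, LinearMap.mulLeft ℂ (c.inA (antip A (u.mat i k))) ∘ₗ
    LinearMap.mulRight ℂ (c.inA (u.mat k j)) ∘ₗ c.piEnv
  suffices h : f = g by
    have := LinearMap.congr_fun h a
    simpa [f, g, mul_assoc] using this
  refine Rep.ext_mat fun w p q => ?_
  have h1 := c.piEnv_corep (w.isCorep.prod u.isCorep) (p, i) (q, j)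
  simp only [prodMat, Matrix.of_apply, Fintype.sum_prod_type] at h1
  simp only [f, g, LinearMap.comp_apply, LinearMap.sub_apply, LinearMap.mulRight_apply,
    LinearMap.smulRight_apply, LinearMap.sum_apply, LinearMap.mulLeft_apply, map_sub, map_smul, h1,
    w.isCorep.antip_mul_rev u.isCorep, c.leibniz, map_add, inΓ_left, inΓ_right, inA_mul]
  have h2 : ∑ x, ∑ y, c.inA (antip A (u.mat i y)) * c.inA (antip A (w.mat p x)) *
      (c.inA (w.mat x q) * c.inΓ (c.d (u.mat y j)))
      = Coalgebra.counit (R := ℂ) (w.mat p q) • c.piEnv (u.mat i j) := by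
    rw [Finset.sum_comm, c.piEnv_corep u.isCorep, Finset.smul_sum]
    refine Finset.sum_congr rfl fun y _ => ?_
    have : ∀ x, c.inA (antip A (u.mat i y)) * c.inA (antip A (w.mat p x)) *
        (c.inA (w.mat x q) * c.inΓ (c.d (u.mat y j)))
        = c.inA (antip A (u.mat i y)) * c.inA (antip A (w.mat p x) * w.mat x q) *
          c.inΓ (c.d (u.mat y j)) := by
      intro x; simp only [inA_mul, mul_assoc]
    simp only [this]
    rw [← Finset.sum_mul, ← Finset.mul_sum, ← map_sum, w.isCorep.antip_mul, w.counit_mat]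
    split_ifs <;> simp [inA_one]
  simp only [mul_add, Finset.sum_add_distrib, h2, add_sub_cancel_left]
  rw [Finset.sum_comm]
  refine Finset.sum_congr rfl fun k _ => ?_
  rw [c.piEnv_corep w.isCorep, Finset.sum_mul, Finset.mul_sum]
  simp only [mul_assoc]

variable [IsCompactMatrixQuantumGroup A] (u : Rep A)

/-- The map `ϑ ↦ ϑ ∘ u_{ij}` on `Γ_inv`. -/
def circ (i j : u.ι) : c.inv →ₗ[ℂ] c.inv :=
  LinearMap.codRestrict c.inv
    ((∑ k, LinearMap.mulLeft ℂ (c.inA (antip A (u.mat i k))) ∘ₗ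
      LinearMap.mulRight ℂ (c.inA (u.mat k j))) ∘ₗ c.inv.subtype) (by
    rintro ⟨_, a, rfl⟩
    refine ⟨_, (c.piEnv_shift u a i j).trans ?_⟩
    simp [mul_assoc])

lemma circ_pi (i j : u.ι) (a : A) : c.circ u i j (c.pi a)
    = c.pi (a * u.mat i j - Coalgebra.counit (R := ℂ) a • u.mat i j) := by
  refine Subtype.ext ((c.piEnv_shift u a i j).trans ?_).symm
  have : ((c.pi a : c.inv) : c.Env) = c.piEnv a := rfl
  simp [circ, mul_assoc, this]

/-- The multiplicative extension of `ϑ ↦ (ϑ ∘ u_{ij})`. -/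
def circT : TensorAlgebra ℂ c.inv →ₐ[ℂ] Matrix u.ι u.ι (TensorAlgebra ℂ c.inv) :=
  TensorAlgebra.lift ℂ
    { toFun := fun θ => Matrix.of fun i j => TensorAlgebra.ι ℂ (c.circ u i j θ)
      map_add' := fun x y => by ext i j; simp
      map_smul' := fun r x => by ext i j; simp }

lemma circT_ι (θ : c.inv) (i j : u.ι) :
    c.circT u (TensorAlgebra.ι ℂ θ) i j = TensorAlgebra.ι ℂ (c.circ u i j θ) := by
  rw [circT, TensorAlgebra.lift_ι_apply]; rfl

/-- The multiplicative extension of `a ↦ (a u_{ij} - ε(a) u_{ij})`. -/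
def shiftT (u : Rep A) : TensorAlgebra ℂ A →ₐ[ℂ] Matrix u.ι u.ι (TensorAlgebra ℂ A) :=
  TensorAlgebra.lift ℂ
    { toFun := fun a => Matrix.of fun i j =>
        TensorAlgebra.ι ℂ (a * u.mat i j - Coalgebra.counit (R := ℂ) a • u.mat i j)
      map_add' := fun x y => by
        ext i j
        simp only [Matrix.of_apply, Matrix.add_apply]
        rw [← map_add, map_add Coalgebra.counit, add_mul, add_smul, add_sub_add_comm]
      map_smul' := fun r x => by
        ext i j
        simp [Matrix.of_apply, Matrix.smul_apply, smul_sub, mul_smul] }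

lemma shiftT_ι (a : A) (i j : u.ι) : shiftT u (TensorAlgebra.ι ℂ a) i j
    = TensorAlgebra.ι ℂ (a * u.mat i j - Coalgebra.counit (R := ℂ) a • u.mat i j) := by
  rw [shiftT, TensorAlgebra.lift_ι_apply]; rfl

lemma piTensor_ι (a : A) : c.piTensor (TensorAlgebra.ι ℂ a) = TensorAlgebra.ι ℂ (c.pi a) :=
  TensorAlgebra.lift_ι_apply _ _

lemma piTensor_shiftT (t : TensorAlgebra ℂ A) :
    c.piTensor.mapMatrix (shiftT u t) = c.circT u (c.piTensor t) := by
  have : c.piTensor.mapMatrix.comp (shiftT u) = (c.circT u).comp c.piTensor := by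
    refine TensorAlgebra.hom_ext (LinearMap.ext fun a => ?_)
    ext i j
    simp only [LinearMap.comp_apply, AlgHom.toLinearMap_apply, AlgHom.comp_apply,
      AlgHom.mapMatrix_apply, Matrix.map_apply, shiftT_ι, piTensor_ι, circT_ι, circ_pi]
  exact DFunLike.congr_fun this t

/-- The adjoint action on the tensor algebra of `A`, followed by the projection onto the tensor
algebra of `Γ_inv`. -/
def adPi : TensorAlgebra ℂ A →ₐ[ℂ] TensorAlgebra ℂ c.inv ⊗[ℂ] A :=
  (Algebra.TensorProduct.map c.piTensor (AlgHom.id ℂ A)).comp (adTensor A)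

lemma adPi_apply (t : TensorAlgebra ℂ A) :
    c.adPi t = TensorProduct.map c.piTensor.toLinearMap LinearMap.id (adTensor A t) := rfl

lemma adPi_corep {ι : Type} [Fintype ι] [DecidableEq ι] {v : Matrix ι ι A} (hv : IsCorep v)
    (i j : ι) : c.adPi (TensorAlgebra.ι ℂ (v i j))
      = ∑ p, ∑ q, TensorAlgebra.ι ℂ (c.pi (v p q)) ⊗ₜ[ℂ] (antip A (v i p) * v q j) := by
  rw [adPi_apply, adTensor, TensorAlgebra.lift_ι_apply, LinearMap.comp_apply, Calc.ad_corep hv]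
  simp only [map_sum, TensorProduct.map_tmul, AlgHom.toLinearMap_apply, piTensor_ι,
    LinearMap.id_apply]

/-- The extension of `circT` to the tensor product with `A`. -/
def circHat : TensorAlgebra ℂ c.inv ⊗[ℂ] A →ₐ[ℂ]
    Matrix u.ι u.ι (TensorAlgebra ℂ c.inv ⊗[ℂ] A) :=
  Algebra.TensorProduct.lift
    ((Algebra.TensorProduct.includeLeft (R := ℂ) (S := ℂ) (A := TensorAlgebra ℂ c.inv)
      (B := A)).mapMatrix.comp (c.circT u))
    ((Matrix.scalarAlgHom u.ι ℂ).comp Algebra.TensorProduct.includeRight) (by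
    intro θ a
    change _ * _ = _ * _
    ext i j
    simp [Matrix.scalar_apply])

lemma circHat_tmul (θ : TensorAlgebra ℂ c.inv) (a : A) (i j : u.ι) :
    c.circHat u (θ ⊗ₜ a) i j = c.circT u θ i j ⊗ₜ a := by
  rw [circHat, Algebra.TensorProduct.lift_tmul]
  simp [Matrix.scalar_apply]

/-- Conjugation by the matrix of the representation. -/
def conjMat (M : Matrix u.ι u.ι (TensorAlgebra ℂ c.inv ⊗[ℂ] A)) :
    Matrix u.ι u.ι (TensorAlgebra ℂ c.inv ⊗[ℂ] A) :=
  (Matrix.of fun i j => 1 ⊗ₜ antip A (u.mat i j)) * M * (Matrix.of fun i j => 1 ⊗ₜ u.mat i j)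

lemma conjMat_apply (M : Matrix u.ι u.ι (TensorAlgebra ℂ c.inv ⊗[ℂ] A)) (i j : u.ι) :
    c.conjMat u M i j = ∑ l, ∑ k, 1 ⊗ₜ antip A (u.mat i k) * M k l * 1 ⊗ₜ u.mat l j := by
  simp only [conjMat, Matrix.mul_apply, Matrix.of_apply, Finset.sum_mul]

lemma conjMat_one : c.conjMat u 1 = 1 := by
  ext i j
  simp only [conjMat, mul_one, Matrix.mul_apply, Matrix.of_apply,
    Algebra.TensorProduct.tmul_mul_tmul, ← TensorProduct.tmul_sum, u.isCorep.antip_mul,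
    Matrix.one_apply]
  split_ifs <;> simp [Algebra.TensorProduct.one_def]

lemma conjMat_mul (M N : Matrix u.ι u.ι (TensorAlgebra ℂ c.inv ⊗[ℂ] A)) :
    c.conjMat u (M * N) = c.conjMat u M * c.conjMat u N := by
  have h : (Matrix.of fun i j => (1 : TensorAlgebra ℂ c.inv) ⊗ₜ[ℂ] u.mat i j)
      * (Matrix.of fun i j => 1 ⊗ₜ antip A (u.mat i j)) = 1 := by
    ext i j
    simp only [Matrix.mul_apply, Matrix.of_apply,
      Algebra.TensorProduct.tmul_mul_tmul, ← TensorProduct.tmul_sum, u.isCorep.mul_antip,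
      Matrix.one_apply]
    split_ifs <;> simp [Algebra.TensorProduct.one_def]
  have h' : ∀ {R : Type _} [Ring R] {x y : R} (_ : y * x = 1) (a b : R),
      x * (a * b) * y = x * a * y * (x * b * y) := by
    intro R _ x y hxy a b
    calc _ = x * a * 1 * b * y := by simp only [mul_one, mul_assoc]
      _ = _ := by rw [← hxy]; simp only [mul_assoc]
  exact h' h M N

lemma conjMat_pow (M : Matrix u.ι u.ι (TensorAlgebra ℂ c.inv ⊗[ℂ] A)) (k : ℕ) :
    c.conjMat u (M ^ k) = c.conjMat u M ^ k := by
  induction k with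
  | zero => rw [pow_zero, pow_zero, conjMat_one]
  | succ k ih => rw [pow_succ, pow_succ, conjMat_mul, ih]

lemma conjMat_add (M N : Matrix u.ι u.ι (TensorAlgebra ℂ c.inv ⊗[ℂ] A)) :
    c.conjMat u (M + N) = c.conjMat u M + c.conjMat u N := by
  simp only [conjMat, mul_add, add_mul]

/-- The adjoint action on a product of matrix elements `w u` involves `κ(u) κ(w)` on one side and `w
u` on the other: that of `w`, conjugated by `u`. The counit terms in the definition of `∘` match
separately. -/
lemma adPi_shiftT_ι (a : A) : c.adPi.mapMatrix (shiftT u (TensorAlgebra.ι ℂ a))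
    = c.conjMat u (c.circHat u (c.adPi (TensorAlgebra.ι ℂ a))) := by
  ext i j
  let f : A →ₗ[ℂ] TensorAlgebra ℂ c.inv ⊗[ℂ] A := c.adPi.toLinearMap ∘ₗ TensorAlgebra.ι ℂ ∘ₗ
    (LinearMap.mulRight ℂ (u.mat i j)
    - (Coalgebra.counit (R := ℂ) (A := A)).smulRight (u.mat i j))
  let g : A →ₗ[ℂ] TensorAlgebra ℂ c.inv ⊗[ℂ] A := ∑ l, ∑ k,
    LinearMap.mulRight ℂ (1 ⊗ₜ u.mat l j) ∘ₗ LinearMap.mulLeft ℂ (1 ⊗ₜ antip A (u.mat i k)) ∘ₗ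
    Matrix.entryLinearMap ℂ _ k l ∘ₗ (c.circHat u).toLinearMap ∘ₗ c.adPi.toLinearMap ∘ₗ
    TensorAlgebra.ι ℂ
  suffices h : f = g by
    have := LinearMap.congr_fun h a
    rw [conjMat_apply, AlgHom.mapMatrix_apply, Matrix.map_apply, shiftT_ι]
    simpa [f, g] using this
  refine Rep.ext_mat fun w p q => ?_
  have h1 := c.adPi_corep (w.isCorep.prod u.isCorep) (p, i) (q, j)
  simp only [prodMat, Matrix.of_apply, Fintype.sum_prod_type] at h1
  have hf : f (w.mat p q) = c.adPi (TensorAlgebra.ι ℂ (w.mat p q * u.mat i j))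
      - Coalgebra.counit (R := ℂ) (w.mat p q) • c.adPi (TensorAlgebra.ι ℂ (u.mat i j)) := by
    simp [f]
  have hg : g (w.mat p q) = ∑ l, ∑ k, ∑ r, ∑ s,
      TensorAlgebra.ι ℂ (c.pi (w.mat r s * u.mat k l)) ⊗ₜ
        (antip A (u.mat i k) * antip A (w.mat p r) * (w.mat s q * u.mat l j))
      - ∑ l, ∑ k, TensorAlgebra.ι ℂ (c.pi (u.mat k l)) ⊗ₜ
        (Coalgebra.counit (R := ℂ) (w.mat p q) • (antip A (u.mat i k) * u.mat l j)) := by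
    simp only [g, LinearMap.sum_apply, LinearMap.comp_apply, AlgHom.toLinearMap_apply,
      c.adPi_corep w.isCorep, map_sum, Matrix.entryLinearMap_apply, circHat_tmul, circT_ι, circ_pi,
      LinearMap.mulLeft_apply, LinearMap.mulRight_apply, Algebra.TensorProduct.tmul_mul_tmul,
      one_mul, mul_one, map_sub, TensorProduct.sub_tmul, Finset.sum_sub_distrib, mul_assoc]
    congr 1
    refine Finset.sum_congr rfl fun l _ => Finset.sum_congr rfl fun k _ => ?_
    simp only [w.counit_mat, ite_smul, one_smul, zero_smul, apply_ite c.pi, map_zero,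
      apply_ite (TensorAlgebra.ι ℂ), TensorProduct.ite_tmul,
      Finset.sum_ite_eq, Finset.mem_univ, if_true, ← TensorProduct.tmul_sum]
    have : ∀ r, antip A (u.mat i k) * (antip A (w.mat p r) * (w.mat r q * u.mat l j))
        = antip A (u.mat i k) * (antip A (w.mat p r) * w.mat r q) * u.mat l j := by
      intro r; simp only [mul_assoc]
    simp only [this]
    rw [← Finset.sum_mul, ← Finset.mul_sum, w.isCorep.antip_mul]
    split_ifs <;> simp
  rw [hf, hg, h1, c.adPi_corep u.isCorep]
  congr 1
  · simp only [w.isCorep.antip_mul_rev u.isCorep]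
    rw [Finset.sum_comm]
    conv_rhs => rw [Finset.sum_comm]
    refine Finset.sum_congr rfl fun k _ => ?_
    conv_rhs => rw [Finset.sum_comm]
    refine Finset.sum_congr rfl fun r _ => ?_
    rw [Finset.sum_comm]
  · rw [Finset.smul_sum, Finset.sum_comm]
    refine Finset.sum_congr rfl fun l _ => ?_
    rw [Finset.smul_sum]
    refine Finset.sum_congr rfl fun k _ => ?_
    rw [TensorProduct.tmul_smul]

lemma adPi_shiftT (t : TensorAlgebra ℂ A) :
    c.adPi.mapMatrix (shiftT u t) = c.conjMat u (c.circHat u (c.adPi t)) := by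
  induction t using TensorAlgebra.induction with
  | algebraMap r =>
    rw [Algebra.algebraMap_eq_smul_one]
    simp only [map_smul, map_one]
    conv_lhs => rw [← c.conjMat_one u]
    simp only [conjMat, mul_smul_comm, smul_mul_assoc]
  | ι a => exact c.adPi_shiftT_ι u a
  | mul a b ha hb => simp only [map_mul, conjMat_mul, ha, hb]
  | add a b ha hb => simp only [map_add, conjMat_add, ha, hb]

/-- The element `∑ C⁻¹_{ji} (ϑ ∘ u_{il}) ⊗ (π(u)^k)_{lj}`. -/
def twist (k : ℕ) : TensorAlgebra ℂ c.inv →ₗ[ℂ] TensorAlgebra ℂ c.inv where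
  toFun θ := ∑ i, ∑ j, u.canon⁻¹ j i • (c.circT u θ *
    (Matrix.of fun i j => TensorAlgebra.ι ℂ (c.pi (u.mat i j)) : Matrix u.ι u.ι _) ^ k) i j
  map_add' x y := by
    simp only [map_add, add_mul, Matrix.add_apply, smul_add, Finset.sum_add_distrib]
  map_smul' r x := by
    simp only [map_smul, smul_mul_assoc, Matrix.smul_apply, RingHom.id_apply, Finset.smul_sum]
    exact Finset.sum_congr rfl fun i _ => Finset.sum_congr rfl fun j _ => smul_comm _ _ _

lemma twist_apply (k : ℕ) (θ : TensorAlgebra ℂ c.inv) : c.twist u k θ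
    = ∑ i, ∑ j, u.canon⁻¹ j i • (c.circT u θ *
      (Matrix.of fun i j => TensorAlgebra.ι ℂ (c.pi (u.mat i j)) : Matrix u.ι u.ι _) ^ k) i j :=
  rfl

variable {c} in
-- The matrix `(ϑ ∘ u) π(u)^k` is conjugated by `u` under the adjoint action when `ϑ` is invariant,
-- because `π(u)` is conjugated and conjugation respects products. The sum weighted by `C_u⁻¹` is
-- unchanged by such a conjugation.
lemma IsInvariant.twist {θ : TensorAlgebra ℂ c.inv} (hθ : c.IsInvariant θ) (k : ℕ) :
    c.IsInvariant (c.twist u k θ) := by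
  obtain ⟨t, rfl, ht⟩ := hθ
  rw [← adPi_apply] at ht
  set W : Matrix u.ι u.ι (TensorAlgebra ℂ A) := Matrix.of fun i j => TensorAlgebra.ι ℂ (u.mat i j)
  set V : Matrix u.ι u.ι (TensorAlgebra ℂ c.inv) :=
    Matrix.of fun i j => TensorAlgebra.ι ℂ (c.pi (u.mat i j))
  let incl : TensorAlgebra ℂ c.inv →ₐ[ℂ] TensorAlgebra ℂ c.inv ⊗[ℂ] A :=
    Algebra.TensorProduct.includeLeft
  have hW : c.piTensor.mapMatrix W = V := by
    ext i j; exact c.piTensor_ι _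
  have hW' : c.adPi.mapMatrix W = c.conjMat u (incl.mapMatrix V) := by
    ext i j
    rw [conjMat_apply, Finset.sum_comm]
    refine (c.adPi_corep u.isCorep i j).trans ?_
    simp [incl, V]
  have h1 : c.circHat u (c.piTensor t ⊗ₜ 1) = incl.mapMatrix (c.circT u (c.piTensor t)) := by
    ext i j; exact c.circHat_tmul u _ _ i j
  refine ⟨∑ i, ∑ j, u.canon⁻¹ j i • (shiftT u t * W ^ k) i j, ?_, ?_⟩
  · have h2 := congrArg₂ (fun x y => x * y ^ k) (c.piTensor_shiftT u t) hW
    simp only [← map_pow, ← map_mul] at h2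
    simp only [map_sum, map_smul]
    rw [twist_apply, ← h2]
    rfl
  · have h2 := congrArg₂ (fun x y => x * y ^ k) (c.adPi_shiftT u t) hW'
    simp only [← map_pow, ← map_mul, ← conjMat_pow, ← conjMat_mul, ht, h1] at h2
    rw [← adPi_apply]
    simp only [map_sum, map_smul]
    have h3 : ∀ i j, c.adPi ((shiftT u t * W ^ k) i j)
        = ∑ q, ∑ p, (c.circT u (c.piTensor t) * V ^ k) p q ⊗ₜ (antip A (u.mat i p) * u.mat q j) := by
      intro i j
      refine (congrFun (congrFun h2 i) j).trans ?_
      rw [conjMat_apply]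
      simp [incl]
    simp only [h3, Finset.smul_sum]
    -- The weight cancels `κ(u_{ip}) u_{qj}` down to a scalar, by `sum_canon_inv`.
    have h4 : ∀ q p, ∑ i, ∑ j, u.canon⁻¹ j i •
        ((c.circT u (c.piTensor t) * V ^ k) p q ⊗ₜ[ℂ] (antip A (u.mat i p) * u.mat q j))
        = (u.canon⁻¹ q p • (c.circT u (c.piTensor t) * V ^ k) p q) ⊗ₜ[ℂ] (1 : A) := by
      intro q p
      rw [TensorProduct.smul_tmul, ← u.sum_canon_inv]
      simp only [TensorProduct.tmul_sum, TensorProduct.tmul_smul]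
    have h5 : ∀ {M : Type _} [AddCommMonoid M] (g : u.ι → u.ι → u.ι → M),
        ∑ i, ∑ j, ∑ q, g i j q = ∑ q, ∑ i, ∑ j, g i j q := fun g =>
      (Finset.sum_congr rfl fun i _ => Finset.sum_comm).trans Finset.sum_comm
    rw [twist_apply]
    simp only [TensorProduct.sum_tmul]
    refine (h5 _).trans ((Finset.sum_congr rfl fun q _ => h5 _).trans (Finset.sum_comm.trans ?_))
    exact Finset.sum_congr rfl fun p _ => Finset.sum_congr rfl fun q _ => h4 q p

end FODC

end Bundles
end QPB

namespace QPB

section Bundles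

open FODC

variable {A Γ : Type*} [Ring A] [HopfAlgebra ℂ A] [StarRing A] [StarModule ℂ A]
    [AddCommGroup Γ] [Module ℂ Γ] [Module A Γ] [Module Aᵐᵒᵖ Γ] [SMulCommClass A Aᵐᵒᵖ Γ]
    [IsScalarTower ℂ A Γ] [IsScalarTower ℂ Aᵐᵒᵖ Γ]

variable {B Ω : Type*} [Ring B] [Algebra ℂ B] [StarRing B] [StarModule ℂ B]
  [Ring Ω] [Algebra ℂ Ω]

namespace Calc

variable {c : FODC A Γ} {P : Bundle A B} {𝒪 : ℕ → Submodule ℂ Ω} [GradedAlgebra 𝒪]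

/-! ### The matrix formula and the invariance of the characteristic classes -/

lemma sum_rot {κ₁ κ₂ κ₃ M : Type*} [Fintype κ₁] [Fintype κ₂] [Fintype κ₃] [AddCommMonoid M]
    (g : κ₁ → κ₂ → κ₃ → M) : ∑ i, ∑ j, ∑ q, g i j q = ∑ q, ∑ i, ∑ j, g i j q :=
  (Finset.sum_congr rfl fun _ _ => Finset.sum_comm).trans Finset.sum_comm

namespace RegularConnection

variable {X : Calc c P 𝒪} (w : X.RegularConnection) [IsCompactMatrixQuantumGroup A] {u : Rep A}

lemma D_pow_two_mul (m : ℕ) (x : X.bimod u.mat) (j : u.ι) :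
    (w.D ^ (2 * m)) (x.1 j) = (-1 : ℂ) ^ m • ∑ l, x.1 l * (w.curv u ^ m) l j := by
  rw [← w.D_pow_eq, w.DM_pow]

/-- Replacing `D^{2m}` by `(-1)^m` times the `m`-th power of the curvature matrix turns the
canonical trace into an ordinary matrix trace; this is the origin of the sign in the formula of (i).
-/
lemma trace_mat_mul_curv (S : X.DualFamily u) (z : X.base) (m : ℕ) :
    (S.mat (X.compOp u (LinearMap.mulLeft ℂ (z : Ω))) * w.curv u ^ m).trace
      = (-1 : ℂ) ^ m • w.tauL S.fam m z := by
  rw [tauL_eq_sum]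
  have h1 : ∀ a : S.fam.κ, pairMinus u (S.fam.ν a).1
      (fun j => (z : Ω) * (w.D ^ (2 * m)) ((S.fam.μ a).1 j))
      = (-1 : ℂ) ^ m • ∑ l, ∑ i, ∑ j, u.canon⁻¹ i l •
        ((S.ν a).1 l * (z * (S.μ a).1 j) * (w.curv u ^ m) j i) := by
    intro a
    simp only [w.D_pow_two_mul, pairMinus, Finset.smul_sum]
    refine Finset.sum_congr rfl fun l _ => Finset.sum_congr rfl fun i _ => ?_
    simp only [mul_smul_comm, Finset.mul_sum, Finset.smul_sum]
    refine Finset.sum_congr rfl fun j _ => ?_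
    rw [smul_comm, ← mul_assoc, ← mul_assoc, ← mul_assoc]
    rfl
  simp only [h1]
  rw [← Finset.smul_sum, smul_smul, neg_one_pow_mul_self, one_smul, Matrix.trace]
  simp only [Matrix.diag_apply, Matrix.mul_apply, DualFamily.mat, Matrix.of_apply, Finset.sum_mul,
    smul_mul_assoc]
  refine (sum_rot _).trans ((Finset.sum_congr rfl fun l _ => sum_rot _).trans ?_)
  exact Finset.sum_comm

lemma trace_mem (S : X.DualFamily u) {z : Ω} {p : ℕ} (hz : z ∈ X.closed ⊓ 𝒪 p) (m : ℕ) :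
    (S.mat (X.compOp u (LinearMap.mulLeft ℂ z)) * w.curv u ^ m).trace
      ∈ X.closed ⊓ 𝒪 (p + 2 * m) := by
  rw [w.trace_mat_mul_curv S ⟨z, closed_le_base hz.1⟩]
  exact Submodule.smul_mem _ _ ⟨w.tauL_mem_closed _ m hz.1,
    w.tauL_mem S.fam (y := ⟨z, closed_le_base hz.1⟩) hz.2 m⟩

lemma chOp_clsHat_eq (S : X.DualFamily u) {z : ℕ → Ω} (hz : ∀ n, z n ∈ X.closed ⊓ 𝒪 n) (n : ℕ) :
    (w.chOp u (X.clsHat z hz)).1 n = ∑ m ∈ Finset.range (n / 2 + 1),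
      ((-1) ^ m / ((2 * Real.pi * Complex.I) ^ m * (m.factorial : ℂ))) •
        X.cls ⟨_, (w.trace_mem S (hz (n - 2 * m)) m).1⟩ := by
  rw [chOp_apply]
  refine Finset.sum_congr rfl fun m _ => ?_
  rw [w.tau_eq w S.fam]
  have h1 : (⟨_, (w.trace_mem S (hz (n - 2 * m)) m).1⟩ : X.closed)
      = (-1 : ℂ) ^ m • w.tauC S.fam m ⟨z (n - 2 * m), (hz _).1⟩ :=
    Subtype.ext (w.trace_mat_mul_curv S ⟨z (n - 2 * m), closed_le_base (hz _).1⟩ m)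
  rw [h1, map_smul, smul_smul, chernCoeff, div_mul_eq_mul_div, neg_one_pow_mul_self]
  rfl

/-- The multiplicative extension of the curvature is regular. -/
lemma lift_R_mul (x : X.bimod u.mat) (θ : TensorAlgebra ℂ c.inv) (j : u.ι) :
    TensorAlgebra.lift ℂ w.R θ * x.1 j
      = ∑ l, x.1 l * TensorAlgebra.lift ℂ w.R (c.circT u θ l j) := by
  induction θ using TensorAlgebra.induction generalizing j with
  | algebraMap r =>
    simp only [AlgHom.commutes, Matrix.algebraMap_matrix_apply, apply_ite (TensorAlgebra.lift ℂ w.R),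
      map_zero, mul_ite, mul_zero, Finset.sum_ite_eq', Finset.mem_univ, if_true]
    exact Algebra.commutes _ _
  | ι ϑ =>
    obtain ⟨_, a, rfl⟩ := ϑ
    have h : (⟨c.piEnv a, ⟨a, rfl⟩⟩ : c.inv) = c.pi a := rfl
    simp only [h, circT_ι, TensorAlgebra.lift_ι_apply, circ_pi]
    exact w.R_mul x.2 a j
  | mul a b ha hb =>
    rw [map_mul, mul_assoc, hb, Finset.mul_sum]
    simp only [← mul_assoc, ha, Finset.sum_mul, map_mul, Matrix.mul_apply, map_sum, Finset.mul_sum]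
    exact Finset.sum_comm
  | add a b ha hb =>
    simp only [map_add, add_mul, ha, hb, Matrix.add_apply, mul_add, Finset.sum_add_distrib]

/-- For operators given by right multiplication with a matrix the dual family drops out, leaving the
sum of matrix entries weighted by `C_u⁻¹`. -/
lemma sum_pairMinus_matrix (S : X.DualFam u) (N : Matrix u.ι u.ι Ω) :
    ∑ a, pairMinus u (S.ν a).1 (fun j => ∑ l, (S.μ a).1 l * N l j)
      = ∑ i, ∑ j, u.canon⁻¹ j i • N i j := by
  simp only [pairMinus]
  rw [Finset.sum_comm]
  refine Finset.sum_congr rfl fun i _ => ?_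
  rw [Finset.sum_comm]
  refine Finset.sum_congr rfl fun j _ => ?_
  rw [← Finset.smul_sum]
  congr 1
  simp only [Finset.mul_sum, ← mul_assoc]
  rw [Finset.sum_comm]
  simp only [← Finset.sum_mul, S.sum_eq]
  simp

/-- Regularity carries the form `R^⊗(ϑ)` to the right of the components of `μ_k`, turning it into
the matrix of `ϑ ∘ u`. The whole operator is then right multiplication by a matrix in the curvature,
and its trace is the image of `twist`. -/
lemma tauL_lift_R (S : X.DualFam u) (k : ℕ) {θ : TensorAlgebra ℂ c.inv}
    (hθ : TensorAlgebra.lift ℂ w.R θ ∈ X.base) :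
    w.tauL S k ⟨_, hθ⟩ = (-1 : ℂ) ^ k • TensorAlgebra.lift ℂ w.R (c.twist u k θ) := by
  have hcurv : (TensorAlgebra.lift ℂ w.R).mapMatrix
      (Matrix.of fun i j => TensorAlgebra.ι ℂ (c.pi (u.mat i j))) = w.curv u := by
    ext i j
    exact TensorAlgebra.lift_ι_apply _ _
  have h1 : ∀ (x : X.bimod u.mat) (j : u.ι),
      TensorAlgebra.lift ℂ w.R θ * (w.D ^ (2 * k)) (x.1 j) = (-1 : ℂ) ^ k • ∑ l, x.1 l *
        ((TensorAlgebra.lift ℂ w.R).mapMatrix (c.circT u θ) * w.curv u ^ k) l j := by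
    intro x j
    rw [w.D_pow_two_mul, mul_smul_comm, Finset.mul_sum]
    simp only [← mul_assoc, w.lift_R_mul, Matrix.mul_apply, Finset.mul_sum, Finset.sum_mul]
    rw [Finset.sum_comm]
    rfl
  rw [tauL_eq_sum]
  simp only [h1]
  have h2 : ∀ a, pairMinus u (S.ν a).1 (fun j => (-1 : ℂ) ^ k • ∑ l, (S.μ a).1 l *
        ((TensorAlgebra.lift ℂ w.R).mapMatrix (c.circT u θ) * w.curv u ^ k) l j)
      = (-1 : ℂ) ^ k • pairMinus u (S.ν a).1 (fun j => ∑ l, (S.μ a).1 l *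
        ((TensorAlgebra.lift ℂ w.R).mapMatrix (c.circT u θ) * w.curv u ^ k) l j) := by
    intro a
    rw [← pairMinusL_apply, ← pairMinusL_apply, ← map_smul]
    rfl
  simp only [h2]
  rw [← Finset.smul_sum, sum_pairMinus_matrix, ← hcurv, ← map_pow, ← map_mul, twist_apply]
  simp only [map_sum, map_smul]
  rfl

lemma zero_mem_weil : (0 : X.HZ) ∈ w.weil :=
  ⟨0, ⟨0, map_zero _, by simp⟩, by simp,
    (map_zero X.cls).symm.trans (congrArg _ (Subtype.ext (map_zero _).symm))⟩

lemma add_mem_weil {ξ η : X.HZ} (hξ : ξ ∈ w.weil) (hη : η ∈ w.weil) : ξ + η ∈ w.weil := by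
  obtain ⟨θ, ⟨t, rfl, ht⟩, h, rfl⟩ := hξ
  obtain ⟨θ', ⟨t', rfl, ht'⟩, h', rfl⟩ := hη
  refine ⟨c.piTensor t + c.piTensor t', ⟨t + t', map_add _ _ _, ?_⟩, ?_, ?_⟩
  · rw [map_add, map_add, ht, ht', TensorProduct.add_tmul]
  · rw [map_add]; exact add_mem h h'
  · rw [← map_add]
    exact congrArg _ (Subtype.ext (map_add _ _ _).symm)

lemma smul_mem_weil (r : ℂ) {ξ : X.HZ} (hξ : ξ ∈ w.weil) : r • ξ ∈ w.weil := by
  obtain ⟨θ, ⟨t, rfl, ht⟩, h, rfl⟩ := hξ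
  refine ⟨r • c.piTensor t, ⟨r • t, map_smul _ _ _, ?_⟩, ?_, ?_⟩
  · rw [map_smul, map_smul, ht, TensorProduct.smul_tmul']
  · rw [map_smul]; exact Submodule.smul_mem _ r h
  · rw [← map_smul]
    exact congrArg _ (Subtype.ext (map_smul _ _ _).symm)

/-- Represent the class by an invariant `ϑ`; the trace is, up to sign, the curvature image of `twist
u k ϑ`, which is again invariant, and the image is closed because the trace is. -/
lemma tau_mem_weil (u : Rep A) (k : ℕ) {ξ : X.HZ} (hξ : ξ ∈ w.weil) : w.tau u k ξ ∈ w.weil := by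
  obtain ⟨θ, hθ, h, rfl⟩ := hξ
  have h1 := w.tauL_lift_R (X.exists_dualFam u).some k (closed_le_base h)
  have h2 : TensorAlgebra.lift ℂ w.R (c.twist u k θ) ∈ X.closed := by
    have h3 : (-1 : ℂ) ^ k • TensorAlgebra.lift ℂ w.R (c.twist u k θ) ∈ X.closed := by
      rw [← h1]
      exact w.tauL_mem_closed _ k (y := ⟨_, closed_le_base h⟩) h
    have h5 := Submodule.smul_mem _ ((-1 : ℂ) ^ k) h3
    rwa [smul_smul, neg_one_pow_mul_self, one_smul] at h5
  have h4 : w.tau u k (X.cls ⟨_, h⟩) = (-1 : ℂ) ^ k • X.cls ⟨_, h2⟩ := by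
    rw [tau, tauFam_cls, ← map_smul]
    exact congrArg _ (Subtype.ext h1)
  rw [h4]
  exact w.smul_mem_weil _ ⟨_, hθ.twist u k, h2, rfl⟩

/-- The space of characteristic classes. -/
def weilSpace : Submodule ℂ X.HZ where
  carrier := w.weil
  zero_mem' := w.zero_mem_weil
  add_mem' := w.add_mem_weil
  smul_mem' := w.smul_mem_weil

/-- Induction over the generators of the ring. In the product case the left factor acts first, so
the series has to vary in the induction. -/
lemma chernCharacter_mem_weil {ρ : X.Kᵐᵒᵖ →+* Module.End ℂ X.HZhat} (hρ : X.IsChernCharacter ρ)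
    (x : X.K) (ξ : X.HZhat) (hξ : ∀ n, ξ.1 n ∈ w.weilSpace) (n : ℕ) :
    (ρ (MulOpposite.op x) ξ).1 n ∈ w.weilSpace := by
  induction x using K_induction generalizing ξ n with
  | h0 m =>
    rw [MulOpposite.op_intCast, map_intCast]
    have h : ((m : Module.End ℂ X.HZhat) ξ) = m • ξ := by
      rw [← zsmul_one, LinearMap.smul_apply, Module.End.one_apply]
    rw [h]
    exact zsmul_mem (hξ n) m
  | h1 u =>
    rw [hρ.kcls_eq w, chOp_apply]
    exact sum_mem fun k _ => Submodule.smul_mem _ _ (w.tau_mem_weil u k (hξ _))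
  | ha x y hx hy =>
    rw [MulOpposite.op_add, map_add]
    exact add_mem (hx ξ hξ n) (hy ξ hξ n)
  | hm x y hx hy =>
    rw [MulOpposite.op_mul, map_mul]
    exact hy _ (hx ξ hξ) n

end RegularConnection

end Calc

end Bundles
end QPB

end

/-! ### The Chern character and its matrix formula. -/

theorem mainTheorem6 {A Γ B Ω : Type*}
    [Ring A] [HopfAlgebra ℂ A] [StarRing A] [StarModule ℂ A] [QPB.IsCompactMatrixQuantumGroup A]
    [AddCommGroup Γ] [Module ℂ Γ] [Module A Γ] [Module Aᵐᵒᵖ Γ] [SMulCommClass A Aᵐᵒᵖ Γ]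
    [IsScalarTower ℂ A Γ] [IsScalarTower ℂ Aᵐᵒᵖ Γ] (c : QPB.FODC A Γ)
    [Ring B] [Algebra ℂ B] [StarRing B] [StarModule ℂ B] (P : QPB.Bundle A B)
    [Ring Ω] [Algebra ℂ Ω] (𝒪 : ℕ → Submodule ℂ Ω) [GradedAlgebra 𝒪] (X : QPB.Calc c P 𝒪)
    (hX : Nonempty X.RegularConnection) :
    (∃! ρ : X.Kᵐᵒᵖ →+* Module.End ℂ X.HZhat, X.IsChernCharacter ρ) ∧
    ∀ ρ : X.Kᵐᵒᵖ →+* Module.End ℂ X.HZhat, X.IsChernCharacter ρ →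
      (∀ (w : X.RegularConnection) (u : QPB.Rep A), Nonempty (X.DualFamily u) ∧
        ∀ (S : X.DualFamily u) (z : ℕ → Ω) (hz : ∀ n, z n ∈ X.closed ⊓ 𝒪 n),
          ∃ h : ∀ p α, (S.mat (X.compOp u (LinearMap.mulLeft ℂ (z p))) * w.curv u ^ α).trace
              ∈ X.closed ⊓ 𝒪 (p + 2 * α),
            ∀ n, (ρ (MulOpposite.op (X.kcls u)) (X.clsHat z hz)).1 n =
              ∑ α ∈ Finset.range (n / 2 + 1),
                ((-1) ^ α / ((2 * Real.pi * Complex.I) ^ α * (α.factorial : ℂ))) •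
                  X.cls ⟨_, (h (n - 2 * α) α).1⟩) ∧
      (∀ (w : X.RegularConnection) (κ : X.K) (ξ : X.HZhat), (∀ n, ξ.1 n ∈ w.weil) →
        ∀ n, (ρ (MulOpposite.op κ) ξ).1 n ∈ w.weil) := by
  obtain ⟨w₀⟩ := hX
  refine ⟨⟨w₀.chernRep, w₀.isChernCharacter_chernRep,
    fun ρ hρ => w₀.isChernCharacter_unique hρ w₀.isChernCharacter_chernRep⟩,
    fun ρ hρ => ⟨fun w u => ⟨X.nonempty_dualFamily u, fun S z hz =>
      ⟨fun p α => w.trace_mem S (hz p) α, fun n => ?_⟩⟩, fun w κ ξ hξ n =>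
      w.chernCharacter_mem_weil hρ κ ξ hξ n⟩⟩
  rw [hρ.kcls_eq w]
  exact w.chOp_clsHat_eq S hz n
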